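/- \textbf{Setting.} Let $m\ge 0$, $n\ge 1$, $\alpha_j,\beta_j\in\mathbb C$ with $\Re\alpha_j>-1/2$, and for every $j$ either $\alpha_j=0$ or $e^{4\pi i\alpha_j}\ne1$ $(0\le j\le m)$. Let $z_j=e^{i\theta_j}$ with $\theta_0<\theta_1<\dots<\theta_m<\theta_0+2\pi=:\theta_{m+1}$ (for example $\theta_0=0$), let $\arg z\in[\theta_0,\theta_0+2\pi)$, and let $$f(z)=z^{\sum_j\beta_j}\prod_{j=0}^m|z-z_j|^{2\alpha_j}g_j(z)z_j^{-\beta_j},\qquad g_j(z)=\begin{cases}e^{i\pi\beta_j},&\theta_0\le\arg z<\theta_j\\ e^{-i\pi\beta_j},&\theta_j\le\arg z<\theta_0+2\pi\end{cases}\qquad(|z|=1,\ z_j^{-\beta_j}:=e^{-i\theta_j\beta_j}),$$ be the pure Fisher--Hartwig symbol, $f_j=\frac1{2\pi}\int_0^{2\pi}f(e^{it})e^{-ijt}dt$ and $D_n=\det(f_{j-k})_{j,k=0}^{n-1}$. All $\partial/\partial z_k$ are derivatives along the unit circle, $\partial/\partial z_k=(iz_k)^{-1}\partial/\partial\theta_k$.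 Put $\lambda=\sum_k\frac{\beta_k-\alpha_k}2-\frac n2$, $\sigma_3=\mathrm{diag}(1,-1)$, $U(c)=\begin{pmatrix}1&c\\0&1\end{pmatrix}$, $$s_j=\exp\Bigl\{-i\pi\sum_{k\le j}\beta_k+i\pi\sum_{k>j}\beta_k-i\pi\sum_{k\le j}\alpha_k-3i\pi\sum_{k>j}\alpha_k\Bigr\},\qquad d_j=-s_j(1-e^{2\pi i\beta_j}).$$ The function $z^\lambda$ is cut along the ray $\arg z=\theta_0$ from $0$ to infinity with $\theta_0<\arg z<\theta_0+2\pi$; functions of $z-z_j$ are cut along the ray $\Gamma_j=\{rz_j:r\ge1\}$ with $\theta_j<\arg(z-z_j)<\theta_j+2\pi$. \textbf{The $\Phi$-Riemann--Hilbert problem.} Let $C$ be the unit circle, oriented counterclockwise; orient $[0,z_0]$ from $0$ to $z_0$ and each $\Gamma_j$ towards infinity; the $+$ side is the left side. Find a $2\times2$ matrix function $\Phi$ with the following properties. (a) $\Phi$ is analytic off $C\cup[0,z_0]\cup\bigcup_j\Gamma_j$. (b) At every point of the contour other than $0$ and the $z_j$ it has boundary values with $\Phi_+=\Phi_-J$,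 where $J=U(s_j)$ on the arc $\theta_j<\arg z<\theta_{j+1}$ of $C$; $J=e^{-2\pi i\alpha_j\sigma_3}$ on $\Gamma_j$, $j\ge1$; $J=e^{-2\pi i(\alpha_0+\lambda)\sigma_3}$ on $\Gamma_0$; $J=e^{-2\pi i\lambda\sigma_3}$ on $[0,z_0]$. (c) $\Phi(z)=(I+O(1/z))\,z^{(\sum_k\frac{\beta_k+\alpha_k}2+\frac n2)\sigma_3}e^{2\pi i\sum_{k>j}\alpha_k\sigma_3}$ as $z\to\infty$, $\theta_j<\arg z<\theta_{j+1}$. (d) In a disc around $z_j$, off the contour, $\Phi=\widetilde\Phi_j(z)\,(z-z_j)^{\alpha_j\sigma_3}C_j$ if $\alpha_j\ne0$ and $\Phi=\widetilde\Phi_j(z)\,U\bigl(\tfrac{d_j}{2\pi i}\ln(z-z_j)\bigr)C_j$ if $\alpha_j=0$, with $\widetilde\Phi_j$ holomorphic in the disc. Here $C_j=U(c_j)$ for $j\ge1$; $C_0=U(c_0)$ on the side $\arg z>\theta_0$ and $C_0=U(c_0)e^{2\pi i\lambda\sigma_3}$ on the side $\arg z<\theta_0$ of the line through $0$ and $z_0$.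 In the three regions $|z|<1$; $|z|>1$, $\arg z<\theta_j$; $|z|>1$, $\arg z>\theta_j$ (sides of $\Gamma_j$), the constant $c_j$ equals respectively $$s_j\tfrac{1-e^{2\pi i(\beta_j+\alpha_j)}}{1-e^{4\pi i\alpha_j}},\quad s_j\tfrac{1-e^{2\pi i(\beta_j-\alpha_j)}}{1-e^{4\pi i\alpha_j}},\quad s_je^{4\pi i\alpha_j}\tfrac{1-e^{2\pi i(\beta_j-\alpha_j)}}{1-e^{4\pi i\alpha_j}}\quad\text{if }\alpha_j\ne0;\qquad s_je^{2\pi i\beta_j},\quad 0,\quad d_j\quad\text{if }\alpha_j=0.$$ (e) In a disc around $0$, off the contour, $\Phi=\widetilde\Phi^{(0)}(z)z^{\lambda\sigma_3}$ with $\widetilde\Phi^{(0)}$ holomorphic in the disc. \textbf{Statement.} Suppose that the $\Phi$-Riemann--Hilbert problem is solvable at $(z_0,\dots,z_m)$. Then $D_n\neq0$, and the problem is solvable at all nearby points, with discs in (d), (e) of a common radius. For every such family of solutions, with $$A_j=\begin{cases}\alpha_j\widetilde\Phi_j(z_j)\sigma_3\widetilde\Phi_j^{-1}(z_j),&\alpha_j\ne0\\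 \frac{d_j}{2\pi i}\widetilde\Phi_j(z_j)\begin{pmatrix}0&1\\0&0\end{pmatrix}\widetilde\Phi_j^{-1}(z_j),&\alpha_j=0\end{cases},\qquad B=\lambda\,\widetilde\Phi^{(0)}(0)\sigma_3\widetilde\Phi^{(0)}(0)^{-1},$$ the function $\Phi$ satisfies the Fuchsian system $\frac{d\Phi}{dz}=\Bigl(\sum_{k=0}^m\frac{A_k}{z-z_k}+\frac Bz\Bigr)\Phi$ off the contour, all the derivatives below exist, and for every $k=0,1,\dots,m$ $$\frac{\partial\ln D_n}{\partial z_k}=\sum_{j=0}^m\mathrm{trace}\,A_j\frac{\partial\widetilde\Phi_j(z_j)}{\partial z_k}\widetilde\Phi_j^{-1}(z_j)+\mathrm{trace}\,B\,\frac{\partial\widetilde\Phi^{(0)}(0)}{\partial z_k}\widetilde\Phi^{(0)}(0)^{-1}+2\sum_{j\ne k}\frac{\alpha_k\alpha_j}{z_j-z_k}-2\lambda\frac{\alpha_k}{z_k}-n\,\frac{\alpha_k+\beta_k}{z_k}.$$ Here $\partial\widetilde\Phi_j(z_j)/\partial z_k$ is the derivative of $\widetilde\Phi_j(z)$ with respect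 to the parameter $z_k$ at fixed argument $z$, evaluated at $z=z_j$ (also for $j=k$). Moreover $$\tau=D_n\prod_{j<k}(z_k-z_j)^{2\alpha_j\alpha_k}\prod_{j=0}^mz_j^{2\alpha_j\lambda+n(\alpha_j+\beta_j)}$$ (with $\theta_j<\arg(z_k-z_j)<\theta_j+2\pi$, $\arg z_j=\theta_j$) is the Jimbo--Miwa--Ueno $\tau$-function of this system: $$\frac{\partial\ln\tau}{\partial z_k}=\mathrm{trace}\,A_k\frac{\partial\widetilde\Phi_k(z_k)}{\partial z}\widetilde\Phi_k^{-1}(z_k),\qquad k=0,\dots,m.$$ -/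

import Mathlib

open Complex Filter Topology

noncomputable section

namespace FisherHartwig

/-- Two by two complex matrices. -/
abbrev Mat : Type := Matrix (Fin 2) (Fin 2) ℂ

/-- Argument of `w` with values in `[φ, φ + 2π)`. -/
def argFrom (φ : ℝ) (w : ℂ) : ℝ := toIcoMod Real.two_pi_pos φ (Complex.arg w)

/-- Logarithm of `w` with its cut along the direction `φ`: the imaginary part lies in
`[φ, φ + 2π)`. -/
def logFrom (φ : ℝ) (w : ℂ) : ℂ := (Real.log ‖w‖ : ℂ) + (argFrom φ w : ℂ) * I

/-- The Pauli matrix `σ₃`. -/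
def sigma3 : Mat := !![1, 0; 0, -1]

/-- The matrix unit `E₁₂`. -/
def unit12 : Mat := !![0, 1; 0, 0]

/-- `exp (x σ₃)`; in particular `w ^ (a σ₃)` is `expSigma3 (a * log w)`. -/
def expSigma3 (x : ℂ) : Mat := !![exp x, 0; 0, exp (-x)]

/-- The upper triangular unipotent matrix with entry `c`. -/
def upper (c : ℂ) : Mat := !![1, c; 0, 1]

section Configuration

variable {m : ℕ}

/-- The angles are ordered and lie in one turn of the circle, starting at `θ 0`. The
normalisation `θ 0 = 0` is a special case; keeping `θ 0` free is what gives a meaning to the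
derivative with respect to the point `z_0`. -/
def IsConfiguration (θ : Fin (m + 1) → ℝ) : Prop :=
  StrictMono θ ∧ θ (Fin.last m) < θ 0 + 2 * Real.pi

/-- The singular point `z_j = exp (i θ_j)`. -/
def zpt (θ : Fin (m + 1) → ℝ) (j : Fin (m + 1)) : ℂ := exp ((θ j : ℂ) * I)

/-- `θ_{j+1}`, with the convention `θ_{m+1} = θ_0 + 2π`. -/
def nextAngle (θ : Fin (m + 1) → ℝ) (j : Fin (m + 1)) : ℝ :=
  if h : (j : ℕ) + 1 < m + 1 then θ ⟨(j : ℕ) + 1, h⟩ else θ 0 + 2 * Real.pi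

/-- The open sector `θ_j < arg z < θ_{j+1}`. -/
def sector (θ : Fin (m + 1) → ℝ) (j : Fin (m + 1)) : Set ℂ :=
  {z | z ≠ 0 ∧ argFrom (θ 0) z ∈ Set.Ioo (θ j) (nextAngle θ j)}

/-! ### The symbol and its Toeplitz determinant -/

/-- The pure Fisher-Hartwig symbol (`V = 0`) on the unit circle,
`z ^ (∑ β_j) ∏ |z - z_j| ^ (2 α_j) g_j(z) z_j ^ (-β_j)`, where `g_j` equals `exp (iπβ_j)` for
`θ_0 ≤ arg z < θ_j` and `exp (-iπβ_j)` for `θ_j ≤ arg z < θ_0 + 2π`. -/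
def symbol (α β : Fin (m + 1) → ℂ) (θ : Fin (m + 1) → ℝ) (z : ℂ) : ℂ :=
  exp ((argFrom (θ 0) z : ℂ) * I * ∑ j, β j) *
    ∏ j, ((‖z - zpt θ j‖ : ℂ) ^ (2 * α j) *
      (if argFrom (θ 0) z < θ j then exp (I * Real.pi * β j) else exp (-(I * Real.pi * β j))) *
      exp (-((θ j : ℂ) * I * β j)))

/-- Fourier coefficients of a function on the unit circle. -/
def fourierCoef (f : ℂ → ℂ) (j : ℤ) : ℂ :=
  (1 / (2 * Real.pi) : ℂ) *
    ∫ t in (0 : ℝ)..(2 * Real.pi), f (exp ((t : ℂ) * I)) * exp (-(I * (j : ℂ) * (t : ℂ)))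

/-- The Toeplitz determinant `D_n` of the symbol. -/
def toeplitzDet (n : ℕ) (α β : Fin (m + 1) → ℂ) (θ : Fin (m + 1) → ℝ) : ℂ :=
  Matrix.det (Matrix.of fun j k : Fin n =>
    fourierCoef (symbol α β θ) ((j : ℤ) - (k : ℤ)))

/-! ### The Riemann-Hilbert problem for `Φ` -/

/-- The exponent `λ = ∑ (β_k - α_k) / 2 - n / 2`. -/
def lam (n : ℕ) (α β : Fin (m + 1) → ℂ) : ℂ := (∑ k, (β k - α k) / 2) - (n : ℂ) / 2

/-- The exponent at infinity `∑ (β_k + α_k) / 2 + n / 2`. -/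
def expInfty (n : ℕ) (α β : Fin (m + 1) → ℂ) : ℂ := (∑ k, (β k + α k) / 2) + (n : ℂ) / 2

/-- The jump constants `s_j`. -/
def sConst (α β : Fin (m + 1) → ℂ) (j : Fin (m + 1)) : ℂ :=
  exp (-(I * Real.pi * ∑ k ∈ Finset.Iic j, β k) + I * Real.pi * ∑ k ∈ Finset.Ioi j, β k
    - I * Real.pi * ∑ k ∈ Finset.Iic j, α k - 3 * I * Real.pi * ∑ k ∈ Finset.Ioi j, α k)

/-- The constants `d_j = -s_j (1 - exp (2πiβ_j))`. -/
def dConst (α β : Fin (m + 1) → ℂ) (j : Fin (m + 1)) : ℂ :=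
  -(sConst α β j * (1 - exp (2 * Real.pi * I * β j)))

/-- The segment from `0` to `z_0`, without its endpoints. -/
def openSegment0 (θ : Fin (m + 1) → ℝ) : Set ℂ :=
  {z | ∃ r : ℝ, 0 < r ∧ r < 1 ∧ z = r * zpt θ 0}

/-- The radial ray from `z_j` to infinity, without its endpoint. -/
def openRay (θ : Fin (m + 1) → ℝ) (j : Fin (m + 1)) : Set ℂ :=
  {z | ∃ r : ℝ, 1 < r ∧ z = r * zpt θ j}

/-- The whole contour: the unit circle, the segment `[0, z_0]` and the rays. -/
def contour (θ : Fin (m + 1) → ℝ) : Set ℂ :=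
  Metric.sphere 0 1 ∪ ({0} ∪ openSegment0 θ) ∪ ⋃ j, openRay θ j

/-- `Φ` has boundary values at the point `p` from the two sides `plus` and `minus`, related by
`Φ₊ = Φ₋ J`. -/
def HasJump (Φ : ℂ → Mat) (plus minus : Set ℂ) (p : ℂ) (J : Mat) : Prop :=
  ∃ Φp Φm : Mat, Tendsto Φ (𝓝[plus] p) (𝓝 Φp) ∧ Tendsto Φ (𝓝[minus] p) (𝓝 Φm) ∧ Φp = Φm * J

/-- The half plane to the left of the line through `0` in the direction of angle `φ`; near the
radial ray of angle `φ` this is the region where `arg z > φ`. -/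
def leftOf (φ : ℝ) : Set ℂ := {z | 0 < (z * exp (-((φ : ℂ) * I))).im}

/-- The half plane to the right of that line; near the radial ray of angle `φ` this is the
region where `arg z < φ`. -/
def rightOf (φ : ℝ) : Set ℂ := {z | (z * exp (-((φ : ℂ) * I))).im < 0}

open Classical in
/-- The entry `c_j` of the connection matrix, a piecewise constant function near `z_j`.
If `α_j = 0`, the value inside the circle, `s_j exp (2πiβ_j)`, equals `s_{j-1}` for `j ≠ 0` and
`s_m exp (4πiλ)` for `j = 0`. -/
def cConst (α β : Fin (m + 1) → ℂ) (θ : Fin (m + 1) → ℝ) (j : Fin (m + 1)) (z : ℂ) : ℂ :=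
  if α j ≠ 0 then
    if ‖z‖ < 1 then
      sConst α β j * ((1 - exp (2 * Real.pi * I * (β j + α j))) /
        (1 - exp (4 * Real.pi * I * α j)))
    else if z ∈ leftOf (θ j) then
      sConst α β j * (exp (4 * Real.pi * I * α j) *
        (1 - exp (2 * Real.pi * I * (β j - α j))) / (1 - exp (4 * Real.pi * I * α j)))
    else
      sConst α β j * ((1 - exp (2 * Real.pi * I * (β j - α j))) /
        (1 - exp (4 * Real.pi * I * α j)))
  else
    if ‖z‖ < 1 then sConst α β j * exp (2 * Real.pi * I * β j)
    else if z ∈ leftOf (θ j) then dConst α β j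
    else 0

open Classical in
/-- The connection matrix `C_j`; for `j = 0` there is an additional factor on the side
`arg z < θ_0` of the cut of `z ^ λ`. -/
def connection (n : ℕ) (α β : Fin (m + 1) → ℂ) (θ : Fin (m + 1) → ℝ) (j : Fin (m + 1))
    (z : ℂ) : Mat :=
  upper (cConst α β θ j z) *
    (if j = 0 ∧ z ∈ rightOf (θ 0) then expSigma3 (2 * Real.pi * I * lam n α β) else 1)

open Classical in
/-- The explicit singular factor at `z_j`: `(z - z_j) ^ (α_j σ₃)` if `α_j ≠ 0`, and the
unipotent matrix with entry `d_j / (2πi) * log (z - z_j)` if `α_j = 0`. The cut of the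
logarithm is the ray from `z_j` to infinity, and `θ_j ≤ arg (z - z_j) < θ_j + 2π`. -/
def singFactor (α β : Fin (m + 1) → ℂ) (θ : Fin (m + 1) → ℝ) (j : Fin (m + 1)) (z : ℂ) : Mat :=
  if α j ≠ 0 then expSigma3 (α j * logFrom (θ j) (z - zpt θ j))
  else upper (dConst α β j / (2 * Real.pi * I) * logFrom (θ j) (z - zpt θ j))

/-- `Φ` solves the Riemann-Hilbert problem, with holomorphic factors `F j` in the disc of radius
`ε` around `z_j` and `F0` in the disc of radius `ε` around `0`. -/
structure IsPhiSolution (n : ℕ) (α β : Fin (m + 1) → ℂ) (θ : Fin (m + 1) → ℝ) (ε : ℝ)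
    (Φ : ℂ → Mat) (F : Fin (m + 1) → ℂ → Mat) (F0 : ℂ → Mat) : Prop where
  analytic : ∀ a b, DifferentiableOn ℂ (fun z => Φ z a b) (contour θ)ᶜ
  jump_circle : ∀ j, ∀ p ∈ Metric.sphere (0 : ℂ) 1 ∩ sector θ j,
    HasJump Φ {z | ‖z‖ < 1} {z | 1 < ‖z‖} p (upper (sConst α β j))
  jump_ray : ∀ j, j ≠ 0 → ∀ p ∈ openRay θ j,
    HasJump Φ (leftOf (θ j)) (rightOf (θ j)) p (expSigma3 (-(2 * Real.pi * I * α j)))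
  jump_ray_zero : ∀ p ∈ openRay θ 0,
    HasJump Φ (leftOf (θ 0)) (rightOf (θ 0)) p
      (expSigma3 (-(2 * Real.pi * I * (α 0 + lam n α β))))
  jump_segment : ∀ p ∈ openSegment0 θ,
    HasJump Φ (leftOf (θ 0)) (rightOf (θ 0)) p (expSigma3 (-(2 * Real.pi * I * lam n α β)))
  infinity : ∀ j a b,
    (fun z => (Φ z * expSigma3 (-(expInfty n α β * logFrom (θ 0) z
        + 2 * Real.pi * I * ∑ k ∈ Finset.Ioi j, α k)) - 1) a b)
      =O[Bornology.cobounded ℂ ⊓ 𝓟 (sector θ j \ contour θ)] fun z => z⁻¹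
  factor_analytic : ∀ j a b, DifferentiableOn ℂ (fun z => F j z a b) (Metric.ball (zpt θ j) ε)
  factor : ∀ j, ∀ z ∈ Metric.ball (zpt θ j) ε \ contour θ,
    Φ z = F j z * singFactor α β θ j z * connection n α β θ j z
  factor0_analytic : ∀ a b, DifferentiableOn ℂ (fun z => F0 z a b) (Metric.ball 0 ε)
  factor0 : ∀ z ∈ Metric.ball (0 : ℂ) ε \ contour θ,
    Φ z = F0 z * expSigma3 (lam n α β * logFrom (θ 0) z)

/-- The Riemann-Hilbert problem for `Φ` is solvable. -/
def PhiSolvable (n : ℕ) (α β : Fin (m + 1) → ℂ) (θ : Fin (m + 1) → ℝ) : Prop :=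
  ∃ ε > 0, ∃ Φ F F0, IsPhiSolution n α β θ ε Φ F F0

/-! ### The Fuchsian system -/

open Classical in
/-- The coefficient `A_j`, from the holomorphic factor `F j`. -/
def coefA (α β : Fin (m + 1) → ℂ) (θ : Fin (m + 1) → ℝ) (F : Fin (m + 1) → ℂ → Mat)
    (j : Fin (m + 1)) : Mat :=
  if α j ≠ 0 then α j • (F j (zpt θ j) * sigma3 * (F j (zpt θ j))⁻¹)
  else (dConst α β j / (2 * Real.pi * I)) • (F j (zpt θ j) * unit12 * (F j (zpt θ j))⁻¹)

/-- The coefficient `B`, from the holomorphic factor at `0`. -/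
def coefB (n : ℕ) (α β : Fin (m + 1) → ℂ) (F0 : ℂ → Mat) : Mat :=
  lam n α β • (F0 0 * sigma3 * (F0 0)⁻¹)

/-- `A(z) = ∑ A_k / (z - z_k) + B / z`. -/
def fuchsMatrix (n : ℕ) (α β : Fin (m + 1) → ℂ) (θ : Fin (m + 1) → ℝ)
    (F : Fin (m + 1) → ℂ → Mat) (F0 : ℂ → Mat) (z : ℂ) : Mat :=
  (∑ k, (z - zpt θ k)⁻¹ • coefA α β θ F k) + z⁻¹ • coefB n α β F0

/-! ### Derivatives -/

/-- The restriction of `G` to the line on which only the angle `θ_k` varies. -/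
def alongAngle (θ : Fin (m + 1) → ℝ) (k : Fin (m + 1)) (G : (Fin (m + 1) → ℝ) → ℂ) : ℝ → ℂ :=
  fun t => G (Function.update θ k t)

/-- `∂G/∂z_k = (i z_k)⁻¹ ∂G/∂θ_k`, the derivative along the unit circle. -/
def partialZ (θ : Fin (m + 1) → ℝ) (k : Fin (m + 1)) (G : (Fin (m + 1) → ℝ) → ℂ) : ℂ :=
  (I * zpt θ k)⁻¹ * deriv (alongAngle θ k G) (θ k)

/-- Entrywise `∂G/∂z_k` of a matrix function. -/
def partialZMat (θ : Fin (m + 1) → ℝ) (k : Fin (m + 1)) (G : (Fin (m + 1) → ℝ) → Mat) : Mat :=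
  Matrix.of fun a b => partialZ θ k fun θ' => G θ' a b

/-- Entrywise complex derivative of a matrix function. -/
def derivMat (G : ℂ → Mat) (z : ℂ) : Mat := Matrix.of fun a b => deriv (fun w => G w a b) z

/-- The explicit factor
`∏_{j<k} (z_k - z_j) ^ (2 α_j α_k) ∏_j z_j ^ (2 α_j λ + n (α_j + β_j))`,
where `θ_j < arg (z_k - z_j) < θ_j + 2π` and `arg z_j = θ_j`. -/
def tauFactor (n : ℕ) (α β : Fin (m + 1) → ℂ) (θ : Fin (m + 1) → ℝ) : ℂ :=
  (∏ k, ∏ j ∈ Finset.Iio k, exp (2 * α j * α k * logFrom (θ j) (zpt θ k - zpt θ j))) *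
    ∏ j, exp ((2 * α j * lam n α β + n * (α j + β j)) * ((θ j : ℂ) * I))

end Configuration

end FisherHartwig

end

open FisherHartwig

open Complex Filter Topology

noncomputable section

namespace FisherHartwig

open MeasureTheory (Measure volume AEStronglyMeasurable LocallyIntegrable IntegrableAtFilter ae_ball_iff
  aestronglyMeasurable_const measure_eq_zero_iff_ae_notMem ae_all_iff ae_restrict_of_ae ae_restrict_iff')
open Function (update Injective update_eq_self)
open Metric Finset Bornology intervalIntegral Matrix
open Real (two_pi_pos norm_of_nonneg norm_eq_abs)
open scoped Real

variable {m n : ℕ} {α β : Fin (m + 1) → ℂ} {θ : Fin (m + 1) → ℝ}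

local notation "ι" => Fin (m + 1)

/-- The condition of local integrability of the symbol. -/
abbrev Admissible (α : ι → ℂ) : Prop := ∀ j, -(1 / 2 : ℝ) < (α j).re

/-- The condition on an exponent in the local analysis. -/
abbrev NonResonant (a : ℂ) : Prop := a = 0 ∨ exp (4 * π * I * a) ≠ 1

lemma eventually_gt_norm (r : ℝ) : ∀ᶠ z in cobounded ℂ, r < ‖z‖ :=
  tendsto_norm_cobounded_atTop.eventually_gt_atTop r

lemma eventually_ge_norm (r : ℝ) : ∀ᶠ z in cobounded ℂ, r ≤ ‖z‖ :=
  tendsto_norm_cobounded_atTop.eventually_ge_atTop r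

/-- The point `exp (i t)` of the unit circle. -/
def ue (t : ℝ) : ℂ := exp (t * I)

/-- One factor of the symbol, as a function of the angle relative to the singular point. -/
def piece (a b : ℂ) (x : ℝ) : ℂ :=
  (‖1 - ue x‖ : ℂ) ^ (2 * a) * exp (I * b * ((toIcoMod two_pi_pos 0 x : ℝ) - π))

lemma ue_zero : ue 0 = 1 := by simp [ue]

lemma ue_add (x y : ℝ) : ue (x + y) = ue x * ue y := by simp [ue, add_mul, exp_add]

lemma ue_neg (x : ℝ) : ue (-x) = (ue x)⁻¹ := by simp [ue, exp_neg]

lemma ue_sub (x y : ℝ) : ue (x - y) = ue x / ue y := by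
  rw [sub_eq_add_neg, ue_add, ue_neg, div_eq_mul_inv]

lemma ue_ne_zero (x : ℝ) : ue x ≠ 0 := exp_ne_zero _

lemma norm_ue (x : ℝ) : ‖ue x‖ = 1 := norm_exp_ofReal_mul_I x

lemma ue_two_pi : ue (2 * π) = 1 := by simp [ue, exp_two_pi_mul_I]

lemma ue_periodic : Function.Periodic ue (2 * π) := fun x => by rw [ue_add, ue_two_pi, mul_one]

lemma ue_eq_one_iff (x : ℝ) : ue x = 1 ↔ ∃ k : ℤ, x = k * (2 * π) := by
  rw [ue, exp_eq_one_iff]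
  constructor
  · rintro ⟨k, hk⟩
    refine ⟨k, ?_⟩
    have h2 : (x : ℂ) = k * (2 * π) := by
      have := mul_right_cancel₀ I_ne_zero (hk.trans (by ring : _ = (k * (2 * π) : ℂ) * I))
      exact this
    exact_mod_cast h2
  · rintro ⟨k, rfl⟩
    exact ⟨k, by push_cast; ring⟩

lemma ue_eq_iff (x y : ℝ) : ue x = ue y ↔ ∃ k : ℤ, x = y + k * (2 * π) := by
  have : ue x = ue y ↔ ue (x - y) = 1 := by rw [ue_sub, div_eq_one_iff_eq (ue_ne_zero y)]
  rw [this, ue_eq_one_iff]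
  exact exists_congr fun k => ⟨fun h => by linarith, fun h => by linarith⟩

lemma countable_ue_eq (z : ℂ) : {t : ℝ | ue t = z}.Countable := by
  by_cases h : ∃ y, ue y = z
  · obtain ⟨y, rfl⟩ := h
    refine (Set.countable_range fun k : ℤ => y + k * (2 * π)).mono ?_
    rintro x hx
    obtain ⟨k, hk⟩ := (ue_eq_iff x y).1 hx
    exact ⟨k, hk.symm⟩
  · push Not at h
    have : {t : ℝ | ue t = z} = ∅ := by ext t; simpa using h t
    rw [this]; exact Set.countable_empty

lemma ae_ue_ne (z : ℂ) : ∀ᵐ t : ℝ, ue t ≠ z := (countable_ue_eq z).ae_notMem volume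

lemma hasDerivAt_ue (x : ℝ) : HasDerivAt ue (I * ue x) x := by
  have h : HasDerivAt (fun y : ℝ => (y : ℂ) * I) (1 * I) x :=
    (Complex.ofRealCLM.hasDerivAt (x := x)).mul_const I
  have := h.cexp
  rw [one_mul, mul_comm] at this
  exact this

lemma continuous_ue : Continuous ue := by unfold ue; fun_prop

lemma contDiff_ue : ContDiff ℝ ⊤ ue := by
  unfold ue
  exact (Complex.ofRealCLM.contDiff.mul contDiff_const).cexp

lemma exists_mem_Ioo_of_ue_ne_one {x : ℝ} (h : ue x ≠ 1) :
    ∃ k : ℤ, x ∈ Set.Ioo (k * (2 * π)) (k * (2 * π) + 2 * π) := by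
  have h1 := toIcoMod_mem_Ico two_pi_pos 0 x
  have h2 := toIcoMod_add_toIcoDiv_zsmul two_pi_pos 0 x
  set k := toIcoDiv two_pi_pos 0 x
  set y := toIcoMod two_pi_pos 0 x
  rw [zsmul_eq_mul] at h2
  refine ⟨k, ?_, by linarith [h1.2]⟩
  rcases h1.1.lt_or_eq with h3 | h3
  · linarith
  · exact absurd ((ue_eq_one_iff x).2 ⟨k, by rw [← h2, ← h3, zero_add]⟩) h

lemma toIcoMod_zero_eq {x : ℝ} {k : ℤ}
    (h : x ∈ Set.Ico (k * (2 * π)) (k * (2 * π) + 2 * π)) :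
    toIcoMod two_pi_pos 0 x = x - k * (2 * π) := by
  rw [toIcoMod_eq_iff]
  exact ⟨⟨by linarith [h.1], by linarith [h.2]⟩, k, by simp⟩

lemma ue_toIcoMod (a x : ℝ) : ue (toIcoMod two_pi_pos a x) = ue x := by
  rw [ue_eq_iff]
  refine ⟨-toIcoDiv two_pi_pos a x, ?_⟩
  have h2 := toIcoMod_add_toIcoDiv_zsmul two_pi_pos a x
  rw [zsmul_eq_mul] at h2
  push_cast
  linarith

lemma one_sub_ue_eq (x : ℝ) :
    1 - ue x = ((2 * Real.sin (x / 2) : ℝ) : ℂ) * exp (((x - π) / 2 : ℝ) * I) := by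
  have h1 : exp (((x - π) / 2 : ℝ) * I) = ue (x / 2) * (-I) := by
    have : (((x - π) / 2 : ℝ) : ℂ) * I = (x / 2 : ℝ) * I + -(π / 2 * I) := by push_cast; ring
    rw [this, exp_add, exp_neg, exp_pi_div_two_mul_I, inv_I]; rfl
  have h2 : ue x = ue (x / 2) * ue (x / 2) := by rw [← ue_add]; congr 1; ring
  have h3 : ue (x/2) * ue (-(x/2)) = 1 := by rw [← ue_add, add_neg_cancel, ue_zero]
  have h4 : ((2 * Real.sin (x / 2) : ℝ) : ℂ) = (ue (-(x/2)) - ue (x/2)) * I := by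
    push_cast
    rw [Complex.sin, ue, ue]
    push_cast
    ring_nf
  rw [h1, h2, h4]
  linear_combination (-1 : ℂ) * h3 + (ue (x/2) * ue (-(x/2)) - ue (x/2) * ue (x/2)) * I_sq

lemma norm_one_sub_ue (x : ℝ) : ‖1 - ue x‖ = |2 * Real.sin (x / 2)| := by
  rw [one_sub_ue_eq, norm_mul, norm_exp_ofReal_mul_I, mul_one, norm_real, norm_eq_abs]

lemma log_one_sub_ue {x : ℝ} (h0 : 0 < x) (h1 : x < 2 * π) :
    log (1 - ue x) = (Real.log ‖1 - ue x‖ : ℂ) + ((x - π) / 2 : ℝ) * I := by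
  have hs : 0 < 2 * Real.sin (x / 2) :=
    mul_pos two_pos (Real.sin_pos_of_pos_of_lt_pi (by linarith) (by linarith))
  rw [norm_one_sub_ue, abs_of_pos hs, one_sub_ue_eq, log_ofReal_mul hs (exp_ne_zero _), log_exp]
  · simp; linarith [Real.pi_pos]
  · simp; linarith [Real.pi_pos]

lemma one_sub_ue_ne_zero {x : ℝ} (h : ue x ≠ 1) : 1 - ue x ≠ 0 := fun h' => h (by
  linear_combination -h')

lemma one_sub_mem_slitPlane {z : ℂ} (h : ‖z‖ ≤ 1) (h1 : z ≠ 1) : 1 - z ∈ slitPlane := by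
  left
  have h2 : z.re ≤ ‖z‖ := (le_abs_self _).trans (abs_re_le_norm z)
  rcases (h2.trans h).lt_or_eq with h3 | h3
  · simpa using h3
  · exfalso
    apply h1
    have h4 : z.re ^ 2 + z.im ^ 2 ≤ 1 := by
      have := Complex.sq_norm z
      rw [normSq_apply] at this
      nlinarith [norm_nonneg z]
    have : z.im = 0 := by nlinarith
    exact Complex.ext h3 this

lemma piece_periodic (a b : ℂ) : Function.Periodic (piece a b) (2 * π) := fun x => by
  rw [piece, piece, ue_periodic, toIcoMod_add_right]

lemma piece_eq_exp (a b : ℂ) {x : ℝ} {k : ℤ}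
    (h : x ∈ Set.Ioo (k * (2 * π)) (k * (2 * π) + 2 * π)) :
    piece a b x = exp (2 * a * log (1 - ue x) + I * (b - a) * (x - k * (2 * π) - π)) := by
  have h1 : ue (x - k * (2 * π)) = ue x := (ue_eq_iff _ _).2 ⟨-k, by push_cast; ring⟩
  have h2 := log_one_sub_ue (x := x - k * (2 * π)) (by linarith [h.1]) (by linarith [h.2])
  have hne : ue x ≠ 1 := by
    intro h3
    obtain ⟨l, hl⟩ := (ue_eq_one_iff x).1 h3
    rw [hl] at h
    have h4 : (k : ℝ) < l := lt_of_mul_lt_mul_right h.1 two_pi_pos.le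
    have h5 : (l : ℝ) < k + 1 := by
      have := h.2
      rw [← add_one_mul] at this
      exact lt_of_mul_lt_mul_right this two_pi_pos.le
    norm_cast at h4 h5
    omega
  have h3 : (‖1 - ue x‖ : ℂ) ≠ 0 := by simpa using one_sub_ue_ne_zero hne
  rw [h1] at h2
  rw [piece, toIcoMod_zero_eq ⟨h.1.le, h.2⟩, cpow_def_of_ne_zero h3, ← exp_add, ← ofReal_log
    (norm_nonneg _), h2]
  congr 1
  push_cast
  ring

/-- The logarithmic derivative of `piece a b`. -/
def pieceLog (a b : ℂ) (x : ℝ) : ℂ := I * (2 * a * ue x / (ue x - 1) + b - a)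

lemma hasDerivAt_piece (a b : ℂ) {x : ℝ} (h : ue x ≠ 1) :
    HasDerivAt (piece a b) (piece a b x * pieceLog a b x) x := by
  obtain ⟨k, hk⟩ := exists_mem_Ioo_of_ue_ne_one h
  have h1 : HasDerivAt (fun y : ℝ => 1 - ue y) (-(I * ue x)) x := by
    simpa using (hasDerivAt_ue x).const_sub 1
  have h2 : HasDerivAt (fun y : ℝ => log (1 - ue y)) (-(I * ue x) / (1 - ue x)) x :=
    h1.clog_real (one_sub_mem_slitPlane (norm_ue x).le h)
  have h3 : HasDerivAt (fun y : ℝ => 2 * a * log (1 - ue y) + I * (b - a) * (y - k * (2 * π) - π))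
      (2 * a * (-(I * ue x) / (1 - ue x)) + I * (b - a) * 1) x :=
    (h2.const_mul _).add ((((Complex.ofRealCLM.hasDerivAt (x := x)).sub_const _).sub_const _
      ).const_mul _)
  have h4 := h3.cexp
  rw [← piece_eq_exp a b hk] at h4
  refine (h4.congr_deriv ?_).congr_of_eventuallyEq ?_
  · rw [pieceLog]
    have h5 := one_sub_ue_ne_zero h
    have h6 : ue x - 1 ≠ 0 := sub_ne_zero.2 h
    field_simp
    ring
  · filter_upwards [isOpen_Ioo.mem_nhds hk] with y hy using piece_eq_exp a b hy

lemma continuousAt_piece (a b : ℂ) {x : ℝ} (h : ue x ≠ 1) : ContinuousAt (piece a b) x :=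
  (hasDerivAt_piece a b h).continuousAt

lemma aestronglyMeasurable_of_continuousAt {f : ℝ → ℂ} {z : Set ℂ} (hz : z.Finite)
    (hf : ∀ x, ue x ∉ z → ContinuousAt f x) : AEStronglyMeasurable f := by
  have hS : ({x : ℝ | ue x ∈ z}).Countable := by
    have : {x : ℝ | ue x ∈ z} = ⋃ w ∈ z, {x | ue x = w} := by ext; simp
    rw [this]
    exact hz.countable.biUnion fun w _ => countable_ue_eq w
  have h1 : ContinuousOn f {x : ℝ | ue x ∈ z}ᶜ := fun x hx => (hf x hx).continuousWithinAt
  have h2 := h1.aestronglyMeasurable (μ := volume) hS.measurableSet.compl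
  rwa [MeasureTheory.Measure.restrict_eq_self_of_ae_mem] at h2
  exact hS.ae_notMem volume

lemma norm_piece_le (a b : ℂ) {x : ℝ} (h : ue x ≠ 1) :
    ‖piece a b x‖ ≤ Real.exp (|b.im| * π) * ‖1 - ue x‖ ^ (2 * a.re) := by
  have h0 : 0 < ‖1 - ue x‖ := norm_pos_iff.2 (one_sub_ue_ne_zero h)
  rw [piece, norm_mul, norm_cpow_eq_rpow_re_of_pos h0, mul_comm]
  have h2 : (2 * a).re = 2 * a.re := by simp
  rw [h2]
  gcongr
  rw [norm_exp, Real.exp_le_exp]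
  have h1 := toIcoMod_mem_Ico two_pi_pos 0 x
  set y := toIcoMod two_pi_pos 0 x
  have h3 : (I * b * ((y : ℂ) - π)).re = -b.im * (y - π) := by simp
  rw [h3]
  have h4 : |y - π| ≤ π := abs_le.2 ⟨by linarith [h1.1], by linarith [h1.2]⟩
  calc -b.im * (y - π) ≤ |-b.im * (y - π)| := le_abs_self _
    _ = |b.im| * |y - π| := by rw [abs_mul, abs_neg]
    _ ≤ _ := by gcongr

lemma two_div_pi_mul_le_norm {x : ℝ} (h : |x| ≤ π) : 2 / π * |x| ≤ ‖1 - ue x‖ := by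
  have := Real.mul_abs_le_abs_sin (x := x / 2) (by rw [abs_div]; simp; linarith)
  rw [norm_one_sub_ue, abs_mul, abs_two]
  rw [abs_div, abs_two] at this
  linarith

lemma intervalIntegrable_piece (a b : ℂ) (ha : -(1 / 2 : ℝ) < a.re) (u v : ℝ) :
    IntervalIntegrable (piece a b) volume u v := by
  refine (piece_periodic a b).intervalIntegrable two_pi_pos.ne' (t := 0) ?_ u v
  rw [zero_add]
  have hm : AEStronglyMeasurable (piece a b) :=
    aestronglyMeasurable_of_continuousAt (Set.finite_singleton 1)
      fun x hx => continuousAt_piece a b (by simpa using hx)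
  set C := Real.exp (|b.im| * π)
  have hC : 0 < C := Real.exp_pos _
  set p := 2 * a.re
  have hp : -1 < p := by simp only [p]; linarith
  have hae : ∀ᵐ x : ℝ, ue x ≠ 1 := ae_ue_ne 1
  by_cases hp0 : 0 ≤ p
  · refine (intervalIntegrable_const (c := C * 2 ^ p)).mono_fun hm.restrict ?_
    refine ae_restrict_of_ae ?_
    filter_upwards [hae] with x hx
    refine (norm_piece_le a b hx).trans ?_
    rw [norm_of_nonneg (by positivity)]
    have : ‖1 - ue x‖ ≤ 2 := (norm_sub_le _ _).trans (by rw [norm_ue, norm_one]; norm_num)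
    gcongr
  · push Not at hp0
    have i1 : IntervalIntegrable (fun x : ℝ => x ^ p) volume 0 (2 * π) :=
      intervalIntegrable_rpow' hp
    have i2 : IntervalIntegrable (fun x : ℝ => (2 * π - x) ^ p) volume 0 (2 * π) := by
      have := (intervalIntegrable_rpow' hp (a := 0) (b := 2 * π)).comp_sub_left
        (2 * π)
      simpa using this.symm
    refine ((i1.add i2).const_mul (C * (2 / π) ^ p)).mono_fun hm.restrict ?_
    refine (ae_restrict_iff' measurableSet_uIoc).2 ?_
    filter_upwards [hae] with x hx hx2
    rw [Set.uIoc_of_le two_pi_pos.le] at hx2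
    have hx3 : x < 2 * π := by refine lt_of_le_of_ne hx2.2 fun h => hx (by rw [h, ue_two_pi])
    refine (norm_piece_le a b hx).trans ?_
    have hp1 : 0 ≤ x ^ p := Real.rpow_nonneg hx2.1.le _
    have hp2 : 0 ≤ (2 * π - x) ^ p := Real.rpow_nonneg (by linarith) _
    have hpi := Real.pi_pos
    rw [norm_of_nonneg (by positivity), mul_assoc]
    refine mul_le_mul_of_nonneg_left ?_ hC.le
    rcases le_total x π with h | h
    · have h5 := two_div_pi_mul_le_norm (x := x) (by rw [abs_of_pos hx2.1]; exact h)
      rw [abs_of_pos hx2.1] at h5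
      calc ‖1 - ue x‖ ^ p ≤ (2 / π * x) ^ p :=
            Real.rpow_le_rpow_of_nonpos (mul_pos (by positivity) hx2.1) h5 hp0.le
        _ = (2 / π) ^ p * x ^ p := Real.mul_rpow (by positivity) hx2.1.le
        _ ≤ _ := by gcongr; linarith
    · have h5 := two_div_pi_mul_le_norm (x := x - 2 * π)
        (by rw [abs_of_neg (by linarith)]; linarith)
      rw [abs_of_neg (by linarith), ue_sub, ue_two_pi, div_one, neg_sub] at h5
      calc ‖1 - ue x‖ ^ p ≤ (2 / π * (2 * π - x)) ^ p :=
            Real.rpow_le_rpow_of_nonpos (mul_pos (by positivity) (by linarith)) h5 hp0.le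
        _ = (2 / π) ^ p * (2 * π - x) ^ p := Real.mul_rpow (by positivity) (by linarith)
        _ ≤ _ := by gcongr; linarith

lemma locallyIntegrable_of_intervalIntegrable {f : ℝ → ℂ}
    (h : ∀ u v, IntervalIntegrable f volume u v) : LocallyIntegrable f := fun x =>
  ⟨Set.Ioc (x - 1) (x + 1), Ioc_mem_nhds (by linarith) (by linarith),
    (intervalIntegrable_iff_integrableOn_Ioc_of_le (by linarith)).1 (h _ _)⟩

lemma LocallyIntegrable.intervalIntegrable' {f : ℝ → ℂ} (h : LocallyIntegrable f) (u v : ℝ) :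
    IntervalIntegrable f volume u v :=
  (h.integrableOn_isCompact isCompact_uIcc).intervalIntegrable

lemma locallyIntegrable_mul {f g : ℝ → ℂ} (hf : LocallyIntegrable f) (hg : LocallyIntegrable g)
    (h : ∀ x, (∀ᶠ y in 𝓝 x, ContinuousAt f y) ∨ (∀ᶠ y in 𝓝 x, ContinuousAt g y)) :
    LocallyIntegrable fun x => f x * g x := by
  have key : ∀ {f g : ℝ → ℂ}, LocallyIntegrable g → ∀ x, (∀ᶠ y in 𝓝 x, ContinuousAt f y) →
      IntegrableAtFilter (fun x => f x * g x) (𝓝 x) := by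
    intro f g hg x hx
    obtain ⟨ε, hε, hb⟩ := eventually_nhds_iff_ball.1 hx
    refine ⟨closedBall x (ε / 2), closedBall_mem_nhds x (by linarith), ?_⟩
    have hK : IsCompact (closedBall x (ε / 2)) := isCompact_closedBall _ _
    refine (hg.integrableOn_isCompact hK).continuousOn_mul (fun y hy => ?_) hK
    exact (hb y (closedBall_subset_ball (by linarith) hy)).continuousWithinAt
  intro x
  rcases h x with h1 | h1
  · exact key hg x h1
  · simpa only [mul_comm] using key hf x h1

/-- Continuously differentiable functions of period `2π`. -/
structure PerC1 (p : ℝ → ℂ) : Prop where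
  contDiff : ContDiff ℝ 1 p
  periodic : Function.Periodic p (2 * π)

namespace PerC1

variable {p q : ℝ → ℂ}

lemma continuous (hp : PerC1 p) : Continuous p := hp.contDiff.continuous

lemma hasDerivAt (hp : PerC1 p) (t : ℝ) : HasDerivAt p (deriv p t) t :=
  (hp.contDiff.differentiable one_ne_zero t).hasDerivAt

lemma continuous_deriv (hp : PerC1 p) : Continuous (deriv p) := hp.contDiff.continuous_deriv le_rfl

lemma deriv_periodic (hp : PerC1 p) : Function.Periodic (deriv p) (2 * π) := fun t => by
  rw [← deriv_comp_add_const, funext hp.periodic]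

lemma mul (hp : PerC1 p) (hq : PerC1 q) : PerC1 fun t => p t * q t :=
  ⟨hp.contDiff.mul hq.contDiff, fun t => by simp [hp.periodic t, hq.periodic t]⟩

lemma sub (hp : PerC1 p) (hq : PerC1 q) : PerC1 fun t => p t - q t :=
  ⟨hp.contDiff.sub hq.contDiff, fun t => by simp [hp.periodic t, hq.periodic t]⟩

lemma add (hp : PerC1 p) (hq : PerC1 q) : PerC1 fun t => p t + q t :=
  ⟨hp.contDiff.add hq.contDiff, fun t => by simp [hp.periodic t, hq.periodic t]⟩

lemma const (c : ℂ) : PerC1 fun _ => c := ⟨contDiff_const, fun _ => rfl⟩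

lemma inv (hp : PerC1 p) (h : ∀ t, p t ≠ 0) : PerC1 fun t => (p t)⁻¹ :=
  ⟨hp.contDiff.inv h, fun t => by simp [hp.periodic t]⟩

lemma sum {κ : Type*} {s : Finset κ} {f : κ → ℝ → ℂ} (h : ∀ i ∈ s, PerC1 (f i)) :
    PerC1 fun t => ∑ i ∈ s, f i t :=
  ⟨ContDiff.sum fun i hi => (h i hi).contDiff,
    fun t => sum_congr rfl fun i hi => (h i hi).periodic t⟩

lemma prod {κ : Type*} {s : Finset κ} {f : κ → ℝ → ℂ} (h : ∀ i ∈ s, PerC1 (f i)) :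
    PerC1 fun t => ∏ i ∈ s, f i t :=
  ⟨contDiff_prod fun i hi => (h i hi).contDiff,
    fun t => prod_congr rfl fun i hi => (h i hi).periodic t⟩

lemma ue_pow (l : ℕ) : PerC1 fun t => ue t ^ l :=
  ⟨(contDiff_ue.of_le le_top).pow l, fun t => by simp [ue_periodic t]⟩

lemma polynomial (p : Polynomial ℂ) : PerC1 fun t => p.eval (ue t) := by
  have : (fun t => p.eval (ue t)) = fun t => ∑ i ∈ p.support, p.coeff i * ue t ^ i := by
    ext t; rw [Polynomial.eval_eq_sum, Polynomial.sum]
  rw [this]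
  exact sum fun i _ => (const _).mul (ue_pow i)

end PerC1

lemma perC1_ue : PerC1 ue := ⟨contDiff_ue.of_le le_top, ue_periodic⟩

lemma exists_bound_of_periodic {f : ℝ → ℂ} (hf : Continuous f)
    (hp : Function.Periodic f (2 * π)) : ∃ C, 0 < C ∧ ∀ t, ‖f t‖ ≤ C := by
  obtain ⟨C, hC⟩ := (isCompact_Icc (a := (0 : ℝ)) (b := 0 + 2 * π)).exists_bound_of_continuousOn
    hf.continuousOn
  refine ⟨max C 1, by positivity, fun t => ?_⟩
  obtain ⟨y, hy, hty⟩ := hp.exists_mem_Ico two_pi_pos t 0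
  rw [hty]
  exact (hC y ⟨hy.1, hy.2.le⟩).trans (le_max_left _ _)

lemma norm_ue_sub_ue (x y : ℝ) : ‖ue x - ue y‖ = ‖1 - ue (x - y)‖ := by
  rw [ue_sub, ← mul_one ‖1 - ue x / ue y‖, ← norm_ue y, ← norm_mul, sub_mul, one_mul,
    div_mul_cancel₀ _ (ue_ne_zero y), norm_sub_rev]

lemma PerC1.norm_le_of_eq_zero {p : ℝ → ℂ} (hp : PerC1 p) {c : ℝ} (hc : p c = 0) :
    ∃ C, 0 < C ∧ ∀ t, ‖p t‖ ≤ C * ‖ue t - ue c‖ := by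
  obtain ⟨C, hC0, hC⟩ := exists_bound_of_periodic hp.continuous_deriv hp.deriv_periodic
  refine ⟨C * (π / 2), by positivity, fun t => ?_⟩
  set y := toIcoMod two_pi_pos (c - π) t with hy
  have h1 : p t = p y := by
    have := toIcoMod_add_toIcoDiv_zsmul two_pi_pos (c - π) t
    rw [← this, ← hy]
    exact (hp.periodic.zsmul _ y)
  have h2 : ue t = ue y := (ue_toIcoMod _ _).symm
  have h3 : ‖p y - p c‖ ≤ C * ‖y - c‖ :=
    Convex.norm_image_sub_le_of_norm_hasDerivWithin_le
      (fun x _ => (hp.hasDerivAt x).hasDerivWithinAt) (fun x _ => hC x) convex_univ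
      (Set.mem_univ c) (Set.mem_univ y)
  have h4 := toIcoMod_mem_Ico two_pi_pos (c - π) t
  have h5 : |y - c| ≤ π := abs_le.2 ⟨by linarith [h4.1], by linarith [h4.2]⟩
  have h6 := two_div_pi_mul_le_norm h5
  rw [hc, sub_zero, ← h1] at h3
  rw [h2, norm_ue_sub_ue]
  refine h3.trans ?_
  rw [norm_eq_abs, mul_assoc]
  refine mul_le_mul_of_nonneg_left ?_ hC0.le
  have hpi := Real.pi_pos
  calc |y - c| = π / 2 * (2 / π * |y - c|) := by field_simp
    _ ≤ _ := by gcongr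

lemma zpt_eq (θ : ι → ℝ) (j : ι) : zpt θ j = ue (θ j) := rfl

/-- The product of the factors of the symbol belonging to a set of indices. -/
def prodPiece (α β : ι → ℂ) (θ : ι → ℝ) (S : Finset ι) (t : ℝ) : ℂ :=
  ∏ j ∈ S, piece (α j) (β j) (t - θ j)

/-- The normalised symbol times `z ^ (-n)`, as a function of the angle. -/
def weight (n : ℕ) (α β : ι → ℂ) (θ : ι → ℝ) (t : ℝ) : ℂ :=
  exp (I * ∑ j, (θ j : ℂ) * (α j + β j)) * exp (-(n * I * t)) * prodPiece α β θ univ t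

local notation "𝓦" => weight n α β θ

/-- Integration over the unit circle against the weight. -/
def mom (n : ℕ) (α β : ι → ℂ) (θ : ι → ℝ) (q : ℝ → ℂ) : ℂ :=
  (2 * π : ℂ)⁻¹ * ∫ t in (0 : ℝ)..(2 * π), q t * (ue t * weight n α β θ t)

lemma ue_sub_ne_one {t c : ℝ} (h : ue t ≠ ue c) : ue (t - c) ≠ 1 := by
  rwa [ue_sub, Ne, div_eq_one_iff_eq (ue_ne_zero c)]

lemma hasDerivAt_piece_sub (a b : ℂ) {t c : ℝ} (h : ue t ≠ ue c) :
    HasDerivAt (fun t => piece a b (t - c))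
      (piece a b (t - c) * (I * (2 * a * ue t / (ue t - ue c) + b - a))) t := by
  have h1 := (hasDerivAt_piece a b (ue_sub_ne_one h)).comp_sub_const t c
  refine h1.congr_deriv ?_
  rw [pieceLog, ue_sub]
  have h2 := ue_ne_zero c
  have h3 : ue t - ue c ≠ 0 := sub_ne_zero.2 h
  have h4 : ue t / ue c - 1 ≠ 0 := by rw [div_sub_one h2]; exact div_ne_zero h3 h2
  congr 4
  rw [div_sub_one h2]
  field_simp

lemma prodPiece_periodic (S : Finset ι) :
    Function.Periodic (prodPiece α β θ S) (2 * π) := fun t => by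
  refine prod_congr rfl fun j _ => ?_
  rw [add_sub_right_comm, piece_periodic]

lemma weight_periodic : Function.Periodic 𝓦 (2 * π) := fun t => by
  rw [weight, weight, prodPiece_periodic]
  congr 2
  have : -(n * I * ((t + 2 * π : ℝ) : ℂ)) = -(n * I * t) + (-n : ℤ) * (2 * π * I) := by
    push_cast; ring
  rw [this, exp_add, exp_int_mul_two_pi_mul_I, mul_one]

lemma hasDerivAt_prodPiece (S : Finset ι) {t : ℝ} (h : ∀ j ∈ S, ue t ≠ zpt θ j) :
    HasDerivAt (prodPiece α β θ S) (prodPiece α β θ S t *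
      ∑ j ∈ S, I * (2 * α j * ue t / (ue t - zpt θ j) + β j - α j)) t := by
  induction S using Finset.induction_on with
  | empty =>
    have : prodPiece α β θ ∅ = fun _ => 1 := by ext; simp [prodPiece]
    simpa [this] using hasDerivAt_const t (1 : ℂ)
  | insert a S ha ih =>
    have h1 := ih fun j hj => h j (mem_insert_of_mem hj)
    have h2 := hasDerivAt_piece_sub (α a) (β a) (h a (mem_insert_self a S))
    have h3 := h2.mul h1
    refine (h3.congr_deriv ?_).congr_of_eventuallyEq (.of_forall fun t => ?_)
    · rw [sum_insert ha, prodPiece, prodPiece, prod_insert ha, zpt_eq]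
      ring
    · simp [prodPiece, prod_insert ha]

lemma continuousAt_prodPiece (S : Finset ι) {t : ℝ} (h : ∀ j ∈ S, ue t ≠ zpt θ j) :
    ContinuousAt (prodPiece α β θ S) t := (hasDerivAt_prodPiece S h).continuousAt

lemma eventually_ne_of_ne {S : Finset ι} {t : ℝ} (h : ∀ j ∈ S, ue t ≠ zpt θ j) :
    ∀ᶠ y in 𝓝 t, ∀ j ∈ S, ue y ≠ zpt θ j :=
  (Finset.eventually_all S).2 fun j hj => continuous_ue.continuousAt.eventually_ne (h j hj)

lemma locallyIntegrable_prodPiece (hα : Admissible α)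
    (hinj : Injective (zpt θ)) (S : Finset ι) :
    LocallyIntegrable (prodPiece α β θ S) := by
  induction S using Finset.induction_on with
  | empty =>
    have : prodPiece α β θ ∅ = fun _ => 1 := by ext; simp [prodPiece]
    rw [this]
    exact continuous_const.locallyIntegrable
  | insert a S ha ih =>
    have h1 : LocallyIntegrable fun t => piece (α a) (β a) (t - θ a) :=
      locallyIntegrable_of_intervalIntegrable fun u v => by
        simpa using (intervalIntegrable_piece (α a) (β a) (hα a) (u - θ a) (v - θ a)).comp_sub_right
          (θ a)
    have h2 := locallyIntegrable_mul h1 ih fun x => by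
      by_cases hx : ue x = zpt θ a
      · right
        refine (eventually_ne_of_ne fun j hj h => ?_).mono fun y hy => continuousAt_prodPiece S hy
        exact ha (by rwa [hinj (hx.symm.trans h)])
      · left
        have : ∀ᶠ y in 𝓝 x, ue y ≠ zpt θ a := continuous_ue.continuousAt.eventually_ne hx
        exact this.mono fun y hy => (hasDerivAt_piece_sub _ _ hy).continuousAt
    refine h2.congr ?_
    exact .of_forall fun t => by simp [prodPiece, prod_insert ha]

lemma continuous_expFactor : Continuous fun t : ℝ =>
    exp (I * ∑ j, (θ j : ℂ) * (α j + β j)) * exp (-(n * I * t)) := by fun_prop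

lemma intervalIntegrable_weight (hα : Admissible α)
    (hinj : Injective (zpt θ)) (u v : ℝ) :
    IntervalIntegrable 𝓦 volume u v :=
  (LocallyIntegrable.intervalIntegrable' (locallyIntegrable_prodPiece hα hinj _) u v
    ).continuousOn_mul continuous_expFactor.continuousOn

lemma intervalIntegrable_mul_weight (hα : Admissible α)
    (hinj : Injective (zpt θ)) {q : ℝ → ℂ} (hq : AEStronglyMeasurable q) {C : ℝ}
    (hC : ∀ t, ‖q t‖ ≤ C) (u v : ℝ) :
    IntervalIntegrable (fun t => q t * (ue t * weight n α β θ t)) volume u v := by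
  have h := ((intervalIntegrable_weight (n := n) (β := β) hα hinj u v).norm.const_mul C)
  refine h.mono_fun (hq.restrict.mul (continuous_ue.aestronglyMeasurable.restrict.mul
    (intervalIntegrable_weight hα hinj u v).aestronglyMeasurable_restrict_uIoc)) ?_
  refine .of_forall fun t => ?_
  have hC0 : 0 ≤ C := (norm_nonneg _).trans (hC 0)
  simp only [norm_mul, norm_ue, one_mul, norm_norm, norm_of_nonneg hC0]
  gcongr
  exact hC t

lemma PerC1.intervalIntegrable {p : ℝ → ℂ} (hp : Continuous p)
    (hp' : Function.Periodic p (2 * π)) (hα : Admissible α)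
    (hinj : Injective (zpt θ)) (u v : ℝ) :
    IntervalIntegrable (fun t => p t * (ue t * 𝓦 t)) volume u v := by
  obtain ⟨C, _, hC⟩ := exists_bound_of_periodic hp hp'
  exact intervalIntegrable_mul_weight hα hinj hp.aestronglyMeasurable hC u v

lemma PerC1.exists_bound_div {p : ℝ → ℂ} (hp : PerC1 p) {c : ℝ} (hc : p c = 0) :
    AEStronglyMeasurable (fun t => p t / (ue t - ue c)) ∧
      ∃ C, 0 < C ∧ ∀ t, ‖p t / (ue t - ue c)‖ ≤ C := by
  obtain ⟨C, hC0, hC⟩ := hp.norm_le_of_eq_zero hc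
  refine ⟨aestronglyMeasurable_of_continuousAt (Set.finite_singleton (ue c)) fun x hx =>
    hp.continuous.continuousAt.div (continuous_ue.continuousAt.sub continuousAt_const)
      (sub_ne_zero.2 (by simpa using hx)), C, hC0, fun t => ?_⟩
  rw [norm_div]
  exact div_le_of_le_mul₀ (norm_nonneg _) hC0.le (hC t)

lemma PerC1.intervalIntegrable_div {p : ℝ → ℂ} (hp : PerC1 p) (hα : Admissible α)
    (hinj : Injective (zpt θ)) {c : ℝ} (hc : p c = 0) (u v : ℝ) :
    IntervalIntegrable (fun t => p t / (ue t - ue c) * (ue t * 𝓦 t)) volume u v := by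
  obtain ⟨h1, C, _, hC⟩ := hp.exists_bound_div hc
  exact intervalIntegrable_mul_weight hα hinj h1 hC u v

lemma mom_add {p q : ℝ → ℂ}
    (hp : IntervalIntegrable (fun t => p t * (ue t * 𝓦 t)) volume 0 (2 * π))
    (hq : IntervalIntegrable (fun t => q t * (ue t * 𝓦 t)) volume 0 (2 * π)) :
    mom n α β θ (fun t => p t + q t) = mom n α β θ p + mom n α β θ q := by
  simp only [mom, add_mul]
  rw [integral_add hp hq, mul_add]

lemma mom_const_mul (c : ℂ) (q : ℝ → ℂ) :
    mom n α β θ (fun t => c * q t) = c * mom n α β θ q := by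
  simp only [mom, mul_assoc, integral_const_mul]
  ring

lemma mom_sub {p q : ℝ → ℂ}
    (hp : IntervalIntegrable (fun t => p t * (ue t * 𝓦 t)) volume 0 (2 * π))
    (hq : IntervalIntegrable (fun t => q t * (ue t * 𝓦 t)) volume 0 (2 * π)) :
    mom n α β θ (fun t => p t - q t) = mom n α β θ p - mom n α β θ q := by
  simp only [mom, sub_mul]
  rw [integral_sub hp hq, mul_sub]

lemma mom_sum {κ : Type*} (s : Finset κ) {f : κ → ℝ → ℂ}
    (h : ∀ i ∈ s, IntervalIntegrable (fun t => f i t * (ue t * 𝓦 t)) volume 0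
      (2 * π)) :
    mom n α β θ (fun t => ∑ i ∈ s, f i t) = ∑ i ∈ s, mom n α β θ (f i) := by
  simp only [mom, sum_mul]
  rw [integral_finsetSum h, mul_sum]

lemma mom_congr {p q : ℝ → ℂ} (z : Set ℂ) (hz : z.Finite) (h : ∀ t, ue t ∉ z → p t = q t) :
    mom n α β θ p = mom n α β θ q := by
  rw [mom, mom]
  congr 1
  refine integral_congr_ae ?_
  have : ∀ᵐ t : ℝ, ∀ w ∈ z, ue t ≠ w := (ae_ball_iff hz.countable).2 fun w _ => ae_ue_ne w
  filter_upwards [this] with t ht _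
  rw [h t fun hz => ht _ hz rfl]

/-- `∫ (p' + r p) v ds` with the singularities at the points `z_j` subtracted. -/
def exactForm (n : ℕ) (α β : ι → ℂ) (θ : ι → ℝ) (p : ℝ → ℂ) : ℂ :=
  mom n α β θ fun t => deriv p t / (I * ue t) + 2 * lam n α β * p t / ue t +
    ∑ j, 2 * α j * ((p t - p (θ j)) / (ue t - zpt θ j))

lemma hasDerivAt_weight {t : ℝ} (h : ∀ j, ue t ≠ zpt θ j) :
    HasDerivAt (weight n α β θ) (weight n α β θ t *
      (I * (2 * lam n α β + ∑ j, 2 * α j * ue t / (ue t - zpt θ j)))) t := by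
  have h1 : HasDerivAt (fun t : ℝ => exp (-(n * I * t))) (exp (-(n * I * t)) * (-(n * I * 1))) t :=
    (((Complex.ofRealCLM.hasDerivAt (x := t)).const_mul (n * I)).neg).cexp
  have h2 := ((h1.const_mul (exp (I * ∑ j, (θ j : ℂ) * (α j + β j)))).mul
    (hasDerivAt_prodPiece (α := α) (β := β) univ fun j _ => h j))
  refine h2.congr_deriv ?_
  have h3 : ∑ j, I * (2 * α j * ue t / (ue t - zpt θ j) + β j - α j) =
      I * (∑ j, 2 * α j * ue t / (ue t - zpt θ j) + ∑ j, (β j - α j)) := by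
    rw [← sum_add_distrib, mul_sum]
    exact sum_congr rfl fun j _ => by ring
  have h4 : 2 * lam n α β = ∑ j, (β j - α j) - n := by rw [lam, ← sum_div]; ring
  rw [h3, h4, weight]
  ring

lemma continuous_mul_piece (a b : ℂ) (ha : -(1 / 2 : ℝ) < a.re) {p : ℝ → ℂ} (hp : PerC1 p) {c : ℝ}
    (hc : p c = 0) : Continuous fun t => p t * piece a b (t - c) := by
  refine continuous_iff_continuousAt.2 fun t => ?_
  by_cases ht : ue t = ue c
  · obtain ⟨C, hC0, hC⟩ := hp.norm_le_of_eq_zero hc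
    have hb : ∀ x, ‖p x * piece a b (x - c)‖ ≤
        C * Real.exp (|b.im| * π) * ‖ue x - ue c‖ ^ (1 + 2 * a.re) := by
      intro x
      by_cases hx : ue x = ue c
      · have : p x = 0 := by simpa [hx] using hC x
        rw [this, zero_mul, norm_zero]
        positivity
      · have h1 := norm_piece_le a b (ue_sub_ne_one hx)
        have h2 : 0 < ‖ue x - ue c‖ := norm_pos_iff.2 (sub_ne_zero.2 hx)
        rw [← norm_ue_sub_ue] at h1
        rw [norm_mul, Real.rpow_add h2, Real.rpow_one]
        calc _ ≤ (C * ‖ue x - ue c‖) *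
              (Real.exp (|b.im| * π) * ‖ue x - ue c‖ ^ (2 * a.re)) := by
              gcongr; exact hC x
          _ = _ := by ring
    have h0 : p t * piece a b (t - c) = 0 := by
      have h := hb t
      rw [ht, sub_self, norm_zero, Real.zero_rpow (by linarith), mul_zero] at h
      exact norm_le_zero_iff.1 h
    rw [ContinuousAt, h0]
    refine squeeze_zero_norm hb ?_
    have h3 : Continuous fun x => C * Real.exp (|b.im| * π) * ‖ue x - ue c‖ ^ (1 + 2 * a.re) :=
      continuous_const.mul ((continuous_ue.sub continuous_const).norm.rpow_const
        fun x => Or.inr (by linarith))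
    have h4 := h3.tendsto t
    rwa [ht, sub_self, norm_zero, Real.zero_rpow (by linarith), mul_zero] at h4
  · exact hp.continuous.continuousAt.mul (hasDerivAt_piece_sub _ _ ht).continuousAt

lemma continuous_mul_weight (hα : Admissible α)
    (hinj : Injective (zpt θ)) {p : ℝ → ℂ} (hp : PerC1 p) (h0 : ∀ j, p (θ j) = 0) :
    Continuous fun t => p t * 𝓦 t := by
  refine continuous_iff_continuousAt.2 fun t => ?_
  by_cases h : ∃ j, ue t = zpt θ j
  · obtain ⟨j, hj⟩ := h
    have h1 : (fun t => p t * 𝓦 t) = fun t : ℝ =>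
        (exp (I * ∑ j, (θ j : ℂ) * (α j + β j)) * exp (-(n * I * t))) *
        ((p t * piece (α j) (β j) (t - θ j)) * prodPiece α β θ (univ.erase j) t) := by
      ext t
      rw [weight, prodPiece, prodPiece, ← mul_prod_erase _ _ (mem_univ j)]
      ring
    rw [h1]
    refine continuous_expFactor.continuousAt.mul
      ((continuous_mul_piece _ _ (hα j) hp (h0 j)).continuousAt.mul
        (continuousAt_prodPiece _ fun i hi h => ?_))
    exact (ne_of_mem_erase hi) (hinj (h.symm.trans hj))
  · push Not at h
    exact hp.continuous.continuousAt.mul (hasDerivAt_weight h).continuousAt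

lemma PerC1.intervalIntegrable_exactForm {p : ℝ → ℂ} (hp : PerC1 p)
    (hα : Admissible α) (hinj : Injective (zpt θ)) (u v : ℝ) :
    IntervalIntegrable (fun t => (deriv p t / (I * ue t) + 2 * lam n α β * p t / ue t +
      ∑ j, 2 * α j * ((p t - p (θ j)) / (ue t - zpt θ j))) * (ue t * 𝓦 t))
      volume u v := by
  have h1 : IntervalIntegrable (fun t => (deriv p t / (I * ue t) + 2 * lam n α β * p t / ue t) *
      (ue t * 𝓦 t)) volume u v := by
    refine PerC1.intervalIntegrable ?_ (fun t => ?_) hα hinj u v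
    · exact (hp.continuous_deriv.div (continuous_const.mul continuous_ue)
        fun t => mul_ne_zero I_ne_zero (ue_ne_zero t)).add
        ((continuous_const.mul hp.continuous).div continuous_ue ue_ne_zero)
    · simp [hp.deriv_periodic t, hp.periodic t, ue_periodic t]
  have h2 := IntervalIntegrable.sum (univ : Finset (Fin (m+1)))
    (f := fun j t => (2 * α j) * ((p t - p (θ j)) / (ue t - zpt θ j) *
      (ue t * 𝓦 t))) (μ := volume) (a := u) (b := v) fun j _ =>
    ((hp.sub (PerC1.const (p (θ j)))).intervalIntegrable_div hα hinj (sub_self _) u v).const_mul _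
  refine (h1.add h2).congr_ae (.of_forall fun t => ?_)
  simp only [Finset.sum_apply, add_mul _ (∑ j, _), sum_mul, mul_assoc]

lemma exactForm_eq_zero (hα : Admissible α) (hinj : Injective (zpt θ))
    {p : ℝ → ℂ} (hp : PerC1 p) (h0 : ∀ j, p (θ j) = 0) : exactForm n α β θ p = 0 := by
  have hint := hp.intervalIntegrable_exactForm (n := n) (β := β) hα hinj 0 (2 * π)
  have hS : ({t : ℝ | ∃ j, ue t = zpt θ j}).Countable := by
    rw [Set.ofPred_exists]
    exact Set.countable_iUnion fun j => countable_ue_eq _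
  have key := MeasureTheory.integral_eq_of_hasDerivAt_off_countable
    (fun t => p t * weight n α β θ t) _ (a := 0) (b := 2 * π) hS
    (continuous_mul_weight hα hinj hp h0).continuousOn
    (fun t ht => ?_) (hint.const_mul I)
  · have hp1 := hp.periodic 0
    have hp2 := weight_periodic (n := n) (α := α) (β := β) (θ := θ) 0
    rw [zero_add] at hp1 hp2
    rw [hp1, hp2, sub_self, integral_const_mul] at key
    rw [exactForm, mom, (mul_eq_zero.1 key).resolve_left I_ne_zero, mul_zero]
  · have ht' : ∀ j, ue t ≠ zpt θ j := fun j hj => ht.2 ⟨j, hj⟩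
    refine ((hp.hasDerivAt t).mul (hasDerivAt_weight ht')).congr_deriv ?_
    have h1 := ue_ne_zero t
    have h2 : I * (deriv p t / (I * ue t) * ue t) = deriv p t := by field_simp
    have h3 : 2 * lam n α β * p t / ue t * ue t = 2 * lam n α β * p t := by field_simp
    have h4 : ∑ j, 2 * α j * ue t / (ue t - zpt θ j) * p t =
      (∑ j, 2 * α j * ((p t - p (θ j)) / (ue t - zpt θ j))) * ue t := by
      rw [sum_mul]
      exact sum_congr rfl fun j _ => by rw [h0, sub_zero]; ring
    rw [← sum_mul] at h4
    linear_combination (-weight n α β θ t) * h2 - (I * weight n α β θ t) * h3 +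
      (I * weight n α β θ t) * h4

lemma exactForm_sub_sum (hα : Admissible α) (hinj : Injective (zpt θ))
    {p : ℝ → ℂ} (hp : PerC1 p) {κ : Type*} (s : Finset κ) {f : κ → ℝ → ℂ} (hf : ∀ i, PerC1 (f i))
    (c : κ → ℂ) :
    exactForm n α β θ (fun t => p t - ∑ i ∈ s, c i * f i t) =
      exactForm n α β θ p - ∑ i ∈ s, c i * exactForm n α β θ (f i) := by
  have hi := fun i => (hf i).intervalIntegrable_exactForm (n := n) (β := β) hα hinj 0 (2 * π)
  simp only [exactForm, ← mom_const_mul]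
  rw [← mom_sum, ← mom_sub]
  · congr 1
    ext t
    have h1 : deriv (fun t => p t - ∑ i ∈ s, c i * f i t) t =
        deriv p t - ∑ i ∈ s, c i * deriv (f i) t :=
      ((hp.hasDerivAt t).sub (HasDerivAt.fun_sum fun i _ =>
        ((hf i).hasDerivAt t).const_mul (c i))).deriv
    rw [h1]
    have h2 : ∀ j, (p t - ∑ i ∈ s, c i * f i t - (p (θ j) - ∑ i ∈ s, c i * f i (θ j))) =
      (p t - p (θ j)) - ∑ i ∈ s, c i * (f i t - f i (θ j)) := fun j => by
        simp only [mul_sub, sum_sub_distrib]; ring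
    simp only [h2, sub_div, mul_sub, sum_sub_distrib, sum_div, mul_sum, mul_add, sum_add_distrib]
    rw [sum_comm (s := s)]
    have h3 : ∀ (i : κ) (j : Fin (m+1)), 2 * α j * (c i * f i t / (ue t - zpt θ j)) =
      c i * (2 * α j * (f i t / (ue t - zpt θ j))) := fun i j => by ring
    have h4 : ∀ (i : κ) (j : Fin (m+1)), 2 * α j * (c i * f i (θ j) / (ue t - zpt θ j)) =
      c i * (2 * α j * (f i (θ j) / (ue t - zpt θ j))) := fun i j => by ring
    have h5 : ∀ i, 2 * lam n α β * (c i * f i t) / ue t = c i * (2 * lam n α β * f i t / ue t) :=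
      fun i => by ring
    have h6 : ∀ i, c i * deriv (f i) t / (I * ue t) = c i * (deriv (f i) t / (I * ue t)) :=
      fun i => by ring
    simp only [h3, h4, h5, h6]
    have h7 := sum_comm (s := s) (t := (univ : Finset (Fin (m+1))))
      (f := fun i j => c i * (2 * α j * (f i (θ j) / (ue t - zpt θ j))))
    rw [h7]
    ring
  · exact hp.intervalIntegrable_exactForm hα hinj _ _
  · have := IntervalIntegrable.sum s (fun i _ => (hi i).const_mul (c i))
    refine this.congr_ae (.of_forall fun t => ?_)
    simp only [Finset.sum_apply, sum_mul, mul_assoc]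
  · intro i _
    refine ((hi i).const_mul (c i)).congr_ae (.of_forall fun t => ?_)
    simp only [mul_assoc]

/-- The Lagrange basis of the points `z_j`, on the unit circle. -/
def lagr (θ : ι → ℝ) (j : ι) (t : ℝ) : ℂ :=
  ∏ i ∈ univ.erase j, (ue t - zpt θ i) * (zpt θ j - zpt θ i)⁻¹

lemma perC1_lagr (j : ι) : PerC1 (lagr θ j) :=
  PerC1.prod fun _ _ => (perC1_ue.sub (PerC1.const _)).mul (PerC1.const _)

lemma lagr_self (hinj : Injective (zpt θ)) (j : ι) : lagr θ j (θ j) = 1 := by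
  refine prod_eq_one fun i hi => ?_
  rw [← zpt_eq]
  exact mul_inv_cancel₀ (sub_ne_zero.2 fun h => ne_of_mem_erase hi (hinj h.symm))

lemma lagr_of_ne {i j : ι} (h : i ≠ j) : lagr θ j (θ i) = 0 :=
  prod_eq_zero (mem_erase.2 ⟨h, mem_univ i⟩) (by simp [zpt_eq])

/-- The residue at `z_j` of `G' - r G`, where `G` is the Cauchy transform of the weight. -/
def resid (n : ℕ) (α β : ι → ℂ) (θ : ι → ℝ) (j : ι) : ℂ := exactForm n α β θ (lagr θ j)

lemma exactForm_eq (hα : Admissible α) (hinj : Injective (zpt θ))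
    {p : ℝ → ℂ} (hp : PerC1 p) :
    exactForm n α β θ p = ∑ j, p (θ j) * resid n α β θ j := by
  have h1 := exactForm_sub_sum (n := n) (β := β) hα hinj hp univ
    (perC1_lagr (θ := θ)) (fun j => p (θ j))
  have h2 : exactForm n α β θ (fun t => p t - ∑ i, p (θ i) * lagr θ i t) = 0 := by
    refine exactForm_eq_zero hα hinj (hp.sub (PerC1.sum fun i _ =>
      (PerC1.const _).mul (perC1_lagr i))) fun j => ?_
    rw [sum_eq_single j, lagr_self hinj, mul_one, sub_self]
    · intro i _ hij
      rw [lagr_of_ne hij.symm, mul_zero]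
    · simp
  rw [h2] at h1
  exact (sub_eq_zero.1 h1.symm)

lemma contDiffAt_piece (a b : ℂ) {x : ℝ} (h : ue x ≠ 1) : ContDiffAt ℝ 1 (piece a b) x := by
  obtain ⟨k, hk⟩ := exists_mem_Ioo_of_ue_ne_one h
  have h1 : ContDiffAt ℝ 1 (fun y : ℝ => 1 - ue y) x :=
    contDiffAt_const.sub (contDiff_ue.of_le le_top).contDiffAt
  have h2 : ContDiffAt ℝ 1 (fun y : ℝ => log (1 - ue y)) x :=
    by
    have h0 := (contDiffAt_log (n := 1) (one_sub_mem_slitPlane (norm_ue x).le h)).restrict_scalars ℝ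
    exact h0.comp x h1
  have h3 : ContDiffAt ℝ 1 (fun y : ℝ => exp (2 * a * log (1 - ue y) +
      I * (b - a) * (y - k * (2 * π) - π))) x :=
    ((contDiffAt_const.mul h2).add (contDiffAt_const.mul
      ((Complex.ofRealCLM.contDiff.contDiffAt.sub contDiffAt_const).sub contDiffAt_const))).cexp
  refine h3.congr_of_eventuallyEq ?_
  filter_upwards [isOpen_Ioo.mem_nhds hk] with y hy using piece_eq_exp a b hy

/-- A smooth periodic cutoff function around the angle `c`. -/
def bump (η c t : ℝ) : ℂ := (Real.smoothTransition (2 - (2 - 2 * Real.cos (t - c)) / η) : ℝ)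

lemma norm_ue_sub_ue_sq (t c : ℝ) : ‖ue t - ue c‖ ^ 2 = 2 - 2 * Real.cos (t - c) := by
  rw [norm_ue_sub_ue, norm_one_sub_ue, sq_abs, mul_pow, Real.sin_sq_eq_half_sub]
  ring_nf

lemma perC1_bump (η c : ℝ) : PerC1 (bump η c) := by
  constructor
  · have : ContDiff ℝ 1 fun t : ℝ => Real.smoothTransition (2 - (2 - 2 * Real.cos (t - c)) / η) := by
      refine Real.smoothTransition.contDiff.comp ?_
      exact contDiff_const.sub ((contDiff_const.sub (contDiff_const.mul
        (Real.contDiff_cos.comp (contDiff_id.sub contDiff_const)))).div_const _)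
    exact Complex.ofRealCLM.contDiff.comp this
  · intro t
    rw [bump, bump, add_sub_right_comm, Real.cos_add_two_pi]

lemma bump_eq_one {η c t : ℝ} (hη : 0 < η) (h : ‖ue t - ue c‖ ^ 2 ≤ η) : bump η c t = 1 := by
  rw [norm_ue_sub_ue_sq] at h
  rw [bump, Real.smoothTransition.one_of_one_le, ofReal_one]
  have := (div_le_one hη).2 h
  linarith

lemma bump_eq_zero {η c t : ℝ} (hη : 0 < η) (h : 2 * η ≤ ‖ue t - ue c‖ ^ 2) : bump η c t = 0 := by
  rw [norm_ue_sub_ue_sq] at h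
  rw [bump, Real.smoothTransition.zero_of_nonpos, ofReal_zero]
  have := (le_div_iff₀ hη).2 h
  linarith

lemma bump_self {η c : ℝ} (hη : 0 < η) : bump η c c = 1 := bump_eq_one hη (by simpa using hη.le)

lemma integral_mul_piece_shift {φ : ℝ → ℂ} (hφ : Function.Periodic φ (2 * π)) (a b : ℂ)
    (τ : ℝ) : ∫ t in (0 : ℝ)..(2 * π), φ t * piece a b (t - τ) =
      ∫ x in (0 : ℝ)..(2 * π), φ (x + τ) * piece a b x := by
  have h1 : Function.Periodic (fun t => φ t * piece a b (t - τ)) (2 * π) := fun t => by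
    simp only []
    rw [hφ, add_sub_right_comm, piece_periodic]
  have h2 := h1.intervalIntegral_add_eq 0 τ
  rw [zero_add] at h2
  rw [h2]
  have h3 := integral_comp_add_right (fun t => φ t * piece a b (t - τ)) τ
    (a := 0) (b := 2 * π)
  simp only [add_sub_cancel_right, zero_add] at h3
  rw [h3, add_comm τ]

lemma hasDerivAt_integral_mul_piece_sub {φ : ℝ → ℂ} (hφ : PerC1 φ) {a : ℂ} (b : ℂ)
    (ha : -(1 / 2 : ℝ) < a.re) (τ₀ : ℝ) :
    HasDerivAt (fun τ => ∫ t in (0 : ℝ)..(2 * π), φ t * piece a b (t - τ))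
      (∫ t in (0 : ℝ)..(2 * π), deriv φ t * piece a b (t - τ₀)) τ₀ := by
  simp only [integral_mul_piece_shift hφ.periodic, integral_mul_piece_shift hφ.deriv_periodic]
  obtain ⟨C, hC0, hC⟩ := exists_bound_of_periodic hφ.continuous_deriv hφ.deriv_periodic
  have hp := intervalIntegrable_piece a b ha 0 (2 * π)
  have hm : ∀ f : ℝ → ℂ, Continuous f → ∀ τ, IntervalIntegrable (fun x => f (x + τ) * piece a b x)
      volume 0 (2 * π) := fun f hf τ =>
    hp.continuousOn_mul (hf.comp (continuous_id.add continuous_const)).continuousOn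
  refine (hasDerivAt_integral_of_dominated_loc_of_deriv_le (s := Set.univ)
    (F' := fun τ x => deriv φ (x + τ) * piece a b x)
    (bound := fun x => C * ‖piece a b x‖) univ_mem
    (.of_forall fun τ => (hm φ hφ.continuous τ).aestronglyMeasurable_restrict_uIoc)
    (hm φ hφ.continuous τ₀)
    (hm _ hφ.continuous_deriv τ₀).aestronglyMeasurable_restrict_uIoc
    (.of_forall fun x _ τ _ => ?_) (hp.norm.const_mul C) (.of_forall fun x _ τ _ => ?_)).2
  · rw [norm_mul]
    gcongr
    exact hC _
  · exact ((hφ.hasDerivAt (x + τ)).comp_const_add x τ).mul_const _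

lemma norm_piece_le_of_le (a b : ℂ) {c : ℝ} (hc : 0 < c) :
    ∃ C, 0 < C ∧ ∀ x, c ≤ ‖1 - ue x‖ → ‖piece a b x‖ ≤ C ∧ ‖piece a b x * pieceLog a b x‖ ≤ C := by
  set A := Real.exp (|b.im| * π) * (2 ^ (2 * a.re) + c ^ (2 * a.re)) with hA
  set B := 2 * ‖a‖ / c + ‖b‖ + ‖a‖ with hB
  have hA0 : 0 < A := by positivity
  have hB0 : 0 ≤ B := by positivity
  refine ⟨A * (1 + B), by positivity, fun x hx => ?_⟩
  have hne : ue x ≠ 1 := fun h => by rw [h, sub_self, norm_zero] at hx; linarith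
  have h2 : ‖1 - ue x‖ ≤ 2 := (norm_sub_le _ _).trans (by rw [norm_ue, norm_one]; norm_num)
  have h1 : ‖piece a b x‖ ≤ A := by
    refine (norm_piece_le a b hne).trans ?_
    refine mul_le_mul_of_nonneg_left ?_ (Real.exp_pos _).le
    rcases le_total 0 (2 * a.re) with h | h
    · exact (Real.rpow_le_rpow (norm_nonneg _) h2 h).trans (le_add_of_nonneg_right (by positivity))
    · exact (Real.rpow_le_rpow_of_nonpos hc hx h).trans (le_add_of_nonneg_left (by positivity))
  have h3 : ‖pieceLog a b x‖ ≤ B := by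
    rw [pieceLog, norm_mul, norm_I, one_mul]
    refine (norm_sub_le _ _).trans (add_le_add ((norm_add_le _ _).trans
      (add_le_add ?_ le_rfl)) le_rfl)
    rw [norm_div, norm_mul, norm_mul, norm_ue, mul_one, norm_ofNat, norm_sub_rev]
    gcongr
  refine ⟨h1.trans (le_mul_of_one_le_right hA0.le (by linarith)), ?_⟩
  rw [norm_mul]
  calc _ ≤ A * B := by gcongr
    _ ≤ _ := by nlinarith

lemma hasDerivAt_integral_mul_piece_sub_of_eq_zero {Q : ℝ → ℂ} (a b : ℂ)
    (hQ : IntervalIntegrable Q volume 0 (2 * π)) {c τ₀ : ℝ} (hc : 0 < c)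
    (h0 : ∀ t, ‖ue t - ue τ₀‖ < c → Q t = 0) :
    IntervalIntegrable (fun t => Q t * -(piece a b (t - τ₀) * pieceLog a b (t - τ₀))) volume 0
      (2 * π) ∧
    HasDerivAt (fun τ => ∫ t in (0 : ℝ)..(2 * π), Q t * piece a b (t - τ))
      (∫ t in (0 : ℝ)..(2 * π), Q t * -(piece a b (t - τ₀) * pieceLog a b (t - τ₀))) τ₀ := by
  obtain ⟨C, hC0, hC⟩ := norm_piece_le_of_le a b (half_pos hc)
  set s : Set ℝ := {τ | ‖ue τ - ue τ₀‖ < c / 2}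
  have hs : s ∈ 𝓝 τ₀ := (continuous_ue.sub continuous_const).norm.continuousAt.preimage_mem_nhds
    (Iio_mem_nhds (by simpa using half_pos hc))
  have hsep : ∀ τ ∈ s, ∀ t, Q t ≠ 0 → c / 2 ≤ ‖1 - ue (t - τ)‖ := by
    intro τ hτ t ht
    have h1 : c ≤ ‖ue t - ue τ₀‖ := not_lt.1 fun h => ht (h0 t h)
    have h2 := norm_sub_le_norm_sub_add_norm_sub (ue t) (ue τ) (ue τ₀)
    rw [← norm_ue_sub_ue]
    have h3 : ‖ue τ - ue τ₀‖ < c / 2 := hτ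
    linarith
  have hmp : ∀ τ, AEStronglyMeasurable (fun t => piece a b (t - τ)) := fun τ =>
    aestronglyMeasurable_of_continuousAt (Set.finite_singleton (ue τ))
      fun x hx => (hasDerivAt_piece_sub a b (by simpa using hx)).continuousAt
  have hml : ∀ τ, AEStronglyMeasurable (fun t => pieceLog a b (t - τ)) := fun τ =>
    aestronglyMeasurable_of_continuousAt (Set.finite_singleton (ue τ)) fun x hx => by
      have h1 : ContinuousAt (fun t => ue (t - τ)) x :=
        (continuous_ue.comp (continuous_id.sub continuous_const)).continuousAt
      exact continuousAt_const.mul ((((continuousAt_const.mul h1).div (h1.sub continuousAt_const)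
        (sub_ne_zero.2 (ue_sub_ne_one (by simpa using hx)))).add
        continuousAt_const).sub continuousAt_const)
  have hQm := hQ.aestronglyMeasurable_restrict_uIoc
  refine hasDerivAt_integral_of_dominated_loc_of_deriv_le (s := s)
    (F' := fun τ t => Q t * -(piece a b (t - τ) * pieceLog a b (t - τ)))
    (bound := fun t => ‖Q t‖ * C) hs (.of_forall fun τ => hQm.mul (hmp τ).restrict)
    ((hQ.norm.mul_const C).mono_fun (hQm.mul (hmp τ₀).restrict) (.of_forall fun t => show ‖Q t * piece a b (t - τ₀)‖ ≤ ‖‖Q t‖ * C‖ from ?_))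
    (hQm.mul ((hmp τ₀).mul (hml τ₀)).neg.restrict)
    (.of_forall fun t _ τ hτ => ?_) (hQ.norm.mul_const C) (.of_forall fun t _ τ hτ => ?_)
  · rw [norm_mul, norm_of_nonneg (by positivity)]
    by_cases ht : Q t = 0
    · simp [ht]
    · gcongr
      exact (hC _ (hsep τ₀ (mem_of_mem_nhds hs) t ht)).1
  · rw [norm_mul, norm_neg]
    by_cases ht : Q t = 0
    · simp [ht]
    · gcongr
      exact (hC _ (hsep τ hτ t ht)).2
  · by_cases ht : Q t = 0
    · simpa [ht] using hasDerivAt_const τ (0 : ℂ)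
    · have h1 := hsep τ hτ t ht
      have hne : ue (t - τ) ≠ 1 := fun h => by rw [h, sub_self, norm_zero] at h1; linarith
      have := (hasDerivAt_piece a b hne).comp_const_sub t τ
      exact this.const_mul (Q t)

lemma exists_sep (hinj : Injective (zpt θ)) :
    ∃ d, 0 < d ∧ ∀ i j, i ≠ j → d ≤ ‖zpt θ i - zpt θ j‖ := by
  classical
  have h : ∀ q : ι × ι, ∃ d, 0 < d ∧ (q.1 ≠ q.2 → d ≤ ‖zpt θ q.1 - zpt θ q.2‖) := by
    intro q
    by_cases hq : q.1 = q.2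
    · exact ⟨1, one_pos, fun h => absurd hq h⟩
    · exact ⟨_, norm_pos_iff.2 (sub_ne_zero.2 fun h => hq (hinj h)), fun _ => le_rfl⟩
  choose d hd0 hd using h
  refine ⟨univ.inf' univ_nonempty d, ?_, fun i j hij => ?_⟩
  · rw [lt_inf'_iff]
    exact fun q _ => hd0 q
  · exact (inf'_le d (mem_univ (i, j))).trans (hd (i, j) hij)

lemma contDiffAt_prodPiece (S : Finset ι) {t : ℝ} (h : ∀ j ∈ S, ue t ≠ zpt θ j) :
    ContDiffAt ℝ 1 (prodPiece α β θ S) t :=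
  contDiffAt_prod fun j hj => (contDiffAt_piece (α j) (β j) (x := t - θ j)
    (ue_sub_ne_one (h j hj))).comp t (contDiff_id.sub contDiff_const).contDiffAt

lemma perC1_bump_mul_prodPiece {d : ℝ} (hd : 0 < d)
    (hsep : ∀ i j, i ≠ j → d ≤ ‖zpt θ i - zpt θ j‖) (k : ι) {p : ℝ → ℂ} (hp : PerC1 p) :
    PerC1 fun t => bump (d ^ 2 / 8) (θ k) t * p t * prodPiece α β θ (univ.erase k) t := by
  constructor
  · refine contDiff_iff_contDiffAt.2 fun t => ?_
    have hcont : Continuous fun t => ‖ue t - ue (θ k)‖ := (continuous_ue.sub continuous_const).norm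
    by_cases ht : ‖ue t - ue (θ k)‖ < d
    · refine ((perC1_bump _ _).mul hp).contDiff.contDiffAt.mul (contDiffAt_prodPiece _ fun j hj h => ?_)
      have := hsep j k (ne_of_mem_erase hj)
      rw [← h, zpt_eq] at this
      linarith
    · have : ∀ᶠ x in 𝓝 t, d / 2 < ‖ue x - ue (θ k)‖ :=
        hcont.continuousAt.eventually (lt_mem_nhds (by push Not at ht; linarith))
      refine (contDiffAt_const (c := (0 : ℂ))).congr_of_eventuallyEq ?_
      filter_upwards [this] with x hx
      rw [bump_eq_zero (by positivity) (by nlinarith), zero_mul, zero_mul]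
  · intro t
    simp only [(perC1_bump _ _).periodic t, hp.periodic t, prodPiece_periodic _ t]

lemma weight_update (k : ι) (τ t : ℝ) :
    weight n α β (update θ k τ) t =
      exp (I * (τ * (α k + β k) + ∑ j ∈ univ.erase k, (θ j : ℂ) * (α j + β j))) *
      (exp (-(n * I * t)) * prodPiece α β θ (univ.erase k) t) * piece (α k) (β k) (t - τ) := by
  have h1 : ∑ j, ((update θ k τ j : ℝ) : ℂ) * (α j + β j) =
      τ * (α k + β k) + ∑ j ∈ univ.erase k, (θ j : ℂ) * (α j + β j) := by
    rw [← add_sum_erase _ _ (mem_univ k), Function.update_self]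
    congr 1
    exact sum_congr rfl fun j hj => by rw [Function.update_of_ne (ne_of_mem_erase hj)]
  have h2 : prodPiece α β (update θ k τ) univ t =
      piece (α k) (β k) (t - τ) * prodPiece α β θ (univ.erase k) t := by
    rw [prodPiece, ← mul_prod_erase _ _ (mem_univ k), Function.update_self]
    congr 1
    exact prod_congr rfl fun j hj => by rw [Function.update_of_ne (ne_of_mem_erase hj)]
  rw [weight, h1, h2]
  ring

lemma weight_eq (k : ι) (t : ℝ) :
    𝓦 t = exp (I * (θ k * (α k + β k) + ∑ j ∈ univ.erase k, (θ j : ℂ) * (α j + β j))) *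
      (exp (-(n * I * t)) * prodPiece α β θ (univ.erase k) t) * piece (α k) (β k) (t - θ k) := by
  conv_lhs => rw [← update_eq_self k θ, weight_update]

lemma perC1_exp_neg (n : ℕ) : PerC1 fun t : ℝ => exp (-(n * I * t)) := by
  have : (fun t : ℝ => exp (-(n * I * t))) = fun t => (ue t ^ n)⁻¹ := by
    ext t
    rw [ue, ← exp_nat_mul, ← exp_neg]
    ring_nf
  rw [this]
  exact (PerC1.ue_pow n).inv fun t => pow_ne_zero _ (ue_ne_zero t)

/-- The derivative of a moment with respect to one of the angles. -/
lemma hasDerivAt_mom (hα : Admissible α) (hinj : Injective (zpt θ))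
    (k : ι) {p : ℝ → ℂ} (hp : PerC1 p) :
    HasDerivAt (fun τ => mom n α β (update θ k τ) p)
      (I * zpt θ k * (-2 * α k * mom n α β θ (fun t => (p t - p (θ k)) / (ue t - zpt θ k)) +
        resid n α β θ k * p (θ k))) (θ k) := by
  obtain ⟨d, hd, hsep⟩ := exists_sep hinj
  set χ := bump (d ^ 2 / 8) (θ k) with hχ
  have hη : 0 < d ^ 2 / 8 := by positivity
  have hχC : PerC1 χ := perC1_bump _ _
  set B : ℝ → ℂ := prodPiece α β θ (univ.erase k) with hB
  set P : ℝ → ℂ := fun t => p t * ue t * exp (-(n * I * t)) with hP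
  have hPC : PerC1 P := (hp.mul perC1_ue).mul (perC1_exp_neg n)
  set φ : ℝ → ℂ := fun t => χ t * P t * B t with hφ
  have hφC : PerC1 φ := perC1_bump_mul_prodPiece hd hsep k hPC
  set Q : ℝ → ℂ := fun t => (1 - χ t) * P t * B t with hQ
  have hBint := LocallyIntegrable.intervalIntegrable'
    (locallyIntegrable_prodPiece (β := β) hα hinj (univ.erase k)) 0 (2 * π)
  have hQint : IntervalIntegrable Q volume 0 (2 * π) :=
    hBint.continuousOn_mul (((PerC1.const 1).sub hχC).mul hPC).continuous.continuousOn
  set V := piece (α k) (β k) with hV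
  set c : ℂ := ∑ j ∈ univ.erase k, (θ j : ℂ) * (α j + β j) with hc
  have hpc : ∀ τ : ℝ, ∀ f : ℝ → ℂ, Continuous f →
      IntervalIntegrable (fun t => f t * V (t - τ)) volume 0 (2 * π) := fun τ f hf => by
    have := (intervalIntegrable_piece (α k) (β k) (hα k) (0 - τ) (2 * π - τ)).comp_sub_right τ
    simp only [sub_add_cancel] at this
    exact this.continuousOn_mul hf.continuousOn
  have hQ0 : ∀ t, ‖ue t - ue (θ k)‖ < d / 4 → Q t = 0 := fun t ht => by
    simp only [hQ]
    rw [hχ, bump_eq_one hη (by nlinarith [norm_nonneg (ue t - ue (θ k))]), sub_self, zero_mul,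
      zero_mul]
  have hQV : ∀ᶠ τ in 𝓝 (θ k), IntervalIntegrable (fun t => Q t * V (t - τ)) volume 0
      (2 * π) := by
    obtain ⟨C, hC0, hC⟩ := norm_piece_le_of_le (α k) (β k) (show 0 < d / 8 by positivity)
    have : ∀ᶠ τ in 𝓝 (θ k), ‖ue τ - ue (θ k)‖ < d / 8 :=
      (continuous_ue.sub continuous_const).norm.continuousAt.eventually
        (gt_mem_nhds (by simpa using hd))
    filter_upwards [this] with τ hτ
    have hm : AEStronglyMeasurable (fun t => V (t - τ)) :=
      aestronglyMeasurable_of_continuousAt (Set.finite_singleton (ue τ))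
        fun x hx => (hasDerivAt_piece_sub _ _ (by simpa using hx)).continuousAt
    refine (hQint.norm.mul_const C).mono_fun
      (hQint.aestronglyMeasurable_restrict_uIoc.mul hm.restrict)
      (.of_forall fun t => show ‖Q t * V (t - τ)‖ ≤ ‖‖Q t‖ * C‖ from ?_)
    rw [norm_mul, norm_of_nonneg (by positivity)]
    by_cases ht : Q t = 0
    · simp [ht]
    · gcongr
      refine (hC _ ?_).1
      have h1 : d / 4 ≤ ‖ue t - ue (θ k)‖ := not_lt.1 fun h => ht (hQ0 t h)
      have h2 := norm_sub_le_norm_sub_add_norm_sub (ue t) (ue τ) (ue (θ k))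
      rw [← norm_ue_sub_ue]
      linarith
  obtain ⟨hi2, hd2⟩ := hasDerivAt_integral_mul_piece_sub_of_eq_zero (α k) (β k) hQint
    (show 0 < d / 4 by positivity) hQ0
  have hd1 := hasDerivAt_integral_mul_piece_sub hφC (β k) (hα k) (θ k)
  have hd3 : HasDerivAt (fun τ : ℝ => exp (I * (τ * (α k + β k) + c)))
      (exp (I * (θ k * (α k + β k) + c)) * (I * (1 * (α k + β k)))) (θ k) :=
    ((((Complex.ofRealCLM.hasDerivAt (x := θ k)).mul_const (α k + β k)).add_const c).const_mul
      I).cexp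
  have hd4 := ((hd3.mul (hd1.add hd2)).const_mul (2 * π : ℂ)⁻¹)
  have hev : (fun τ => mom n α β (update θ k τ) p) =ᶠ[𝓝 (θ k)] fun τ =>
      (2 * π : ℂ)⁻¹ * (exp (I * (τ * (α k + β k) + c)) *
        ((∫ t in (0 : ℝ)..(2 * π), φ t * V (t - τ)) +
          ∫ t in (0 : ℝ)..(2 * π), Q t * V (t - τ))) := by
    filter_upwards [hQV] with τ hτ
    rw [← integral_add (hpc τ φ hφC.continuous) hτ, ← integral_const_mul, mom]
    congr 1
    refine integral_congr fun t _ => ?_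
    simp only [weight_update, hφ, hQ, hP, hB, hV, hc]
    ring
  refine (hd4.congr_of_eventuallyEq hev).congr_deriv ?_
  set u : ℝ → ℂ := fun t => χ t * p t * ue t * (zpt θ k)⁻¹ with hu
  have huC : PerC1 u := (((hχC.mul hp).mul perC1_ue)).mul (PerC1.const _)
  have huk : u (θ k) = p (θ k) := by
    simp only [hu, hχ, bump_self hη, one_mul, zpt_eq]
    rw [mul_assoc, mul_inv_cancel₀ (ue_ne_zero _), mul_one]
  have huj : ∀ j, j ≠ k → u (θ j) = 0 := fun j hj => by
    simp only [hu, hχ]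
    rw [bump_eq_zero hη, zero_mul, zero_mul, zero_mul]
    have := hsep j k hj
    rw [zpt_eq, zpt_eq] at this
    nlinarith
  have hE := exactForm_eq (n := n) (β := β) hα hinj huC
  rw [sum_eq_single k (fun j _ hj => by rw [huj j hj, zero_mul]) (by simp), huk] at hE
  rw [mul_comm (resid n α β θ k), ← hE, exactForm, ← mom_const_mul, ← mom_add
    (by
      have := (hp.sub (PerC1.const (p (θ k)))).intervalIntegrable_div (n := n) (β := β) hα hinj
        (sub_self (p (θ k))) 0 (2 * π)
      refine (this.const_mul (-2 * α k)).congr_ae (.of_forall fun t => ?_)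
      simp only [mul_assoc, zpt_eq])
    (huC.intervalIntegrable_exactForm hα hinj _ _), ← mom_const_mul, mom]
  congr 1
  have hsum1 : (∫ t in (0 : ℝ)..(2 * π), φ t * V (t - θ k)) +
      ∫ t in (0 : ℝ)..(2 * π), Q t * V (t - θ k) =
      ∫ t in (0 : ℝ)..(2 * π), (φ t * V (t - θ k) + Q t * V (t - θ k)) :=
    (integral_add (hpc _ φ hφC.continuous) hQV.self_of_nhds).symm
  simp only [Pi.add_apply]
  rw [hsum1, ← integral_add (hpc _ _ hφC.continuous_deriv) hi2,
    ← integral_const_mul, ← integral_const_mul, ← integral_add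
      (((hpc _ φ hφC.continuous).add hQV.self_of_nhds).const_mul _)
      (((hpc _ _ hφC.continuous_deriv).add hi2).const_mul _)]
  refine integral_congr_ae ?_
  have hae : ∀ᵐ t : ℝ, ∀ j, ue t ≠ zpt θ j := ae_all_iff.2 fun j => ae_ue_ne _
  filter_upwards [hae] with t ht _
  have hφ' : HasDerivAt φ ((deriv u t * zpt θ k) * (exp (-(n * I * t)) * B t) +
      (χ t * p t * ue t) * (exp (-(n * I * t)) * (-(n * I * 1)) * B t + exp (-(n * I * t)) * (B t *
      ∑ j ∈ univ.erase k, I * (2 * α j * ue t / (ue t - zpt θ j) + β j - α j)))) t := by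
    have h1 : HasDerivAt (fun t : ℝ => exp (-(n * I * t))) (exp (-(n * I * t)) * (-(n * I * 1))) t :=
      (((Complex.ofRealCLM.hasDerivAt (x := t)).const_mul (n * I)).neg).cexp
    have h2 := hasDerivAt_prodPiece (α := α) (β := β) (univ.erase k) fun j _ => ht j
    have h3 : HasDerivAt (fun t => χ t * p t * ue t) (deriv u t * zpt θ k) t := by
      have := (huC.hasDerivAt t).mul_const (zpt θ k)
      refine this.congr_of_eventuallyEq (.of_forall fun x => ?_)
      simp only [hu]
      rw [mul_assoc _ (zpt θ k)⁻¹, inv_mul_cancel₀ (show zpt θ k ≠ 0 from ue_ne_zero _), mul_one]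
    refine (h3.mul (h1.mul h2)).congr_of_eventuallyEq (.of_forall fun x => ?_)
    simp only [hφ, hP, hB, Pi.mul_apply]
    ring
  rw [hφ'.deriv]
  have hs1 : ∑ j ∈ univ.erase k, I * (2 * α j * ue t / (ue t - zpt θ j) + β j - α j) =
      I * (ue t * ∑ j ∈ univ.erase k, 2 * α j * (1 / (ue t - zpt θ j)) +
        ∑ j ∈ univ.erase k, (β j - α j)) := by
    rw [mul_sum (a := ue t), ← sum_add_distrib, mul_sum]
    exact sum_congr rfl fun j _ => by ring
  have hs2 : ∑ j, 2 * α j * ((u t - u (θ j)) / (ue t - zpt θ j)) =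
      2 * α k * ((u t - p (θ k)) / (ue t - zpt θ k)) +
      u t * ∑ j ∈ univ.erase k, 2 * α j * (1 / (ue t - zpt θ j)) := by
    rw [← add_sum_erase _ _ (mem_univ k), huk, mul_sum]
    congr 1
    exact sum_congr rfl fun j hj => by rw [huj j (ne_of_mem_erase hj), sub_zero]; ring
  have hlam : 2 * lam n α β = (β k - α k) + ∑ j ∈ univ.erase k, (β j - α j) - n := by
    rw [lam, ← sum_div, ← add_sum_erase _ _ (mem_univ k)]; ring
  have hpl : pieceLog (α k) (β k) (t - θ k) =
      I * (2 * α k * ue t / (ue t - zpt θ k) + β k - α k) := by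
    rw [pieceLog, ue_sub]
    have h2 := ue_ne_zero (θ k)
    have h3 : ue t - ue (θ k) ≠ 0 := sub_ne_zero.2 (ht k)
    rw [zpt_eq, div_sub_one h2]
    field_simp
  rw [hs1, hs2, hlam, hpl, weight_eq k, show piece (α k) (β k) (t - θ k) = V (t - θ k) from rfl,
    show prodPiece α β θ (univ.erase k) t = B t from rfl]
  have hz : zpt θ k ≠ 0 := ue_ne_zero _
  have hutt : u t = χ t * p t * ue t * (zpt θ k)⁻¹ := rfl
  rw [hutt]
  simp only [hφ, hQ, hP]
  have h1 := ue_ne_zero t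
  have h3 : ue t - zpt θ k ≠ 0 := sub_ne_zero.2 (ht k)
  generalize ∑ j ∈ univ.erase k, 2 * α j * (1 / (ue t - zpt θ j)) = S
  generalize ∑ j ∈ univ.erase k, (β j - α j) = S'
  generalize deriv u t = u'
  generalize exp (I * (θ k * (α k + β k) + c)) = E1
  generalize exp (-(n * I * t)) = E2
  generalize B t = b
  generalize V (t - θ k) = v
  generalize zpt θ k = z at *
  generalize ue t = s at *
  field_simp
  ring

section DominatedContinuity

variable {X : Type*} [TopologicalSpace X]

lemma exists_eventually_bound {Ψ : X → ℝ → ℂ} {x₀ : X} {a b : ℝ}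
    (h : ∀ t ∈ Set.Icc a b, ContinuousAt (fun q : X × ℝ => Ψ q.1 q.2) (x₀, t)) :
    ∃ C, 0 ≤ C ∧ ∀ᶠ x in 𝓝 x₀, ∀ t ∈ Set.Icc a b, ‖Ψ x t‖ ≤ C := by
  have hc : ContinuousOn (Ψ x₀) (Set.Icc a b) := fun t ht =>
    ((h t ht).comp (f := fun t => (x₀, t)) (Continuous.prodMk_right x₀).continuousAt).continuousWithinAt
  obtain ⟨C, hC⟩ := isCompact_Icc.exists_bound_of_continuousOn hc
  refine ⟨max C 0 + 1, by positivity, isCompact_Icc.eventually_forall_of_forall_eventually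
    fun t ht => ?_⟩
  have h0 : ‖Ψ x₀ t‖ < max C 0 + 1 := by
    have := (hC t ht).trans (le_max_left C 0)
    linarith
  have h1 := (h t ht).norm.eventually (gt_mem_nhds h0)
  exact h1.mono fun q hq => hq.le

lemma continuousAt_integral_mul [FirstCountableTopology X] {Ψ : X → ℝ → ℂ} {V : ℝ → ℂ} {x₀ : X}
    {a b : ℝ} (hab : a ≤ b)
    (h : ∀ t ∈ Set.Icc a b, ContinuousAt (fun q : X × ℝ => Ψ q.1 q.2) (x₀, t))
    (hm : ∀ x, AEStronglyMeasurable (Ψ x)) (hV : IntervalIntegrable V volume a b) :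
    ContinuousAt (fun x => ∫ t in a..b, Ψ x t * V t) x₀ := by
  obtain ⟨C, hC0, hC⟩ := exists_eventually_bound h
  refine continuousAt_of_dominated_interval (bound := fun t => C * ‖V t‖)
    (.of_forall fun x => (hm x).restrict.mul hV.aestronglyMeasurable_restrict_uIoc) ?_
    (hV.norm.const_mul C) (.of_forall fun t ht => ?_)
  · filter_upwards [hC] with x hx
    refine .of_forall fun t ht => ?_
    rw [Set.uIoc_of_le hab] at ht
    rw [norm_mul]
    gcongr
    exact hx t ⟨ht.1.le, ht.2⟩
  · rw [Set.uIoc_of_le hab] at ht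
    have := (h t ⟨ht.1.le, ht.2⟩).comp (f := fun x => (x, t)) (Continuous.prodMk_left t).continuousAt
    exact this.mul continuousAt_const

end DominatedContinuity

lemma continuous_zpt (j : ι) : Continuous fun θ : ι → ℝ => zpt θ j :=
  continuous_ue.comp (continuous_apply j)

lemma eventually_injective_zpt (hinj : Injective (zpt θ)) :
    ∀ᶠ θ' in 𝓝 θ, Injective (zpt θ') := by
  have : ∀ᶠ θ' in 𝓝 θ, ∀ i j, i ≠ j → zpt θ' i ≠ zpt θ' j := by
    refine eventually_all.2 fun i => eventually_all.2 fun j => ?_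
    by_cases hij : i = j
    · exact .of_forall fun _ h => absurd hij h
    · have hne : zpt θ i - zpt θ j ≠ 0 := sub_ne_zero.2 fun h => hij (hinj h)
      filter_upwards [((continuous_zpt i).sub (continuous_zpt j)).continuousAt.eventually_ne hne]
        with θ' h _ using sub_ne_zero.1 h
  filter_upwards [this] with θ' h i j hij
  by_contra hne
  exact h i j hne hij

lemma continuousAt_prodPiece_joint (S : Finset ι) {t : ℝ} (h : ∀ j ∈ S, ue t ≠ zpt θ j) :
    ContinuousAt (fun q : (ι → ℝ) × ℝ => prodPiece α β q.1 S q.2) (θ, t) := by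
  refine tendsto_finsetProd S fun j hj => ?_
  have h1 : ContinuousAt (fun q : (ι → ℝ) × ℝ => q.2 - q.1 j) (θ, t) := by fun_prop
  exact ContinuousAt.comp (f := fun q : (ι → ℝ) × ℝ => q.2 - q.1 j)
    (continuousAt_piece (α j) (β j) (ue_sub_ne_one (h j hj))) h1

lemma aestronglyMeasurable_prodPiece_comp (S : Finset ι) (c : ℝ) :
    AEStronglyMeasurable fun t => prodPiece α β θ S (t + c) := by
  refine aestronglyMeasurable_of_continuousAt (z := Set.range fun j => zpt θ j / ue c)
    (Set.finite_range _) fun x hx => ?_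
  refine (continuousAt_prodPiece S fun j _ h => hx ⟨j, ?_⟩).comp
    (f := fun t => t + c) (by fun_prop)
  show zpt θ j / ue c = ue x
  rw [← h, ue_add, mul_div_cancel_right₀ _ (ue_ne_zero c)]

lemma continuous_expFactor_joint : Continuous fun q : (ι → ℝ) × ℝ =>
    exp (I * ∑ j, (q.1 j : ℂ) * (α j + β j)) * exp (-(n * I * q.2)) := by fun_prop

lemma exists_partition (hinj : Injective (zpt θ)) :
    ∃ d > 0, ∃ χ : ι → ℝ → ℂ, (∀ j, PerC1 (χ j)) ∧ (∀ j t, d / 2 ≤ ‖ue t - zpt θ j‖ → χ j t = 0) ∧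
      (∀ j t, ‖ue t - zpt θ j‖ < d / 4 → ∑ i, χ i t = 1) ∧
      ∀ i j, i ≠ j → d ≤ ‖zpt θ i - zpt θ j‖ := by
  obtain ⟨d, hd, hsep⟩ := exists_sep hinj
  have hη : 0 < d ^ 2 / 8 := by positivity
  have h0 : ∀ j t, d / 2 ≤ ‖ue t - zpt θ j‖ → bump (d ^ 2 / 8) (θ j) t = 0 := fun j t ht =>
    bump_eq_zero hη (by rw [zpt_eq] at ht; nlinarith)
  refine ⟨d, hd, fun j => bump (d ^ 2 / 8) (θ j), fun j => perC1_bump _ _, h0,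
    fun j t ht => ?_, hsep⟩
  rw [sum_eq_single j (fun i _ hij => h0 i t ?_) (by simp)]
  · exact bump_eq_one hη (by rw [zpt_eq] at ht; nlinarith [norm_nonneg (ue t - ue (θ j))])
  · have h1 := hsep i j hij
    have h2 := norm_sub_le_norm_sub_add_norm_sub (zpt θ i) (ue t) (zpt θ j)
    have h3 := norm_sub_rev (zpt θ i) (ue t)
    linarith

/-- Integrals against the product of the singular factors depend continuously on the
configuration. -/
lemma continuousAt_integral_mul_prodPiece (hα : Admissible α)
    (hinj : Injective (zpt θ)) {Ψ : (ι → ℝ) → ℝ → ℂ}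
    (hΨ : Continuous fun q : (ι → ℝ) × ℝ => Ψ q.1 q.2)
    (hΨp : ∀ θ', Function.Periodic (Ψ θ') (2 * π)) :
    ContinuousAt (fun θ' => ∫ t in (0 : ℝ)..(2 * π), Ψ θ' t * prodPiece α β θ' univ t) θ := by
  obtain ⟨d, hd, χ, hχ, hχ0, hχ1, hsep⟩ := exists_partition hinj
  let F : ι → (ι → ℝ) → ℝ → ℂ := fun j θ' t => χ j t * Ψ θ' t * prodPiece α β θ' (univ.erase j) t
  let Fs : (ι → ℝ) → ℝ → ℂ := fun θ' t => (1 - ∑ j, χ j t) * Ψ θ' t * prodPiece α β θ' univ t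
  have hFc : ∀ j t, ContinuousAt (fun q : (ι → ℝ) × ℝ => F j q.1 q.2) (θ, t) := by
    intro j t
    by_cases ht : ‖ue t - zpt θ j‖ < d
    · have h1 : Continuous fun q : (ι → ℝ) × ℝ => χ j q.2 * Ψ q.1 q.2 :=
        ((hχ j).continuous.comp continuous_snd).mul hΨ
      refine h1.continuousAt.mul (continuousAt_prodPiece_joint _ fun i hi h => ?_)
      have := hsep i j (ne_of_mem_erase hi)
      rw [h] at ht
      linarith
    · have h1 : ∀ᶠ q : (ι → ℝ) × ℝ in 𝓝 (θ, t), d / 2 < ‖ue q.2 - zpt θ j‖ :=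
        ((continuous_ue.comp continuous_snd).sub continuous_const).norm.continuousAt.eventually
          (lt_mem_nhds (show d / 2 < ‖ue t - zpt θ j‖ by push Not at ht; linarith))
      refine continuousAt_const (y := (0 : ℂ)).congr ?_
      filter_upwards [h1] with q hq
      simp only [F]
      rw [hχ0 j _ hq.le, zero_mul, zero_mul]
  have hcs : Continuous fun t => 1 - ∑ j, χ j t :=
    continuous_const.sub (continuous_finsetSum _ fun j _ => (hχ j).continuous)
  have hFsc : ∀ t, ContinuousAt (fun q : (ι → ℝ) × ℝ => Fs q.1 q.2) (θ, t) := by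
    intro t
    by_cases ht : ∃ j, ue t = zpt θ j
    · obtain ⟨j, hj⟩ := ht
      have h1 : ∀ᶠ q : (ι → ℝ) × ℝ in 𝓝 (θ, t), ‖ue q.2 - zpt θ j‖ < d / 4 :=
        ((continuous_ue.comp continuous_snd).sub continuous_const).norm.continuousAt.eventually
          (gt_mem_nhds (by simpa [hj] using hd))
      refine continuousAt_const (y := (0 : ℂ)).congr ?_
      filter_upwards [h1] with q hq
      simp only [Fs]
      rw [hχ1 j _ hq, sub_self, zero_mul, zero_mul]
    · push Not at ht
      exact ((hcs.comp continuous_snd).mul hΨ).continuousAt.mul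
        (continuousAt_prodPiece_joint _ fun i _ => ht i)
  have hΨt : ∀ θ', Continuous (Ψ θ') := fun θ' => hΨ.comp (Continuous.prodMk_right θ')
  have hFm : ∀ j θ' (c : ℝ), AEStronglyMeasurable fun t => F j θ' (t + c) := fun j θ' c =>
    (((hχ j).continuous.mul (hΨt θ')).comp
      (continuous_id.add continuous_const)).aestronglyMeasurable.mul
      (aestronglyMeasurable_prodPiece_comp _ c)
  have hFsm : ∀ θ', AEStronglyMeasurable (Fs θ') := fun θ' =>
    (hcs.mul (hΨt θ')).aestronglyMeasurable.mul
      (by simpa using aestronglyMeasurable_prodPiece_comp (α := α) (β := β) (θ := θ') univ 0)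
  have h2pi := two_pi_pos.le
  have hI : ∀ j, ContinuousAt (fun θ' : ι → ℝ => ∫ x in (0 : ℝ)..(2 * π),
      F j θ' (x + θ' j) * piece (α j) (β j) x) θ := fun j => by
    refine continuousAt_integral_mul (Ψ := fun θ' x => F j θ' (x + θ' j)) h2pi (fun t _ => ?_)
      (fun θ' => hFm j θ' _) (intervalIntegrable_piece _ _ (hα j) _ _)
    have h1 : ContinuousAt (fun q : (ι → ℝ) × ℝ => (q.1, q.2 + q.1 j)) (θ, t) := by fun_prop
    exact ContinuousAt.comp (f := fun q : (ι → ℝ) × ℝ => (q.1, q.2 + q.1 j))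
      (hFc j (t + θ j)) h1
  have hIs : ContinuousAt (fun θ' : ι → ℝ => ∫ x in (0 : ℝ)..(2 * π), Fs θ' x * 1) θ :=
    continuousAt_integral_mul h2pi (fun t _ => hFsc t) hFsm intervalIntegrable_const
  have hsum : ContinuousAt (fun θ' : ι → ℝ =>
      (∑ j, (∫ x in (0 : ℝ)..(2 * π), F j θ' (x + θ' j) * piece (α j) (β j) x) +
        ∫ x in (0 : ℝ)..(2 * π), Fs θ' x * 1)) θ :=
    (tendsto_finsetSum _ fun j _ => hI j).add hIs
  refine hsum.congr ?_
  filter_upwards [eventually_injective_zpt hinj] with θ' hinj'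
  have hper : ∀ j, Function.Periodic (F j θ') (2 * π) := fun j t => by
    simp only [F, (hχ j).periodic t, hΨp θ' t, prodPiece_periodic _ t]
  simp only [← integral_mul_piece_shift (hper _)]
  have hint : ∀ q : ℝ → ℂ, Continuous q → IntervalIntegrable
      (fun t => q t * Ψ θ' t * prodPiece α β θ' univ t) volume 0 (2 * π) :=
    fun q hq => (LocallyIntegrable.intervalIntegrable'
      (locallyIntegrable_prodPiece hα hinj' univ) _ _).continuousOn_mul
      (hq.mul (hΨt θ')).continuousOn
  have e1 : ∀ j, ∀ t, F j θ' t * piece (α j) (β j) (t - θ' j) =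
      χ j t * Ψ θ' t * prodPiece α β θ' univ t := fun j t => by
    rw [prodPiece, ← mul_prod_erase _ _ (mem_univ j)]
    simp only [F, prodPiece]
    ring
  simp only [e1]
  rw [← integral_finsetSum (fun j _ => hint _ (hχ j).continuous), ← integral_add]
  · refine integral_congr fun t _ => ?_
    simp only [Fs, ← sum_mul]
    ring
  · have := IntervalIntegrable.sum univ (fun j _ => hint _ (hχ j).continuous)
    refine this.congr_ae (.of_forall fun t => ?_)
    simp
  · simpa only [Fs, mul_one] using hint _ hcs

/-- Moments depend continuously on the configuration. -/
lemma continuousAt_mom (hα : Admissible α) (hinj : Injective (zpt θ))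
    {p : ℝ → ℂ} (hp : PerC1 p) : ContinuousAt (fun θ' => mom n α β θ' p) θ := by
  have h := continuousAt_integral_mul_prodPiece (β := β) hα hinj
    (Ψ := fun θ' t => p t * ue t * (exp (I * ∑ j, (θ' j : ℂ) * (α j + β j)) * exp (-(n * I * t))))
    (((hp.mul perC1_ue).continuous.comp continuous_snd).mul continuous_expFactor_joint)
    (fun θ' t => by simp only [hp.periodic t, ue_periodic t, (perC1_exp_neg n).periodic t])
  refine (continuousAt_const (y := (2 * π : ℂ)⁻¹)).mul h |>.congr (.of_forall fun θ' => ?_)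
  simp only [mom, weight, Pi.mul_apply]
  congr 2
  ext t
  ring

/-! ### The symbol and its Toeplitz determinant -/

lemma zpt_injective (hθ : IsConfiguration θ) : Injective (zpt θ) := by
  intro i j hij
  have hij' : ue (θ i) = ue (θ j) := hij
  obtain ⟨k, hk⟩ := (ue_eq_iff _ _).1 hij'
  have hmem : ∀ i, θ 0 ≤ θ i ∧ θ i < θ 0 + 2 * π := fun i =>
    ⟨hθ.1.monotone (Fin.zero_le i), (hθ.1.monotone (Fin.le_last i)).trans_lt hθ.2⟩
  have h1 : |(k : ℝ)| < 1 := by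
    rw [abs_lt]
    have hi := hmem i
    have hj := hmem j
    have hpi := two_pi_pos
    constructor <;> nlinarith
  have : k = 0 := by
    have : |k| < 1 := by exact_mod_cast h1
    exact Int.abs_lt_one_iff.1 this
  refine hθ.1.injective ?_
  rw [hk, this]
  simp

lemma argFrom_ue (φ t : ℝ) : argFrom φ (ue t) = toIcoMod two_pi_pos φ t := by
  rw [argFrom, ue, arg_exp_mul_I, toIcoMod_toIocMod]

lemma toIcoMod_sub_eq {φ t c : ℝ} (h0 : φ ≤ c) (h1 : c < φ + 2 * π) :
    toIcoMod two_pi_pos 0 (t - c) =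
      toIcoMod two_pi_pos φ t - c + if toIcoMod two_pi_pos φ t < c then 2 * π else 0 := by
  have ha := toIcoMod_mem_Ico two_pi_pos φ t
  have hb := toIcoMod_add_toIcoDiv_zsmul two_pi_pos φ t
  set a := toIcoMod two_pi_pos φ t
  rw [toIcoMod_eq_iff]
  rw [zsmul_eq_mul] at hb
  generalize toIcoDiv two_pi_pos φ t = k at hb
  split_ifs with h
  · refine ⟨⟨by linarith [ha.1], by linarith⟩, k - 1, ?_⟩
    rw [zsmul_eq_mul]
    push_cast
    linarith
  · push Not at h
    refine ⟨⟨by linarith, by linarith [ha.2]⟩, k, ?_⟩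
    rw [zsmul_eq_mul]
    linarith

lemma symbol_ue (hθ : IsConfiguration θ) (t : ℝ) :
    symbol α β θ (ue t) = prodPiece α β θ univ t := by
  rw [symbol, prodPiece, mul_sum, exp_sum, ← prod_mul_distrib]
  refine prod_congr rfl fun j _ => ?_
  rw [argFrom_ue, piece, zpt_eq, norm_ue_sub_ue,
    toIcoMod_sub_eq (hθ.1.monotone (Fin.zero_le j)) ((hθ.1.monotone (Fin.le_last j)).trans_lt hθ.2)]
  set a := toIcoMod two_pi_pos (θ 0) t
  split_ifs with h
  · rw [mul_assoc (_ ^ _), ← exp_add, mul_left_comm, ← exp_add]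
    congr 2
    push_cast
    ring
  · rw [mul_assoc (_ ^ _), ← exp_add, mul_left_comm, ← exp_add]
    congr 2
    push_cast
    ring

/-- The matrix of moments. -/
def momMatrix (n : ℕ) (α β : ι → ℂ) (θ : ι → ℝ) : Matrix (Fin n) (Fin n) ℂ :=
  Matrix.of fun j k => mom n α β θ fun t => ue t ^ (n - 1 - (j : ℕ) + k)

lemma fourierCoef_eq (hθ : IsConfiguration θ) (j k : Fin n) :
    fourierCoef (symbol α β θ) ((j : ℤ) - (k : ℤ)) =
      exp (-(I * ∑ j, (θ j : ℂ) * (α j + β j))) * momMatrix n α β θ j k := by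
  rw [fourierCoef, momMatrix, of_apply, mom, one_div, mul_left_comm,
    ← integral_const_mul (exp (-(I * ∑ j, (θ j : ℂ) * (α j + β j))))]
  congr 1
  refine integral_congr fun t _ => ?_
  have h1 : symbol α β θ (exp (t * I)) = _ := symbol_ue hθ t
  simp only [h1, weight]
  set c := ∑ j, (θ j : ℂ) * (α j + β j)
  have h2 : exp (-(I * c)) * exp (I * c) = 1 := by rw [← exp_add, neg_add_cancel, exp_zero]
  have h3 : exp (-(I * (((j : ℤ) - (k : ℤ) : ℤ) : ℂ) * t)) =
      ue t ^ (n - 1 - (j : ℕ) + k) * ue t * exp (-(n * I * t)) := by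
    rw [ue, ← exp_nat_mul, ← exp_add, ← exp_add]
    congr 1
    have hj : (j : ℕ) + 1 ≤ n := j.2
    have : ((n - 1 - (j : ℕ) + k : ℕ) : ℂ) = n - 1 - j + k := by
      rw [Nat.sub_sub, Nat.cast_add, Nat.cast_sub (by omega)]
      push_cast; ring
    rw [this]
    push_cast
    ring
  rw [h3]
  linear_combination (-prodPiece α β θ univ t * (ue t ^ (n - 1 - (j : ℕ) + k) * ue t *
    exp (-(n * I * t)))) * h2

lemma toeplitzDet_eq (hθ : IsConfiguration θ) :
    toeplitzDet n α β θ =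
      exp (-(n * (I * ∑ j, (θ j : ℂ) * (α j + β j)))) * (momMatrix n α β θ).det := by
  have : (Matrix.of fun j k : Fin n => fourierCoef (symbol α β θ) ((j : ℤ) - (k : ℤ))) =
      exp (-(I * ∑ j, (θ j : ℂ) * (α j + β j))) • momMatrix n α β θ := by
    ext j k
    rw [of_apply, fourierCoef_eq hθ, Matrix.smul_apply, smul_eq_mul]
  rw [toeplitzDet, this, det_smul, Fintype.card_fin, ← exp_nat_mul]
  ring_nf

/-- Differentiation under the integral sign for kernels with a continuous derivative. -/
lemma hasDerivAt_integral_mul {𝕜 : Type*} [RCLike 𝕜] [NormedAlgebra 𝕜 ℂ] {Ψ Ψ' : 𝕜 → ℝ → ℂ}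
    {V : ℝ → ℂ} {s₀ : 𝕜} {a b : ℝ} (hab : a ≤ b)
    (hd : ∀ᶠ s in 𝓝 s₀, ∀ t ∈ Set.Icc a b, HasDerivAt (fun s => Ψ s t) (Ψ' s t) s)
    (hc : ∀ t ∈ Set.Icc a b, ContinuousAt (fun q : 𝕜 × ℝ => Ψ' q.1 q.2) (s₀, t))
    (hΨ : ∀ᶠ s in 𝓝 s₀, ContinuousOn (Ψ s) (Set.Icc a b))
    (hV : IntervalIntegrable V volume a b) :
    HasDerivAt (fun s => ∫ t in a..b, Ψ s t * V t) (∫ t in a..b, Ψ' s₀ t * V t) s₀ := by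
  obtain ⟨C, hC0, hC⟩ := exists_eventually_bound hc
  obtain ⟨U, hU, hUm⟩ := (hd.and hC).exists_mem
  have hsub : Set.uIoc a b ⊆ Set.Icc a b := by
    rw [Set.uIoc_of_le hab]; exact Set.Ioc_subset_Icc_self
  have hmeas : ∀ {f : ℝ → ℂ}, ContinuousOn f (Set.Icc a b) →
      AEStronglyMeasurable f (volume.restrict (Set.uIoc a b)) := fun hf =>
    (hf.mono hsub).aestronglyMeasurable measurableSet_uIoc
  have hV' := hV.aestronglyMeasurable_restrict_uIoc
  refine (hasDerivAt_integral_of_dominated_loc_of_deriv_le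
    (bound := fun t => C * ‖V t‖) (F := fun s t => Ψ s t * V t) (F' := fun s t => Ψ' s t * V t) hU
    ?_ ?_ ?_ (.of_forall fun t ht x hx => ?_) (hV.norm.const_mul C)
    (.of_forall fun t ht x hx => ?_)).2
  · filter_upwards [hΨ] with s hs using (hmeas hs).mul hV'
  · have := mem_of_mem_nhds (show {s | ContinuousOn (Ψ s) (Set.Icc a b)} ∈ 𝓝 s₀ from hΨ)
    exact hV.continuousOn_mul (by rwa [Set.uIcc_of_le hab])
  · refine (hmeas fun t ht => ?_).mul hV'
    exact ((hc t ht).comp (f := fun t => (s₀, t))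
      (Continuous.prodMk_right s₀).continuousAt).continuousWithinAt
  · rw [norm_mul]
    gcongr
    exact (hUm x hx).2 t (hsub ht)
  · exact ((hUm x hx).1 t (hsub ht)).mul_const (V t)

/-- The Cauchy transform of the weight. -/
def cauchyT (n : ℕ) (α β : ι → ℂ) (θ : ι → ℝ) (z : ℂ) : ℂ := mom n α β θ fun t => (ue t - z)⁻¹

local notation "𝓒" => cauchyT n α β θ

/-- The derivative of the Cauchy transform. -/
def cauchyT' (n : ℕ) (α β : ι → ℂ) (θ : ι → ℝ) (z : ℂ) : ℂ :=
  mom n α β θ fun t => ((ue t - z) ^ 2)⁻¹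

lemma ue_sub_ne_zero {z : ℂ} (hz : ‖z‖ ≠ 1) (t : ℝ) : ue t - z ≠ 0 := fun h => hz (by
  rw [← sub_eq_zero.1 h, norm_ue])

lemma perC1_inv_sub {z : ℂ} (hz : ‖z‖ ≠ 1) : PerC1 fun t => (ue t - z)⁻¹ :=
  (perC1_ue.sub (PerC1.const z)).inv (ue_sub_ne_zero hz)

lemma perC1_inv_sub_sq {z : ℂ} (hz : ‖z‖ ≠ 1) : PerC1 fun t => ((ue t - z) ^ 2)⁻¹ := by
  simpa only [sq, mul_inv] using (perC1_inv_sub hz).mul (perC1_inv_sub hz)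

lemma intervalIntegrable_ue_mul_weight (hα : Admissible α)
    (hinj : Injective (zpt θ)) (u v : ℝ) :
    IntervalIntegrable (fun t => ue t * 𝓦 t) volume u v :=
  (intervalIntegrable_weight hα hinj u v).continuousOn_mul continuous_ue.continuousOn

/-- Differentiation of moments with respect to a parameter of the integrand. -/
lemma hasDerivAt_mom_param (hα : Admissible α)
    (hinj : Injective (zpt θ)) {Ψ Ψ' : ℂ → ℝ → ℂ} {s₀ : ℂ}
    (hd : ∀ᶠ s in 𝓝 s₀, ∀ t, HasDerivAt (fun s => Ψ s t) (Ψ' s t) s)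
    (hc : ∀ t, ContinuousAt (fun q : ℂ × ℝ => Ψ' q.1 q.2) (s₀, t))
    (hΨ : ∀ᶠ s in 𝓝 s₀, Continuous (Ψ s)) :
    HasDerivAt (fun s => mom n α β θ (Ψ s)) (mom n α β θ (Ψ' s₀)) s₀ :=
  (hasDerivAt_integral_mul two_pi_pos.le (hd.mono fun _ h t _ => h t) (fun t _ => hc t)
    (hΨ.mono fun _ h => h.continuousOn)
    (intervalIntegrable_ue_mul_weight hα hinj _ _)).const_mul _

lemma eventually_norm_ne {z : ℂ} (hz : ‖z‖ ≠ 1) : ∀ᶠ w in 𝓝 z, ‖w‖ ≠ 1 :=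
  continuous_norm.continuousAt.eventually_ne hz

lemma hasDerivAt_cauchyT (hα : Admissible α)
    (hinj : Injective (zpt θ)) {z : ℂ} (hz : ‖z‖ ≠ 1) :
    HasDerivAt 𝓒 (cauchyT' n α β θ z) z := by
  refine hasDerivAt_mom_param hα hinj (Ψ := fun z t => (ue t - z)⁻¹)
    (Ψ' := fun z t => ((ue t - z) ^ 2)⁻¹) ?_ (fun t => ?_) ?_
  · filter_upwards [eventually_norm_ne hz] with w hw t
    have := ((hasDerivAt_id w).const_sub (ue t)).inv (ue_sub_ne_zero hw t)
    refine this.congr_deriv ?_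
    simp [div_eq_mul_inv]
  · have : Continuous fun q : ℂ × ℝ => (ue q.2 - q.1) ^ 2 :=
      ((continuous_ue.comp continuous_snd).sub continuous_fst).pow 2
    exact this.continuousAt.inv₀ (pow_ne_zero 2 (ue_sub_ne_zero hz t))
  · filter_upwards [eventually_norm_ne hz] with w hw using (perC1_inv_sub hw).continuous

/-- The residue at `0` of `G' - r G`. -/
def resid0 (n : ℕ) (α β : ι → ℂ) (θ : ι → ℝ) : ℂ := -2 * lam n α β * mom n α β θ fun t => (ue t)⁻¹

/-- The logarithmic derivative of the weight. -/
def logDerivW (n : ℕ) (α β : ι → ℂ) (θ : ι → ℝ) (z : ℂ) : ℂ :=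
  2 * lam n α β / z + ∑ j, 2 * α j / (z - zpt θ j)

/-- The inhomogeneous term of the differential equation of the Cauchy transform. -/
def residSum (n : ℕ) (α β : ι → ℂ) (θ : ι → ℝ) (z : ℂ) : ℂ :=
  resid0 n α β θ / z + ∑ j, resid n α β θ j / (z - zpt θ j)

lemma zpt_ne_of_norm {z : ℂ} (hz : ‖z‖ ≠ 1) (j : ι) : z - zpt θ j ≠ 0 := fun h => hz (by
  rw [sub_eq_zero.1 h, zpt_eq, norm_ue])

lemma perC1_inv_ue : PerC1 fun t => (ue t)⁻¹ := perC1_ue.inv ue_ne_zero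

/-- The first order differential equation of the Cauchy transform. -/
lemma cauchyT'_eq (hα : Admissible α)
    (hinj : Injective (zpt θ)) {z : ℂ} (hz : ‖z‖ ≠ 1) (hz0 : z ≠ 0) :
    cauchyT' n α β θ z = logDerivW n α β θ z * cauchyT n α β θ z + residSum n α β θ z := by
  have hp := perC1_inv_sub hz
  have h := exactForm_eq (n := n) (β := β) hα hinj hp
  have hI : ∀ {q : ℝ → ℂ}, PerC1 q → IntervalIntegrable
      (fun t => q t * (ue t * weight n α β θ t)) volume 0 (2 * π) := fun hq =>
    PerC1.intervalIntegrable hq.continuous hq.periodic hα hinj _ _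
  have h1 : exactForm n α β θ (fun t => (ue t - z)⁻¹) =
      -cauchyT' n α β θ z + logDerivW n α β θ z * cauchyT n α β θ z + resid0 n α β θ / z := by
    have e : mom n α β θ (fun t => (-1) * ((ue t - z) ^ 2)⁻¹ +
        (logDerivW n α β θ z * (ue t - z)⁻¹ + (-2 * lam n α β / z) * (ue t)⁻¹)) =
        -cauchyT' n α β θ z + logDerivW n α β θ z * cauchyT n α β θ z + resid0 n α β θ / z := by
      rw [mom_add (hI ((PerC1.const _).mul (perC1_inv_sub_sq hz)))
        (hI (((PerC1.const _).mul hp).add ((PerC1.const _).mul perC1_inv_ue))),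
        mom_add (hI ((PerC1.const _).mul hp)) (hI ((PerC1.const _).mul perC1_inv_ue)),
        mom_const_mul, mom_const_mul, mom_const_mul, cauchyT', cauchyT, resid0]
      ring
    rw [← e, exactForm]
    refine mom_congr (Set.range (zpt θ)) (Set.finite_range _) fun t ht => ?_
    have hs := ue_sub_ne_zero hz t
    have hd : deriv (fun t => (ue t - z)⁻¹) t = -(I * ue t) / (ue t - z) ^ 2 :=
      (((hasDerivAt_ue t).sub_const z).inv hs).deriv
    have hj : ∀ j, 2 * α j * (((ue t - z)⁻¹ - (ue (θ j) - z)⁻¹) / (ue t - zpt θ j)) =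
        2 * α j / (z - zpt θ j) * (ue t - z)⁻¹ := fun j => by
      have h1 : ue t - zpt θ j ≠ 0 := sub_ne_zero.2 fun h => ht ⟨j, h.symm⟩
      have h2 := zpt_ne_of_norm (θ := θ) hz j
      have h3 : zpt θ j - z ≠ 0 := by rw [← neg_sub]; exact neg_ne_zero.2 h2
      rw [← zpt_eq]
      field_simp
      ring
    rw [hd, sum_congr rfl fun j _ => hj j, ← sum_mul, logDerivW]
    have := ue_ne_zero t
    field_simp
    ring
  rw [h1] at h
  have h2 : ∑ j, (ue (θ j) - z)⁻¹ * resid n α β θ j = -∑ j, resid n α β θ j / (z - zpt θ j) := by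
    rw [← sum_neg_distrib]
    refine sum_congr rfl fun j _ => ?_
    rw [← neg_sub, inv_neg, zpt_eq]
    ring
  rw [h2] at h
  rw [residSum]
  linear_combination -h

/-! ### The jump of the Cauchy transform -/

lemma norm_real_mul_sub {s p : ℂ} (hs : ‖s‖ = 1) (hp : ‖p‖ = 1) (ρ : ℝ) :
    ‖ρ * s - p‖ = ‖s - ρ * p‖ := by
  have hs0 : s ≠ 0 := fun h => by simp [h] at hs
  have hp0 : p ≠ 0 := fun h => by simp [h] at hp
  have h1 : ∀ w : ℂ, ‖w‖ = 1 → (starRingEnd ℂ) w = w⁻¹ := fun w hw => (inv_eq_conj hw).symm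
  rw [← norm_conj (s - ρ * p), map_sub, map_mul, conj_ofReal, h1 s hs, h1 p hp]
  have : ρ * s - p = -(s * p) * (s⁻¹ - ρ * p⁻¹) := by field_simp; ring
  rw [this, norm_mul, norm_neg, norm_mul, hs, hp, one_mul, one_mul]

/-- The Poisson kernel as a difference of two Cauchy kernels. -/
def poisson (p : ℂ) (r : ℝ) (s : ℂ) : ℂ := s * ((s - Real.exp (-r) * p)⁻¹ - (s - Real.exp r * p)⁻¹)

lemma norm_real_mul_ne {p : ℂ} (hp : ‖p‖ = 1) {r : ℝ} (hr : r ≠ 0) : ‖(Real.exp r : ℂ) * p‖ ≠ 1 := by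
  rw [norm_mul, hp, mul_one, norm_real, norm_eq_abs, Real.abs_exp]
  exact fun h => hr (Real.exp_eq_one_iff r |>.1 h)

lemma norm_poisson_le {p s : ℂ} (hp : ‖p‖ = 1) (hs : ‖s‖ = 1) (hsp : s ≠ p) {r : ℝ} (hr : 0 < r) :
    ‖poisson p r s‖ ≤ 8 * (1 - Real.exp (-r)) / ‖s - p‖ ^ 2 ∧ ‖poisson p r s‖ ≤ 4 / ‖s - p‖ := by
  set ρ := Real.exp (-r) with hρ
  have hρ0 : 0 < ρ := Real.exp_pos _
  have hρ1 : ρ < 1 := Real.exp_lt_one_iff.2 (by linarith)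
  have hρC : (ρ : ℂ) ≠ 0 := ofReal_ne_zero.2 hρ0.ne'
  have he : (Real.exp r : ℂ) = (ρ : ℂ)⁻¹ := by rw [hρ, Real.exp_neg, ofReal_inv, inv_inv]
  have ha : s - ρ * p ≠ 0 := fun h => by
    have := norm_real_mul_ne hp (r := -r) (by linarith)
    rw [← hρ, ← sub_eq_zero.1 h] at this
    exact this hs
  have hb : ρ * s - p ≠ 0 := fun h => by
    have := norm_real_mul_sub hs hp ρ
    rw [h, norm_zero] at this
    exact ha (norm_eq_zero.1 this.symm)
  have hsp' : 0 < ‖s - p‖ := norm_pos_iff.2 (sub_ne_zero.2 hsp)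
  have ha' : 0 < ‖s - ρ * p‖ := norm_pos_iff.2 ha
  have key : poisson p r s = s * p * (ρ ^ 2 - 1) / ((s - ρ * p) * (ρ * s - p)) := by
    rw [poisson, he, ← hρ]
    have : s - (ρ : ℂ)⁻¹ * p = (ρ : ℂ)⁻¹ * (ρ * s - p) := by field_simp
    rw [this, mul_inv, inv_inv, eq_div_iff (mul_ne_zero ha hb)]
    have h1 := inv_mul_cancel₀ ha
    have h2 := inv_mul_cancel₀ hb
    linear_combination s * (ρ * s - p) * h1 - s * ρ * (s - ρ * p) * h2
  have hn : ‖poisson p r s‖ = (1 - ρ ^ 2) / ‖s - ρ * p‖ ^ 2 := by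
    rw [key, norm_div, norm_mul, norm_mul, norm_mul, norm_real_mul_sub hs hp, hs, hp,
      ← sq ‖s - ρ * p‖]
    congr 1
    have : (ρ : ℂ) ^ 2 - 1 = -((1 - ρ ^ 2 : ℝ) : ℂ) := by push_cast; ring
    rw [this, norm_neg, norm_real, norm_of_nonneg (by nlinarith), one_mul, one_mul]
  have h1 : ‖s - ρ * p‖ ≥ 1 - ρ := by
    have := norm_sub_norm_le s (ρ * p)
    rwa [hs, norm_mul, hp, norm_real, norm_of_nonneg hρ0.le, mul_one] at this
  have h2 : ‖s - p‖ ≤ 2 * ‖s - ρ * p‖ := by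
    have h3 := norm_sub_le_norm_sub_add_norm_sub s (ρ * p) p
    have h4 : ‖(ρ : ℂ) * p - p‖ = 1 - ρ := by
      have : (ρ : ℂ) * p - p = -((1 - ρ : ℝ) : ℂ) * p := by push_cast; ring
      rw [this, norm_mul, hp, norm_neg, norm_real, norm_of_nonneg (by linarith), mul_one]
    linarith
  rw [hn]
  constructor
  · rw [div_le_div_iff₀ (by positivity) (by positivity)]
    have : ‖s - p‖ ^ 2 ≤ 4 * ‖s - ρ * p‖ ^ 2 := by nlinarith
    have h5 : 1 - ρ ^ 2 ≤ 2 * (1 - ρ) := by nlinarith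
    calc (1 - ρ ^ 2) * ‖s - p‖ ^ 2 ≤ 2 * (1 - ρ) * (4 * ‖s - ρ * p‖ ^ 2) := by
          gcongr
      _ = _ := by ring
  · rw [div_le_div_iff₀ (by positivity) (by positivity)]
    have h5 : 1 - ρ ^ 2 ≤ 2 * (1 - ρ) := by nlinarith
    calc (1 - ρ ^ 2) * ‖s - p‖ ≤ 2 * ‖s - ρ * p‖ * (2 * ‖s - ρ * p‖) := by
          gcongr; linarith
      _ = _ := by ring

lemma continuous_poisson {p : ℂ} (hp : ‖p‖ = 1) {r : ℝ} (hr : r ≠ 0) :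
    Continuous fun t => poisson p r (ue t) :=
  continuous_ue.mul ((perC1_inv_sub (norm_real_mul_ne hp (by simpa using hr))).continuous.sub
    (perC1_inv_sub (norm_real_mul_ne hp hr)).continuous)

lemma poisson_periodic (p : ℂ) (r : ℝ) : Function.Periodic (fun t => poisson p r (ue t))
    (2 * π) := fun t => by simp only [ue_periodic t]

lemma integral_ue_mul_inv_sub_of_lt {a : ℂ} (ha : ‖a‖ < 1) :
    ∫ t in (0 : ℝ)..(2 * π), ue t * (ue t - a)⁻¹ = 2 * π := by
  have h := circleIntegral.integral_sub_inv_of_mem_ball (c := 0) (R := 1) (w := a) (by simpa using ha)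
  rw [circleIntegral] at h
  have h2 : ∀ t : ℝ, deriv (circleMap 0 1) t • (circleMap 0 1 t - a)⁻¹ =
      I * (ue t * (ue t - a)⁻¹) := fun t => by
    rw [deriv_circleMap, circleMap_zero, ofReal_one, one_mul, smul_eq_mul, ue]
    ring
  simp only [h2, integral_const_mul] at h
  refine mul_left_cancel₀ I_ne_zero ?_
  rw [h]
  ring

lemma integral_ue_mul_inv_sub_of_gt {a : ℂ} (ha : 1 < ‖a‖) :
    ∫ t in (0 : ℝ)..(2 * π), ue t * (ue t - a)⁻¹ = 0 := by
  have h := Complex.circleIntegral_eq_zero_of_differentiable_on_off_countable (R := 1) (c := 0)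
    zero_le_one (s := ∅) Set.countable_empty (f := fun z => (z - a)⁻¹) ?_ ?_
  · rw [circleIntegral] at h
    have h2 : ∀ t : ℝ, deriv (circleMap 0 1) t • (circleMap 0 1 t - a)⁻¹ =
        I * (ue t * (ue t - a)⁻¹) := fun t => by
      rw [deriv_circleMap, circleMap_zero, ofReal_one, one_mul, smul_eq_mul, ue]
      ring
    simp only [h2, integral_const_mul] at h
    exact (mul_eq_zero.1 h).resolve_left I_ne_zero
  · refine (continuous_id.sub continuous_const).continuousOn.inv₀ fun z hz h0 => ?_
    rw [mem_closedBall_zero_iff] at hz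
    have : z = a := sub_eq_zero.1 h0
    rw [this] at hz
    linarith
  · intro z hz
    refine (differentiableAt_id.sub_const a).inv fun h0 => ?_
    have h1 := mem_ball_zero_iff.1 hz.1
    have : z = a := sub_eq_zero.1 h0
    rw [this] at h1
    linarith

lemma integral_poisson {p : ℂ} (hp : ‖p‖ = 1) {r : ℝ} (hr : 0 < r) :
    ∫ t in (0 : ℝ)..(2 * π), poisson p r (ue t) = 2 * π := by
  have h1 : ‖(Real.exp (-r) : ℂ) * p‖ < 1 := by
    rw [norm_mul, hp, mul_one, norm_real, norm_eq_abs, Real.abs_exp]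
    exact Real.exp_lt_one_iff.2 (by linarith)
  have h2 : 1 < ‖(Real.exp r : ℂ) * p‖ := by
    rw [norm_mul, hp, mul_one, norm_real, norm_eq_abs, Real.abs_exp]
    exact Real.one_lt_exp_iff.2 hr
  simp only [poisson, mul_sub]
  rw [integral_sub, integral_ue_mul_inv_sub_of_lt h1, integral_ue_mul_inv_sub_of_gt h2, sub_zero]
  · exact (continuous_ue.mul (perC1_inv_sub h1.ne).continuous).intervalIntegrable _ _
  · exact (continuous_ue.mul (perC1_inv_sub h2.ne').continuous).intervalIntegrable _ _

/-- The radial jump of the Cauchy transform at a point of the circle which is not singular. -/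
lemma tendsto_cauchyT_sub (hα : Admissible α)
    (hinj : Injective (zpt θ)) {c : ℝ} (hc : ∀ j, ue c ≠ zpt θ j) :
    Tendsto (fun r : ℝ => cauchyT n α β θ (Real.exp (-r) * ue c) -
      cauchyT n α β θ (Real.exp r * ue c)) (𝓝[>] 0) (𝓝 (weight n α β θ c)) := by
  set v := weight n α β θ
  have hpi := Real.pi_pos
  have hper : ∀ f : ℝ → ℂ, Function.Periodic f (2 * π) →
      ∫ t in (c - π)..(c + π), f t = ∫ t in (0 : ℝ)..(2 * π), f t := fun f hf => by
    have := hf.intervalIntegral_add_eq (c - π) 0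
    rw [zero_add, show c - π + 2 * π = c + π by ring] at this
    exact this
  have hv : IntervalIntegrable v volume (c - π) (c + π) := intervalIntegrable_weight hα hinj _ _
  have hle : c - π ≤ c + π := by linarith
  -- a bound of the difference quotient of the weight
  obtain ⟨C, δ, hδ, hC0, hC⟩ : ∃ C δ : ℝ, 0 < δ ∧ 0 ≤ C ∧
      ∀ t, |t - c| < δ → ‖v t - v c‖ ≤ C * |t - c| := by
    have h1 := (hasDerivAt_weight (n := n) (α := α) (β := β) hc).differentiableAt.isBigO_sub
    obtain ⟨C, hC0, hC⟩ := h1.exists_nonneg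
    obtain ⟨δ, hδ, h⟩ := Metric.eventually_nhds_iff.1 hC.bound
    exact ⟨C, δ, hδ, hC0, fun t ht => by simpa using h ht⟩
  have hlow : ∀ t ∈ Set.uIoc (c - π) (c + π), 2 / π * |t - c| ≤ ‖ue t - ue c‖ := by
    intro t ht
    rw [Set.uIoc_of_le hle] at ht
    rw [norm_ue_sub_ue]
    exact two_div_pi_mul_le_norm (abs_le.2 ⟨by linarith [ht.1], by linarith [ht.2]⟩)
  set K : ℝ → ℝ := fun t => 4 * (π / 2 * C + π / 2 / δ * (‖v t‖ + ‖v c‖))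
  have hK : IntervalIntegrable K volume (c - π) (c + π) :=
    (intervalIntegrable_const.add ((hv.norm.add intervalIntegrable_const).const_mul _)).const_mul 4
  have hbd : ∀ t ∈ Set.uIoc (c - π) (c + π), ue t ≠ ue c →
      4 / ‖ue t - ue c‖ * ‖v t - v c‖ ≤ K t := by
    intro t ht hne
    have h0 : 0 < ‖ue t - ue c‖ := norm_pos_iff.2 (sub_ne_zero.2 hne)
    have h1 := hlow t ht
    rw [div_mul_eq_mul_div, mul_div_assoc]
    refine mul_le_mul_of_nonneg_left ?_ (by norm_num)
    rw [div_le_iff₀ h0]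
    have h2 : |t - c| ≤ π / 2 * ‖ue t - ue c‖ := by
      rw [div_mul_eq_mul_div, div_le_iff₀ hpi] at h1
      linarith
    by_cases hlt : |t - c| < δ
    · calc ‖v t - v c‖ ≤ C * |t - c| := hC t hlt
        _ ≤ C * (π / 2 * ‖ue t - ue c‖) := by gcongr
        _ = π / 2 * C * ‖ue t - ue c‖ := by ring
        _ ≤ _ := by
          gcongr
          have : 0 ≤ π / 2 / δ * (‖v t‖ + ‖v c‖) := by positivity
          linarith
    · push Not at hlt
      have h3 : 1 ≤ π / 2 / δ * ‖ue t - ue c‖ := by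
        rw [div_mul_eq_mul_div, le_div_iff₀ hδ]
        linarith
      calc ‖v t - v c‖ ≤ (‖v t‖ + ‖v c‖) * 1 := by rw [mul_one]; exact norm_sub_le _ _
        _ ≤ (‖v t‖ + ‖v c‖) * (π / 2 / δ * ‖ue t - ue c‖) := by gcongr
        _ = π / 2 / δ * (‖v t‖ + ‖v c‖) * ‖ue t - ue c‖ := by ring
        _ ≤ _ := by
          gcongr
          have : 0 ≤ π / 2 * C := by positivity
          linarith
  have hlim : Tendsto (fun r : ℝ => ∫ t in (c - π)..(c + π),
      poisson (ue c) r (ue t) * (v t - v c)) (𝓝[>] 0)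
      (𝓝 (∫ t in (c - π)..(c + π), (0 : ℂ))) := by
    refine tendsto_integral_filter_of_dominated_convergence K ?_ ?_ hK ?_
    · filter_upwards [self_mem_nhdsWithin] with r hr
      exact (continuous_poisson (norm_ue c) (ne_of_gt hr)).aestronglyMeasurable.mul
        (hv.aestronglyMeasurable_restrict_uIoc.sub aestronglyMeasurable_const)
    · filter_upwards [self_mem_nhdsWithin] with r hr
      filter_upwards [ae_ue_ne (ue c)] with t hne ht
      rw [norm_mul]
      refine le_trans ?_ (hbd t ht hne)
      gcongr
      exact (norm_poisson_le (norm_ue c) (norm_ue t) hne hr).2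
    · filter_upwards [ae_ue_ne (ue c)] with t hne ht
      have h1 : Tendsto (fun r : ℝ => 8 * (1 - Real.exp (-r)) / ‖ue t - ue c‖ ^ 2) (𝓝[>] 0)
          (𝓝 0) := by
        have : Continuous fun r : ℝ => 8 * (1 - Real.exp (-r)) / ‖ue t - ue c‖ ^ 2 := by fun_prop
        have h2 := this.tendsto 0
        simp only [neg_zero, Real.exp_zero, sub_self, mul_zero, zero_div] at h2
        exact h2.mono_left nhdsWithin_le_nhds
      have h2 : Tendsto (fun r : ℝ => poisson (ue c) r (ue t)) (𝓝[>] 0) (𝓝 0) := by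
        refine squeeze_zero_norm' ?_ h1
        filter_upwards [self_mem_nhdsWithin] with r hr
        exact (norm_poisson_le (norm_ue c) (norm_ue t) hne hr).1
      simpa using h2.mul_const (v t - v c)
  rw [integral_zero] at hlim
  have h2pi : (2 * π : ℂ) ≠ 0 := by exact_mod_cast two_pi_pos.ne'
  have hfin : Tendsto (fun r : ℝ => (2 * π : ℂ)⁻¹ * (∫ t in (c - π)..(c + π),
      poisson (ue c) r (ue t) * (v t - v c)) + v c) (𝓝[>] 0) (𝓝 (v c)) := by
    simpa using (hlim.const_mul (2 * π : ℂ)⁻¹).add_const (v c)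
  refine hfin.congr' ?_
  filter_upwards [self_mem_nhdsWithin] with r hr
  have hr' : r ≠ 0 := ne_of_gt hr
  have hP := continuous_poisson (norm_ue c) hr'
  have e1 : ∫ t in (c - π)..(c + π), poisson (ue c) r (ue t) * (v t - v c) =
      (∫ t in (0 : ℝ)..(2 * π), poisson (ue c) r (ue t) * v t) - 2 * π * v c := by
    simp only [mul_sub]
    have h3 : IntervalIntegrable (fun t => poisson (ue c) r (ue t) * v c) volume (c - π)
        (c + π) := (hP.mul continuous_const).intervalIntegrable _ _
    rw [integral_sub (hv.continuousOn_mul hP.continuousOn) h3, integral_mul_const,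
      hper _ (poisson_periodic _ _), integral_poisson (norm_ue c) hr,
      hper _ fun t => by rw [show v (t + 2 * π) = v t from weight_periodic t, ue_periodic t]]
  have hI : ∀ {q : ℝ → ℂ}, PerC1 q → IntervalIntegrable
      (fun t => q t * (ue t * v t)) volume 0 (2 * π) := fun hq =>
    PerC1.intervalIntegrable hq.continuous hq.periodic hα hinj _ _
  rw [e1, cauchyT, cauchyT, ← mom_sub
    (hI (perC1_inv_sub (norm_real_mul_ne (norm_ue c) (by simpa using hr'))))
    (hI (perC1_inv_sub (norm_real_mul_ne (norm_ue c) hr'))), mom]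
  have e2 : ∀ t, ((ue t - Real.exp (-r) * ue c)⁻¹ - (ue t - Real.exp r * ue c)⁻¹) *
      (ue t * v t) = poisson (ue c) r (ue t) * v t := fun t => by
    rw [poisson]; ring
  simp only [v] at e2 ⊢
  simp only [e2]
  rw [mul_sub, ← mul_assoc _ (2 * π : ℂ), inv_mul_cancel₀ h2pi, one_mul, sub_add_cancel]

/-! ### Removing lines of discontinuity -/

lemma isConservativeOn_of_differentiableOn_off_real {g : ℂ → ℂ} {r : ℝ}
    (hc : ContinuousOn g (ball 0 r))
    (hd : ∀ w ∈ ball (0 : ℂ) r, w.im ≠ 0 → DifferentiableAt ℂ g w) :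
    IsConservativeOn g (ball 0 r) := by
  intro z w hzw
  rw [← add_eq_zero_iff_eq_neg, wedgeIntegral_add_wedgeIntegral_eq]
  have hzw' : Set.uIcc z.re w.re ×ℂ Set.uIcc z.im w.im ⊆ ball 0 r := hzw
  have hrect : ∀ y₀ y₁ : ℝ, Set.uIcc y₀ y₁ ⊆ Set.uIcc z.im w.im → 0 ∉ Set.Ioo (min y₀ y₁) (max y₀ y₁) →
      (∫ x : ℝ in z.re..w.re, g (x + y₀ * I)) - (∫ x : ℝ in z.re..w.re, g (x + y₁ * I)) +
      I • (∫ y : ℝ in y₀..y₁, g (w.re + y * I)) - I • (∫ y : ℝ in y₀..y₁, g (z.re + y * I)) = 0 := by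
    intro y₀ y₁ hsub h0
    have hsub' : Set.uIcc z.re w.re ×ℂ Set.uIcc y₀ y₁ ⊆ ball 0 r := fun u hu =>
      hzw' ⟨hu.1, hsub hu.2⟩
    have h := integral_boundary_rect_eq_zero_of_continuousOn_of_differentiableOn g
      (⟨z.re, y₀⟩ : ℂ) ⟨w.re, y₁⟩ (hc.mono hsub') ?_
    · exact h
    · intro u hu
      refine (hd u (hsub' ⟨Set.Ioo_subset_Icc_self hu.1, Set.Ioo_subset_Icc_self hu.2⟩)
        fun h1 => ?_).differentiableWithinAt
      have := hu.2
      rw [Set.mem_preimage, h1] at this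
      exact h0 this
  by_cases h0 : (0 : ℝ) ∈ Set.uIcc z.im w.im
  · have e1 := hrect z.im 0 (Set.uIcc_subset_uIcc_left h0) (by
      rcases le_total z.im 0 with h | h <;> simp [h])
    have e2 := hrect 0 w.im (Set.uIcc_subset_uIcc_right h0) (by
      rcases le_total w.im 0 with h | h <;> simp [h])
    have hint : ∀ x ∈ Set.uIcc z.re w.re, ∀ y₀ ∈ Set.uIcc z.im w.im, ∀ y₁ ∈ Set.uIcc z.im w.im,
        IntervalIntegrable (fun y : ℝ => g (x + y * I)) volume y₀ y₁ := by
      intro x hx y₀ h₀ y₁ h₁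
      refine ContinuousOn.intervalIntegrable (hc.comp (by fun_prop) fun y hy => hzw' ⟨?_, ?_⟩)
      · simpa using hx
      · simpa using Set.uIcc_subset_uIcc h₀ h₁ hy
    rw [← integral_add_adjacent_intervals
        (hint _ Set.right_mem_uIcc _ Set.left_mem_uIcc _ h0)
        (hint _ Set.right_mem_uIcc _ h0 _ Set.right_mem_uIcc), ← integral_add_adjacent_intervals
        (hint _ Set.left_mem_uIcc _ Set.left_mem_uIcc _ h0)
        (hint _ Set.left_mem_uIcc _ h0 _ Set.right_mem_uIcc)]
    simp only [smul_eq_mul] at e1 e2 ⊢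
    linear_combination e1 + e2
  · refine hrect z.im w.im subset_rfl fun h => h0 ?_
    exact Set.Ioo_subset_Icc_self h

/-- A function which is holomorphic off the real line, with equal boundary values from both sides,
extends holomorphically. -/
lemma exists_extension_across_real {f : ℂ → ℂ} {r : ℝ}
    (hd : ∀ w ∈ ball (0 : ℂ) r, w.im ≠ 0 → DifferentiableAt ℂ f w)
    (hl : ∀ x : ℝ, |x| < r → ∃ L, Tendsto f (𝓝[{w | 0 < w.im}] x) (𝓝 L) ∧
      Tendsto f (𝓝[{w | w.im < 0}] x) (𝓝 L)) :
    ∃ g, DifferentiableOn ℂ g (ball 0 r) ∧ ∀ w ∈ ball (0 : ℂ) r, w.im ≠ 0 → g w = f w := by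
  set A : Set ℂ := {w | w.im ≠ 0} with hA
  have hAopen : IsOpen A := isOpen_ne_fun continuous_im continuous_const
  have hAd : ∀ w : ℂ, w ∈ closure A := by
    intro w
    rw [Metric.mem_closure_iff]
    intro ε hε
    by_cases hw : w.im = 0
    · refine ⟨w + (ε / 2 : ℝ) * I, by simp [hA, hw, hε.ne'], ?_⟩
      rw [dist_eq_norm, sub_add_cancel_left, norm_neg, norm_mul, norm_I, mul_one, norm_real,
        norm_of_nonneg (by positivity)]
      linarith
    · exact ⟨w, hw, by simpa using hε⟩
  have hoff : ∀ w ∈ ball (0 : ℂ) r, w.im ≠ 0 → Tendsto f (𝓝[A] w) (𝓝 (f w)) :=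
    fun w hw h => (hd w hw h).continuousAt.continuousWithinAt
  have heq : ∀ w ∈ ball (0 : ℂ) r, w.im ≠ 0 → extendFrom A f w = f w := fun w hw h =>
    extendFrom_eq (hAd w) (hoff w hw h)
  have hcont : ContinuousOn (extendFrom A f) (ball 0 r) := by
    refine continuousOn_extendFrom (fun w _ => hAd w) fun w hw => ?_
    by_cases h : w.im = 0
    · have hwr : w = (w.re : ℂ) := by apply Complex.ext <;> simp [h]
      obtain ⟨L, h1, h2⟩ := hl w.re (by
        rw [mem_ball_zero_iff, hwr, norm_real] at hw; exact hw)
      refine ⟨L, ?_⟩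
      have : A = {w : ℂ | 0 < w.im} ∪ {w : ℂ | w.im < 0} := by
        ext u
        simp only [hA, Set.mem_ofPred_eq, Set.mem_union]
        exact ⟨fun h => (lt_or_gt_of_ne h).symm, fun h => h.elim ne_of_gt ne_of_lt⟩
      rw [this, nhdsWithin_union, hwr]
      exact h1.sup h2
    · exact ⟨_, hoff w hw h⟩
  have hdiff : ∀ w ∈ ball (0 : ℂ) r, w.im ≠ 0 → DifferentiableAt ℂ (extendFrom A f) w := by
    intro w hw h
    refine (hd w hw h).congr_of_eventuallyEq ?_
    filter_upwards [hAopen.mem_nhds h, isOpen_ball.mem_nhds hw] with u hu hu'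
      using heq u hu' hu
  exact ⟨extendFrom A f, (isConservativeOn_and_continuousOn_iff_isDifferentiableOn
    isOpen_ball).1 ⟨isConservativeOn_of_differentiableOn_off_real hcont hdiff, hcont⟩, heq⟩

lemma norm_log_div_le {p z : ℂ} (hp : p ≠ 0) (h : ‖z - p‖ ≤ ‖p‖ / 2) :
    ‖log (z / p)‖ ≤ 3 / 2 * (‖z - p‖ / ‖p‖) := by
  have hp' : 0 < ‖p‖ := norm_pos_iff.2 hp
  have h1 : z / p = 1 + (z - p) / p := by field_simp; ring
  rw [h1, ← norm_div]
  refine norm_log_one_add_half_le_self ?_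
  rw [norm_div, div_le_iff₀ hp']
  linarith

lemma div_mem_slitPlane {p z : ℂ} (hp : p ≠ 0) (h : ‖z - p‖ ≤ ‖p‖ / 2) : z / p ∈ slitPlane := by
  have hp' : 0 < ‖p‖ := norm_pos_iff.2 hp
  have h1 : z / p = 1 + (z - p) / p := by field_simp; ring
  rw [h1]
  refine mem_slitPlane_of_norm_lt_one ?_
  rw [norm_div, div_lt_one hp']
  linarith

/-- The version of `exists_extension_across_real` for a curve `x ↦ p * exp (c * x)`. -/
lemma exists_extension_across {f : ℂ → ℂ} {p c : ℂ} {plus minus : Set ℂ} (hp : p ≠ 0)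
    (hc : ‖c‖ = 1) {r : ℝ} (hr : 0 < r)
    (hside : ∀ w ∈ ball (0 : ℂ) r, (0 < w.im ↔ p * exp (c * w) ∈ plus) ∧
      (w.im < 0 ↔ p * exp (c * w) ∈ minus))
    (hd : ∀ w ∈ ball (0 : ℂ) r, w.im ≠ 0 → DifferentiableAt ℂ f (p * exp (c * w)))
    (hl : ∀ x : ℝ, |x| < r → ∃ L, Tendsto f (𝓝[plus] (p * exp (c * x))) (𝓝 L) ∧
      Tendsto f (𝓝[minus] (p * exp (c * x))) (𝓝 L)) :
    ∃ ρ > 0, ∃ g, DifferentiableOn ℂ g (ball p ρ) ∧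
      ∀ z ∈ ball p ρ, z ∈ plus ∪ minus → g z = f z := by
  have hc0 : c ≠ 0 := fun h => by simp [h] at hc
  have hp' : 0 < ‖p‖ := norm_pos_iff.2 hp
  have hE : Continuous fun w : ℂ => p * exp (c * w) := by fun_prop
  obtain ⟨g, hg, hgf⟩ := exists_extension_across_real (f := fun w => f (p * exp (c * w))) (r := r)
    (fun w hw h => (hd w hw h).comp w (by fun_prop)) (fun x hx => by
      obtain ⟨L, h1, h2⟩ := hl x hx
      have hx' : (x : ℂ) ∈ ball (0 : ℂ) r := by simpa using hx
      refine ⟨L, h1.comp ?_, h2.comp ?_⟩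
      · refine tendsto_nhdsWithin_iff.2 ⟨hE.continuousAt.continuousWithinAt, ?_⟩
        filter_upwards [self_mem_nhdsWithin, nhdsWithin_le_nhds (isOpen_ball.mem_nhds hx')]
          with w h3 h4 using (hside w h4).1.1 h3
      · refine tendsto_nhdsWithin_iff.2 ⟨hE.continuousAt.continuousWithinAt, ?_⟩
        filter_upwards [self_mem_nhdsWithin, nhdsWithin_le_nhds (isOpen_ball.mem_nhds hx')]
          with w h3 h4 using (hside w h4).2.1 h3)
  set ρ := min (‖p‖ / 2) (r * ‖p‖ / 2)
  have hρ : 0 < ρ := by positivity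
  have hmap : ∀ z ∈ ball p ρ, log (z / p) / c ∈ ball (0 : ℂ) r := by
    intro z hz
    rw [mem_ball_iff_norm] at hz
    have h1 : ‖z - p‖ < ‖p‖ / 2 := hz.trans_le (min_le_left _ _)
    have h2 : ‖z - p‖ < r * ‖p‖ / 2 := hz.trans_le (min_le_right _ _)
    rw [mem_ball_zero_iff, norm_div, hc, div_one]
    refine (norm_log_div_le hp h1.le).trans_lt ?_
    rw [← mul_div_assoc, div_lt_iff₀ hp']
    nlinarith [norm_nonneg (z - p)]
  have hinv : ∀ z ∈ ball p ρ, p * exp (c * (log (z / p) / c)) = z := by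
    intro z hz
    rw [mem_ball_iff_norm] at hz
    have h1 : ‖z - p‖ ≤ ‖p‖ / 2 := (hz.trans_le (min_le_left _ _)).le
    rw [mul_div_cancel₀ _ hc0, exp_log (slitPlane_ne_zero (div_mem_slitPlane hp h1)),
      mul_div_cancel₀ _ hp]
  refine ⟨ρ, hρ, fun z => g (log (z / p) / c), fun z hz => ?_, fun z hz hz' => ?_⟩
  · have h1 : ‖z - p‖ ≤ ‖p‖ / 2 := ((mem_ball_iff_norm.1 hz).trans_le (min_le_left _ _)).le
    have h2 : DifferentiableAt ℂ g (log (z / p) / c) :=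
      hg.differentiableAt (isOpen_ball.mem_nhds (hmap z hz))
    have h3 : DifferentiableAt ℂ (fun z => log (z / p) / c) z :=
      ((differentiableAt_id.div_const p).clog (div_mem_slitPlane hp h1)).div_const c
    exact (h2.comp z h3).differentiableWithinAt
  · have h1 := hside _ (hmap z hz)
    rw [hinv z hz] at h1
    have h2 : (log (z / p) / c).im ≠ 0 := hz'.elim (fun h => (h1.1.2 h).ne') fun h => (h1.2.2 h).ne
    have h3 := hgf _ (hmap z hz) h2
    rw [hinv z hz] at h3
    exact h3

/-- Local holomorphic extensions across a set with dense complement glue to an entire function. -/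
lemma exists_entire_extension {f : ℂ → ℂ} {S : Set ℂ} (hS : Dense Sᶜ)
    (h : ∀ p, ∃ r > 0, ∃ g, DifferentiableOn ℂ g (ball p r) ∧ ∀ z ∈ ball p r, z ∉ S → g z = f z) :
    ∃ F, Differentiable ℂ F ∧ ∀ z ∉ S, F z = f z := by
  choose r hr g hg hgf using h
  have key : ∀ p, ∀ q ∈ ball p (r p), g q q = g p q := by
    intro p q hq
    have hq' : q ∈ ball q (r q) := mem_ball_self (hr q)
    have h1 : ContinuousAt (g q) q := ((hg q).differentiableAt
      (isOpen_ball.mem_nhds hq')).continuousAt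
    have h2 : ContinuousAt (g p) q := ((hg p).differentiableAt
      (isOpen_ball.mem_nhds hq)).continuousAt
    have : Filter.NeBot (𝓝[Sᶜ] q) := mem_closure_iff_nhdsWithin_neBot.1 (hS q)
    refine tendsto_nhds_unique_of_eventuallyEq (l := 𝓝[Sᶜ] q) (h1.mono_left nhdsWithin_le_nhds)
      (h2.mono_left nhdsWithin_le_nhds) ?_
    filter_upwards [self_mem_nhdsWithin, nhdsWithin_le_nhds (isOpen_ball.mem_nhds hq),
      nhdsWithin_le_nhds (isOpen_ball.mem_nhds hq')] with z h3 h4 h5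
    rw [hgf q z h5 h3, hgf p z h4 h3]
  refine ⟨fun q => g q q, fun p => ?_, fun z hz => hgf z z (mem_ball_self (hr z)) hz⟩
  refine ((hg p).differentiableAt (isOpen_ball.mem_nhds
    (mem_ball_self (hr p)))).congr_of_eventuallyEq ?_
  filter_upwards [isOpen_ball.mem_nhds (mem_ball_self (hr p))] with q hq
    using key p q hq

/-- An entire function of polynomial growth is a polynomial. -/
lemma exists_polynomial_of_growth {F : ℂ → ℂ} (hF : Differentiable ℂ F) (n : ℕ)
    (hO : F =O[cobounded ℂ] fun z => z ^ n) :
    ∃ p : Polynomial ℂ, p.natDegree ≤ n ∧ ∀ z, F z = p.eval z := by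
  induction n generalizing F with
  | zero =>
    obtain ⟨C, hC⟩ := hO.bound
    simp only [pow_zero, norm_one, mul_one] at hC
    have hb : IsBounded (Set.range F) := by
      have h1 : IsBounded {z | ‖F z‖ ≤ C}ᶜ := isBounded_def.2 (by
        rw [compl_compl]; exact hC)
      obtain ⟨R, hR⟩ := h1.subset_closedBall 0
      have h2 : IsBounded (F '' closedBall 0 R) :=
        ((isCompact_closedBall 0 R).image hF.continuous).isBounded
      refine (h2.union (isBounded_closedBall (x := (0 : ℂ)) (r := C))).subset ?_
      rintro _ ⟨z, rfl⟩
      by_cases hz : ‖F z‖ ≤ C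
      · exact .inr (by simpa using hz)
      · exact .inl ⟨z, hR hz, rfl⟩
    refine ⟨Polynomial.C (F 0), by simp, fun z => ?_⟩
    rw [Polynomial.eval_C]
    exact hF.apply_eq_apply_of_bounded hb z 0
  | succ n ih =>
    have hd : Differentiable ℂ (dslope F 0) := by
      have := (differentiableOn_dslope (c := (0 : ℂ)) (s := Set.univ) (f := F)
        Filter.univ_mem).2 hF.differentiableOn
      exact differentiableOn_univ.1 this
    have hO' : dslope F 0 =O[cobounded ℂ] fun z => z ^ n := by
      have h1 : (fun z => F z - F 0) =O[cobounded ℂ] fun z : ℂ => z ^ (n + 1) := by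
        refine hO.sub ?_
        rw [Asymptotics.isBigO_iff]
        refine ⟨‖F 0‖, ?_⟩
        filter_upwards [eventually_ge_norm 1] with z hz
        rw [norm_pow]
        exact le_mul_of_one_le_right (norm_nonneg _) (one_le_pow₀ hz)
      have h2 := h1.mul (Asymptotics.isBigO_refl (fun z : ℂ => z⁻¹) (cobounded ℂ))
      refine h2.congr' ?_ ?_
      · filter_upwards [eventually_ge_norm 1] with z hz
        have : z ≠ 0 := fun h => by norm_num [h] at hz
        rw [dslope_of_ne _ this, slope_def_field, sub_zero, div_eq_mul_inv]
      · filter_upwards [eventually_ge_norm 1] with z hz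
        have : z ≠ 0 := fun h => by norm_num [h] at hz
        rw [pow_succ, mul_assoc, mul_inv_cancel₀ this, mul_one]
    obtain ⟨p, hp, hpe⟩ := ih hd hO'
    refine ⟨Polynomial.X * p + Polynomial.C (F 0), ?_, fun z => ?_⟩
    · refine (Polynomial.natDegree_add_le _ _).trans (max_le ?_ (by simp))
      refine Polynomial.natDegree_mul_le.trans ?_
      rw [Polynomial.natDegree_X]
      omega
    · have := sub_smul_dslope F 0 z
      rw [sub_zero, smul_eq_mul, hpe] at this
      rw [Polynomial.eval_add, Polynomial.eval_mul, Polynomial.eval_X, Polynomial.eval_C, this]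
      ring

/-! ### Linear differential equations of first order -/

/-- Two solutions of a linear equation of first order differ by a solution of the homogeneous
equation; here along a map `E` from a connected set. -/
lemma exists_const_of_ode {G L W E E' r R : ℂ → ℂ} {S : Set ℂ} (hSo : IsOpen S)
    (hSc : IsPreconnected S) (hE : ∀ w ∈ S, HasDerivAt E (E' w) w)
    (hG : ∀ w ∈ S, HasDerivAt G (r (E w) * G (E w) + R (E w)) (E w))
    (hL : ∀ w ∈ S, HasDerivAt L (r (E w) / 2) (E w))
    (hW : ∀ w ∈ S, HasDerivAt W (R (E w) * exp (-(2 * L (E w)))) (E w)) :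
    ∃ c, ∀ w ∈ S, G (E w) = exp (2 * L (E w)) * (W (E w) + c) := by
  have hder : ∀ w ∈ S, HasDerivAt (fun w => G (E w) * exp (-(2 * L (E w))) - W (E w)) 0 w := by
    intro w hw
    have h1 := (hG w hw).comp w (hE w hw)
    have h2 := ((((hL w hw).const_mul 2).neg).cexp).comp w (hE w hw)
    have h3 := (hW w hw).comp w (hE w hw)
    refine ((h1.mul h2).sub h3).congr_deriv ?_
    simp only [Function.comp, Pi.neg_apply]
    ring
  obtain ⟨c, hc⟩ := hSo.exists_is_const_of_deriv_eq_zero hSc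
    (fun w hw => (hder w hw).differentiableAt.differentiableWithinAt)
    (fun w hw => (hder w hw).deriv)
  refine ⟨c, fun w hw => ?_⟩
  have h1 := hc w hw
  have h2 : exp (-(2 * L (E w))) * exp (2 * L (E w)) = 1 := by
    rw [← exp_add, neg_add_cancel, exp_zero]
  rw [← h1]
  linear_combination -G (E w) * h2

/-! ### Logarithms with a prescribed cut -/

lemma exp_neg_eq_ue (φ : ℝ) : exp (-((φ : ℂ) * I)) = ue (-φ) := by rw [ue, ofReal_neg, neg_mul]

lemma mem_leftOf {φ : ℝ} {z : ℂ} : z ∈ leftOf φ ↔ 0 < (z * ue (-φ)).im := by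
  rw [← exp_neg_eq_ue]; rfl

lemma mem_rightOf {φ : ℝ} {z : ℂ} : z ∈ rightOf φ ↔ (z * ue (-φ)).im < 0 := by
  rw [← exp_neg_eq_ue]; rfl

lemma ue_neg_mul (x : ℝ) : ue (-x) * ue x = 1 := by rw [← ue_add, neg_add_cancel, ue_zero]

lemma arg_mul_ue (w : ℂ) (hw : w ≠ 0) (c : ℝ) :
    ∃ k : ℤ, arg (w * ue c) = arg w + c - k * (2 * π) := by
  have h1 : (arg (w * ue c) : Real.Angle) = ((arg w + c : ℝ) : Real.Angle) := by
    rw [arg_mul_coe_angle hw (ue_ne_zero c), Real.Angle.coe_add, ue, arg_exp_mul_I]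
    congr 1
    rw [Real.Angle.angle_eq_iff_two_pi_dvd_sub]
    have h2 := toIocMod_add_toIocDiv_zsmul two_pi_pos (-π) c
    refine ⟨-toIocDiv two_pi_pos (-π) c, ?_⟩
    rw [zsmul_eq_mul] at h2
    push_cast
    linarith
  rw [Real.Angle.angle_eq_iff_two_pi_dvd_sub] at h1
  obtain ⟨k, hk⟩ := h1
  refine ⟨-k, ?_⟩
  push_cast
  linarith

lemma argFrom_eq {φ : ℝ} {w : ℂ} {x : ℝ} {k : ℤ} (hx : x ∈ Set.Ico φ (φ + 2 * π))
    (h : arg w = x - k * (2 * π)) : argFrom φ w = x := by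
  rw [argFrom, toIcoMod_eq_iff]
  refine ⟨hx, -k, ?_⟩
  rw [zsmul_eq_mul, h]
  push_cast
  ring

lemma log_mul_ue (w : ℂ) (c : ℝ) :
    log (w * ue c) = (Real.log ‖w‖ : ℂ) + (arg (w * ue c) : ℂ) * I := by
  rw [log, norm_mul, norm_ue, mul_one]

lemma logFrom_of_nonneg {φ : ℝ} {w : ℂ} (hw : w ≠ 0) (h : 0 ≤ (w * ue (-φ)).im) :
    logFrom φ w = log (w * ue (-φ)) + φ * I := by
  obtain ⟨k, hk⟩ := arg_mul_ue w hw (-φ)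
  have h1 := arg_nonneg_iff.2 h
  have h2 := arg_le_pi (w * ue (-φ))
  rw [logFrom, log_mul_ue, argFrom_eq (x := arg (w * ue (-φ)) + φ) (k := -k)
    ⟨by linarith, by linarith [Real.pi_pos]⟩ (by push_cast; linarith)]
  push_cast
  ring

lemma logFrom_of_neg {φ : ℝ} {w : ℂ} (hw : w ≠ 0) (h : (w * ue (-φ)).im < 0) :
    logFrom φ w = log (w * ue (-φ)) + φ * I + 2 * π * I := by
  obtain ⟨k, hk⟩ := arg_mul_ue w hw (-φ)
  have h1 := arg_neg_iff.2 h
  have h2 := neg_pi_lt_arg (w * ue (-φ))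
  rw [logFrom, log_mul_ue, argFrom_eq (x := arg (w * ue (-φ)) + φ + 2 * π) (k := 1 - k)
    ⟨by linarith [Real.pi_pos], by linarith⟩ (by push_cast; linarith)]
  push_cast
  ring

/-- The logarithm is holomorphic off its cut. -/
lemma logFrom_eq {φ : ℝ} {w : ℂ} (h : -(w * ue (-φ)) ∈ slitPlane) :
    logFrom φ w = log (-(w * ue (-φ))) + (φ + π) * I := by
  have hw : w ≠ 0 := fun h0 => by simp [h0] at h
  have e1 : -(w * ue (-φ)) = w * ue (π - φ) := by
    rw [sub_eq_add_neg, ue_add]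
    have : ue π = -1 := by rw [ue, exp_pi_mul_I]
    rw [this]; ring
  rw [e1] at h ⊢
  obtain ⟨k, hk⟩ := arg_mul_ue w hw (π - φ)
  have h1 := mem_slitPlane_iff_arg.1 h
  have h2 := neg_pi_lt_arg (w * ue (π - φ))
  have h3 := lt_of_le_of_ne (arg_le_pi (w * ue (π - φ))) h1.1
  rw [logFrom, log_mul_ue, argFrom_eq (x := arg (w * ue (π - φ)) + φ + π) (k := 1 - k)
    ⟨by linarith, by linarith⟩ (by push_cast; linarith)]
  push_cast
  ring

lemma neg_sub_mul_ue (j : ι) (z : ℂ) :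
    -((z - zpt θ j) * ue (-θ j)) = 1 - z * ue (-θ j) := by
  have := ue_neg_mul (θ j)
  rw [← zpt_eq] at this
  linear_combination this

lemma logFrom_sub_eq {j : ι} {z : ℂ} (h : 1 - z * ue (-θ j) ∈ slitPlane) :
    logFrom (θ j) (z - zpt θ j) = log (1 - z * ue (-θ j)) + (θ j + π) * I := by
  rw [← neg_sub_mul_ue] at h ⊢
  exact logFrom_eq h

lemma hasDerivAt_log_one_sub {j : ι} {z : ℂ} (h : 1 - z * ue (-θ j) ∈ slitPlane) :
    HasDerivAt (fun z => log (1 - z * ue (-θ j))) (1 / (z - zpt θ j)) z := by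
  have h1 := (((hasDerivAt_id z).mul_const (ue (-θ j))).const_sub 1).clog h
  refine h1.congr_deriv ?_
  have h2 := slitPlane_ne_zero h
  have h3 := ue_neg_mul (θ j)
  have h4 : z - zpt θ j ≠ 0 := fun h0 => h2 (by
    rw [← neg_sub_mul_ue, h0, zero_mul, neg_zero])
  simp only [id]
  rw [div_eq_div_iff h2 h4, zpt_eq]
  linear_combination h3

/-- The points off all the cuts of the logarithms. -/
def CutFree (θ : ι → ℝ) (z : ℂ) : Prop :=
  -(z * ue (-θ 0)) ∈ slitPlane ∧ ∀ j, 1 - z * ue (-θ j) ∈ slitPlane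

lemma isOpen_cutFree : IsOpen {z | CutFree θ z} := by
  have h0 : IsOpen {z : ℂ | -(z * ue (-θ 0)) ∈ slitPlane} := isOpen_slitPlane.preimage (by fun_prop)
  have h1 : IsOpen {z : ℂ | ∀ j, 1 - z * ue (-θ j) ∈ slitPlane} := by
    simp only [Set.ofPred_forall]
    exact isOpen_iInter_of_finite fun j => isOpen_slitPlane.preimage (by fun_prop)
  exact h0.inter h1

lemma eq_ofReal_of_notMem_slitPlane {z : ℂ} (h : z ∉ slitPlane) : ∃ r : ℝ, r ≤ 0 ∧ z = r := by
  rw [mem_slitPlane_iff, not_or, not_lt, not_not] at h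
  exact ⟨z.re, h.1, by apply Complex.ext <;> simp [h.2]⟩

lemma eq_mul_ue_of {z w : ℂ} {φ : ℝ} (h : z * ue (-φ) = w) : z = w * ue φ := by
  rw [← h, mul_assoc, ue_neg_mul, mul_one]

lemma cutFree_of_notMem_contour {z : ℂ} (hz : z ∉ contour θ) : CutFree θ z := by
  simp only [contour, Set.mem_union, Set.mem_iUnion, not_or, not_exists] at hz
  obtain ⟨⟨hs, h0, hseg⟩, hray⟩ := hz
  have hj : ∀ j (r : ℝ), 1 ≤ r → z ≠ r * zpt θ j := by
    intro j r hr h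
    rcases hr.eq_or_lt with h1 | h1
    · refine hs ?_
      rw [mem_sphere_zero_iff_norm, h, ← h1, ofReal_one, one_mul, zpt_eq, norm_ue]
    · exact hray j ⟨r, h1, h⟩
  constructor
  · by_contra h
    obtain ⟨r, hr, h1⟩ := eq_ofReal_of_notMem_slitPlane h
    have h2 : z = ((-r : ℝ) : ℂ) * zpt θ 0 := eq_mul_ue_of (by
      rw [ofReal_neg, ← h1, neg_neg])
    rcases lt_or_ge (-r) 1 with h3 | h3
    · rcases hr.eq_or_lt with h4 | h4
      · exact h0 (by rw [h2, h4]; simp)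
      · exact hseg ⟨-r, by linarith, h3, h2⟩
    · exact hj 0 _ h3 h2
  · intro j
    by_contra h
    obtain ⟨r, hr, h1⟩ := eq_ofReal_of_notMem_slitPlane h
    exact hj j (1 - r) (by linarith) (eq_mul_ue_of (by push_cast; rw [← h1]; ring))

/-- The logarithm of the function `h` with `weight = s_j h ^ 2`. -/
def hLog (n : ℕ) (α β : ι → ℂ) (θ : ι → ℝ) (z : ℂ) : ℂ :=
  lam n α β * logFrom (θ 0) z + ∑ j, α j * logFrom (θ j) (z - zpt θ j)

lemma hasDerivAt_logFrom {φ : ℝ} {z : ℂ} (h : -(z * ue (-φ)) ∈ slitPlane) :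
    HasDerivAt (logFrom φ) (1 / z) z := by
  have h1 := (((hasDerivAt_id z).mul_const (ue (-φ))).neg.clog h).add_const ((φ + π) * I)
  have h2 : HasDerivAt (fun z => log (-(z * ue (-φ))) + (φ + π) * I) (1 / z) z := by
    refine h1.congr_deriv ?_
    have h3 : z ≠ 0 := fun h0 => by simp [h0] at h
    have := ue_ne_zero (-φ)
    simp only [id, Pi.neg_apply]
    field_simp
  refine h2.congr_of_eventuallyEq ?_
  have : ∀ᶠ w in 𝓝 z, -(w * ue (-φ)) ∈ slitPlane :=
    (show Continuous fun w : ℂ => -(w * ue (-φ)) by fun_prop).continuousAt.eventually_mem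
      (isOpen_slitPlane.mem_nhds h)
  filter_upwards [this] with w hw using logFrom_eq hw

lemma hasDerivAt_logFrom_sub {j : ι} {z : ℂ} (h : 1 - z * ue (-θ j) ∈ slitPlane) :
    HasDerivAt (fun z => logFrom (θ j) (z - zpt θ j)) (1 / (z - zpt θ j)) z := by
  rw [← neg_sub_mul_ue] at h
  exact (hasDerivAt_logFrom h).comp_sub_const z (zpt θ j)

lemma hasDerivAt_hLog {z : ℂ} (h : CutFree θ z) :
    HasDerivAt (hLog n α β θ) (logDerivW n α β θ z / 2) z := by
  have h1 := ((hasDerivAt_logFrom h.1).const_mul (lam n α β)).add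
    (HasDerivAt.fun_sum (u := univ) fun j _ => (hasDerivAt_logFrom_sub (h.2 j)).const_mul (α j))
  refine h1.congr_deriv ?_
  rw [logDerivW, add_div, sum_div]
  congr 1
  · ring
  · exact sum_congr rfl fun j _ => by ring

/-! ### The weight on the arcs -/

lemma weight_eq_of_mem {t : ℝ} {k : ι → ℤ}
    (hk : ∀ i, t - θ i ∈ Set.Ioo (k i * (2 * π)) (k i * (2 * π) + 2 * π)) :
    𝓦 t = exp (∑ i, I * π * (-(2 * k i + 1) * β i + (2 * k i - 1) * α i)) *
      exp (2 * (lam n α β * (t * I) + ∑ i, α i * (log (1 - ue (t - θ i)) + (θ i + π) * I))) := by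
  rw [weight, prodPiece, prod_congr rfl fun i _ => piece_eq_exp (α i) (β i) (hk i),
    ← exp_sum, ← exp_add, ← exp_add, ← exp_add]
  congr 1
  have hl : 2 * (lam n α β * (t * I)) = ∑ i, (β i - α i) * t * I - n * I * t := by
    rw [lam, ← sum_mul, ← sum_mul, ← sum_div]
    ring
  rw [mul_add, hl, mul_sum, mul_sum]
  have : ∀ a b c d e x : ℂ, a + c = d + b + e → a + -x + c = d + (b - x + e) := fun a b c d e x h => by
    linear_combination h
  refine this _ _ _ _ _ _ ?_
  rw [← sum_add_distrib, ← sum_add_distrib, ← sum_add_distrib]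
  refine sum_congr rfl fun i _ => ?_
  push_cast
  ring

lemma sConst_eq (j : ι) :
    sConst α β j = exp (∑ i, I * π * (-(2 * ((if i ≤ j then 0 else -1 : ℤ) : ℂ) + 1) * β i +
      (2 * ((if i ≤ j then 0 else -1 : ℤ) : ℂ) - 1) * α i)) := by
  rw [sConst]
  congr 1
  have h1 : ∀ f : ι → ℂ, ∑ k ∈ Iic j, f k = ∑ k, if k ≤ j then f k else 0 := fun f => by
    rw [← sum_filter]; congr 1; ext; simp
  have h2 : ∀ f : ι → ℂ, ∑ k ∈ Ioi j, f k = ∑ k, if k ≤ j then 0 else f k := fun f => by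
    simp only [← ite_not (p := _ ≤ j)]
    rw [← sum_filter]; congr 1; ext; simp
  rw [h1, h1, h2, h2, mul_sum, mul_sum, mul_sum, mul_sum,
    ← sum_neg_distrib, ← sum_add_distrib, ← sum_sub_distrib, ← sum_sub_distrib]
  refine sum_congr rfl fun i _ => ?_
  split_ifs <;> push_cast <;> ring

lemma nextAngle_le (hθ : IsConfiguration θ) (j : ι) :
    nextAngle θ j ≤ θ 0 + 2 * π := by
  rw [nextAngle]
  split_ifs with h
  · exact (hθ.1.monotone (Fin.le_last _)).trans hθ.2.le
  · exact le_rfl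

lemma nextAngle_le_of_lt (hθ : IsConfiguration θ) {i j : ι} (h : j < i) :
    nextAngle θ j ≤ θ i := by
  have h1 : (j : ℕ) < i := h
  rw [nextAngle, dif_pos (by omega)]
  exact hθ.1.monotone (Fin.mk_le_of_le_val (by omega))

lemma mem_Ioo_of_mem_arc (hθ : IsConfiguration θ) {j : ι} {t : ℝ}
    (ht : t ∈ Set.Ioo (θ j) (nextAngle θ j)) (i : ι) :
    t - θ i ∈ Set.Ioo (((if i ≤ j then 0 else -1 : ℤ) : ℝ) * (2 * π))
      (((if i ≤ j then 0 else -1 : ℤ) : ℝ) * (2 * π) + 2 * π) := by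
  have h1 := nextAngle_le hθ j
  have h0 := hθ.1.monotone (Fin.zero_le i)
  have h0' := hθ.1.monotone (Fin.zero_le j)
  have hl := hθ.1.monotone (Fin.le_last i)
  have h2 := hθ.2
  obtain ⟨h3, h4⟩ := ht
  split_ifs with h
  · have := hθ.1.monotone h
    constructor <;> push_cast <;> linarith
  · have := nextAngle_le_of_lt hθ (not_le.1 h)
    constructor <;> push_cast <;> linarith

lemma argFrom_ue_of_mem {φ t : ℝ} (h : t ∈ Set.Ico φ (φ + 2 * π)) : argFrom φ (ue t) = t := by
  rw [argFrom_ue, (toIcoMod_eq_self two_pi_pos).2 h]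

lemma logFrom_ue {φ t : ℝ} (h : t ∈ Set.Ico φ (φ + 2 * π)) : logFrom φ (ue t) = t * I := by
  rw [logFrom, argFrom_ue_of_mem h, norm_ue, Real.log_one, ofReal_zero, zero_add]

lemma ue_ne_one_of_mem {x : ℝ} {k : ℤ}
    (h : x ∈ Set.Ioo (k * (2 * π)) (k * (2 * π) + 2 * π)) : ue x ≠ 1 := by
  intro h1
  obtain ⟨l, hl⟩ := (ue_eq_one_iff x).1 h1
  rw [hl] at h
  have h2 : (k : ℝ) < l := lt_of_mul_lt_mul_right h.1 two_pi_pos.le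
  have h3 : (l : ℝ) < k + 1 := lt_of_mul_lt_mul_right (by linarith [h.2]) two_pi_pos.le
  have h4 : k < l := by exact_mod_cast h2
  have h5 : l < k + 1 := by exact_mod_cast h3
  omega

lemma one_sub_ue_mem_slitPlane {x : ℝ} (h : ue x ≠ 1) : 1 - ue x ∈ slitPlane :=
  one_sub_mem_slitPlane (norm_ue x).le h

lemma cutFree_of_mem_arc (hθ : IsConfiguration θ) {j : ι} {t : ℝ}
    (ht : t ∈ Set.Ioo (θ j) (nextAngle θ j)) : CutFree θ (ue t) := by
  have h1 : ∀ i, ue (t - θ i) ≠ 1 := fun i => ue_ne_one_of_mem (mem_Ioo_of_mem_arc hθ ht i)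
  have h2 : ∀ i, ue t * ue (-θ i) = ue (t - θ i) := fun i => by rw [← ue_add, sub_eq_add_neg]
  refine ⟨?_, fun i => ?_⟩
  · rw [h2]
    by_contra h
    obtain ⟨r, hr, h3⟩ := eq_ofReal_of_notMem_slitPlane h
    have h4 : ‖(r : ℂ)‖ = 1 := by rw [← h3, norm_neg, norm_ue]
    rw [norm_real, Real.norm_of_nonpos hr] at h4
    have : (r : ℂ) = -1 := by rw [show r = -1 by linarith]; simp
    rw [this] at h3
    exact h1 0 (neg_injective h3)
  · rw [h2]
    exact one_sub_ue_mem_slitPlane (h1 i)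

lemma hLog_ue_of_mem_arc (hθ : IsConfiguration θ) {j : ι} {t : ℝ}
    (ht : t ∈ Set.Ioo (θ j) (nextAngle θ j)) :
    hLog n α β θ (ue t) = lam n α β * (t * I) +
      ∑ i, α i * (log (1 - ue (t - θ i)) + (θ i + π) * I) := by
  have h2 : ∀ i, ue t * ue (-θ i) = ue (t - θ i) := fun i => by rw [← ue_add, sub_eq_add_neg]
  rw [hLog, logFrom_ue ⟨(hθ.1.monotone (Fin.zero_le j)).trans ht.1.le,
    ht.2.trans_le (nextAngle_le hθ j)⟩]
  congr 1
  refine sum_congr rfl fun i _ => ?_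
  rw [logFrom_sub_eq ((cutFree_of_mem_arc hθ ht).2 i), h2]

/-- On the arcs the weight is a multiple of the square of `exp hLog`. -/
lemma weight_eq_of_mem_arc (hθ : IsConfiguration θ) {j : ι} {t : ℝ}
    (ht : t ∈ Set.Ioo (θ j) (nextAngle θ j)) :
    𝓦 t = sConst α β j * exp (2 * hLog n α β θ (ue t)) := by
  rw [weight_eq_of_mem (mem_Ioo_of_mem_arc hθ ht), hLog_ue_of_mem_arc hθ ht, sConst_eq]

/-- Every angle in one turn is singular or lies on an arc. -/
lemma exists_arc {t : ℝ} (ht : t ∈ Set.Ico (θ 0) (θ 0 + 2 * π)) :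
    ∃ j, t = θ j ∨ t ∈ Set.Ioo (θ j) (nextAngle θ j) := by
  have hne : (univ.filter fun j => θ j ≤ t).Nonempty := ⟨0, by simpa using ht.1⟩
  obtain ⟨j, hjm, hmax⟩ := exists_max_image _ id hne
  have hj : θ j ≤ t := (mem_filter.1 hjm).2
  refine ⟨j, hj.eq_or_lt.imp Eq.symm fun h => ⟨h, ?_⟩⟩
  rw [nextAngle]
  split_ifs with h1
  · by_contra h2
    have h3 : (⟨(j : ℕ) + 1, h1⟩ : ι) ≤ j := hmax _ (mem_filter.2 ⟨mem_univ _, not_lt.1 h2⟩)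
    have h4 : (j : ℕ) + 1 ≤ j := h3
    omega
  · exact ht.2

/-! ### The kernel inverting `x d/dx - a` -/

/-- The series `∑ u ^ l / (l - a)`, where the term with `l = a` is dropped. -/
def kernelSeries (a u : ℂ) : ℂ := ∑' l : ℕ, u ^ l * ((l : ℂ) - a)⁻¹

/-- The derivative of `kernelSeries`. -/
def kernelSeries' (a u : ℂ) : ℂ := ∑' l : ℕ, (l * u ^ (l - 1)) * ((l : ℂ) - a)⁻¹

lemma exists_bound_inv_sub (a : ℂ) : ∃ C, 0 ≤ C ∧ ∀ l : ℕ, ‖((l : ℂ) - a)⁻¹‖ ≤ C := by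
  have h1 : Tendsto (fun l : ℕ => (l : ℂ) - a) atTop (cobounded ℂ) := by
    have h2 : Tendsto (fun l : ℕ => (l : ℂ)) atTop (cobounded ℂ) := by
      rw [← tendsto_norm_atTop_iff_cobounded]
      simpa using tendsto_natCast_atTop_atTop (R := ℝ)
    rw [← tendsto_norm_atTop_iff_cobounded] at h2 ⊢
    refine tendsto_atTop_mono (fun l => norm_sub_norm_le _ _) ?_
    exact tendsto_atTop_add_const_right _ (-‖a‖) h2
  have h3 := tendsto_inv₀_cobounded.comp h1
  obtain ⟨C, hC⟩ := (isBounded_range_of_tendsto _ h3).exists_norm_le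
  exact ⟨C, (norm_nonneg _).trans (hC _ ⟨0, rfl⟩), fun l => hC _ ⟨l, rfl⟩⟩

lemma summable_kernelSeries (a : ℂ) {u : ℂ} (hu : ‖u‖ < 1) :
    Summable fun l : ℕ => u ^ l * ((l : ℂ) - a)⁻¹ := by
  obtain ⟨C, hC0, hC⟩ := exists_bound_inv_sub a
  refine Summable.of_norm_bounded ((summable_geometric_of_norm_lt_one
    (show ‖‖u‖‖ < 1 by simpa using hu)).mul_right C) fun l => ?_
  rw [norm_mul, norm_pow]
  gcongr
  exact hC l

lemma summable_nat_mul_pow_pred {ρ : ℝ} (h0 : 0 ≤ ρ) (h1 : ρ < 1) :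
    Summable fun l : ℕ => (l : ℝ) * ρ ^ (l - 1) := by
  rw [← summable_nat_add_iff 1]
  have h2 := summable_pow_mul_geometric_of_norm_lt_one 1 (r := ρ)
    (by rwa [norm_of_nonneg h0])
  have h3 := summable_geometric_of_lt_one h0 h1
  refine (h2.add h3).congr fun l => ?_
  rw [Nat.add_sub_cancel]
  push_cast
  ring

lemma summable_kernelSeries' (a : ℂ) {u : ℂ} (hu : ‖u‖ < 1) :
    Summable fun l : ℕ => (l * u ^ (l - 1)) * ((l : ℂ) - a)⁻¹ := by
  obtain ⟨C, hC0, hC⟩ := exists_bound_inv_sub a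
  refine Summable.of_norm_bounded ((summable_nat_mul_pow_pred (norm_nonneg u) hu).mul_right C)
    fun l => ?_
  rw [norm_mul, norm_mul, norm_pow, norm_natCast]
  gcongr
  exact hC l

lemma hasDerivAt_kernelSeries (a : ℂ) {u : ℂ} (hu : ‖u‖ < 1) :
    HasDerivAt (kernelSeries a) (kernelSeries' a u) u := by
  obtain ⟨C, hC0, hC⟩ := exists_bound_inv_sub a
  obtain ⟨ρ, hρ, hρ1⟩ := exists_between hu
  have hρ0 : 0 < ρ := (norm_nonneg u).trans_lt hρ
  refine hasDerivAt_tsum_of_isPreconnected (u := fun l : ℕ => (l : ℝ) * ρ ^ (l - 1) * C)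
    (t := ball 0 ρ) (y₀ := 0)
    (g := fun (l : ℕ) u => u ^ l * ((l : ℂ) - a)⁻¹)
    (g' := fun (l : ℕ) u => (l * u ^ (l - 1)) * ((l : ℂ) - a)⁻¹)
    ((summable_nat_mul_pow_pred hρ0.le hρ1).mul_right C)
    isOpen_ball (convex_ball _ _).isPreconnected (fun l y _ => ?_) (fun l y hy => ?_)
    (mem_ball_self hρ0) (summable_kernelSeries a (by simp)) (by simpa using hρ)
  · exact (hasDerivAt_pow l y).mul_const _
  · rw [mem_ball_zero_iff] at hy
    rw [norm_mul, norm_mul, norm_pow, norm_natCast]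
    gcongr
    exact hC l

open Classical in
lemma mul_kernelSeries'_sub {a : ℂ} (ha : ∀ l : ℕ, l ≠ 0 → a ≠ l) {u : ℂ} (hu : ‖u‖ < 1) :
    u * kernelSeries' a u - a * kernelSeries a u = (1 - u)⁻¹ - if a = 0 then 1 else 0 := by
  have h1 := ((summable_kernelSeries' a hu).hasSum.mul_left u).sub
    ((summable_kernelSeries a hu).hasSum.mul_left a)
  have h2 : HasSum (fun l : ℕ => u ^ l - if l = 0 then (if a = 0 then (1 : ℂ) else 0) else 0)
      ((1 - u)⁻¹ - if a = 0 then 1 else 0) :=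
    (hasSum_geometric_of_norm_lt_one hu).sub (hasSum_ite_eq 0 _)
  refine h1.unique (h2.congr_fun fun l => ?_) |>.trans rfl
  rcases l with _ | l
  · by_cases h : a = 0
    · simp [h]
    · simp [h]
  · have h3 : ((l + 1 : ℕ) : ℂ) - a ≠ 0 := sub_ne_zero.2 fun h => ha _ l.succ_ne_zero h.symm
    rw [if_neg l.succ_ne_zero, Nat.add_sub_cancel, sub_zero]
    field_simp
    ring

/-- The Cauchy type integral inverting `(z - c) d/dz - a`. -/
def kernelInt (a c o : ℂ) (ϱ : ℝ) (B : ℂ → ℂ) (z : ℂ) : ℂ :=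
  (2 * π * I)⁻¹ * ∮ ξ in C(o, ϱ), kernelSeries a ((z - c) / (ξ - c)) * ((ξ - c)⁻¹ * B ξ)

open Classical in
lemma hasDerivAt_kernelInt {a c o : ℂ} (ha : ∀ l : ℕ, l ≠ 0 → a ≠ l) {ϱ : ℝ} {B : ℂ → ℂ}
    (hB : DifferentiableOn ℂ B (closedBall o ϱ)) (hc : c ∈ ball o ϱ) {z : ℂ}
    (hz : z ∈ ball o ϱ) (hzc : ∀ ξ ∈ sphere o ϱ, ‖z - c‖ < ‖ξ - c‖) :
    ∃ k', HasDerivAt (kernelInt a c o ϱ B) k' z ∧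
      (z - c) * k' - a * kernelInt a c o ϱ B z = B z - if a = 0 then B c else 0 := by
  have hϱ : 0 < ϱ := pos_of_mem_ball hc
  have h2pi : (2 * π * I : ℂ) ≠ 0 := two_pi_I_ne_zero
  set γ : ℝ → ℂ := circleMap o ϱ
  have hγ : Continuous γ := continuous_circleMap o ϱ
  have hγs : ∀ t, γ t ∈ sphere o ϱ := fun t => circleMap_mem_sphere o hϱ.le t
  have hγc : ∀ t, γ t - c ≠ 0 := fun t h => by
    have := hγs t
    rw [sub_eq_zero.1 h] at this
    exact (mem_ball.1 hc).ne this
  have hBγ : Continuous fun t => B (γ t) := hB.continuousOn.comp_continuous hγ fun t =>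
    sphere_subset_closedBall (hγs t)
  set V : ℝ → ℂ := fun t => deriv γ t * ((γ t - c)⁻¹ * B (γ t))
  have hγ' : Continuous (deriv γ) := by
    have : deriv γ = fun t => circleMap 0 ϱ t * I := funext fun t => deriv_circleMap o ϱ t
    rw [this]
    exact (continuous_circleMap 0 ϱ).mul continuous_const
  have hV : Continuous V := hγ'.mul (((hγ.sub continuous_const).inv₀ hγc).mul hBγ)
  have hlt : ∀ᶠ w in 𝓝 z, ∀ t ∈ Set.Icc 0 (2 * π), ‖(w - c) / (γ t - c)‖ < 1 := by
    refine isCompact_Icc.eventually_forall_of_forall_eventually fun t _ => ?_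
    have h1 : ContinuousAt (fun q : ℂ × ℝ => ‖(q.1 - c) / (γ q.2 - c)‖) (z, t) := by
      have h2 : ContinuousAt (fun q : ℂ × ℝ => (q.1 - c) / (γ q.2 - c)) (z, t) :=
        (continuous_fst.sub continuous_const).continuousAt.div
          ((hγ.comp continuous_snd).sub continuous_const).continuousAt (hγc t)
      exact h2.norm
    refine h1.eventually (gt_mem_nhds ?_)
    show ‖(z - c) / (γ t - c)‖ < 1
    rw [norm_div, div_lt_one (norm_pos_iff.2 (hγc t))]
    exact hzc _ (hγs t)
  have hder : HasDerivAt (fun w => ∫ t in (0 : ℝ)..(2 * π),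
      kernelSeries a ((w - c) / (γ t - c)) * V t)
      (∫ t in (0 : ℝ)..(2 * π), kernelSeries' a ((z - c) / (γ t - c)) / (γ t - c) * V t) z := by
    refine hasDerivAt_integral_mul (Ψ := fun w t => kernelSeries a ((w - c) / (γ t - c)))
      (Ψ' := fun w t => kernelSeries' a ((w - c) / (γ t - c)) / (γ t - c)) two_pi_pos.le
      ?_ (fun t ht => ?_) ?_ (hV.intervalIntegrable _ _)
    · filter_upwards [hlt] with w hw t ht
      have h1 := (hasDerivAt_kernelSeries a (hw t ht)).comp w
        (((hasDerivAt_id w).sub_const c).div_const (γ t - c))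
      refine h1.congr_deriv ?_
      ring
    · have h1 : ContinuousAt (fun q : ℂ × ℝ => (q.1 - c) / (γ q.2 - c)) (z, t) :=
        (continuous_fst.sub continuous_const).continuousAt.div
          ((hγ.comp continuous_snd).sub continuous_const).continuousAt (hγc t)
      have h2 : ContinuousAt (kernelSeries' a) ((z - c) / (γ t - c)) := by
        have h3 : DifferentiableOn ℂ (kernelSeries a) (ball 0 1) := fun u hu =>
          (hasDerivAt_kernelSeries a (mem_ball_zero_iff.1 hu)).differentiableAt.differentiableWithinAt
        have hmem : (z - c) / (γ t - c) ∈ ball (0 : ℂ) 1 :=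
          mem_ball_zero_iff.2 (mem_of_mem_nhds hlt t ht)
        have h4 := ((h3.deriv isOpen_ball).continuousOn).continuousAt
          (isOpen_ball.mem_nhds hmem)
        refine h4.congr ?_
        filter_upwards [isOpen_ball.mem_nhds hmem] with u hu
        exact (hasDerivAt_kernelSeries a (mem_ball_zero_iff.1 hu)).deriv
      exact (ContinuousAt.comp (f := fun q : ℂ × ℝ => (q.1 - c) / (γ q.2 - c)) h2 h1).div
        ((hγ.comp continuous_snd).sub continuous_const).continuousAt (hγc t)
    · filter_upwards [hlt] with w hw t ht
      have h1 : ContinuousAt (fun t => (w - c) / (γ t - c)) t :=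
        continuousAt_const.div (hγ.sub continuous_const).continuousAt (hγc t)
      exact (ContinuousAt.comp (f := fun t => (w - c) / (γ t - c))
        (hasDerivAt_kernelSeries a (hw t ht)).continuousAt h1).continuousWithinAt
  have hk : ∀ w, kernelInt a c o ϱ B w = (2 * π * I)⁻¹ * ∫ t in (0 : ℝ)..(2 * π),
      kernelSeries a ((w - c) / (γ t - c)) * V t := fun w => by
    rw [kernelInt, circleIntegral]
    congr 1
    refine integral_congr fun t _ => ?_
    simp only [smul_eq_mul, V, γ]
    ring
  refine ⟨_, (hder.const_mul (2 * π * I)⁻¹).congr_of_eventuallyEq (.of_forall hk), ?_⟩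
  have hc1 := hB.circleIntegral_sub_inv_smul hz
  have hc2 := hB.circleIntegral_sub_inv_smul hc
  have hzγ : ∀ t, γ t - z ≠ 0 := fun t h => by
    have := hγs t
    rw [sub_eq_zero.1 h] at this
    exact (mem_ball.1 hz).ne this
  rw [circleIntegral] at hc1 hc2
  simp only [smul_eq_mul] at hc1 hc2
  have hiK : IntervalIntegrable (fun t => kernelSeries a ((z - c) / (γ t - c)) * V t) volume 0
      (2 * π) := by
    refine (hV.intervalIntegrable _ _).continuousOn_mul fun t ht => ?_
    rw [Set.uIcc_of_le two_pi_pos.le] at ht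
    have h1 : ContinuousAt (fun t => (z - c) / (γ t - c)) t :=
      continuousAt_const.div (hγ.sub continuous_const).continuousAt (hγc t)
    exact (ContinuousAt.comp (f := fun t => (z - c) / (γ t - c))
      (hasDerivAt_kernelSeries a (mem_of_mem_nhds hlt t ht)).continuousAt h1).continuousWithinAt
  have key : ∀ t ∈ Set.Icc 0 (2 * π),
      (z - c) * (kernelSeries' a ((z - c) / (γ t - c)) / (γ t - c) * V t) =
      a * (kernelSeries a ((z - c) / (γ t - c)) * V t) + (deriv γ t * ((γ t - z)⁻¹ * B (γ t)) -
        (if a = 0 then 1 else 0) * (deriv γ t * ((γ t - c)⁻¹ * B (γ t)))) := by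
    intro t ht
    have h1 := mul_kernelSeries'_sub ha (mem_of_mem_nhds hlt t ht)
    have h2 := hγc t
    have h3 := hzγ t
    have h4 : (1 - (z - c) / (γ t - c))⁻¹ = (γ t - c) * (γ t - z)⁻¹ := by
      rw [one_sub_div h2, sub_sub_sub_cancel_right, inv_div, div_eq_mul_inv]
    rw [h4] at h1
    have h5 : (γ t - c) * (γ t - c)⁻¹ = 1 := mul_inv_cancel₀ h2
    simp only [V]
    generalize kernelSeries' a ((z - c) / (γ t - c)) = K' at h1 ⊢
    generalize kernelSeries a ((z - c) / (γ t - c)) = K at h1 ⊢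
    rw [div_eq_mul_inv] at h1 ⊢
    linear_combination (deriv γ t * ((γ t - c)⁻¹ * B (γ t))) * h1 +
      deriv γ t * B (γ t) * (γ t - z)⁻¹ * h5
  have hi1 : IntervalIntegrable (fun t => deriv γ t * ((γ t - z)⁻¹ * B (γ t))) volume 0
      (2 * π) :=
    (hγ'.mul (((hγ.sub continuous_const).inv₀ hzγ).mul hBγ)).intervalIntegrable _ _
  have hi2 : IntervalIntegrable (fun t => (if a = 0 then (1 : ℂ) else 0) * (deriv γ t *
      ((γ t - c)⁻¹ * B (γ t)))) volume 0 (2 * π) :=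
    (continuous_const.mul hV).intervalIntegrable _ _
  have e1 : (z - c) * ∫ t in (0 : ℝ)..(2 * π),
      kernelSeries' a ((z - c) / (γ t - c)) / (γ t - c) * V t =
      a * (∫ t in (0 : ℝ)..(2 * π), kernelSeries a ((z - c) / (γ t - c)) * V t) +
      ((2 * π * I) * B z - (if a = 0 then 1 else 0) * ((2 * π * I) * B c)) := by
    rw [← hc1, ← hc2, ← integral_const_mul, ← integral_const_mul,
      ← integral_const_mul, ← integral_sub hi1 hi2, ← integral_add (hiK.const_mul a) (hi1.sub hi2)]
    refine integral_congr fun t ht => ?_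
    rw [Set.uIcc_of_le two_pi_pos.le] at ht
    exact key t ht
  rw [hk]
  rw [mul_left_comm, e1]
  split_ifs <;> field_simp <;> ring

/-! ### Parametric integrals of continuously differentiable functions -/

lemma differentiableAt_integral_of_contDiffAt {Ψ : ℝ × ℝ → ℂ} {τ : ℝ} {a b : ℝ} (hab : a ≤ b)
    (h : ∀ t ∈ Set.Icc a b, ContDiffAt ℝ 1 Ψ (τ, t)) :
    DifferentiableAt ℝ (fun s => ∫ t in a..b, Ψ (s, t)) τ := by
  have h1 : ∀ᶠ s in 𝓝 τ, ∀ t ∈ Set.Icc a b, ContDiffAt ℝ 1 Ψ (s, t) :=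
    isCompact_Icc.eventually_forall_of_forall_eventually fun t ht =>
      (h t ht).eventually (by norm_num)
  have h2 := hasDerivAt_integral_mul (𝕜 := ℝ) (Ψ := fun s t => Ψ (s, t))
    (Ψ' := fun s t => fderiv ℝ Ψ (s, t) (1, 0)) (V := fun _ => 1) (s₀ := τ) hab ?_ (fun t ht => ?_) ?_
    intervalIntegrable_const
  · simpa using h2.differentiableAt
  · filter_upwards [h1] with s hs t ht
    have h3 : HasDerivAt (fun s : ℝ => (s, t)) (1, 0) s :=
      (hasDerivAt_id s).prodMk (hasDerivAt_const s t)
    exact ((hs t ht).differentiableAt one_ne_zero).hasFDerivAt.comp_hasDerivAt s h3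
  · have h3 : ContinuousAt (fderiv ℝ Ψ) (τ, t) :=
      ((h t ht).fderiv_right (m := 0) (by norm_num)).continuousAt
    exact h3.clm_apply continuousAt_const
  · filter_upwards [h1] with s hs t ht
    exact ((hs t ht).continuousAt.comp (f := fun t => (s, t))
      (Continuous.prodMk_right s).continuousAt).continuousWithinAt

/-! ### Polar coordinates around a point of the circle -/

lemma norm_ue_mul_exp (t : ℝ) (w : ℂ) : ‖ue t * exp w‖ = Real.exp w.re := by
  rw [norm_mul, norm_ue, one_mul, norm_exp]

lemma im_ue_mul_exp (t : ℝ) (w : ℂ) : (ue t * exp w * ue (-t)).im = Real.exp w.re * Real.sin w.im := by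
  have : ue t * exp w * ue (-t) = exp w := by
    rw [mul_right_comm, ← ue_add, add_neg_cancel, ue_zero, one_mul]
  rw [this, exp_im]

lemma eq_ue_mul_exp_log {t : ℝ} {z : ℂ} (h : ‖z - ue t‖ ≤ 1 / 2) :
    z = ue t * exp (log (z / ue t)) ∧ ‖log (z / ue t)‖ ≤ 3 / 2 * ‖z - ue t‖ := by
  have h0 := ue_ne_zero t
  have h1 : ‖z - ue t‖ ≤ ‖ue t‖ / 2 := by rwa [norm_ue]
  refine ⟨?_, by simpa [norm_ue] using norm_log_div_le h0 h1⟩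
  rw [exp_log (slitPlane_ne_zero (div_mem_slitPlane h0 h1)), mul_div_cancel₀ _ h0]

lemma eventually_polar (t : ℝ) {δ : ℝ} (hδ : 0 < δ) :
    ∀ᶠ z in 𝓝 (ue t), ∃ w ∈ ball (0 : ℂ) δ, z = ue t * exp w := by
  filter_upwards [ball_mem_nhds (ue t) (show 0 < min (1 / 2) (δ / 2) by positivity)] with z hz
  rw [mem_ball_iff_norm] at hz
  obtain ⟨h1, h2⟩ := eq_ue_mul_exp_log (hz.trans_le (min_le_left _ _)).le
  refine ⟨_, mem_ball_zero_iff.2 (h2.trans_lt ?_), h1⟩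
  have := hz.trans_le (min_le_right _ _)
  linarith

lemma tendsto_ue_mul_exp (t : ℝ) : Tendsto (fun w : ℂ => ue t * exp w) (𝓝 0) (𝓝 (ue t)) := by
  have : Continuous fun w : ℂ => ue t * exp w := by fun_prop
  simpa using this.tendsto 0

lemma hasDerivAt_ue_mul_exp (t : ℝ) (w : ℂ) :
    HasDerivAt (fun w : ℂ => ue t * exp w) (ue t * exp w) w :=
  (hasDerivAt_exp w).const_mul _

lemma isPreconnected_ball_inter_re_neg (δ : ℝ) :
    IsPreconnected (ball (0 : ℂ) δ ∩ {w | w.re < 0}) :=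
  ((convex_ball _ _).inter (convex_halfSpace_re_lt 0)).isPreconnected

lemma isPreconnected_ball_inter_re_pos (δ : ℝ) :
    IsPreconnected (ball (0 : ℂ) δ ∩ {w | 0 < w.re}) :=
  ((convex_ball _ _).inter (convex_halfSpace_re_gt 0)).isPreconnected

lemma isOpen_re_neg : IsOpen {w : ℂ | w.re < 0} := isOpen_lt continuous_re continuous_const

lemma isOpen_re_pos : IsOpen {w : ℂ | 0 < w.re} := isOpen_lt continuous_const continuous_re

/-! ### The Cauchy transform near an arc -/

lemma CutFree.ne_zero {z : ℂ} (h : CutFree θ z) : z ≠ 0 := fun h0 => by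
  have := h.1
  simp [h0] at this

lemma CutFree.sub_ne_zero {z : ℂ} (h : CutFree θ z) (j : ι) : z - zpt θ j ≠ 0 := fun h0 => by
  have := slitPlane_ne_zero (h.2 j)
  rw [← neg_sub_mul_ue, h0, zero_mul, neg_zero] at this
  exact this rfl

lemma differentiableAt_residSum {z : ℂ} (h0 : z ≠ 0) (h : ∀ j, z - zpt θ j ≠ 0) :
    DifferentiableAt ℂ (residSum n α β θ) z :=
  ((differentiableAt_const _).div differentiableAt_id h0).add
    (DifferentiableAt.fun_sum fun j _ =>
      (differentiableAt_const _).div (differentiableAt_id.sub_const _) (h j))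

lemma hasDerivAt_cauchyT_ode (hα : Admissible α)
    (hinj : Injective (zpt θ)) {z : ℂ} (hz : ‖z‖ ≠ 1) (hz0 : z ≠ 0) :
    HasDerivAt 𝓒
      (logDerivW n α β θ z * 𝓒 z + residSum n α β θ z) z := by
  rw [← cauchyT'_eq hα hinj hz hz0]
  exact hasDerivAt_cauchyT hα hinj hz

/-- If the Cauchy transform is given by `exp (2 L) (W + c)` on the two sides of the circle near
a regular point, then the jump of the constant is determined by the weight. -/
lemma const_sub_eq_of_jump (hα : Admissible α)
    (hinj : Injective (zpt θ)) {t : ℝ} (ht : ∀ j, ue t ≠ zpt θ j) {L W : ℂ → ℂ}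
    {c₁ c₂ s : ℂ} (hL : ContinuousAt L (ue t)) (hW : ContinuousAt W (ue t))
    (h₁ : ∀ᶠ r in 𝓝[>] (0 : ℝ), 𝓒 (Real.exp (-r) * ue t) =
      exp (2 * L (Real.exp (-r) * ue t)) * (W (Real.exp (-r) * ue t) + c₁))
    (h₂ : ∀ᶠ r in 𝓝[>] (0 : ℝ), 𝓒 (Real.exp r * ue t) =
      exp (2 * L (Real.exp r * ue t)) * (W (Real.exp r * ue t) + c₂))
    (hw : 𝓦 t = s * exp (2 * L (ue t))) : c₁ - c₂ = s := by
  have hf : ContinuousAt (fun z => exp (2 * L z)) (ue t) := (continuousAt_const.mul hL).cexp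
  have e : ∀ u : ℝ → ℝ, Continuous u → u 0 = 0 →
      Tendsto (fun r : ℝ => (Real.exp (u r) : ℂ) * ue t) (𝓝[>] 0) (𝓝 (ue t)) := fun u hu h0 => by
    have h1 : Continuous fun r : ℝ => (Real.exp (u r) : ℂ) * ue t := by fun_prop
    have h2 := h1.tendsto 0
    simp only [h0, Real.exp_zero, ofReal_one, one_mul] at h2
    exact h2.mono_left nhdsWithin_le_nhds
  have l₁ : Tendsto (fun r : ℝ => 𝓒 (Real.exp (-r) * ue t)) (𝓝[>] 0)
      (𝓝 (exp (2 * L (ue t)) * (W (ue t) + c₁))) := by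
    have h3 := (hf.mul (hW.add (continuousAt_const (y := c₁)))).tendsto.comp
      (e (fun r => -r) continuous_neg neg_zero)
    exact h3.congr' (h₁.mono fun r hr => hr.symm)
  have l₂ : Tendsto (fun r : ℝ => 𝓒 (Real.exp r * ue t)) (𝓝[>] 0)
      (𝓝 (exp (2 * L (ue t)) * (W (ue t) + c₂))) := by
    have h3 := (hf.mul (hW.add (continuousAt_const (y := c₂)))).tendsto.comp
      (e (fun r => r) continuous_id rfl)
    exact h3.congr' (h₂.mono fun r hr => hr.symm)
  have h3 := tendsto_nhds_unique (l₁.sub l₂) (tendsto_cauchyT_sub hα hinj ht)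
  rw [hw] at h3
  refine mul_left_cancel₀ (exp_ne_zero (2 * L (ue t))) ?_
  linear_combination h3

lemma ofReal_exp_mul_ue (r t : ℝ) : (Real.exp r : ℂ) * ue t = ue t * exp (r : ℂ) := by
  rw [ofReal_exp, mul_comm]

lemma exists_arc_local (hα : Admissible α) (hθ : IsConfiguration θ)
    {j : ι} {t : ℝ} (ht : t ∈ Set.Ioo (θ j) (nextAngle θ j)) :
    ∃ (W : ℂ → ℂ) (c : ℂ), ContinuousAt W (ue t) ∧ (∀ᶠ z in 𝓝 (ue t), ‖z‖ < 1 → cauchyT n α β θ z =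
        exp (2 * hLog n α β θ z) * (W z + (c + sConst α β j))) ∧
      (∀ᶠ z in 𝓝 (ue t), 1 < ‖z‖ → cauchyT n α β θ z = exp (2 * hLog n α β θ z) * (W z + c)) := by
  have hinj := zpt_injective hθ
  have hcf := cutFree_of_mem_arc hθ ht
  obtain ⟨ρ, hρ, hball⟩ := isOpen_iff.1 (isOpen_cutFree (θ := θ)) _ hcf
  have hRd : DifferentiableOn ℂ (fun z => residSum n α β θ z * exp (-(2 * hLog n α β θ z)))
      (ball (ue t) ρ) := fun z hz => by
    have h1 : CutFree θ z := hball hz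
    have h2 := (hasDerivAt_hLog (n := n) (α := α) (β := β) h1).differentiableAt
    exact ((differentiableAt_residSum h1.ne_zero h1.sub_ne_zero).mul
      ((h2.const_mul 2).neg.cexp)).differentiableWithinAt
  obtain ⟨W, hW⟩ := hRd.isExactOn_ball
  obtain ⟨δ, hδ, hδρ⟩ := eventually_nhds_iff_ball.1
    ((tendsto_ue_mul_exp t).eventually (ball_mem_nhds _ hρ))
  have hode : ∀ S : Set ℂ, IsOpen S → IsPreconnected S → S ⊆ ball 0 δ →
      (∀ w ∈ S, w.re ≠ 0) → ∃ c, ∀ w ∈ S, cauchyT n α β θ (ue t * exp w) =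
        exp (2 * hLog n α β θ (ue t * exp w)) * (W (ue t * exp w) + c) := by
    intro S hSo hSc hSδ hS
    refine exists_const_of_ode (E := fun w => ue t * exp w) (E' := fun w => ue t * exp w)
      (r := logDerivW n α β θ) (R := residSum n α β θ) hSo hSc
      (fun w _ => hasDerivAt_ue_mul_exp t w) (fun w hw => ?_) (fun w hw => ?_) (fun w hw => ?_)
    · refine hasDerivAt_cauchyT_ode hα hinj ?_ (mul_ne_zero (ue_ne_zero t) (exp_ne_zero w))
      rw [norm_ue_mul_exp]
      exact fun h => hS w hw ((Real.exp_eq_one_iff _).1 h)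
    · exact hasDerivAt_hLog (hball (hδρ w (hSδ hw)))
    · exact hW _ (hδρ w (hSδ hw))
  obtain ⟨c₁, hc₁⟩ := hode _ (isOpen_ball.inter isOpen_re_neg)
    (isPreconnected_ball_inter_re_neg δ) Set.inter_subset_left fun w hw => ne_of_lt hw.2
  obtain ⟨c₂, hc₂⟩ := hode _ (isOpen_ball.inter isOpen_re_pos)
    (isPreconnected_ball_inter_re_pos δ) Set.inter_subset_left fun w hw => ne_of_gt hw.2
  have hWc : ContinuousAt W (ue t) := (hW _ (mem_ball_self hρ)).continuousAt
  have hne : ∀ i, ue t ≠ zpt θ i := fun i h => hcf.sub_ne_zero i (sub_eq_zero.2 h)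
  have hsmall : ∀ᶠ r in 𝓝[>] (0 : ℝ), 0 < r ∧ r < δ := Ioo_mem_nhdsGT hδ
  have hs : c₁ - c₂ = sConst α β j := by
    refine const_sub_eq_of_jump hα hinj hne
      (hasDerivAt_hLog (n := n) (α := α) (β := β) hcf).continuousAt hWc ?_ ?_
      (weight_eq_of_mem_arc hθ ht)
    · filter_upwards [hsmall] with r hr
      have := hc₁ (((-r : ℝ) : ℂ)) ⟨by simpa [abs_of_pos hr.1] using hr.2, by simpa using hr.1⟩
      rwa [← ofReal_exp_mul_ue] at this
    · filter_upwards [hsmall] with r hr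
      have := hc₂ ((r : ℝ) : ℂ) ⟨by simpa [abs_of_pos hr.1] using hr.2, by simpa using hr.1⟩
      rwa [← ofReal_exp_mul_ue] at this
  refine ⟨W, c₂, hWc, ?_, ?_⟩
  · filter_upwards [eventually_polar t hδ] with z hz h1
    obtain ⟨w, hw, rfl⟩ := hz
    rw [norm_ue_mul_exp, Real.exp_lt_one_iff] at h1
    rw [← hs, add_sub_cancel]
    exact hc₁ w ⟨hw, h1⟩
  · filter_upwards [eventually_polar t hδ] with z hz h1
    obtain ⟨w, hw, rfl⟩ := hz
    rw [norm_ue_mul_exp, Real.one_lt_exp_iff] at h1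
    exact hc₂ w ⟨hw, h1⟩

/-! ### The regular factors near a singular point -/

/-- The singular points are separated by `d`. -/
def Sep (θ : ι → ℝ) (d : ℝ) : Prop := 0 < d ∧ d ≤ 1 ∧ ∀ i j, i ≠ j → d ≤ ‖zpt θ i - zpt θ j‖

lemma Sep.injective {d : ℝ} (h : Sep θ d) : Injective (zpt θ) := fun i j hij => by
  by_contra hne
  have := h.2.2 i j hne
  rw [hij, sub_self, norm_zero] at this
  linarith [h.1]

/-- The logarithm of `h` without the singular term of the index `j`. -/
def eLog (n : ℕ) (α β : ι → ℂ) (θ : ι → ℝ) (j : ι) (z : ℂ) : ℂ :=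
  lam n α β * (log (z * ue (-θ j)) + θ j * I) +
    ∑ i ∈ univ.erase j, α i * (log (1 - z * ue (-θ i)) + (θ i + π) * I)

lemma mul_ue_mem_slitPlane {j : ι} {z : ℂ} (h : ‖z - zpt θ j‖ < 1) :
    z * ue (-θ j) ∈ slitPlane := by
  have h1 : z * ue (-θ j) = 1 + (z - zpt θ j) * ue (-θ j) := by
    have := ue_neg_mul (θ j)
    rw [← zpt_eq] at this
    linear_combination this
  rw [h1]
  refine mem_slitPlane_of_norm_lt_one ?_
  rwa [norm_mul, norm_ue, mul_one]

lemma Sep.one_sub_mem {d : ℝ} (h : Sep θ d) {i j : ι} (hij : i ≠ j) {z : ℂ}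
    (hz : ‖z - zpt θ j‖ < d / 2) : 1 - z * ue (-θ i) ∈ slitPlane := by
  by_contra hn
  obtain ⟨r, hr, h1⟩ := eq_ofReal_of_notMem_slitPlane hn
  have h2 : z = ((1 - r : ℝ) : ℂ) * zpt θ i := eq_mul_ue_of (by push_cast; rw [← h1]; ring)
  have h3 : ‖z‖ = 1 - r := by
    rw [h2, norm_mul, zpt_eq, norm_ue, mul_one, norm_real, norm_of_nonneg (by linarith)]
  have h4 : -r ≤ ‖z - zpt θ j‖ := by
    have := norm_sub_norm_le z (zpt θ j)
    rw [h3, zpt_eq, norm_ue] at this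
    rw [zpt_eq]
    linarith
  have h5 : ‖zpt θ i - z‖ = -r := by
    have : zpt θ i - z = (r : ℂ) * zpt θ i := by rw [h2]; push_cast; ring
    rw [this, norm_mul, zpt_eq, norm_ue, mul_one, norm_real, Real.norm_of_nonpos hr]
  have h6 := norm_sub_le_norm_sub_add_norm_sub (zpt θ i) z (zpt θ j)
  have h7 := h.2.2 i j hij
  linarith

lemma Sep.sub_ne_zero {d : ℝ} (h : Sep θ d) {i j : ι} (hij : i ≠ j) {z : ℂ}
    (hz : ‖z - zpt θ j‖ < d / 2) : z - zpt θ i ≠ 0 := fun h0 => by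
  have := slitPlane_ne_zero (h.one_sub_mem hij hz)
  rw [← neg_sub_mul_ue, h0, zero_mul, neg_zero] at this
  exact this rfl

lemma Sep.lt_one {d : ℝ} (h : Sep θ d) {x : ℝ} (hx : x < d / 2) : x < 1 := by linarith [h.2.1]

lemma Sep.ne_zero {d : ℝ} (h : Sep θ d) {j : ι} {z : ℂ}
    (hz : ‖z - zpt θ j‖ < d / 2) : z ≠ 0 := fun h0 => by
  have := slitPlane_ne_zero (mul_ue_mem_slitPlane (h.lt_one hz))
  rw [h0, zero_mul] at this
  exact this rfl

lemma hasDerivAt_log_mul_ue {c : ℝ} {z : ℂ} (h : z * ue (-c) ∈ slitPlane) :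
    HasDerivAt (fun z => log (z * ue (-c))) (1 / z) z := by
  refine (((hasDerivAt_id z).mul_const (ue (-c))).clog h).congr_deriv ?_
  have h3 : z ≠ 0 := fun h0 => by simp [h0] at h
  have := ue_ne_zero (-c)
  simp only [id]
  field_simp

lemma Sep.hasDerivAt_eLog {d : ℝ} (h : Sep θ d) {j : ι} {z : ℂ}
    (hz : ‖z - zpt θ j‖ < d / 2) :
    HasDerivAt (eLog n α β θ j)
      (lam n α β / z + ∑ i ∈ univ.erase j, α i / (z - zpt θ i)) z := by
  have h1 := ((hasDerivAt_log_mul_ue (mul_ue_mem_slitPlane (h.lt_one hz))).add_const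
    (θ j * I)).const_mul (lam n α β)
  have h2 := HasDerivAt.fun_sum (u := univ.erase j) fun i hi =>
    ((hasDerivAt_log_one_sub (h.one_sub_mem (ne_of_mem_erase hi) hz)).add_const
      ((θ i + π) * I)).const_mul (α i)
  refine (h1.add h2).congr_deriv ?_
  congr 1
  · ring
  · exact sum_congr rfl fun i _ => by ring

/-- The right hand side `(z - z_j) R(z) exp (-2 eLog)` of the local equation, continued to
`z_j`. -/
def residLoc (n : ℕ) (α β : ι → ℂ) (θ : ι → ℝ) (j : ι) (z : ℂ) : ℂ :=
  (resid n α β θ j + (z - zpt θ j) * (resid0 n α β θ / z +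
    ∑ i ∈ univ.erase j, resid n α β θ i / (z - zpt θ i))) * exp (-(2 * eLog n α β θ j z))

lemma residLoc_self (j : ι) :
    residLoc n α β θ j (zpt θ j) = resid n α β θ j * exp (-(2 * eLog n α β θ j (zpt θ j))) := by
  rw [residLoc, sub_self, zero_mul, add_zero]

lemma residLoc_eq {j : ι} {z : ℂ} (hz : z - zpt θ j ≠ 0) :
    residLoc n α β θ j z = (z - zpt θ j) * residSum n α β θ z * exp (-(2 * eLog n α β θ j z)) := by
  rw [residLoc, residSum, ← add_sum_erase _ _ (mem_univ j)]
  congr 1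
  field_simp
  ring

lemma Sep.differentiableAt_residLoc {d : ℝ} (h : Sep θ d) {j : ι} {z : ℂ}
    (hz : ‖z - zpt θ j‖ < d / 2) : DifferentiableAt ℂ (residLoc n α β θ j) z := by
  have h1 : DifferentiableAt ℂ (eLog n α β θ j) z := (h.hasDerivAt_eLog hz).differentiableAt
  have h2 : DifferentiableAt ℂ (fun z => ∑ i ∈ univ.erase j, resid n α β θ i / (z - zpt θ i)) z :=
    DifferentiableAt.fun_sum fun i hi => (differentiableAt_const _).div
      (differentiableAt_id.sub_const _) (h.sub_ne_zero (ne_of_mem_erase hi) hz)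
  have h3 : DifferentiableAt ℂ (fun z => resid0 n α β θ / z) z :=
    (differentiableAt_const _).div differentiableAt_id (h.ne_zero hz)
  exact (((differentiableAt_id.sub_const _).mul (h3.add h2)).const_add _).mul
    ((h1.const_mul 2).neg.cexp)

/-- The regular local solution divided by `exp (2 eLog)`. -/
def kLoc (n : ℕ) (α β : ι → ℂ) (θ : ι → ℝ) (o : ℂ) (d : ℝ) (j : ι)
    (z : ℂ) : ℂ :=
  kernelInt (2 * α j) (zpt θ j) o (d / 4) (residLoc n α β θ j) z

lemma two_mul_ne_nat {a : ℂ} (ha : NonResonant a) (l : ℕ) (hl : l ≠ 0) :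
    2 * a ≠ l := by
  rintro h
  rcases ha with ha | ha
  · rw [ha, mul_zero] at h
    exact hl (by exact_mod_cast h.symm)
  · refine ha (exp_eq_one_iff.2 ⟨l, ?_⟩)
    push_cast
    rw [← h]; ring

open Classical in
lemma Sep.hasDerivAt_kLoc {d : ℝ} (h : Sep θ d) {o : ℂ} {j : ι}
    (ha : NonResonant (α j)) (ho : ‖zpt θ j - o‖ < d / 32) {z : ℂ}
    (hz : ‖z - o‖ < d / 16) :
    ∃ k', HasDerivAt (kLoc n α β θ o d j) k' z ∧
      (z - zpt θ j) * k' - 2 * α j * kLoc n α β θ o d j z =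
        residLoc n α β θ j z - if α j = 0 then residLoc n α β θ j (zpt θ j) else 0 := by
  have hd := h.1
  have h1 := hasDerivAt_kernelInt (a := 2 * α j) (c := zpt θ j) (o := o) (two_mul_ne_nat ha)
    (ϱ := d / 4) (B := residLoc n α β θ j) (fun ξ hξ => ?_) ?_ (z := z) ?_ fun ξ hξ => ?_
  · simp only [mul_eq_zero, OfNat.ofNat_ne_zero, false_or] at h1
    exact h1
  · rw [mem_closedBall_iff_norm] at hξ
    refine (h.differentiableAt_residLoc ?_).differentiableWithinAt
    have h2 := norm_sub_le_norm_sub_add_norm_sub ξ o (zpt θ j)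
    rw [norm_sub_rev o] at h2
    linarith
  · rw [mem_ball_iff_norm]; linarith
  · rw [mem_ball_iff_norm]; linarith
  · rw [mem_sphere_iff_norm] at hξ
    have h2 := norm_sub_le_norm_sub_add_norm_sub z o (zpt θ j)
    have h3 := norm_sub_le_norm_sub_add_norm_sub ξ (zpt θ j) o
    rw [norm_sub_rev o] at h2
    linarith

/-! ### The weight near a singular point -/

lemma norm_ue_sub_ue_le (x y : ℝ) : ‖ue x - ue y‖ ≤ |x - y| := by
  rw [norm_ue_sub_ue, norm_one_sub_ue]
  have h1 := Real.abs_sin_le_abs (x := (x - y) / 2)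
  rw [abs_div, abs_two] at h1
  rw [abs_mul, abs_two]
  linarith

lemma Sep.le_sub {d : ℝ} (h : Sep θ d) (hθ : IsConfiguration θ) {i j : ι} (hij : i < j) :
    d ≤ θ j - θ i ∧ θ j - θ i ≤ 2 * π - d := by
  have h0 := hθ.1 hij
  have h1 := h.2.2 j i hij.ne'
  have h2 := h.2.2 i j hij.ne
  constructor
  · have := norm_ue_sub_ue_le (θ j) (θ i)
    rw [abs_of_pos (by linarith)] at this
    exact h1.trans this
  · have := norm_ue_sub_ue_le (θ i + 2 * π) (θ j)
    rw [ue_periodic (θ i)] at this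
    have h3 := hθ.1.monotone (Fin.zero_le i)
    have h4 := hθ.1.monotone (Fin.le_last j)
    rw [abs_of_pos (by linarith [hθ.2])] at this
    linarith [h2.trans this]

/-- The logarithm of `h` near `z_j`, without the jump of `z ^ λ`. -/
def hatLog (n : ℕ) (α β : ι → ℂ) (θ : ι → ℝ) (j : ι) (z : ℂ) : ℂ :=
  eLog n α β θ j z + α j * logFrom (θ j) (z - zpt θ j)

lemma log_ue {x : ℝ} (h : |x| < π) : log (ue x) = x * I := by
  rw [ue, log_exp]
  · simpa using (abs_lt.1 h).1
  · simpa using (abs_lt.1 h).2.le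

lemma hatLog_ue {j : ι} {t : ℝ} (h : |t - θ j| < π) (hne : ue t ≠ zpt θ j) :
    hatLog n α β θ j (ue t) = lam n α β * (t * I) +
      ∑ i, α i * (log (1 - ue (t - θ i)) + (θ i + π) * I) := by
  have h2 : ∀ i, ue t * ue (-θ i) = ue (t - θ i) := fun i => by rw [← ue_add, sub_eq_add_neg]
  rw [hatLog, eLog, logFrom_sub_eq (by rw [h2]; exact one_sub_ue_mem_slitPlane (ue_sub_ne_one hne)),
    h2, log_ue h, ← add_sum_erase _ _ (mem_univ j), sum_congr rfl fun i _ => by rw [h2 i]]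
  push_cast
  ring

lemma weight_eq_left {d : ℝ} (h : Sep θ d) (hθ : IsConfiguration θ) {j : ι} {t : ℝ}
    (ht : 0 < t - θ j) (ht' : t - θ j < d) :
    (∀ i, ue t ≠ zpt θ i) ∧
      𝓦 t = sConst α β j * exp (2 * hatLog n α β θ j (ue t)) := by
  have hpi := Real.two_le_pi
  have hd1 := h.2.1
  have hk : ∀ i, t - θ i ∈ Set.Ioo (((if i ≤ j then 0 else -1 : ℤ) : ℝ) * (2 * π))
      (((if i ≤ j then 0 else -1 : ℤ) : ℝ) * (2 * π) + 2 * π) := by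
    intro i
    split_ifs with hij
    · rcases hij.eq_or_lt with rfl | hij
      · constructor <;> push_cast <;> linarith
      · have := h.le_sub hθ hij
        constructor <;> push_cast <;> linarith
    · have := h.le_sub hθ (not_le.1 hij)
      constructor <;> push_cast <;> linarith
  have hne : ∀ i, ue t ≠ zpt θ i := fun i h0 => by
    refine ue_ne_one_of_mem (hk i) ?_
    rw [ue_sub, h0, zpt_eq, div_self (ue_ne_zero _)]
  refine ⟨hne, ?_⟩
  rw [weight_eq_of_mem hk, hatLog_ue (by rw [abs_of_pos ht]; linarith) (hne j), sConst_eq]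

lemma weight_eq_right {d : ℝ} (h : Sep θ d) (hθ : IsConfiguration θ) {j : ι} {t : ℝ}
    (ht : t - θ j < 0) (ht' : -d < t - θ j) :
    (∀ i, ue t ≠ zpt θ i) ∧ 𝓦 t = sConst α β j * exp (2 * π * I * (β j - α j)) *
        exp (2 * hatLog n α β θ j (ue t)) := by
  have hpi := Real.two_le_pi
  have hd1 := h.2.1
  have hk : ∀ i, t - θ i ∈ Set.Ioo (((if i < j then 0 else -1 : ℤ) : ℝ) * (2 * π))
      (((if i < j then 0 else -1 : ℤ) : ℝ) * (2 * π) + 2 * π) := by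
    intro i
    split_ifs with hij
    · have := h.le_sub hθ hij
      constructor <;> push_cast <;> linarith
    · rcases (not_lt.1 hij).eq_or_lt with rfl | hij
      · constructor <;> push_cast <;> linarith
      · have := h.le_sub hθ hij
        constructor <;> push_cast <;> linarith
  have hne : ∀ i, ue t ≠ zpt θ i := fun i h0 => by
    refine ue_ne_one_of_mem (hk i) ?_
    rw [ue_sub, h0, zpt_eq, div_self (ue_ne_zero _)]
  refine ⟨hne, ?_⟩
  rw [weight_eq_of_mem hk, hatLog_ue (by rw [abs_of_neg ht]; linarith) (hne j), sConst_eq]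
  congr 1
  rw [← exp_add]
  congr 1
  rw [← add_sum_erase _ _ (mem_univ j), ← add_sum_erase _ (fun i => I *
    π * (-(2 * ((if i ≤ j then 0 else -1 : ℤ) : ℂ) + 1) * β i +
      (2 * ((if i ≤ j then 0 else -1 : ℤ) : ℂ) - 1) * α i)) (mem_univ j),
    sum_congr rfl fun i hi => by
      rw [show (if i < j then 0 else -1 : ℤ) = if i ≤ j then 0 else -1 from by
        simp only [lt_iff_le_and_ne, ne_of_mem_erase hi, ne_eq, not_false_eq_true, and_true]]]
  simp only [lt_irrefl, le_refl, if_true, if_false]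
  push_cast
  ring

/-! ### The Cauchy transform near a singular point -/

open Classical in
/-- The local solution of the equation divided by `exp (2 hatLog)`. -/
def wLoc (n : ℕ) (α β : ι → ℂ) (θ : ι → ℝ) (o : ℂ) (d : ℝ) (j : ι)
    (z : ℂ) : ℂ :=
  kLoc n α β θ o d j z * exp (-(2 * α j * logFrom (θ j) (z - zpt θ j))) +
    if α j = 0 then residLoc n α β θ j (zpt θ j) * logFrom (θ j) (z - zpt θ j) else 0

lemma Sep.hasDerivAt_hatLog {d : ℝ} (h : Sep θ d) {j : ι} {z : ℂ}
    (hz : ‖z - zpt θ j‖ < d / 2) (hs : 1 - z * ue (-θ j) ∈ slitPlane) :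
    HasDerivAt (hatLog n α β θ j) (logDerivW n α β θ z / 2) z := by
  refine ((h.hasDerivAt_eLog hz).add ((hasDerivAt_logFrom_sub hs).const_mul (α j))).congr_deriv ?_
  rw [logDerivW, ← add_sum_erase _ _ (mem_univ j), add_div, add_div, sum_div,
    sum_congr rfl fun i _ => show 2 * α i / (z - zpt θ i) / 2 = α i / (z - zpt θ i) by ring]
  ring

lemma Sep.hasDerivAt_wLoc {d : ℝ} (h : Sep θ d) {o : ℂ} {j : ι}
    (ha : NonResonant (α j)) (ho : ‖zpt θ j - o‖ < d / 32) {z : ℂ}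
    (hz : ‖z - o‖ < d / 16) (hs : 1 - z * ue (-θ j) ∈ slitPlane) :
    HasDerivAt (wLoc n α β θ o d j)
      (residSum n α β θ z * exp (-(2 * hatLog n α β θ j z))) z := by
  obtain ⟨k', hk, hke⟩ := h.hasDerivAt_kLoc (n := n) (β := β) ha ho hz
  have hl := hasDerivAt_logFrom_sub hs
  have hzj : z - zpt θ j ≠ 0 := fun h0 => by
    have := slitPlane_ne_zero hs
    rw [← neg_sub_mul_ue, h0, zero_mul, neg_zero] at this
    exact this rfl
  have h1 := hk.mul ((hl.const_mul (2 * α j)).neg.cexp)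
  have hR := residLoc_eq (n := n) (α := α) (β := β) hzj
  have he : exp (-(2 * hatLog n α β θ j z)) = exp (-(2 * eLog n α β θ j z)) *
      exp (-(2 * α j * logFrom (θ j) (z - zpt θ j))) := by
    rw [← exp_add, hatLog]; congr 1; ring
  rw [he]
  by_cases h0 : α j = 0
  · have h2 : wLoc n α β θ o d j = fun z => kLoc n α β θ o d j z *
        exp (-(2 * α j * logFrom (θ j) (z - zpt θ j))) +
        residLoc n α β θ j (zpt θ j) * logFrom (θ j) (z - zpt θ j) := by
      ext z; rw [wLoc, if_pos h0]
    rw [h2]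
    refine (h1.add (hl.const_mul (residLoc n α β θ j (zpt θ j)))).congr_deriv ?_
    rw [if_pos h0, hR, h0] at hke
    simp only [Pi.neg_apply, h0, mul_zero, zero_mul, neg_zero, exp_zero, mul_one, add_zero]
    refine mul_left_cancel₀ hzj ?_
    have h3 : (z - zpt θ j) * (1 / (z - zpt θ j)) = 1 := mul_one_div_cancel hzj
    linear_combination hke + residLoc n α β θ j (zpt θ j) * h3
  · have h2 : wLoc n α β θ o d j = fun z => kLoc n α β θ o d j z *
        exp (-(2 * α j * logFrom (θ j) (z - zpt θ j))) := by
      ext z; rw [wLoc, if_neg h0, add_zero]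
    rw [h2]
    refine h1.congr_deriv ?_
    rw [if_neg h0, hR, sub_zero] at hke
    simp only [Pi.neg_apply]
    refine mul_left_cancel₀ hzj ?_
    have h3 : (z - zpt θ j) * (1 / (z - zpt θ j)) = 1 := mul_one_div_cancel hzj
    generalize exp (-(2 * α j * logFrom (θ j) (z - zpt θ j))) = P
    linear_combination P * hke - 2 * α j * kLoc n α β θ o d j z * P * h3

lemma isOpen_im_pos : IsOpen {w : ℂ | 0 < w.im} := isOpen_lt continuous_const continuous_im

lemma isOpen_im_neg : IsOpen {w : ℂ | w.im < 0} := isOpen_lt continuous_im continuous_const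

lemma sin_im_pos {w : ℂ} (h : ‖w‖ < 1) (hw : 0 < w.im) : 0 < Real.sin w.im :=
  Real.sin_pos_of_pos_of_lt_pi hw (by
    have := (le_abs_self _).trans (abs_im_le_norm w)
    linarith [Real.two_le_pi])

lemma sin_im_neg {w : ℂ} (h : ‖w‖ < 1) (hw : w.im < 0) : Real.sin w.im < 0 :=
  Real.sin_neg_of_neg_of_neg_pi_lt hw (by
    have := neg_le_of_abs_le (abs_im_le_norm w)
    linarith [Real.two_le_pi])

lemma one_sub_mem_slitPlane_of_im_ne {z : ℂ} (h : z.im ≠ 0) : 1 - z ∈ slitPlane := by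
  rw [mem_slitPlane_iff]
  right
  simpa using h

lemma norm_ue_mul_exp_sub_le (t : ℝ) {w : ℂ} (hw : ‖w‖ ≤ 1) : ‖ue t * exp w - ue t‖ ≤ 2 * ‖w‖ := by
  have : ue t * exp w - ue t = ue t * (exp w - 1) := by ring
  rw [this, norm_mul, norm_ue, one_mul]
  exact norm_exp_sub_one_le hw

/-- The Cauchy transform in the three regions near `z_j`. -/
lemma exists_const_regions {d : ℝ} (h : Sep θ d) (hα : Admissible α) {o : ℂ}
    {j : ι} (ha : NonResonant (α j))
    (ho : ‖zpt θ j - o‖ < d / 32) {S : Set ℂ} (hSo : IsOpen S)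
    (hSc : IsPreconnected (ball (0 : ℂ) (d / 64) ∩ S)) (hS : ∀ w ∈ S, w.re ≠ 0)
    (hS' : ∀ w ∈ S, w.re < 0 ∨ w.im ≠ 0) :
    ∃ c, ∀ w ∈ ball (0 : ℂ) (d / 64) ∩ S, 𝓒 (ue (θ j) * exp w) =
      exp (2 * hatLog n α β θ j (ue (θ j) * exp w)) *
        (wLoc n α β θ o d j (ue (θ j) * exp w) + c) := by
  have hd := h.1
  have hd1 := h.2.1
  have hclose : ∀ w ∈ ball (0 : ℂ) (d / 64), ‖ue (θ j) * exp w - ue (θ j)‖ < d / 32 :=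
    fun w hw => by
    rw [mem_ball_zero_iff] at hw
    have := norm_ue_mul_exp_sub_le (θ j) (w := w) (by linarith)
    linarith
  have hslit : ∀ w ∈ ball (0 : ℂ) (d / 64) ∩ S, 1 - ue (θ j) * exp w * ue (-θ j) ∈ slitPlane := by
    rintro w ⟨hw, hwS⟩
    rw [mem_ball_zero_iff] at hw
    have e : ue (θ j) * exp w * ue (-θ j) = exp w := by
      rw [mul_right_comm, ← ue_add, add_neg_cancel, ue_zero, one_mul]
    rw [e]
    by_cases him : w.im = 0
    · have hre := (hS' w hwS).resolve_right (not_not.2 him)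
      refine one_sub_mem_slitPlane ?_ fun h1 => ?_
      · rw [norm_exp]; exact (Real.exp_lt_one_iff.2 hre).le
      · have := congrArg norm h1
        rw [norm_exp, norm_one, Real.exp_eq_one_iff] at this
        exact hre.ne this
    · refine one_sub_mem_slitPlane_of_im_ne ?_
      rw [exp_im]
      refine mul_ne_zero (Real.exp_pos _).ne' ?_
      rcases lt_or_gt_of_ne him with h1 | h1
      · exact (sin_im_neg (by linarith) h1).ne
      · exact (sin_im_pos (by linarith) h1).ne'
  refine exists_const_of_ode (E := fun w => ue (θ j) * exp w) (E' := fun w => ue (θ j) * exp w)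
    (r := logDerivW n α β θ) (R := residSum n α β θ) (isOpen_ball.inter hSo) hSc
    (fun w _ => hasDerivAt_ue_mul_exp _ w) (fun w hw => ?_) (fun w hw => ?_) (fun w hw => ?_)
  · refine hasDerivAt_cauchyT_ode hα h.injective ?_ (mul_ne_zero (ue_ne_zero _) (exp_ne_zero w))
    rw [norm_ue_mul_exp]
    exact fun h => hS w hw.2 ((Real.exp_eq_one_iff _).1 h)
  · refine h.hasDerivAt_hatLog ?_ (hslit w hw)
    have := hclose w hw.1
    rw [zpt_eq]
    linarith
  · refine h.hasDerivAt_wLoc ha ho ?_ (hslit w hw)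
    have h1 := hclose w hw.1
    have h2 := norm_sub_le_norm_sub_add_norm_sub (ue (θ j) * exp w) (ue (θ j)) o
    rw [zpt_eq] at ho
    linarith

lemma ue_mul_exp_mul_ue_neg (t : ℝ) (w : ℂ) : ue t * exp w * ue (-t) = exp w := by
  rw [mul_right_comm, ← ue_add, add_neg_cancel, ue_zero, one_mul]

lemma ofReal_exp_mul_ue_add (a s r : ℝ) :
    (Real.exp r : ℂ) * ue (a + s) = ue a * exp ((r : ℂ) + s * I) := by
  rw [exp_add, ue_add, ofReal_exp, ue, ue]; ring

lemma convex_lt_re (S : Set ℂ) (hS : Convex ℝ S) (r : ℝ) :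
    IsPreconnected (ball (0 : ℂ) r ∩ S) :=
  ((convex_ball 0 r).inter hS).isPreconnected

lemma Sep.continuousAt_ue {d : ℝ} (h : Sep θ d) {o : ℂ} {j : ι}
    (ha : NonResonant (α j)) (ho : ‖zpt θ j - o‖ < d / 32) {s : ℝ}
    (hs0 : s ≠ 0) (hs : |s| < d / 64) :
    ContinuousAt (hatLog n α β θ j) (ue (θ j + s)) ∧
      ContinuousAt (wLoc n α β θ o d j) (ue (θ j + s)) := by
  have hd := h.1
  have hd1 := h.2.1
  have h1 := norm_ue_sub_ue_le (θ j + s) (θ j)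
  rw [add_sub_cancel_left, ← zpt_eq] at h1
  have h2 := norm_sub_le_norm_sub_add_norm_sub (ue (θ j + s)) (zpt θ j) o
  have h3 : 1 - ue (θ j + s) * ue (-θ j) ∈ slitPlane := by
    rw [← ue_add, add_neg_cancel_comm]
    refine one_sub_mem_slitPlane_of_im_ne ?_
    rw [ue, exp_ofReal_mul_I_im]
    rcases lt_or_gt_of_ne hs0 with h4 | h4
    · refine (Real.sin_neg_of_neg_of_neg_pi_lt h4 ?_).ne
      linarith [neg_le_of_abs_le hs.le, Real.two_le_pi]
    · refine (Real.sin_pos_of_pos_of_lt_pi h4 ?_).ne'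
      linarith [le_of_abs_le hs.le, Real.two_le_pi]
  exact ⟨(h.hasDerivAt_hatLog (by linarith) h3).continuousAt,
    (h.hasDerivAt_wLoc ha ho (by linarith) h3).continuousAt⟩

lemma Sep.const_sub_arc {d : ℝ} (h : Sep θ d) (hα : Admissible α) {o : ℂ}
    {j : ι} (ha : NonResonant (α j))
    (ho : ‖zpt θ j - o‖ < d / 32) {s : ℝ} (hs0 : s ≠ 0) (hs : |s| < d / 64)
    {S₁ S₂ : Set ℂ} {c₁ c₂ c : ℂ}
    (h₁ : ∀ w ∈ ball (0 : ℂ) (d / 64) ∩ S₁, cauchyT n α β θ (ue (θ j) * exp w) =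
      exp (2 * hatLog n α β θ j (ue (θ j) * exp w)) * (wLoc n α β θ o d j (ue (θ j) * exp w) + c₁))
    (h₂ : ∀ w ∈ ball (0 : ℂ) (d / 64) ∩ S₂, cauchyT n α β θ (ue (θ j) * exp w) =
      exp (2 * hatLog n α β θ j (ue (θ j) * exp w)) * (wLoc n α β θ o d j (ue (θ j) * exp w) + c₂))
    (hS₁ : ∀ r : ℝ, 0 < r → ((-r : ℝ) : ℂ) + s * I ∈ S₁) (hS₂ : ∀ r : ℝ, 0 < r → (r : ℂ) + s * I ∈ S₂)
    (hw : (∀ i, ue (θ j + s) ≠ zpt θ i) ∧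
      weight n α β θ (θ j + s) = c * exp (2 * hatLog n α β θ j (ue (θ j + s)))) : c₁ - c₂ = c := by
  obtain ⟨c1, c2⟩ := h.continuousAt_ue (n := n) (β := β) ha ho hs0 hs
  have hev : ∀ u : ℝ → ℝ, Continuous u → u 0 = 0 →
      ∀ᶠ r in 𝓝[>] (0 : ℝ), ((u r : ℝ) : ℂ) + s * I ∈ ball (0 : ℂ) (d / 64) := fun u hu h0 => by
    have : Continuous fun r : ℝ => ((u r : ℝ) : ℂ) + s * I := by fun_prop
    refine (this.tendsto 0).mono_left nhdsWithin_le_nhds (isOpen_ball.mem_nhds ?_)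
    rw [h0, mem_ball_zero_iff]
    simpa using hs
  refine const_sub_eq_of_jump hα h.injective hw.1 c1 c2 ?_ ?_ hw.2
  · filter_upwards [hev _ continuous_neg neg_zero, self_mem_nhdsWithin] with r hr hr0
    rw [ofReal_exp_mul_ue_add]
    exact h₁ _ ⟨hr, hS₁ r hr0⟩
  · filter_upwards [hev _ continuous_id rfl, self_mem_nhdsWithin] with r hr hr0
    rw [ofReal_exp_mul_ue_add]
    exact h₂ _ ⟨hr, hS₂ r hr0⟩

/-- The logarithm of `z - z_j` cut along the opposite ray. -/
def rayLog (θ : ι → ℝ) (j : ι) (z : ℂ) : ℂ := log ((z - zpt θ j) * ue (-θ j)) + θ j * I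

lemma ray_im (j : ι) (z : ℂ) :
    ((z - zpt θ j) * ue (-θ j)).im = (z * ue (-θ j)).im := by
  have : (z - zpt θ j) * ue (-θ j) = z * ue (-θ j) - 1 := by
    have := neg_sub_mul_ue (θ := θ) j z
    linear_combination -this
  rw [this, sub_im, one_im, sub_zero]

lemma logFrom_sub_of_left {j : ι} {z : ℂ} (h : z ∈ leftOf (θ j)) :
    logFrom (θ j) (z - zpt θ j) = rayLog θ j z := by
  rw [mem_leftOf, ← ray_im] at h
  refine logFrom_of_nonneg (fun h0 => ?_) h.le
  simp [h0] at h

lemma logFrom_sub_of_right {j : ι} {z : ℂ} (h : z ∈ rightOf (θ j)) :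
    logFrom (θ j) (z - zpt θ j) = rayLog θ j z + 2 * π * I := by
  rw [mem_rightOf, ← ray_im] at h
  refine logFrom_of_neg (fun h0 => ?_) h
  simp [h0] at h

lemma tendsto_ray (t x : ℝ) (σ : ℝ) :
    Tendsto (fun s : ℝ => ue t * exp ((x : ℂ) + (σ * s : ℝ) * I)) (𝓝[>] 0)
      (𝓝 (ue t * exp (x : ℂ))) := by
  have : Continuous fun s : ℝ => ue t * exp ((x : ℂ) + (σ * s : ℝ) * I) := by fun_prop
  have h := this.tendsto 0
  simp only [mul_zero, ofReal_zero, zero_mul, add_zero] at h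
  exact h.mono_left nhdsWithin_le_nhds

lemma Sep.ray_eq {d : ℝ} (h : Sep θ d) (hα : Admissible α) {o : ℂ}
    {j : ι} (ha : NonResonant (α j))
    (ho : ‖zpt θ j - o‖ < d / 32) {x : ℝ} (hx0 : 0 < x) (hx : x < d / 64) {σ : ℝ}
    {S : Set ℂ} {c q : ℂ}
    (h₁ : ∀ w ∈ ball (0 : ℂ) (d / 64) ∩ S, cauchyT n α β θ (ue (θ j) * exp w) =
      exp (2 * hatLog n α β θ j (ue (θ j) * exp w)) * (wLoc n α β θ o d j (ue (θ j) * exp w) + c))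
    (hS : ∀ s : ℝ, 0 < s → (x : ℂ) + (σ * s : ℝ) * I ∈ S)
    (hq : ∀ w ∈ ball (0 : ℂ) (d / 64) ∩ S,
      logFrom (θ j) (ue (θ j) * exp w - zpt θ j) = rayLog θ j (ue (θ j) * exp w) + q) :
    cauchyT n α β θ (ue (θ j) * exp x) =
      exp (2 * eLog n α β θ j (ue (θ j) * exp x)) * (kLoc n α β θ o d j (ue (θ j) * exp x) +
        ((if α j = 0 then
            residLoc n α β θ j (zpt θ j) * (rayLog θ j (ue (θ j) * exp x) + q) else 0) + c) *
          exp (2 * (α j * (rayLog θ j (ue (θ j) * exp x) + q)))) := by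
  have hd := h.1
  have hd1 := h.2.1
  have hclose : ‖ue (θ j) * exp (x : ℂ) - zpt θ j‖ < d / 32 := by
    have := norm_ue_mul_exp_sub_le (θ j) (w := (x : ℂ)) (by simp [abs_of_pos hx0]; linarith)
    rw [norm_real, norm_of_nonneg hx0.le] at this
    rw [zpt_eq]
    linarith
  have hnorm : ‖ue (θ j) * exp (x : ℂ)‖ ≠ 1 := by
    rw [norm_ue_mul_exp, ofReal_re]
    exact (Real.one_lt_exp_iff.2 hx0).ne'
  have hG := (hasDerivAt_cauchyT (n := n) (β := β) hα h.injective hnorm).continuousAt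
  have hE := (h.hasDerivAt_eLog (n := n) (α := α) (β := β) (j := j)
    (z := ue (θ j) * exp (x : ℂ)) (by linarith)).continuousAt
  have hk : ContinuousAt (kLoc n α β θ o d j) (ue (θ j) * exp (x : ℂ)) := by
    obtain ⟨k', hk, -⟩ := h.hasDerivAt_kLoc (n := n) (β := β) ha ho
      (z := ue (θ j) * exp (x : ℂ)) (by
        have := norm_sub_le_norm_sub_add_norm_sub (ue (θ j) * exp (x : ℂ)) (zpt θ j) o
        linarith)
    exact hk.continuousAt
  have hl : ContinuousAt (rayLog θ j) (ue (θ j) * exp (x : ℂ)) := by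
    refine ContinuousAt.add (ContinuousAt.clog (by fun_prop) ?_) continuousAt_const
    have : (ue (θ j) * exp (x : ℂ) - zpt θ j) * ue (-θ j) = ((Real.exp x - 1 : ℝ) : ℂ) := by
      have := neg_sub_mul_ue (θ := θ) j (ue (θ j) * exp (x : ℂ))
      rw [ue_mul_exp_mul_ue_neg] at this
      push_cast
      linear_combination -this
    rw [this, ofReal_mem_slitPlane]
    linarith [Real.one_lt_exp_iff.2 hx0]
  have ht := tendsto_ray (θ j) x σ
  refine tendsto_nhds_unique (hG.tendsto.comp ht) (Tendsto.congr' ?_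
    (ContinuousAt.tendsto (f := fun z => exp (2 * eLog n α β θ j z) * (kLoc n α β θ o d j z +
        ((if α j = 0 then residLoc n α β θ j (zpt θ j) * (rayLog θ j z + q) else 0) + c) *
          exp (2 * (α j * (rayLog θ j z + q))))) ?_ |>.comp ht))
  · have hb : ∀ᶠ s in 𝓝[>] (0 : ℝ), (x : ℂ) + (σ * s : ℝ) * I ∈ ball (0 : ℂ) (d / 64) := by
      have : Continuous fun s : ℝ => (x : ℂ) + (σ * s : ℝ) * I := by fun_prop
      refine (this.tendsto 0).mono_left nhdsWithin_le_nhds (isOpen_ball.mem_nhds ?_)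
      rw [mem_ball_zero_iff]
      simpa [abs_of_pos hx0] using hx
    filter_upwards [hb, self_mem_nhdsWithin] with s hs hs0
    have hm : (x : ℂ) + (σ * s : ℝ) * I ∈ ball (0 : ℂ) (d / 64) ∩ S := ⟨hs, hS s hs0⟩
    simp only [Function.comp]
    rw [h₁ _ hm, wLoc, hatLog, hq _ hm, mul_add 2,
      Complex.exp_add (2 * eLog _ _ _ _ _ _), mul_assoc (exp (2 * eLog _ _ _ _ _ _))]
    congr 1
    have e1 : ∀ y, exp (2 * (α j * y)) * exp (-(2 * α j * y)) = 1 := fun y => by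
      rw [← exp_add, ← exp_zero]; congr 1; ring
    have := e1 (rayLog θ j (ue (θ j) * exp ((x : ℂ) + (σ * s : ℝ) * I)) + q)
    linear_combination (-kLoc n α β θ o d j (ue (θ j) * exp ((x : ℂ) + (σ * s : ℝ) * I))) * this
  · have hif : ContinuousAt (fun z => if α j = 0 then
        residLoc n α β θ j (zpt θ j) * (rayLog θ j z + q) else 0) (ue (θ j) * exp (x : ℂ)) := by
      split_ifs
      · exact continuousAt_const.mul (hl.add continuousAt_const)
      · exact continuousAt_const
    exact (continuousAt_const.mul hE).cexp.mul (hk.add ((hif.add continuousAt_const).mul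
      (continuousAt_const.mul (continuousAt_const.mul (hl.add continuousAt_const))).cexp))

/-- The Cauchy transform near `z_j`. -/
theorem Sep.exists_locConst {d : ℝ} (h : Sep θ d) (hθ : IsConfiguration θ)
    (hα : Admissible α) {o : ℂ} {j : ι}
    (ha : NonResonant (α j)) (ho : ‖zpt θ j - o‖ < d / 32) :
    ∃ c, (α j ≠ 0 → c = 0) ∧ (α j = 0 → residLoc n α β θ j (zpt θ j) = dConst α β j / (2 * π * I)) ∧
      ∀ z ∈ ball (zpt θ j) (d / 128), ‖z‖ ≠ 1 → z ∉ openRay θ j → cauchyT n α β θ z =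
        exp (2 * hatLog n α β θ j z) * (wLoc n α β θ o d j z + c + cConst α β θ j z) := by
  have hd := h.1
  have hd1 := h.2.1
  have hpi := Real.two_le_pi
  obtain ⟨cI, hI⟩ := exists_const_regions (n := n) (β := β) h hα ha ho isOpen_re_neg
    (isPreconnected_ball_inter_re_neg (d / 64)) (fun w hw => ne_of_lt hw) (fun w hw => Or.inl hw)
  obtain ⟨cL, hL⟩ := exists_const_regions (n := n) (β := β) h hα ha ho
    (isOpen_re_pos.inter isOpen_im_pos) (convex_lt_re _ ((convex_halfSpace_re_gt 0).inter
      (convex_halfSpace_im_gt 0)) (d / 64)) (fun w hw => ne_of_gt hw.1) (fun w hw => Or.inr (ne_of_gt hw.2))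
  obtain ⟨cR, hR⟩ := exists_const_regions (n := n) (β := β) h hα ha ho
    (isOpen_re_pos.inter isOpen_im_neg) (convex_lt_re _ ((convex_halfSpace_re_gt 0).inter
      (convex_halfSpace_im_lt 0)) (d / 64)) (fun w hw => ne_of_gt hw.1) (fun w hw => Or.inr (ne_of_lt hw.2))
  have hIL : cI - cL = sConst α β j := by
    refine h.const_sub_arc hα ha ho (s := d / 128) (by positivity)
      (by rw [abs_of_pos (by positivity)]; linarith) hI hL (fun r hr => ?_) (fun r hr => ?_)
      (weight_eq_left h hθ (by linarith) (by linarith))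
    · simpa using hr
    · exact ⟨by simpa using hr, by simpa using hd⟩
  have hIR : cI - cR = sConst α β j * exp (2 * π * I * (β j - α j)) := by
    refine h.const_sub_arc hα ha ho (s := -(d / 128)) (by linarith)
      (by rw [abs_of_neg (by linarith)]; linarith) hI hR (fun r hr => ?_) (fun r hr => ?_)
      (weight_eq_right h hθ (by linarith) (by linarith))
    · simpa using hr
    · exact ⟨by simpa using hr, by simpa using hd⟩
  have hmemL : ∀ w ∈ ball (0 : ℂ) (d / 64) ∩ ({w | 0 < w.re} ∩ {w | 0 < w.im}),
      ue (θ j) * exp w ∈ leftOf (θ j) := by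
    rintro w ⟨hw, -, hw'⟩
    rw [mem_leftOf, ue_mul_exp_mul_ue_neg, exp_im]
    exact mul_pos (Real.exp_pos _) (sin_im_pos (by rw [mem_ball_zero_iff] at hw; linarith) hw')
  have hmemR : ∀ w ∈ ball (0 : ℂ) (d / 64) ∩ ({w | 0 < w.re} ∩ {w | w.im < 0}),
      ue (θ j) * exp w ∈ rightOf (θ j) := by
    rintro w ⟨hw, -, hw'⟩
    rw [mem_rightOf, ue_mul_exp_mul_ue_neg, exp_im]
    exact mul_neg_of_pos_of_neg (Real.exp_pos _)
      (sin_im_neg (by rw [mem_ball_zero_iff] at hw; linarith) hw')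
  have hx0 : 0 < d / 128 := by positivity
  have rL := h.ray_eq hα ha ho hx0 (by linarith) (σ := 1) (q := 0) hL
    (fun s hs => ⟨by simpa using hd, by simpa using hs⟩)
    (fun w hw => by rw [logFrom_sub_of_left (hmemL w hw), add_zero])
  have rR := h.ray_eq hα ha ho hx0 (by linarith) (σ := -1) (q := 2 * π * I) hR
    (fun s hs => ⟨by simpa using hd, by simpa using hs⟩)
    (fun w hw => logFrom_sub_of_right (hmemR w hw))
  rw [rL] at rR
  replace rR := mul_left_cancel₀ (exp_ne_zero _) rR
  replace rR := add_left_cancel rR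
  generalize rayLog θ j (ue (θ j) * exp ((d / 128 : ℝ) : ℂ)) = l at rR
  have key : ∃ c, (α j ≠ 0 → c = 0) ∧
      (α j = 0 → residLoc n α β θ j (zpt θ j) = dConst α β j / (2 * π * I)) ∧
      (∀ z, ‖z‖ < 1 → c + cConst α β θ j z = cI) ∧
      (∀ z, 1 < ‖z‖ → z ∈ leftOf (θ j) → c + cConst α β θ j z = cL) ∧
      (∀ z, 1 < ‖z‖ → z ∉ leftOf (θ j) → c + cConst α β θ j z = cR) := by
    have h2pi : (2 * π * I : ℂ) ≠ 0 := two_pi_I_ne_zero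
    by_cases h0 : α j = 0
    · simp only [h0, if_true, zero_mul, mul_zero, exp_zero, mul_one, add_zero] at rR
      rw [h0, sub_zero] at hIR
      refine ⟨cR, fun h1 => absurd h0 h1, fun _ => ?_, fun z hz => ?_, fun z hz hz' => ?_,
        fun z hz hz' => ?_⟩
      · rw [eq_div_iff h2pi, dConst]
        linear_combination -rR + hIR - hIL
      · rw [cConst, if_neg (not_not.2 h0), if_pos hz]
        linear_combination -hIR
      · rw [cConst, if_neg (not_not.2 h0), if_neg hz.le.not_gt, if_pos hz', dConst]
        linear_combination hIL - hIR
      · rw [cConst, if_neg (not_not.2 h0), if_neg hz.le.not_gt, if_neg hz', add_zero]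
    · have hE := ha.resolve_left h0
      have hE' : 1 - exp (4 * π * I * α j) ≠ 0 := _root_.sub_ne_zero.2 (Ne.symm hE)
      simp only [h0, if_false, zero_add, add_zero] at rR
      have e1 : exp (2 * (α j * (l + 2 * π * I))) =
          exp (2 * (α j * l)) * exp (4 * π * I * α j) := by
        rw [← exp_add]; congr 1; ring
      have e2 : exp (2 * π * I * (β j + α j)) =
          exp (2 * π * I * (β j - α j)) * exp (4 * π * I * α j) := by
        rw [← exp_add]; congr 1; ring
      rw [e1] at rR
      have rR' : cL = cR * exp (4 * π * I * α j) := by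
        refine mul_right_cancel₀ (exp_ne_zero (2 * (α j * l))) ?_
        linear_combination rR
      generalize hEd : exp (4 * π * I * α j) = E at *
      generalize hbd : exp (2 * π * I * (β j - α j)) = b at *
      have hc : cR * (1 - E) = sConst α β j * (1 - b) := by linear_combination -hIR + hIL + rR'
      have hc' : cR = sConst α β j * ((1 - b) / (1 - E)) := by
        rw [← mul_div_assoc, eq_div_iff hE', hc]
      refine ⟨0, fun _ => rfl, fun h1 => absurd h1 h0, fun z hz => ?_, fun z hz hz' => ?_,
        fun z hz hz' => ?_⟩
      · rw [cConst, if_pos h0, if_pos hz, e2, hEd]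
        field_simp
        linear_combination (-1 + E) * hIR - hc
      · rw [cConst, if_pos h0, if_neg hz.le.not_gt, if_pos hz', rR', hc', hEd, hbd]
        field_simp
        ring
      · rw [cConst, if_pos h0, if_neg hz.le.not_gt, if_neg hz', hc', zero_add, hEd, hbd]
  obtain ⟨c, hc1, hc2, k1, k2, k3⟩ := key
  refine ⟨c, hc1, hc2, fun z hz hz1 hzr => ?_⟩
  rw [mem_ball_iff_norm, zpt_eq] at hz
  obtain ⟨e1, e2⟩ := eq_ue_mul_exp_log (t := θ j) (z := z) (by linarith)
  generalize log (z / ue (θ j)) = w at e1 e2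
  have hw : w ∈ ball (0 : ℂ) (d / 64) := by rw [mem_ball_zero_iff]; linarith
  rw [add_assoc]
  have hnz : ‖z‖ = Real.exp w.re := by rw [e1, norm_ue_mul_exp]
  rcases lt_or_gt_of_ne hz1 with h1 | h1
  · rw [k1 z h1, e1]
    refine hI w ⟨hw, ?_⟩
    rwa [hnz, Real.exp_lt_one_iff] at h1
  · have hre : 0 < w.re := by rwa [hnz, Real.one_lt_exp_iff] at h1
    rcases lt_trichotomy w.im 0 with him | him | him
    · have hm := hmemR w ⟨hw, hre, him⟩
      rw [k3 z h1, e1]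
      · exact hR w ⟨hw, hre, him⟩
      · rw [e1]
        intro h3
        rw [mem_leftOf] at h3
        rw [mem_rightOf] at hm
        exact lt_asymm h3 hm
    · refine absurd ⟨Real.exp w.re, Real.one_lt_exp_iff.2 hre, ?_⟩ hzr
      rw [e1, zpt_eq, ofReal_exp, mul_comm]
      congr 2
      exact Complex.ext rfl (by simp [him])
    · have hm := hmemL w ⟨hw, hre, him⟩
      rw [k2 z h1 (by rw [e1]; exact hm), e1]
      exact hL w ⟨hw, hre, him⟩

/-! ### Elementary matrices -/

lemma upper_mul_upper (a b : ℂ) : upper a * upper b = upper (a + b) := by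
  ext i j; fin_cases i <;> fin_cases j <;> simp [upper, mul_apply, add_comm]

lemma expSigma3_mul (a b : ℂ) : expSigma3 a * expSigma3 b = expSigma3 (a + b) := by
  ext i j; fin_cases i <;> fin_cases j <;> simp [expSigma3, mul_apply, ← exp_add, add_comm]

lemma expSigma3_mul_upper (a b : ℂ) :
    expSigma3 a * upper b = upper (exp (2 * a) * b) * expSigma3 a := by
  ext i j; fin_cases i <;> fin_cases j <;>
    simp [expSigma3, upper, mul_apply]
  rw [mul_right_comm, ← exp_add]
  ring_nf

lemma expSigma3_zero : expSigma3 0 = 1 := by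
  ext i j; fin_cases i <;> fin_cases j <;> simp [expSigma3]

lemma det_upper (a : ℂ) : (upper a).det = 1 := by simp [upper, det_fin_two]

lemma det_expSigma3 (a : ℂ) : (expSigma3 a).det = 1 := by simp [expSigma3, det_fin_two, ← exp_add]

/-! ### The local factorization of `U(G) h ^ σ₃` -/

open Classical in
lemma Sep.logFrom_eq_add {d : ℝ} (h : Sep θ d) (hθ : IsConfiguration θ) {j : ι} {z : ℂ}
    (hz : ‖z - zpt θ j‖ < d / 2) : logFrom (θ 0) z = log (z * ue (-θ j)) + θ j * I +
      if j = 0 ∧ z ∈ rightOf (θ 0) then 2 * π * I else 0 := by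
  have hd1 := h.2.1
  have hz0 : z ≠ 0 := h.ne_zero hz
  by_cases hj : j = 0
  · subst hj
    by_cases hr : z ∈ rightOf (θ 0)
    · rw [if_pos ⟨rfl, hr⟩, logFrom_of_neg hz0 (mem_rightOf.1 hr)]
    · rw [if_neg (fun h1 => hr h1.2), add_zero, logFrom_of_nonneg hz0]
      rw [mem_rightOf, not_lt] at hr
      exact hr
  · rw [if_neg (fun h1 => hj h1.1), add_zero]
    obtain ⟨k, hk⟩ := arg_mul_ue z hz0 (-θ j)
    obtain ⟨l1, l2⟩ := h.le_sub hθ (Fin.pos_of_ne_zero hj)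
    have h1 : ‖z * ue (-θ j) - 1‖ < d / 2 := by
      have := neg_sub_mul_ue (θ := θ) j z
      rw [show z * ue (-θ j) - 1 = (z - zpt θ j) * ue (-θ j) by linear_combination this,
        norm_mul, norm_ue, mul_one]
      exact hz
    have h2 := norm_log_one_add_half_le_self (z := z * ue (-θ j) - 1) (by linarith)
    rw [add_sub_cancel] at h2
    have h3 := abs_le.1 ((abs_im_le_norm _).trans h2)
    rw [log_im] at h3
    rw [logFrom, log_mul_ue, argFrom_eq (x := arg (z * ue (-θ j)) + θ j) (k := -k)
      ⟨by linarith, by linarith⟩ (by push_cast; linarith)]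
    push_cast; ring

open Classical in
lemma Sep.hLog_eq_hatLog {d : ℝ} (h : Sep θ d) (hθ : IsConfiguration θ) {j : ι} {z : ℂ}
    (hz : ‖z - zpt θ j‖ < d / 2) : hLog n α β θ z = hatLog n α β θ j z +
      if j = 0 ∧ z ∈ rightOf (θ 0) then 2 * π * I * lam n α β else 0 := by
  rw [hLog, hatLog, eLog, h.logFrom_eq_add hθ hz, ← add_sum_erase _ _ (mem_univ j),
    sum_congr rfl fun i hi => by rw [logFrom_sub_eq (h.one_sub_mem (ne_of_mem_erase hi) hz)]]
  split_ifs <;> ring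

open Classical in
/-- The additive constant of the regular part of the Cauchy transform at `z_j`. -/
def locConst (n : ℕ) (α β : ι → ℂ) (θ : ι → ℝ) (o : ℂ) (d : ℝ)
    (j : ι) : ℂ :=
  if h : ∃ c, (α j ≠ 0 → c = 0) ∧
      (α j = 0 → residLoc n α β θ j (zpt θ j) = dConst α β j / (2 * π * I)) ∧
      ∀ z ∈ ball (zpt θ j) (d / 128), ‖z‖ ≠ 1 → z ∉ openRay θ j → cauchyT n α β θ z =
        exp (2 * hatLog n α β θ j z) * (wLoc n α β θ o d j z + c + cConst α β θ j z)
  then h.choose else 0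

/-- The regular part of the Cauchy transform at `z_j`. -/
def gLoc (n : ℕ) (α β : ι → ℂ) (θ : ι → ℝ) (o : ℂ) (d : ℝ)
    (j : ι) (z : ℂ) : ℂ :=
  exp (2 * eLog n α β θ j z) * (kLoc n α β θ o d j z + locConst n α β θ o d j)

section

variable {d : ℝ} (h : Sep θ d) (hθ : IsConfiguration θ)
    (hα : Admissible α) {o : ℂ} {j : Fin (m + 1)}
    (ha : NonResonant (α j)) (ho : ‖zpt θ j - o‖ < d / 32)
include h hθ hα ha ho

lemma Sep.locConst_spec : (α j ≠ 0 → locConst n α β θ o d j = 0) ∧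
      (α j = 0 → residLoc n α β θ j (zpt θ j) = dConst α β j / (2 * π * I)) ∧
      ∀ z ∈ ball (zpt θ j) (d / 128), ‖z‖ ≠ 1 → z ∉ openRay θ j → cauchyT n α β θ z =
        exp (2 * hatLog n α β θ j z) *
          (wLoc n α β θ o d j z + locConst n α β θ o d j + cConst α β θ j z) := by
  have h1 := h.exists_locConst (n := n) (β := β) hθ hα ha ho
  rw [locConst, dif_pos h1]
  exact h1.choose_spec

lemma Sep.cauchyT_eq_gLoc {z : ℂ} (hz : z ∈ ball (zpt θ j) (d / 128)) (hz1 : ‖z‖ ≠ 1)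
    (hzr : z ∉ openRay θ j) : cauchyT n α β θ z = gLoc n α β θ o d j z +
      exp (2 * eLog n α β θ j z) * (if α j = 0 then
        dConst α β j / (2 * π * I) * logFrom (θ j) (z - zpt θ j) + cConst α β θ j z
        else exp (2 * (α j * logFrom (θ j) (z - zpt θ j))) * cConst α β θ j z) := by
  obtain ⟨h1, h2, h3⟩ := h.locConst_spec (n := n) (β := β) hθ hα ha ho
  rw [h3 z hz hz1 hzr, gLoc, hatLog, wLoc, mul_add 2, exp_add]
  by_cases h0 : α j = 0
  · rw [if_pos h0, if_pos h0, h2 h0, h0]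
    simp only [mul_zero, zero_mul, exp_zero, neg_zero, mul_one]
    ring
  · rw [if_neg h0, if_neg h0, h1 h0]
    have : exp (2 * (α j * logFrom (θ j) (z - zpt θ j))) *
        exp (-(2 * α j * logFrom (θ j) (z - zpt θ j))) = 1 := by
      rw [← exp_add, ← exp_zero]; congr 1; ring
    linear_combination exp (2 * eLog n α β θ j z) * kLoc n α β θ o d j z * this

lemma Sep.upper_cauchyT_eq {z : ℂ} (hz : z ∈ ball (zpt θ j) (d / 128)) (hz1 : ‖z‖ ≠ 1)
    (hzr : z ∉ openRay θ j) : upper (𝓒 z) * expSigma3 (hLog n α β θ z) =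
      upper (gLoc n α β θ o d j z) * expSigma3 (eLog n α β θ j z) * singFactor α β θ j z *
        connection n α β θ j z := by
  classical
  have hd := h.1
  rw [h.cauchyT_eq_gLoc hθ hα ha ho hz hz1 hzr, h.hLog_eq_hatLog hθ (j := j) (by
    rw [mem_ball_iff_norm] at hz; linarith), connection, singFactor]
  have e : (if j = 0 ∧ z ∈ rightOf (θ 0) then expSigma3 (2 * π * I * lam n α β) else 1) =
      expSigma3 (if j = 0 ∧ z ∈ rightOf (θ 0) then 2 * π * I * lam n α β else 0) := by
    split_ifs
    · rfl
    · rw [expSigma3_zero]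
  rw [e]
  generalize (if j = 0 ∧ z ∈ rightOf (θ 0) then 2 * π * I * lam n α β else 0) = q
  by_cases h0 : α j = 0
  · rw [if_pos h0, if_neg (not_not.2 h0), hatLog, h0, zero_mul, add_zero]
    rw [mul_assoc (upper _ * expSigma3 _), ← mul_assoc (upper _) (upper _), upper_mul_upper,
      mul_assoc (upper _), ← mul_assoc (expSigma3 _) (upper _), expSigma3_mul_upper, mul_assoc (upper _),
      expSigma3_mul, ← mul_assoc, upper_mul_upper]
  · rw [if_neg h0, if_pos h0, hatLog]
    rw [mul_assoc (upper _) (expSigma3 _) (expSigma3 _), expSigma3_mul,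
      mul_assoc (upper (gLoc _ _ _ _ _ _ _ _)), ← mul_assoc (expSigma3 _) (upper _),
      expSigma3_mul_upper, mul_assoc (upper _), expSigma3_mul, ← mul_assoc (upper _) (upper _),
      upper_mul_upper, mul_add 2 (eLog _ _ _ _ _ _), Complex.exp_add (2 * eLog _ _ _ _ _ _), mul_assoc (exp _)]

omit hθ hα in
lemma Sep.differentiableAt_gLoc {z : ℂ} (hz : ‖z - zpt θ j‖ < d / 32) :
    DifferentiableAt ℂ (gLoc n α β θ o d j) z := by
  have hd := h.1
  obtain ⟨k', hk, -⟩ := h.hasDerivAt_kLoc (n := n) (β := β) ha ho (z := z) (by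
    have := norm_sub_le_norm_sub_add_norm_sub z (zpt θ j) o
    linarith)
  have hE := (h.hasDerivAt_eLog (n := n) (α := α) (β := β) (j := j) (z := z) (by linarith))
  exact ((hE.const_mul 2).cexp.mul (hk.add_const _)).differentiableAt

lemma Sep.gLoc_zpt (h0 : α j ≠ 0) :
    -(2 * α j * gLoc n α β θ o d j (zpt θ j)) = resid n α β θ j := by
  have hd := h.1
  obtain ⟨h1, -, -⟩ := h.locConst_spec (n := n) (β := β) hθ hα ha ho
  obtain ⟨k', hk, hke⟩ := h.hasDerivAt_kLoc (n := n) (β := β) ha ho (z := zpt θ j) (by linarith)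
  rw [sub_self, zero_mul, if_neg h0, residLoc_self] at hke
  have : exp (2 * eLog n α β θ j (zpt θ j)) * exp (-(2 * eLog n α β θ j (zpt θ j))) = 1 := by
    rw [← exp_add, add_neg_cancel, exp_zero]
  rw [gLoc, h1 h0]
  linear_combination exp (2 * eLog n α β θ j (zpt θ j)) * hke + resid n α β θ j * this

lemma Sep.resid_eq_of_eq_zero (h0 : α j = 0) :
    dConst α β j / (2 * π * I) * exp (2 * eLog n α β θ j (zpt θ j)) = resid n α β θ j := by
  obtain ⟨-, h1, -⟩ := h.locConst_spec (n := n) (β := β) hθ hα ha ho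
  have : exp (2 * eLog n α β θ j (zpt θ j)) * exp (-(2 * eLog n α β θ j (zpt θ j))) = 1 := by
    rw [← exp_add, add_neg_cancel, exp_zero]
  rw [← h1 h0, residLoc_self]
  linear_combination resid n α β θ j * this

end

open Polynomial

/-! ### Biorthogonal polynomials of a linear functional -/

section Algebra

/-- The difference quotient `(p - p(z)) / (X - z)`. -/
def dq (z : ℂ) (p : ℂ[X]) : ℂ[X] := p /ₘ (X - C z)

lemma dq_spec (z : ℂ) (p : ℂ[X]) : (X - C z) * dq z p + C (p.eval z) = p := by
  have := modByMonic_add_div p (X - C z)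
  rw [modByMonic_X_sub_C_eq_C_eval] at this
  rw [dq, add_comm, this]

lemma dq_unique {z c : ℂ} {p q : ℂ[X]} (h : (X - C z) * q + C c = p) : dq z p = q := by
  have h1 := dq_spec z p
  have hc : p.eval z = c := by rw [← h]; simp
  rw [hc] at h1
  have h2 : (X - C z) * (dq z p - q) = 0 := by linear_combination h1 - h
  exact sub_eq_zero.1 ((mul_eq_zero.1 h2).resolve_left (X_sub_C_ne_zero z))

lemma dq_add (z : ℂ) (p q : ℂ[X]) : dq z (p + q) = dq z p + dq z q :=
  dq_unique (c := p.eval z + q.eval z) (by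
    rw [C_add]; linear_combination dq_spec z p + dq_spec z q)

lemma dq_sub (z : ℂ) (p q : ℂ[X]) : dq z (p - q) = dq z p - dq z q :=
  dq_unique (c := p.eval z - q.eval z) (by
    rw [C_sub]; linear_combination dq_spec z p - dq_spec z q)

lemma dq_smul (z a : ℂ) (p : ℂ[X]) : dq z (a • p) = a • dq z p :=
  dq_unique (c := a * p.eval z) (by
    rw [C_mul, smul_eq_C_mul, smul_eq_C_mul]; linear_combination C a * dq_spec z p)

lemma dq_mul (z : ℂ) (p q : ℂ[X]) : dq z (p * q) = p * dq z q + C (q.eval z) * dq z p :=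
  dq_unique (c := p.eval z * q.eval z) (by
    rw [C_mul]; linear_combination p * dq_spec z q + C (q.eval z) * dq_spec z p)

lemma dq_X (z : ℂ) : dq z X = 1 := dq_unique (c := z) (by ring)

lemma dq_C (z c : ℂ) : dq z (C c) = 0 := dq_unique (c := c) (by ring)

lemma eval_dq_self (z : ℂ) (p : ℂ[X]) : (dq z p).eval z = p.derivative.eval z := by
  conv_rhs => rw [← dq_spec z p]
  simp

lemma degree_dq_lt {k : ℕ} (z : ℂ) {p : ℂ[X]} (h : p.degree < (k + 1 : ℕ)) :
    (dq z p).degree < k := by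
  by_cases h0 : dq z p = 0
  · rw [h0, degree_zero]; exact WithBot.bot_lt_coe k
  have h1 : (dq z p).natDegree = p.natDegree - 1 := by
    rw [dq, natDegree_divByMonic _ (monic_X_sub_C z), natDegree_X_sub_C]
  have h2 : p.natDegree ≠ 0 := fun h2 => h0 (by rw [eq_C_of_natDegree_eq_zero h2, dq_C])
  have hp : p ≠ 0 := fun hp => h2 (by rw [hp, natDegree_zero])
  rw [degree_eq_natDegree hp] at h
  have h3 : p.natDegree < k + 1 := by exact_mod_cast h
  rw [degree_eq_natDegree h0, h1]
  exact_mod_cast (by omega : p.natDegree - 1 < k)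

lemma coeff_dq_of_monic {k : ℕ} (z : ℂ) {p : ℂ[X]} (h : p.Monic) (hk : p.natDegree = k + 1) :
    (dq z p).degree < (k + 1 : ℕ) ∧ (dq z p).coeff k = 1 := by
  have h1 : (dq z p).degree < (k + 1 : ℕ) := degree_dq_lt z (by
    rw [degree_eq_natDegree h.ne_zero, hk]; exact_mod_cast Nat.lt_succ_self _)
  refine ⟨h1, ?_⟩
  have h2 := congrArg (fun q => coeff q (k + 1)) (dq_spec z p)
  simp only [sub_mul, coeff_add, coeff_sub, coeff_X_mul, coeff_C_mul, coeff_C_succ] at h2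
  rw [coeff_eq_zero_of_degree_lt h1, ← hk, h.coeff_natDegree] at h2
  linear_combination h2

variable {ℓ : ℂ[X] →ₗ[ℂ] ℂ} {P Q : ℂ[X]}

/-- `P` is the monic orthogonal polynomial of degree `n`, and `Q` the polynomial of degree less
than `n` that represents minus the leading coefficient. -/
structure IsOrthPair (ℓ : ℂ[X] →ₗ[ℂ] ℂ) (n : ℕ) (P Q : ℂ[X]) : Prop where
  monic : P.Monic
  natDegree : P.natDegree = n
  degree : Q.degree < n
  orth : ∀ q : ℂ[X], q.degree < n → ℓ (P * q) = 0
  coorth : ∀ q : ℂ[X], q.degree < n → ℓ (Q * q) = -q.coeff (n - 1)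

/-- The polynomial `z ↦ ℓ ((p - p(z)) / (X - z))`. -/
lemma exists_remPoly (ℓ : ℂ[X] →ₗ[ℂ] ℂ) (p : ℂ[X]) : ∃ r : ℂ[X], ∀ z, r.eval z = ℓ (dq z p) := by
  induction p using Polynomial.induction_on' with
  | add p q hp hq =>
    obtain ⟨r, hr⟩ := hp
    obtain ⟨s, hs⟩ := hq
    exact ⟨r + s, fun z => by rw [eval_add, hr, hs, dq_add, map_add]⟩
  | monomial k a =>
    suffices h : ∃ r : ℂ[X], ∀ z, r.eval z = ℓ (dq z (X ^ k)) by
      obtain ⟨r, hr⟩ := h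
      exact ⟨a • r, fun z => by
        rw [← C_mul_X_pow_eq_monomial, ← smul_eq_C_mul, dq_smul, map_smul, eval_smul, hr]⟩
    induction k with
    | zero => exact ⟨0, fun z => by rw [pow_zero, ← C_1, dq_C, map_zero, eval_zero]⟩
    | succ k ih =>
      obtain ⟨r, hr⟩ := ih
      refine ⟨C (ℓ (X ^ k)) + X * r, fun z => ?_⟩
      rw [pow_succ, dq_mul, dq_X, mul_one, eval_X, map_add, ← smul_eq_C_mul, map_smul]
      simp [hr]

/-- The polynomial `z ↦ ℓ ((p - p(z)) / (X - z))`. -/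
def remPoly (ℓ : ℂ[X] →ₗ[ℂ] ℂ) (p : ℂ[X]) : ℂ[X] := (exists_remPoly ℓ p).choose

lemma eval_remPoly (p : ℂ[X]) (z : ℂ) : (remPoly ℓ p).eval z = ℓ (dq z p) :=
  (exists_remPoly ℓ p).choose_spec z

/-- `a R_b - b R_a`. -/
lemma mul_rem_sub (a b : ℂ[X]) (z : ℂ) :
    a.eval z * ℓ (dq z b) - b.eval z * ℓ (dq z a) = ℓ (a * dq z b) - ℓ (b * dq z a) := by
  rw [← map_sub, ← smul_eq_mul, ← smul_eq_mul, ← map_smul, ← map_smul, ← map_sub]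
  congr 1
  rw [smul_eq_C_mul, smul_eq_C_mul]
  have h1 := dq_mul z a b
  have h2 := dq_mul z b a
  rw [mul_comm b a] at h2
  linear_combination h1 - h2

namespace IsOrthPair

lemma det_eq_one (h : IsOrthPair ℓ n P Q) (hn : 1 ≤ n) (z : ℂ) :
    P.eval z * ℓ (dq z Q) - Q.eval z * ℓ (dq z P) = 1 := by
  obtain ⟨k, rfl⟩ : ∃ k, n = k + 1 := ⟨n - 1, by omega⟩
  obtain ⟨h1, h2⟩ := coeff_dq_of_monic z h.monic h.natDegree
  rw [mul_rem_sub, h.orth _ ((degree_dq_lt z h.degree).trans (by exact_mod_cast Nat.lt_succ_self k)),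
    h.coorth _ h1, Nat.add_sub_cancel, h2]
  norm_num

/-- `R_{P v - Q u} = v R_P - u R_Q`. -/
lemma rem_wronskian (h : IsOrthPair ℓ n P Q) {u v : ℂ[X]} (hu : u.degree < n) (hv : v.degree < n)
    (z : ℂ) : ℓ (dq z (P * v - Q * u)) = v.eval z * ℓ (dq z P) - u.eval z * ℓ (dq z Q) := by
  obtain rfl | hn := Nat.eq_zero_or_pos n
  · have hu0 : u = 0 := by simpa using hu
    have hv0 : v = 0 := by simpa using hv
    simp [hu0, hv0, dq]
  obtain ⟨k, rfl⟩ : ∃ k, n = k + 1 := ⟨n - 1, by omega⟩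
  have hlt : ((k : ℕ) : WithBot ℕ) < ((k + 1 : ℕ) : WithBot ℕ) := by exact_mod_cast Nat.lt_succ_self k
  have h1 := degree_dq_lt z hu
  have h2 := degree_dq_lt z hv
  rw [dq_sub, dq_mul, dq_mul, map_sub, map_add, map_add, h.orth _ (h2.trans hlt),
    h.coorth _ (h1.trans hlt), Nat.add_sub_cancel, coeff_eq_zero_of_degree_lt h1,
    ← smul_eq_C_mul, ← smul_eq_C_mul, map_smul, map_smul]
  simp

/-- `ℓ ((P v - Q u)') = ℓ (P' v - Q' u)`. -/
lemma apply_derivative_wronskian (h : IsOrthPair ℓ n P Q) {u v : ℂ[X]} (hu : u.degree < n)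
    (hv : v.degree < n) :
    ℓ (derivative (P * v - Q * u)) = ℓ (v * derivative P) - ℓ (u * derivative Q) := by
  have hd : ∀ w : ℂ[X], w.degree < n → (derivative w).degree < n ∧ (derivative w).coeff (n - 1) = 0 := by
    intro w hw
    refine ⟨(degree_derivative_le).trans_lt hw, ?_⟩
    rw [coeff_derivative]
    obtain rfl | hn := Nat.eq_zero_or_pos n
    · have hw0 : w = 0 := by simpa using hw
      simp [hw0]
    · rw [Nat.sub_add_cancel hn, coeff_eq_zero_of_degree_lt hw, zero_mul]
  obtain ⟨u1, u2⟩ := hd u hu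
  obtain ⟨v1, v2⟩ := hd v hv
  rw [derivative_sub, derivative_mul, derivative_mul, map_sub, map_add, map_add, h.orth _ v1,
    h.coorth _ u1, u2, mul_comm v, mul_comm u]
  ring

end IsOrthPair

/-- The Toeplitz matrix of the functional. -/
def toepMatrix (ℓ : ℂ[X] →ₗ[ℂ] ℂ) (n : ℕ) : Matrix (Fin n) (Fin n) ℂ :=
  Matrix.of fun j k => ℓ (X ^ (n - 1 - (j : ℕ) + (k : ℕ)))

/-- The polynomial with given coefficients. -/
def vecPoly (v : Fin n → ℂ) : ℂ[X] := ∑ k, v k • X ^ (k : ℕ)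

lemma degree_vecPoly (v : Fin n → ℂ) : (vecPoly v).degree < n :=
  (degree_sum_le _ _).trans_lt ((Finset.sup_lt_iff (by exact_mod_cast WithBot.bot_lt_coe n)).2 fun k _ => by
    rw [smul_eq_C_mul]
    exact (degree_C_mul_X_pow_le _ _).trans_lt (by exact_mod_cast k.2))

lemma coeff_vecPoly (v : Fin n → ℂ) (k : Fin n) : (vecPoly v).coeff k = v k := by
  simp [vecPoly, finsetSum_coeff, coeff_X_pow, Fin.ext_iff.symm, sum_ite_eq]

lemma vecPoly_coeff {p : ℂ[X]} (hp : p.degree < n) : vecPoly (fun k : Fin n => p.coeff k) = p := by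
  ext i
  by_cases hi : i < n
  · exact coeff_vecPoly (n := n) (fun k => p.coeff k) ⟨i, hi⟩
  · have : ((n : ℕ) : WithBot ℕ) ≤ i := by exact_mod_cast not_lt.1 hi
    rw [coeff_eq_zero_of_degree_lt (hp.trans_le this),
      coeff_eq_zero_of_degree_lt ((degree_vecPoly _).trans_le this)]

lemma toepMatrix_mulVec (v : Fin n → ℂ) (j : Fin n) :
    (toepMatrix ℓ n).mulVec v j = ℓ (vecPoly v * X ^ (n - 1 - (j : ℕ))) := by
  rw [vecPoly, sum_mul, map_sum, mulVec, dotProduct]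
  refine sum_congr rfl fun k _ => ?_
  rw [smul_mul_assoc, map_smul, smul_eq_mul, ← pow_add, toepMatrix, of_apply, mul_comm,
    add_comm (k : ℕ)]

lemma ext_of_orth {p : ℂ[X]} {f : ℂ[X] →ₗ[ℂ] ℂ} (h : ∀ l < n, ℓ (p * X ^ l) = f (X ^ l)) {q : ℂ[X]}
    (hq : q.degree < n) : ℓ (p * q) = f q := by
  rw [← vecPoly_coeff hq, vecPoly, mul_sum, map_sum, map_sum]
  refine sum_congr rfl fun k _ => ?_
  rw [mul_smul_comm, map_smul, map_smul, h _ k.2]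

lemma IsOrthPair.eq_zero_of_orth (h : IsOrthPair ℓ n P Q) (hn : 1 ≤ n) {w : ℂ[X]} (hd : w.degree < n)
    (h2 : ∀ q : ℂ[X], q.degree < n → ℓ (w * q) = 0) : w = 0 := by
  obtain ⟨k, rfl⟩ : ∃ k, n = k + 1 := ⟨n - 1, by omega⟩
  have hlt : ((k : ℕ) : WithBot ℕ) < ((k + 1 : ℕ) : WithBot ℕ) := by exact_mod_cast Nat.lt_succ_self k
  refine Polynomial.funext fun z => ?_
  have e1 := mul_rem_sub (ℓ := ℓ) w P z
  have e2 := mul_rem_sub (ℓ := ℓ) w Q z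
  have d1 := degree_dq_lt z hd
  rw [h2 _ (coeff_dq_of_monic z h.monic h.natDegree).1, h.orth _ (d1.trans hlt)] at e1
  rw [h2 _ ((degree_dq_lt z h.degree).trans hlt), h.coorth _ (d1.trans hlt), Nat.add_sub_cancel,
    coeff_eq_zero_of_degree_lt d1] at e2
  have e3 := h.det_eq_one hn z
  rw [eval_zero]
  linear_combination (-w.eval z) * e3 + P.eval z * e2 - Q.eval z * e1

lemma IsOrthPair.unique {P' Q' : ℂ[X]} (h : IsOrthPair ℓ n P Q) (h' : IsOrthPair ℓ n P' Q')
    (hn : 1 ≤ n) : P = P' ∧ Q = Q' := by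
  constructor
  · refine _root_.sub_eq_zero.1 (h.eq_zero_of_orth hn ?_ fun q hq => ?_)
    · have hd : ∀ {p : ℂ[X]}, p.Monic → p.natDegree = n → p.degree = n := fun hp hpn => by
        rw [degree_eq_natDegree hp.ne_zero, hpn]
      have := degree_sub_lt_left ((hd h.monic h.natDegree).trans (hd h'.monic h'.natDegree).symm)
        h.monic.ne_zero (by rw [h.monic.leadingCoeff, h'.monic.leadingCoeff])
      rwa [hd h.monic h.natDegree] at this
    · rw [sub_mul, map_sub, h.orth q hq, h'.orth q hq, sub_zero]
  · refine _root_.sub_eq_zero.1 (h.eq_zero_of_orth hn ?_ fun q hq => ?_)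
    · exact (degree_sub_le _ _).trans_lt (max_lt h.degree h'.degree)
    · rw [sub_mul, map_sub, h.coorth q hq, h'.coorth q hq, sub_self]

lemma IsOrthPair.det_ne_zero (h : IsOrthPair ℓ n P Q) (hn : 1 ≤ n) : (toepMatrix ℓ n).det ≠ 0 := by
  intro h0
  obtain ⟨v, hv, hv0⟩ := exists_mulVec_eq_zero_iff.2 h0
  have h1 : ∀ l < n, ℓ (vecPoly v * X ^ l) = 0 := fun l hl => by
    have := congrFun hv0 ⟨n - 1 - l, by omega⟩
    rw [toepMatrix_mulVec] at this
    simpa [show n - 1 - (n - 1 - l) = l by omega] using this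
  have h2 : ∀ q : ℂ[X], q.degree < n → ℓ (vecPoly v * q) = 0 := fun q hq =>
    ext_of_orth (f := 0) (fun l hl => by rw [h1 l hl]; rfl) hq
  have hz : vecPoly v = 0 := h.eq_zero_of_orth hn (degree_vecPoly v) h2
  refine hv (_root_.funext fun k => ?_)
  rw [← coeff_vecPoly v k, hz, coeff_zero, Pi.zero_apply]

/-- The coefficients of `Q`. -/
def vecQ (ℓ : ℂ[X] →ₗ[ℂ] ℂ) (n : ℕ) : Fin n → ℂ :=
  (toepMatrix ℓ n)⁻¹.mulVec fun j => if (j : ℕ) = 0 then -1 else 0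

/-- The coefficients of `P`, without the leading one. -/
def vecP (ℓ : ℂ[X] →ₗ[ℂ] ℂ) (n : ℕ) : Fin n → ℂ :=
  (toepMatrix ℓ n)⁻¹.mulVec fun j => -ℓ (X ^ (n + (n - 1 - (j : ℕ))))

/-- The monic orthogonal polynomial. -/
def polyP (ℓ : ℂ[X] →ₗ[ℂ] ℂ) (n : ℕ) : ℂ[X] := X ^ n + vecPoly (vecP ℓ n)

/-- The companion of the monic orthogonal polynomial. -/
def polyQ (ℓ : ℂ[X] →ₗ[ℂ] ℂ) (n : ℕ) : ℂ[X] := vecPoly (vecQ ℓ n)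

lemma isOrthPair_poly (h0 : (toepMatrix ℓ n).det ≠ 0) :
    IsOrthPair ℓ n (polyP ℓ n) (polyQ ℓ n) := by
  have hu : IsUnit (toepMatrix ℓ n).det := isUnit_iff_ne_zero.2 h0
  have hs : ∀ b : Fin n → ℂ, ∀ l (hl : l < n),
      ℓ (vecPoly ((toepMatrix ℓ n)⁻¹.mulVec b) * X ^ l) = b ⟨n - 1 - l, by omega⟩ := fun b l hl => by
    have := toepMatrix_mulVec (ℓ := ℓ) ((toepMatrix ℓ n)⁻¹.mulVec b) ⟨n - 1 - l, by omega⟩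
    rw [mulVec_mulVec, mul_nonsing_inv _ hu, one_mulVec] at this
    simpa [show n - 1 - (n - 1 - l) = l by omega] using this.symm
  refine ⟨monic_X_pow_add (degree_vecPoly _), ?_, degree_vecPoly _, fun q hq => ?_, fun q hq => ?_⟩
  · rw [polyP, natDegree_eq_of_degree_eq_some]
    rw [degree_add_eq_left_of_degree_lt, degree_X_pow]
    rw [degree_X_pow]
    exact degree_vecPoly _
  · refine ext_of_orth (f := 0) (fun l hl => ?_) hq
    rw [polyP, add_mul, map_add, vecP, hs _ l hl, ← pow_add]
    simp [show n - 1 - (n - 1 - l) = l by omega]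
  · refine ext_of_orth (f := -(lcoeff ℂ (n - 1))) (fun l hl => ?_) hq
    rw [polyQ, vecQ, hs _ l hl]
    simp only [LinearMap.neg_apply, lcoeff_apply, coeff_X_pow]
    split_ifs <;> first | rfl | omega | simp

/-- Summing `T⁻¹` along the antidiagonals gives the Wronskian of `P` and `Q`. -/
lemma IsOrthPair.sum_inv_eq (h : IsOrthPair ℓ n P Q) (hn : 1 ≤ n) :
    ∑ k : Fin n, ∑ j : Fin n, (toepMatrix ℓ n)⁻¹ k j • (X : ℂ[X]) ^ (n - 1 - (j : ℕ) + (k : ℕ)) =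
      P * derivative Q - Q * derivative P := by
  have h0 := h.det_ne_zero hn
  have hu : IsUnit (toepMatrix ℓ n).det := isUnit_iff_ne_zero.2 h0
  refine Polynomial.funext fun y => ?_
  obtain ⟨k, rfl⟩ : ∃ k, n = k + 1 := ⟨n - 1, by omega⟩
  have hlt : ((k : ℕ) : WithBot ℕ) < ((k + 1 : ℕ) : WithBot ℕ) := by exact_mod_cast Nat.lt_succ_self k
  set p : ℂ[X] := P.eval y • dq y Q - Q.eval y • dq y P with hp
  have hpd : p.degree < (k + 1 : ℕ) := by
    refine (degree_sub_le _ _).trans_lt (max_lt ?_ ?_)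
    · exact (degree_smul_le _ _).trans_lt ((degree_dq_lt y h.degree).trans hlt)
    · exact (degree_smul_le _ _).trans_lt (coeff_dq_of_monic y h.monic h.natDegree).1
  have hp1 : ℓ p = 1 := by
    rw [hp, map_sub, map_smul, map_smul, smul_eq_mul, smul_eq_mul, h.det_eq_one hn y]
  have hp2 : (X - C y) * p = P.eval y • Q - Q.eval y • P := by
    simp only [hp, smul_eq_C_mul]
    linear_combination C (P.eval y) * dq_spec y Q - C (Q.eval y) * dq_spec y P
  have hp3 : ∀ l < k + 1, ℓ (p * X ^ l) = y ^ l := by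
    intro l hl
    induction l with
    | zero => rw [pow_zero, mul_one, hp1, pow_zero]
    | succ l ih =>
      have e1 : p * X ^ (l + 1) = y • (p * X ^ l) + (P.eval y • (Q * X ^ l) - Q.eval y • (P * X ^ l)) := by
        simp only [smul_eq_C_mul] at hp2 ⊢
        linear_combination X ^ l * hp2
      have hdl : (X ^ l : ℂ[X]).degree < (k + 1 : ℕ) := by
        rw [degree_X_pow]; exact_mod_cast (by omega : l < k + 1)
      rw [e1, map_add, map_sub, map_smul, map_smul, map_smul, ih (by omega), h.orth _ hdl,
        h.coorth _ hdl, Nat.add_sub_cancel, coeff_X_pow, if_neg (by omega)]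
      simp [pow_succ, mul_comm]
  have hv : (toepMatrix ℓ (k + 1)).mulVec (fun i : Fin (k + 1) => p.coeff i) =
      fun j : Fin (k + 1) => y ^ (k + 1 - 1 - (j : ℕ)) := by
    ext j
    rw [toepMatrix_mulVec, vecPoly_coeff hpd, hp3 _ (by omega)]
  have hv2 : (fun i : Fin (k + 1) => p.coeff i) =
      (toepMatrix ℓ (k + 1))⁻¹.mulVec fun j : Fin (k + 1) => y ^ (k + 1 - 1 - (j : ℕ)) := by
    rw [← hv, mulVec_mulVec, nonsing_inv_mul _ hu, one_mulVec]
  have he : p.eval y = ∑ i : Fin (k + 1), p.coeff i * y ^ (i : ℕ) := by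
    conv_lhs => rw [← vecPoly_coeff hpd, vecPoly]
    simp [eval_finsetSum]
  have hself : p.eval y = (P * derivative Q - Q * derivative P).eval y := by simp [hp, eval_dq_self]
  rw [← hself, he, eval_finsetSum]
  refine sum_congr rfl fun i _ => ?_
  rw [congrFun hv2 i, mulVec, dotProduct, sum_mul, eval_finsetSum]
  refine sum_congr rfl fun j _ => ?_
  rw [eval_smul, eval_pow, eval_X, smul_eq_mul, pow_add]
  ring

end Algebra

/-! ### Dependence on a parameter -/

lemma hasDerivAt_det {κ : Type*} [Fintype κ] [DecidableEq κ] {T : ℝ → Matrix κ κ ℂ}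
    {T' : Matrix κ κ ℂ} {τ : ℝ} (h : ∀ i j, HasDerivAt (fun s => T s i j) (T' i j) τ) :
    HasDerivAt (fun s => (T s).det) (∑ i, ∑ j, (T τ).adjugate i j * T' j i) τ := by
  have h1 : HasDerivAt (fun s => (T s).det) (∑ σ : Equiv.Perm κ, ((σ.sign : ℤ) : ℂ) *
      ∑ i, (∏ j ∈ univ.erase i, T τ (σ j) j) • T' (σ i) i) τ := by
    simp only [det_apply']
    exact HasDerivAt.fun_sum fun σ _ => (HasDerivAt.fun_finsetProd fun i _ => h (σ i) i).const_mul _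
  refine h1.congr_deriv ?_
  have h2 : ∀ i, ∑ j, (T τ).adjugate i j * T' j i = ((T τ).updateCol i fun j => T' j i).det :=
    fun i => by rw [← cramer_apply, cramer_eq_adjugate_mulVec]; rfl
  simp only [h2, det_apply', mul_sum]
  rw [sum_comm]
  refine sum_congr rfl fun i _ => sum_congr rfl fun σ _ => ?_
  have h3 : ∏ j ∈ univ.erase i, (T τ).updateCol i (fun j => T' j i) (σ j) j =
      ∏ j ∈ univ.erase i, T τ (σ j) j :=
    prod_congr rfl fun j hj => updateCol_ne (ne_of_mem_erase hj)
  rw [← mul_prod_erase _ _ (mem_univ i), updateCol_self, smul_eq_mul, h3]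
  ring

lemma differentiableAt_inv_apply {κ : Type*} [Fintype κ] [DecidableEq κ] {T : ℝ → Matrix κ κ ℂ}
    {τ : ℝ} (h : ∀ i j, DifferentiableAt ℝ (fun s => T s i j) τ) (h0 : (T τ).det ≠ 0) (i j : κ) :
    DifferentiableAt ℝ (fun s => (T s)⁻¹ i j) τ := by
  have hd : DifferentiableAt ℝ (fun s => (T s).det) τ :=
    (hasDerivAt_det (T' := fun i j => deriv (fun s => T s i j) τ)
      fun i j => (h i j).hasDerivAt).differentiableAt
  have ha : DifferentiableAt ℝ (fun s => (T s).adjugate i j) τ := by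
    simp only [adjugate_apply]
    refine (hasDerivAt_det (T' := fun a b => if a = j then 0 else deriv (fun s => T s a b) τ)
      fun a b => ?_).differentiableAt
    split_ifs with hab
    · subst hab
      simp only [updateRow_self]
      exact hasDerivAt_const _ _
    · simp only [updateRow_ne hab]
      exact (h a b).hasDerivAt
  simp only [Matrix.inv_def, Ring.inverse_eq_inv', Matrix.smul_apply, smul_eq_mul]
  exact (hd.inv h0).mul ha

section Family

variable {ℓ : ℝ → ℂ[X] →ₗ[ℂ] ℂ} {δ : ℂ[X] →ₗ[ℂ] ℂ} {τ : ℝ}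

lemma hasDerivAt_toepMatrix (h : ∀ p, HasDerivAt (fun s => ℓ s p) (δ p) τ) (i j : Fin n) :
    HasDerivAt (fun s => toepMatrix (ℓ s) n i j) (toepMatrix δ n i j) τ := h _

lemma hasDerivAt_det_toepMatrix (h : ∀ p, HasDerivAt (fun s => ℓ s p) (δ p) τ) {P Q : ℂ[X]}
    (hPQ : IsOrthPair (ℓ τ) n P Q) (hn : 1 ≤ n) :
    HasDerivAt (fun s => (toepMatrix (ℓ s) n).det)
      ((toepMatrix (ℓ τ) n).det * δ (P * derivative Q - Q * derivative P)) τ := by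
  refine (hasDerivAt_det (hasDerivAt_toepMatrix h)).congr_deriv ?_
  have h0 := hPQ.det_ne_zero hn
  rw [← hPQ.sum_inv_eq hn, map_sum, mul_sum]
  refine sum_congr rfl fun i _ => ?_
  rw [map_sum, mul_sum]
  refine sum_congr rfl fun j _ => ?_
  have h2 : toepMatrix δ n j i = δ (X ^ (n - 1 - (j : ℕ) + (i : ℕ))) := rfl
  rw [map_smul, Matrix.inv_def, Ring.inverse_eq_inv', Matrix.smul_apply, smul_eq_mul, smul_eq_mul, h2]
  field_simp

lemma hasDerivAt_apply_vecPoly (h : ∀ p, HasDerivAt (fun s => ℓ s p) (δ p) τ) (L : ℂ[X] →ₗ[ℂ] ℂ[X])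
    (q : ℂ[X]) {v : ℝ → Fin n → ℂ} {v' : Fin n → ℂ} (hv : ∀ k, HasDerivAt (fun s => v s k) (v' k) τ) :
    HasDerivAt (fun s => ℓ s (L (q + vecPoly (v s))))
      (δ (L (q + vecPoly (v τ))) + ℓ τ (L (vecPoly v'))) τ := by
  simp only [vecPoly, map_add, map_sum, map_smul, smul_eq_mul]
  refine ((h _).add (HasDerivAt.fun_sum fun k _ => (hv k).mul (h _))).congr_deriv ?_
  rw [sum_add_distrib]
  ring

lemma hasDerivAt_eval_vecPoly (z : ℂ) (q : ℂ[X]) {v : ℝ → Fin n → ℂ} {v' : Fin n → ℂ}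
    (hv : ∀ k, HasDerivAt (fun s => v s k) (v' k) τ) :
    HasDerivAt (fun s => (q + vecPoly (v s)).eval z) ((vecPoly v').eval z) τ := by
  simp only [vecPoly, eval_add, eval_finsetSum, eval_smul, smul_eq_mul]
  exact (HasDerivAt.fun_sum fun k _ => (hv k).mul_const _).const_add _

/-- The derivative of `polyP` with respect to the parameter. -/
def dpolyP (ℓ : ℝ → ℂ[X] →ₗ[ℂ] ℂ) (n : ℕ) (τ : ℝ) : ℂ[X] :=
  vecPoly fun k => deriv (fun s => vecP (ℓ s) n k) τ

/-- The derivative of `polyQ` with respect to the parameter. -/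
def dpolyQ (ℓ : ℝ → ℂ[X] →ₗ[ℂ] ℂ) (n : ℕ) (τ : ℝ) : ℂ[X] :=
  vecPoly fun k => deriv (fun s => vecQ (ℓ s) n k) τ

section

variable (h : ∀ p, HasDerivAt (fun s => ℓ s p) (δ p) τ) (h0 : (toepMatrix (ℓ τ) n).det ≠ 0)
include h h0

lemma hasDerivAt_vecP (k : Fin n) :
    HasDerivAt (fun s => vecP (ℓ s) n k) (deriv (fun s => vecP (ℓ s) n k) τ) τ := by
  refine DifferentiableAt.hasDerivAt ?_
  simp only [vecP, mulVec, dotProduct]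
  exact DifferentiableAt.fun_sum fun j _ => (differentiableAt_inv_apply
    (fun i j => (hasDerivAt_toepMatrix h i j).differentiableAt) h0 k j).mul
      (h _).differentiableAt.neg

lemma hasDerivAt_vecQ (k : Fin n) :
    HasDerivAt (fun s => vecQ (ℓ s) n k) (deriv (fun s => vecQ (ℓ s) n k) τ) τ := by
  refine DifferentiableAt.hasDerivAt ?_
  simp only [vecQ, mulVec, dotProduct]
  exact DifferentiableAt.fun_sum fun j _ => (differentiableAt_inv_apply
    (fun i j => (hasDerivAt_toepMatrix h i j).differentiableAt) h0 k j).mul_const _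

lemma hasDerivAt_eval_polyP (z : ℂ) :
    HasDerivAt (fun s => (polyP (ℓ s) n).eval z) ((dpolyP ℓ n τ).eval z) τ :=
  hasDerivAt_eval_vecPoly z _ (hasDerivAt_vecP h h0)

lemma hasDerivAt_eval_polyQ (z : ℂ) :
    HasDerivAt (fun s => (polyQ (ℓ s) n).eval z) ((dpolyQ ℓ n τ).eval z) τ := by
  simpa [polyQ, dpolyQ] using hasDerivAt_eval_vecPoly z 0 (hasDerivAt_vecQ h h0)

lemma hasDerivAt_apply_polyP (L : ℂ[X] →ₗ[ℂ] ℂ[X]) :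
    HasDerivAt (fun s => ℓ s (L (polyP (ℓ s) n)))
      (δ (L (polyP (ℓ τ) n)) + ℓ τ (L (dpolyP ℓ n τ))) τ :=
  hasDerivAt_apply_vecPoly h L _ (hasDerivAt_vecP h h0)

lemma hasDerivAt_apply_polyQ (L : ℂ[X] →ₗ[ℂ] ℂ[X]) :
    HasDerivAt (fun s => ℓ s (L (polyQ (ℓ s) n)))
      (δ (L (polyQ (ℓ τ) n)) + ℓ τ (L (dpolyQ ℓ n τ))) τ := by
  simpa [polyQ, dpolyQ] using hasDerivAt_apply_vecPoly h L 0 (hasDerivAt_vecQ h h0)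

lemma eventually_isOrthPair :
    ∀ᶠ s in 𝓝 τ, IsOrthPair (ℓ s) n (polyP (ℓ s) n) (polyQ (ℓ s) n) := by
  have : ContinuousAt (fun s => (toepMatrix (ℓ s) n).det) τ :=
    (hasDerivAt_det (hasDerivAt_toepMatrix h)).continuousAt
  exact (this.eventually_ne h0).mono fun s hs => isOrthPair_poly hs

lemma deriv_orth {q : ℂ[X]} (hq : q.degree < n) :
    δ (polyP (ℓ τ) n * q) = -ℓ τ (dpolyP ℓ n τ * q) := by
  have h1 := hasDerivAt_apply_polyP h h0 (LinearMap.mulRight ℂ q)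
  have h2 := (hasDerivAt_const τ (0 : ℂ)).congr_of_eventuallyEq
    ((eventually_isOrthPair h h0).mono fun s hs => hs.orth q hq)
  exact eq_neg_of_add_eq_zero_left (h1.unique h2)

lemma deriv_coorth {q : ℂ[X]} (hq : q.degree < n) :
    δ (polyQ (ℓ τ) n * q) = -ℓ τ (dpolyQ ℓ n τ * q) := by
  have h1 := hasDerivAt_apply_polyQ h h0 (LinearMap.mulRight ℂ q)
  have h2 := (hasDerivAt_const τ (-q.coeff (n - 1))).congr_of_eventuallyEq
    ((eventually_isOrthPair h h0).mono fun s hs => hs.coorth q hq)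
  exact eq_neg_of_add_eq_zero_left (h1.unique h2)

lemma deriv_wronskian :
    δ (polyP (ℓ τ) n * derivative (polyQ (ℓ τ) n) - polyQ (ℓ τ) n * derivative (polyP (ℓ τ) n)) =
      ℓ τ (derivative (polyP (ℓ τ) n * dpolyQ ℓ n τ - polyQ (ℓ τ) n * dpolyP ℓ n τ)) := by
  have hPQ := isOrthPair_poly h0
  have hP : (derivative (polyP (ℓ τ) n)).degree < n := by
    have := degree_derivative_lt hPQ.monic.ne_zero
    rwa [degree_eq_natDegree hPQ.monic.ne_zero, hPQ.natDegree] at this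
  rw [map_sub, deriv_orth h h0 (degree_derivative_le.trans_lt hPQ.degree), deriv_coorth h h0 hP,
    hPQ.apply_derivative_wronskian (u := dpolyP ℓ n τ) (v := dpolyQ ℓ n τ) (degree_vecPoly _)
      (degree_vecPoly _)]
  ring

end

end Family

/-- Integration of polynomials over the circle against the weight. -/
def ell (n : ℕ) (α β : ι → ℂ) (θ : ι → ℝ) : ℂ[X] →ₗ[ℂ] ℂ :=
  lsum fun i => LinearMap.toSpanSingleton ℂ ℂ (mom n α β θ fun t => ue t ^ i)

local notation "ℒ" => ell n α β θ

lemma ell_monomial (i : ℕ) (a : ℂ) :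
    ℒ (monomial i a) = a * mom n α β θ fun t => ue t ^ i := by
  rw [ell, lsum_apply, sum_monomial_index] <;> simp

lemma ell_X_pow (i : ℕ) : ℒ (X ^ i) = mom n α β θ fun t => ue t ^ i := by
  rw [X_pow_eq_monomial, ell_monomial, one_mul]

lemma toepMatrix_ell : toepMatrix ℒ n = momMatrix n α β θ := by
  ext j k
  exact ell_X_pow _

section

variable (hα : Admissible α) (hinj : Injective (zpt θ))
include hα hinj

lemma PerC1.integrable_mom {p : ℝ → ℂ} (hp : PerC1 p) : IntervalIntegrable
    (fun t => p t * (ue t * 𝓦 t)) volume 0 (2 * π) :=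
  PerC1.intervalIntegrable hp.continuous hp.periodic hα hinj _ _

lemma ell_eq (p : ℂ[X]) : ℒ p = mom n α β θ fun t => p.eval (ue t) := by
  induction p using Polynomial.induction_on' with
  | add p q hp hq =>
    simp only [eval_add]
    rw [map_add, hp, hq, mom_add ((PerC1.polynomial p).integrable_mom hα hinj)
      ((PerC1.polynomial q).integrable_mom hα hinj)]
  | monomial k a =>
    simp only [eval_monomial]
    rw [ell_monomial, mom_const_mul]

lemma mom_mul_inv_sub (p : ℂ[X]) {z : ℂ} (hz : ‖z‖ ≠ 1) :
    mom n α β θ (fun t => p.eval (ue t) * (ue t - z)⁻¹) =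
      p.eval z * 𝓒 z + ℒ (dq z p) := by
  rw [ell_eq hα hinj, cauchyT, ← mom_const_mul, ← mom_add
    (((PerC1.const (p.eval z)).mul (perC1_inv_sub hz)).integrable_mom hα hinj)
    ((PerC1.polynomial (dq z p)).integrable_mom hα hinj)]
  refine mom_congr ∅ Set.finite_empty fun t _ => ?_
  have h1 := congrArg (eval (ue t)) (dq_spec z p)
  simp only [eval_add, eval_mul, eval_sub, eval_X, eval_C] at h1
  have h2 := ue_sub_ne_zero hz t
  rw [← h1]
  field_simp
  ring

lemma ell_dq_zpt (p : ℂ[X]) (j : ι) : ℒ (dq (zpt θ j) p) =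
    mom n α β θ fun t => (p.eval (ue t) - p.eval (ue (θ j))) / (ue t - zpt θ j) := by
  rw [ell_eq hα hinj]
  refine mom_congr {zpt θ j} (Set.finite_singleton _) fun t ht => ?_
  have h1 := congrArg (eval (ue t)) (dq_spec (zpt θ j) p)
  simp only [eval_add, eval_mul, eval_sub, eval_X, eval_C] at h1
  rw [eq_div_iff (sub_ne_zero.2 ht), ← h1, zpt_eq]
  ring

/-- The moments of an exact form with polynomial coefficients. -/
lemma ell_derivative_eq (p : ℂ[X]) : ell n α β θ (derivative p) =
    ∑ j, (-(2 * α j * ell n α β θ (dq (zpt θ j) p)) + resid n α β θ j * p.eval (zpt θ j)) +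
      (-(2 * lam n α β * ell n α β θ (dq 0 p)) + resid0 n α β θ * p.eval 0) := by
  have h := exactForm_eq (n := n) (β := β) hα hinj (PerC1.polynomial p)
  have hI : ∀ j, IntervalIntegrable (fun t => (p.eval (ue t) - p.eval (ue (θ j))) / (ue t - zpt θ j) *
      (ue t * weight n α β θ t)) volume 0 (2 * π) := fun j =>
    ((PerC1.polynomial p).sub (PerC1.const _)).intervalIntegrable_div hα hinj (sub_self _) _ _
  have h0 := mom_mul_inv_sub (n := n) (β := β) hα hinj p (z := 0) (by simp)
  simp only [sub_zero] at h0
  have h1 : exactForm n α β θ (fun t => p.eval (ue t)) = ell n α β θ (derivative p) +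
      2 * lam n α β * (p.eval 0 * cauchyT n α β θ 0 + ell n α β θ (dq 0 p)) +
      ∑ j, 2 * α j * ell n α β θ (dq (zpt θ j) p) := by
    rw [← h0, ell_eq hα hinj (derivative p), ← mom_const_mul, sum_congr rfl fun j _ => by
      rw [ell_dq_zpt hα hinj, ← mom_const_mul]]
    rw [← mom_add ((PerC1.polynomial (derivative p)).integrable_mom hα hinj)
      (((PerC1.const _).mul ((PerC1.polynomial p).mul perC1_inv_ue)).integrable_mom hα hinj),
      ← mom_sum _ fun j _ => ?_, ← mom_add ?_ ?_]
    · refine mom_congr ∅ Set.finite_empty fun t _ => ?_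
      have h2 : deriv (fun t => p.eval (ue t)) t = (derivative p).eval (ue t) * (I * ue t) :=
        ((p.hasDerivAt (ue t)).comp t (hasDerivAt_ue t)).deriv
      have h3 := ue_ne_zero t
      rw [h2]
      field_simp
    · exact ((((PerC1.polynomial (derivative p))).add
        ((PerC1.const _).mul ((PerC1.polynomial p).mul perC1_inv_ue))).integrable_mom hα hinj)
    · simp only [sum_mul]
      have h5 := IntervalIntegrable.sum (μ := volume) (a := 0) (b := 2 * π) univ
        (f := fun j t => 2 * α j * (((p.eval (ue t) - p.eval (ue (θ j))) / (ue t - zpt θ j)) *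
          (ue t * weight n α β θ t))) fun j _ => (hI j).const_mul (2 * α j)
      refine h5.congr fun t _ => ?_
      simp only [Finset.sum_apply, mul_assoc]
    · simpa only [mul_assoc] using ((hI j).const_mul (2 * α j))
  have hr : resid0 n α β θ = -(2 * lam n α β * cauchyT n α β θ 0) := by rw [resid0, cauchyT]; simp
  rw [h1] at h
  have h4 : ∑ j, p.eval (ue (θ j)) * resid n α β θ j = ∑ j, resid n α β θ j * p.eval (zpt θ j) :=
    sum_congr rfl fun j _ => by rw [mul_comm, zpt_eq]
  rw [h4] at h
  rw [sum_add_distrib, sum_neg_distrib, hr]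
  linear_combination h

/-- The derivative of the functional along `θ_k`. -/
lemma hasDerivAt_ell (k : ι) (p : ℂ[X]) :
    HasDerivAt (fun τ => ell n α β (update θ k τ) p)
      (I * zpt θ k * (-(2 * α k * ell n α β θ (dq (zpt θ k) p)) +
        resid n α β θ k * p.eval (zpt θ k))) (θ k) := by
  have h := hasDerivAt_mom (n := n) (β := β) hα hinj k (PerC1.polynomial p)
  rw [← ell_dq_zpt hα hinj] at h
  refine (h.congr_of_eventuallyEq ?_).congr_deriv ?_
  · have h1 := eventually_injective_zpt hinj
    have h2 : Tendsto (fun τ => update θ k τ) (𝓝 (θ k)) (𝓝 θ) := by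
      have : Continuous fun τ => update θ k τ := continuous_const.update k continuous_id
      simpa using this.tendsto (θ k)
    exact (h2.eventually h1).mono fun τ hτ => ell_eq hα hτ p
  · rw [zpt_eq]; ring

end

/-- The derivative of the functional along `θ_k`. -/
def dell (n : ℕ) (α β : ι → ℂ) (θ : ι → ℝ) (k : ι) : ℂ[X] →ₗ[ℂ] ℂ where
  toFun p := I * zpt θ k * (-(2 * α k * ell n α β θ (dq (zpt θ k) p)) +
        resid n α β θ k * p.eval (zpt θ k))
  map_add' p q := by rw [dq_add, map_add, eval_add]; ring
  map_smul' a p := by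
    rw [dq_smul, map_smul, eval_smul, smul_eq_mul, smul_eq_mul, smul_eq_mul, RingHom.id_apply]; ring

/-- `p ↦ (p - p(z)) / (X - z)` as a linear map. -/
def dqL (z : ℂ) : ℂ[X] →ₗ[ℂ] ℂ[X] where
  toFun := dq z
  map_add' := dq_add z
  map_smul' := dq_smul z

/-- The polynomial part of the solution of the Riemann-Hilbert problem. -/
def solM (ℓ : ℂ[X] →ₗ[ℂ] ℂ) (n : ℕ) (z : ℂ) : Mat :=
  !![(polyP ℓ n).eval z, (remPoly ℓ (polyP ℓ n)).eval z;
     (polyQ ℓ n).eval z, (remPoly ℓ (polyQ ℓ n)).eval z]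

local notation "𝓜" => solM ℒ n

lemma det_solM {ℓ : ℂ[X] →ₗ[ℂ] ℂ} (h0 : (toepMatrix ℓ n).det ≠ 0) (hn : 1 ≤ n) (z : ℂ) :
    (solM ℓ n z).det = 1 := by
  rw [solM, det_fin_two_of, eval_remPoly, eval_remPoly, mul_comm (ℓ _) (eval _ _)]
  exact (isOrthPair_poly h0).det_eq_one hn z

lemma hasDerivAt_solM {ℓ : ℂ[X] →ₗ[ℂ] ℂ} (z : ℂ) (a b : Fin 2) :
    HasDerivAt (fun z => solM ℓ n z a b)
      ((!![(derivative (polyP ℓ n)).eval z, (derivative (remPoly ℓ (polyP ℓ n))).eval z;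
        (derivative (polyQ ℓ n)).eval z, (derivative (remPoly ℓ (polyQ ℓ n))).eval z] : Mat) a b) z := by
  fin_cases a <;> fin_cases b <;> exact Polynomial.hasDerivAt _ _

/-- The residue matrix of the logarithmic derivative at a singular point. -/
def xiMat (a r : ℂ) : Mat := !![a, r; 0, -a]

lemma inv_of_det_one {M : Mat} (h : M.det = 1) :
    M⁻¹ = !![M 1 1, -M 0 1; -M 1 0, M 0 0] := by
  rw [Matrix.inv_def, h, Ring.inverse_one, one_smul, adjugate_fin_two]

lemma trace_conj_xiMat {M D : Mat} (h : M.det = 1)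
    (hD : D 0 0 * M 1 1 + M 0 0 * D 1 1 - (D 0 1 * M 1 0 + M 0 1 * D 1 0) = 0) (a r : ℂ) :
    trace (M * xiMat a r * M⁻¹ * D * M⁻¹) =
      2 * a * (M 1 1 * D 0 0 - M 0 1 * D 1 0) + r * (M 0 0 * D 1 0 - M 1 0 * D 0 0) := by
  have h1 : trace (M * xiMat a r * M⁻¹ * D * M⁻¹) = trace (xiMat a r * (M⁻¹ * D)) := by
    rw [trace_mul_comm, ← mul_assoc, ← mul_assoc, ← mul_assoc,
      nonsing_inv_mul _ (by rw [h]; exact isUnit_one), one_mul, mul_assoc]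
  rw [h1, inv_of_det_one h, xiMat]
  conv_lhs => rw [eta_fin_two D, mul_fin_two, mul_fin_two, trace_fin_two_of]
  linear_combination (-a) * hD

lemma hasDerivAt_det_two {𝕜 : Type*} [NontriviallyNormedField 𝕜] [NormedAlgebra 𝕜 ℂ] {M : 𝕜 → Mat}
    {D : Mat} {s : 𝕜} (h : ∀ a b, HasDerivAt (fun s => M s a b) (D a b) s)
    (h1 : ∀ᶠ t in 𝓝 s, (M t).det = 1) :
    D 0 0 * M s 1 1 + M s 0 0 * D 1 1 - (D 0 1 * M s 1 0 + M s 0 1 * D 1 0) = 0 := by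
  have h2 := ((h 0 0).mul (h 1 1)).sub ((h 0 1).mul (h 1 0))
  refine h2.unique ((hasDerivAt_const s (1 : ℂ)).congr_of_eventuallyEq ?_)
  filter_upwards [h1] with t ht
  rw [← ht, det_fin_two]
  rfl

/-- The residue at `z_k` is the logarithmic derivative of the determinant. -/
lemma trace_solM_deriv (h0 : (momMatrix n α β θ).det ≠ 0) (hn : 1 ≤ n) (k : ι) {D : Mat}
    (hD : ∀ a b, HasDerivAt (fun z => 𝓜 z a b) (D a b) (zpt θ k)) :
    I * zpt θ k * trace (𝓜 (zpt θ k) * xiMat (α k) (resid n α β θ k) *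
      (𝓜 (zpt θ k))⁻¹ * D * (𝓜 (zpt θ k))⁻¹) =
      dell n α β θ k (polyP ℒ n * derivative (polyQ ℒ n) - polyQ ℒ n * derivative (polyP ℒ n)) := by
  rw [← toepMatrix_ell] at h0
  have hPQ := isOrthPair_poly h0
  have hP : (derivative (polyP ℒ n)).degree < n := by
    have := degree_derivative_lt hPQ.monic.ne_zero
    rwa [degree_eq_natDegree hPQ.monic.ne_zero, hPQ.natDegree] at this
  have hW := hPQ.rem_wronskian hP (degree_derivative_le.trans_lt hPQ.degree) (zpt θ k)
  rw [trace_conj_xiMat (det_solM h0 hn _) (hasDerivAt_det_two hD (.of_forall fun z => det_solM h0 hn z))]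
  have d0 := (hD 0 0).unique (hasDerivAt_solM _ 0 0)
  have d1 := (hD 1 0).unique (hasDerivAt_solM _ 1 0)
  rw [d0, d1]
  simp only [dell, LinearMap.coe_mk, AddHom.coe_mk, hW]
  simp only [solM, of_apply, cons_val', cons_val_zero, cons_val_one,
    cons_val_fin_one, eval_remPoly, eval_sub, eval_mul]
  ring

lemma exists_hasDerivAt_solM_param {ℓ : ℝ → ℂ[X] →ₗ[ℂ] ℂ} {δ : ℂ[X] →ₗ[ℂ] ℂ} {τ : ℝ}
    (h : ∀ p, HasDerivAt (fun s => ℓ s p) (δ p) τ) (h0 : (toepMatrix (ℓ τ) n).det ≠ 0) (z : ℂ) :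
    ∃ D : Mat, (∀ a b, HasDerivAt (fun s => solM (ℓ s) n z a b) (D a b) τ) ∧
      D 0 0 = (dpolyP ℓ n τ).eval z ∧ D 1 0 = (dpolyQ ℓ n τ).eval z := by
  have h1 := hasDerivAt_apply_polyP h h0 (dqL z)
  have h2 := hasDerivAt_apply_polyQ h h0 (dqL z)
  refine ⟨!![(dpolyP ℓ n τ).eval z, δ (dqL z (polyP (ℓ τ) n)) + ℓ τ (dqL z (dpolyP ℓ n τ));
    (dpolyQ ℓ n τ).eval z, δ (dqL z (polyQ (ℓ τ) n)) + ℓ τ (dqL z (dpolyQ ℓ n τ))],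
    fun a b => ?_, rfl, rfl⟩
  fin_cases a <;> fin_cases b <;> simp only [solM, Fin.zero_eta, Fin.mk_one, of_apply,
    cons_val', cons_val_zero, cons_val_one, cons_val_fin_one, eval_remPoly]
  · exact hasDerivAt_eval_polyP h h0 z
  · exact h1
  · exact hasDerivAt_eval_polyQ h h0 z
  · exact h2

/-- The sum of the residues gives the logarithmic derivative of the determinant. -/
lemma sum_trace_solM_param (hα : Admissible α) (hinj : Injective (zpt θ))
    (hn : 1 ≤ n) {ℓ : ℝ → ℂ[X] →ₗ[ℂ] ℂ} {δ : ℂ[X] →ₗ[ℂ] ℂ} {τ : ℝ} (hτ : ℓ τ = ℒ)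
    (h : ∀ p, HasDerivAt (fun s => ℓ s p) (δ p) τ) (h0 : (toepMatrix (ℓ τ) n).det ≠ 0) {D : ℂ → Mat}
    (hD : ∀ z a b, HasDerivAt (fun s => solM (ℓ s) n z a b) (D z a b) τ) :
    ∑ j, trace (solM (ℓ τ) n (zpt θ j) * xiMat (α j) (resid n α β θ j) *
      (solM (ℓ τ) n (zpt θ j))⁻¹ * D (zpt θ j) * (solM (ℓ τ) n (zpt θ j))⁻¹) +
      trace (solM (ℓ τ) n 0 * xiMat (lam n α β) (resid0 n α β θ) *
      (solM (ℓ τ) n 0)⁻¹ * D 0 * (solM (ℓ τ) n 0)⁻¹) =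
      δ (polyP (ℓ τ) n * derivative (polyQ (ℓ τ) n) -
        polyQ (ℓ τ) n * derivative (polyP (ℓ τ) n)) := by
  have hev : ∀ᶠ s in 𝓝 τ, ∀ z, (solM (ℓ s) n z).det = 1 := by
    filter_upwards [eventually_isOrthPair h h0] with s hs z
    exact det_solM (hs.det_ne_zero hn) hn z
  have hPQ := isOrthPair_poly h0
  have key : ∀ z a r, trace (solM (ℓ τ) n z * xiMat a r * (solM (ℓ τ) n z)⁻¹ * D z *
      (solM (ℓ τ) n z)⁻¹) = -(2 * a * ℓ τ (dq z (polyP (ℓ τ) n * dpolyQ ℓ n τ -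
        polyQ (ℓ τ) n * dpolyP ℓ n τ))) + r * (polyP (ℓ τ) n * dpolyQ ℓ n τ -
        polyQ (ℓ τ) n * dpolyP ℓ n τ).eval z := by
    intro z a r
    obtain ⟨D', hD', e0, e1⟩ := exists_hasDerivAt_solM_param h h0 z
    rw [trace_conj_xiMat (det_solM h0 hn z) (hasDerivAt_det_two
        (M := fun s => solM (ℓ s) n z) (s := τ) (hD z) (hev.mono fun s hs => hs z)),
      hPQ.rem_wronskian (u := dpolyP ℓ n τ) (v := dpolyQ ℓ n τ) (degree_vecPoly _) (degree_vecPoly _),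
      (hD z 0 0).unique (hD' 0 0), (hD z 1 0).unique (hD' 1 0), e0, e1]
    simp only [solM, of_apply, cons_val', cons_val_zero, cons_val_one,
      cons_val_fin_one, eval_remPoly, eval_sub, eval_mul]
    ring
  rw [deriv_wronskian h h0]
  simp only [key]
  generalize polyP (ℓ τ) n * dpolyQ ℓ n τ - polyQ (ℓ τ) n * dpolyP ℓ n τ = p
  rw [hτ, ell_derivative_eq hα hinj]



/-! ### Dependence of the local factors on the configuration -/

section Smooth

variable {E : Type*} [NormedAddCommGroup E] [NormedSpace ℝ E] {u : E → Fin (m + 1) → ℝ} {w : E → ℂ}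
  {x : E}

lemma ContDiffAt.clog' {f : E → ℂ} (hf : ContDiffAt ℝ 1 f x) (h : f x ∈ slitPlane) :
    ContDiffAt ℝ 1 (fun y => log (f y)) x :=
  ((contDiffAt_log h (n := 1)).restrict_scalars ℝ).comp x hf

lemma contDiffAt_ue_comp {f : E → ℝ} (hf : ContDiffAt ℝ 1 f x) :
    ContDiffAt ℝ 1 (fun y => ue (f y)) x :=
  (contDiff_ue.of_le le_top).contDiffAt.comp x hf

lemma contDiffAt_ofReal_comp {f : E → ℝ} (hf : ContDiffAt ℝ 1 f x) :
    ContDiffAt ℝ 1 (fun y => (f y : ℂ)) x :=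
  ofRealCLM.contDiff.contDiffAt.comp x hf

variable (hu : ∀ i, ContDiffAt ℝ 1 (fun y => u y i) x) (hw : ContDiffAt ℝ 1 w x)
include hu

lemma contDiffAt_zpt (i : ι) : ContDiffAt ℝ 1 (fun y => zpt (u y) i) x := contDiffAt_ue_comp (hu i)

include hw

lemma Sep.contDiffAt_eLog {d : ℝ} {j : ι} (h : Sep (u x) d)
    (hz : ‖w x - zpt (u x) j‖ < d / 2) :
    ContDiffAt ℝ 1 (fun y => eLog n α β (u y) j (w y)) x := by
  have hue : ∀ i, ContDiffAt ℝ 1 (fun y => ue (-u y i)) x := fun i => contDiffAt_ue_comp (hu i).neg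
  have hof : ∀ i, ContDiffAt ℝ 1 (fun y => (u y i : ℂ)) x := fun i => contDiffAt_ofReal_comp (hu i)
  refine ContDiffAt.add (contDiffAt_const.mul (ContDiffAt.add (ContDiffAt.clog' (hw.mul (hue j))
    (mul_ue_mem_slitPlane (h.lt_one hz))) ((hof j).mul contDiffAt_const))) ?_
  refine ContDiffAt.sum fun i hi => contDiffAt_const.mul (ContDiffAt.add (ContDiffAt.clog'
    (contDiffAt_const.sub (hw.mul (hue i))) (h.one_sub_mem (ne_of_mem_erase hi) hz))
    (((hof i).add contDiffAt_const).mul contDiffAt_const))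

end Smooth

lemma differentiableAt_integral_sum {κ : Type*} [Fintype κ] {c : κ → ℝ → ℂ} {Ψ : κ → ℝ × ℝ → ℂ}
    {τ a b : ℝ} (hab : a ≤ b) (hc : ∀ i, DifferentiableAt ℝ (c i) τ)
    (h : ∀ i, ∀ t ∈ Set.Icc a b, ContDiffAt ℝ 1 (Ψ i) (τ, t)) :
    DifferentiableAt ℝ (fun s => ∫ t in a..b, ∑ i, c i s * Ψ i (s, t)) τ := by
  have h1 : ∀ᶠ s in 𝓝 τ, ∀ i, ∀ t ∈ Set.Icc a b, ContDiffAt ℝ 1 (Ψ i) (s, t) :=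
    eventually_all.2 fun i => isCompact_Icc.eventually_forall_of_forall_eventually fun t ht =>
      (h i t ht).eventually (by norm_num)
  have h2 : DifferentiableAt ℝ (fun s => ∑ i, c i s * ∫ t in a..b, Ψ i (s, t)) τ :=
    DifferentiableAt.fun_sum fun i _ => (hc i).mul (differentiableAt_integral_of_contDiffAt hab (h i))
  refine h2.congr_of_eventuallyEq ?_
  filter_upwards [h1] with s hs
  rw [integral_finsetSum fun i _ => ?_]
  · exact sum_congr rfl fun i _ => by rw [integral_const_mul]
  · refine ContinuousOn.intervalIntegrable ?_
    rw [Set.uIcc_of_le hab]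
    exact fun t ht => (continuousAt_const.mul ((hs i t ht).continuousAt.comp
      (Continuous.prodMk_right s).continuousAt)).continuousWithinAt

/-- The coefficients of the residues in `residLoc`. -/
def residKernel (n : ℕ) (α β : ι → ℂ) (θ : ι → ℝ) (j : ι) (z : ℂ) :
    Option ι → ℂ
  | none => (z - zpt θ j) * z⁻¹ * exp (-(2 * eLog n α β θ j z))
  | some i => if i = j then exp (-(2 * eLog n α β θ j z)) else
      (z - zpt θ j) * (z - zpt θ i)⁻¹ * exp (-(2 * eLog n α β θ j z))

lemma residLoc_eq_sum (j : ι) (z : ℂ) : residLoc n α β θ j z =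
    ∑ i, Option.elim i (resid0 n α β θ) (resid n α β θ) * residKernel n α β θ j z i := by
  rw [residLoc, Fintype.sum_option, ← add_sum_erase _ _ (mem_univ j)]
  simp only [Option.elim, residKernel, if_true]
  have : ∑ i ∈ univ.erase j, resid n α β θ i * (if i = j then exp (-(2 * eLog n α β θ j z))
      else (z - zpt θ j) * (z - zpt θ i)⁻¹ * exp (-(2 * eLog n α β θ j z))) = (z - zpt θ j) * (∑ i ∈ univ.erase j,
      resid n α β θ i / (z - zpt θ i)) * exp (-(2 * eLog n α β θ j z)) := by
    rw [mul_sum, sum_mul]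
    exact sum_congr rfl fun i hi => by rw [if_neg (ne_of_mem_erase hi)]; ring
  rw [this]
  ring

lemma Sep.contDiffAt_residKernel {E : Type*} [NormedAddCommGroup E] [NormedSpace ℝ E]
    {u : E → ι → ℝ} {w : E → ℂ} {x : E} (hu : ∀ i, ContDiffAt ℝ 1 (fun y => u y i) x)
    (hw : ContDiffAt ℝ 1 w x) {d : ℝ} {j : ι} (h : Sep (u x) d)
    (hz : ‖w x - zpt (u x) j‖ < d / 2) (i : Option ι) :
    ContDiffAt ℝ 1 (fun y => residKernel n α β (u y) j (w y) i) x := by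
  have hE : ContDiffAt ℝ 1 (fun y => exp (-(2 * eLog n α β (u y) j (w y)))) x :=
    ((contDiffAt_const.mul (h.contDiffAt_eLog hu hw hz)).neg).cexp
  have hs : ContDiffAt ℝ 1 (fun y => w y - zpt (u y) j) x := hw.sub (contDiffAt_zpt hu j)
  rcases i with _ | i
  · exact (hs.mul (hw.inv (h.ne_zero hz))).mul hE
  · simp only [residKernel]
    split_ifs with hij
    · exact hE
    · exact (hs.mul ((hw.sub (contDiffAt_zpt hu i)).inv (h.sub_ne_zero hij hz))).mul hE

lemma contDiffAt_kernelSeries {E : Type*} [NormedAddCommGroup E] [NormedSpace ℝ E] (a : ℂ) {x : E}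
    {f : E → ℂ} (hf : ContDiffAt ℝ 1 f x) (h : ‖f x‖ < 1) :
    ContDiffAt ℝ 1 (fun y => kernelSeries a (f y)) x := by
  have h1 : DifferentiableOn ℂ (kernelSeries a) (ball 0 1) := fun u hu =>
    (hasDerivAt_kernelSeries a (by simpa using hu)).differentiableAt.differentiableWithinAt
  have h2 : ContDiffAt ℂ 1 (kernelSeries a) (f x) :=
    (h1.analyticAt (isOpen_ball.mem_nhds (by simpa using h))).contDiffAt
  exact (h2.restrict_scalars ℝ).comp x hf

lemma Sep.differentiableAt_kLoc {u : ℝ → ι → ℝ} {τ : ℝ}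
    (hu : ∀ i, ContDiffAt ℝ 1 (fun s => u s i) τ) {d : ℝ} {j : ι} (h : Sep (u τ) d)
    {o z : ℂ} (ho : ‖zpt (u τ) j - o‖ < d / 32) (hz : ‖z - o‖ < d / 16)
    (h0 : DifferentiableAt ℝ (fun s => resid0 n α β (u s)) τ)
    (hr : ∀ i, DifferentiableAt ℝ (fun s => resid n α β (u s) i) τ) :
    DifferentiableAt ℝ (fun s => kLoc n α β (u s) o d j z) τ := by
  have hd := h.1
  have hΨ : ∀ i : Option ι, ∀ t ∈ Set.Icc 0 (2 * π), ContDiffAt ℝ 1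
      (fun q : ℝ × ℝ => deriv (circleMap o (d / 4)) q.2 *
        (kernelSeries (2 * α j) ((z - zpt (u q.1) j) * (circleMap o (d / 4) q.2 - zpt (u q.1) j)⁻¹) *
        ((circleMap o (d / 4) q.2 - zpt (u q.1) j)⁻¹ *
          residKernel n α β (u q.1) j (circleMap o (d / 4) q.2) i))) (τ, t) := by
    intro i t _
    have hu' : ∀ i, ContDiffAt ℝ 1 (fun q : ℝ × ℝ => u q.1 i) (τ, t) := fun i =>
      ContDiffAt.comp (τ, t) (g := fun s => u s i) (f := Prod.fst) (hu i) contDiffAt_fst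
    have hγ : ContDiffAt ℝ 1 (fun q : ℝ × ℝ => circleMap o (d / 4) q.2) (τ, t) :=
      (contDiff_circleMap o (d / 4)).contDiffAt.comp _ contDiffAt_snd
    have hγ' : ContDiffAt ℝ 1 (fun q : ℝ × ℝ => deriv (circleMap o (d / 4)) q.2) (τ, t) := by
      simp only [deriv_circleMap]
      exact ((contDiff_circleMap 0 (d / 4)).contDiffAt.comp (τ, t) contDiffAt_snd).mul contDiffAt_const
    have hn : ‖circleMap o (d / 4) t - o‖ = d / 4 := by
      rw [circleMap_sub_center, norm_circleMap_zero, abs_of_pos (by positivity)]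
    have hn1 : ‖circleMap o (d / 4) t - zpt (u τ) j‖ < d / 2 := by
      have := norm_sub_le_norm_sub_add_norm_sub (circleMap o (d / 4) t) o (zpt (u τ) j)
      rw [norm_sub_rev o] at this
      linarith
    have hn2 : d / 4 - d / 32 < ‖circleMap o (d / 4) t - zpt (u τ) j‖ := by
      have := norm_sub_le_norm_sub_add_norm_sub (circleMap o (d / 4) t) (zpt (u τ) j) o
      linarith
    have hn3 : ‖z - zpt (u τ) j‖ < d / 16 + d / 32 := by
      have := norm_sub_le_norm_sub_add_norm_sub z o (zpt (u τ) j)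
      rw [norm_sub_rev o] at this
      linarith
    have hne : circleMap o (d / 4) t - zpt (u τ) j ≠ 0 := norm_pos_iff.1 (by linarith)
    have hinv : ContDiffAt ℝ 1 (fun q : ℝ × ℝ => (circleMap o (d / 4) q.2 - zpt (u q.1) j)⁻¹) (τ, t) :=
      (hγ.sub (contDiffAt_zpt hu' j)).inv hne
    refine hγ'.mul ((contDiffAt_kernelSeries _ ((contDiffAt_const.sub (contDiffAt_zpt hu' j)).mul hinv)
      ?_).mul (hinv.mul (Sep.contDiffAt_residKernel (d := d) hu' hγ h hn1 i)))
    rw [norm_mul, norm_inv, ← div_eq_mul_inv, div_lt_one (by linarith)]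
    linarith
  have h1 := differentiableAt_integral_sum (c := fun i s => Option.elim i (resid0 n α β (u s))
    (resid n α β (u s))) two_pi_pos.le (by rintro (_ | i); exacts [h0, hr i]) hΨ
  refine (h1.const_mul ((2 * π * I)⁻¹)).congr_of_eventuallyEq (.of_forall fun s => ?_)
  simp only [kLoc, kernelInt, circleIntegral, residLoc_eq_sum, smul_eq_mul, div_eq_mul_inv]
  congr 2
  ext t
  rw [mul_sum, mul_sum, mul_sum]
  exact sum_congr rfl fun i _ => by ring

/-! ### Dependence of the residues on the configuration -/

lemma hasDerivAt_update_apply (k i : ι) (τ : ℝ) :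
    HasDerivAt (fun s => update θ k s i) (if i = k then 1 else 0) τ := by
  by_cases h : i = k
  · subst h
    simp only [Function.update_self, if_true]
    exact hasDerivAt_id τ
  · simp only [Function.update_of_ne h, if_neg h]
    exact hasDerivAt_const _ _

lemma contDiff_update_apply (k i : ι) :
    ContDiff ℝ 1 (fun s => update θ k s i) := by
  by_cases h : i = k
  · subst h
    simpa using! contDiff_id
  · simpa [Function.update_of_ne h] using contDiff_const

lemma differentiableAt_zpt_update (k i : ι) (τ : ℝ) :
    DifferentiableAt ℝ (fun s => zpt (update θ k s) i) τ :=
  (contDiffAt_zpt (fun i => (contDiff_update_apply k i).contDiffAt) i).differentiableAt (by norm_num)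

lemma tendsto_update (k : ι) :
    Tendsto (fun τ => update θ k τ) (𝓝 (θ k)) (𝓝 θ) := by
  have : Continuous fun τ => update θ k τ := continuous_const.update k continuous_id
  simpa using this.tendsto (θ k)

section

variable (hα : Admissible α) (hinj : Injective (zpt θ)) (k : Fin (m + 1))
include hα hinj

lemma differentiableAt_resid0 :
    DifferentiableAt ℝ (fun s => resid0 n α β (update θ k s)) (θ k) :=
  (hasDerivAt_mom hα hinj k perC1_inv_ue).differentiableAt.const_mul _

lemma differentiableAt_cauchyT_update {z : ℂ} (hz : ‖z‖ ≠ 1) :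
    DifferentiableAt ℝ (fun s => cauchyT n α β (update θ k s) z) (θ k) :=
  (hasDerivAt_mom hα hinj k (perC1_inv_sub hz)).differentiableAt

lemma differentiableAt_ell_dq (l : ℕ) {c : ℝ → ℂ} (hc : DifferentiableAt ℝ c (θ k)) :
    DifferentiableAt ℝ (fun s => ell n α β (update θ k s) (dq (c s) (X ^ l))) (θ k) := by
  induction l with
  | zero =>
    simp only [pow_zero, ← C_1, dq_C, map_zero]
    exact differentiableAt_const _
  | succ l ih =>
    simp only [pow_succ, dq_mul, dq_X, mul_one, eval_X, map_add, ← smul_eq_C_mul, map_smul, smul_eq_mul]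
    exact (hasDerivAt_ell hα hinj k _).differentiableAt.add (hc.mul ih)

lemma differentiableAt_resid (j : ι) :
    DifferentiableAt ℝ (fun s => resid n α β (update θ k s) j) (θ k) := by
  set V : ℝ → Matrix ι ι ℂ := fun s => vandermonde (zpt (update θ k s)) with hV
  have hVd : ∀ i l, DifferentiableAt ℝ (fun s => V s i l) (θ k) := fun i l => by
    simp only [hV, vandermonde_apply]
    exact (differentiableAt_zpt_update k i _).pow _
  have h0 : (V (θ k)).det ≠ 0 := by
    simp only [hV, update_eq_self]
    exact det_vandermonde_ne_zero_iff.2 hinj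
  set r : ℝ → ι → ℂ := fun s l => ell n α β (update θ k s) (derivative (X ^ (l : ℕ))) +
    ∑ i, 2 * α i * ell n α β (update θ k s) (dq (zpt (update θ k s) i) (X ^ (l : ℕ))) +
    2 * lam n α β * ell n α β (update θ k s) (dq 0 (X ^ (l : ℕ))) -
    resid0 n α β (update θ k s) * (X ^ (l : ℕ) : ℂ[X]).eval 0 with hr
  have hrd : ∀ l, DifferentiableAt ℝ (fun s => r s l) (θ k) := fun l => by
    refine (((hasDerivAt_ell hα hinj k _).differentiableAt.add (DifferentiableAt.fun_sum fun i _ =>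
      (differentiableAt_ell_dq hα hinj k l (differentiableAt_zpt_update k i _)).const_mul _)).add
      ((differentiableAt_ell_dq hα hinj k l (differentiableAt_const _)).const_mul _)).sub
      ((differentiableAt_resid0 hα hinj k).mul_const _)
  have hev : ∀ᶠ s in 𝓝 (θ k), resid n α β (update θ k s) j = ∑ l, r s l * (V s)⁻¹ l j := by
    filter_upwards [(tendsto_update k).eventually (eventually_injective_zpt hinj)] with s hs
    have h1 : vecMul (resid n α β (update θ k s)) (V s) = r s := by
      ext l
      have h2 := ell_derivative_eq (n := n) (β := β) hα hs (X ^ (l : ℕ))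
      simp only [hr]
      rw [h2, sum_add_distrib, sum_neg_distrib, vecMul, dotProduct]
      simp only [hV, vandermonde_apply, eval_pow, eval_X]
      ring
    have h3 : IsUnit (V s).det := isUnit_iff_ne_zero.2 (det_vandermonde_ne_zero_iff.2 hs)
    have h4 : vecMul (r s) (V s)⁻¹ = resid n α β (update θ k s) := by
      rw [← h1, vecMul_vecMul, mul_nonsing_inv _ h3, vecMul_one]
    rw [← h4]
    rfl
  exact (DifferentiableAt.fun_sum fun l _ => (hrd l).mul
    (differentiableAt_inv_apply hVd h0 l j)).congr_of_eventuallyEq hev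

end

lemma exists_eventually_sep (hinj : Injective (zpt θ)) :
    ∃ d, Sep θ d ∧ ∀ᶠ θ' in 𝓝 θ, Sep θ' d := by
  obtain ⟨d, hd, h⟩ := exists_sep hinj
  have hm : min d 1 / 2 < d := by linarith [min_le_left d 1, lt_min hd one_pos]
  have hm0 : 0 < min d 1 / 2 := half_pos (lt_min hd one_pos)
  have hm1 : min d 1 / 2 ≤ 1 := by linarith [min_le_right d 1, lt_min hd one_pos]
  have hev : ∀ᶠ θ' in 𝓝 θ, Sep θ' (min d 1 / 2) := by
    have h1 : ∀ i j, i ≠ j → ∀ᶠ θ' : ι → ℝ in 𝓝 θ, min d 1 / 2 < ‖zpt θ' i - zpt θ' j‖ :=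
      fun i j hij => ((continuous_zpt i).sub (continuous_zpt j)).norm.continuousAt.eventually
        (lt_mem_nhds (hm.trans_le (h i j hij)))
    have h2 : ∀ᶠ θ' : ι → ℝ in 𝓝 θ, ∀ i j, i ≠ j → min d 1 / 2 < ‖zpt θ' i - zpt θ' j‖ :=
      eventually_all.2 fun i => eventually_all.2 fun j => by
        by_cases hij : i = j
        · exact .of_forall fun _ h => absurd hij h
        · exact (h1 i j hij).mono fun _ h _ => h
    exact h2.mono fun θ' h3 => ⟨hm0, hm1, fun i j hij => (h3 i j hij).le⟩
  exact ⟨_, hev.self_of_nhds, hev⟩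

lemma eventually_isConfiguration (hθ : IsConfiguration θ) : ∀ᶠ θ' in 𝓝 θ, IsConfiguration θ' := by
  have h1 : ∀ᶠ θ' : ι → ℝ in 𝓝 θ, ∀ i j, i < j → θ' i < θ' j :=
    eventually_all.2 fun i => eventually_all.2 fun j => by
      by_cases hij : i < j
      · exact ((continuous_apply i).continuousAt.eventually_lt (continuous_apply j).continuousAt
          (hθ.1 hij)).mono fun _ h _ => h
      · exact .of_forall fun _ h => absurd h hij
  have h2 : ∀ᶠ θ' : ι → ℝ in 𝓝 θ, θ' (Fin.last m) < θ' 0 + 2 * π :=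
    (continuous_apply (Fin.last m)).continuousAt.eventually_lt
      ((continuous_apply 0).add continuous_const).continuousAt hθ.2
  filter_upwards [h1, h2] with θ' h3 h4 using ⟨fun i j hij => h3 i j hij, h4⟩

lemma hasDerivAt_log_mul_ue_neg {z : ℂ} {s : ℝ} (h : z * ue (-s) ∈ slitPlane) :
    HasDerivAt (fun s : ℝ => log (z * ue (-s)) + s * I) 0 s := by
  have h1 : HasDerivAt (fun s : ℝ => ue (-s)) (-(I * ue (-s))) s := by
    refine ((hasDerivAt_ue (-s)).scomp s (hasDerivAt_neg s)).congr_deriv ?_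
    simp
  refine (((h1.const_mul z).clog_real h).add ((ofRealCLM.hasDerivAt (x := s)).mul_const I)).congr_deriv ?_
  have h2 := slitPlane_ne_zero h
  have h3 : z ≠ 0 := left_ne_zero_of_mul h2
  have h4 := ue_ne_zero (-s)
  simp only [ofRealCLM_apply, ofReal_one]
  field_simp
  ring

lemma hasDerivAt_log_one_sub_mul_ue_neg {z : ℂ} {s : ℝ} (h : 1 - z * ue (-s) ∈ slitPlane) :
    HasDerivAt (fun s : ℝ => log (1 - z * ue (-s)) + (s + π) * I) (I * ue s / (ue s - z)) s := by
  have h1 : HasDerivAt (fun s : ℝ => ue (-s)) (-(I * ue (-s))) s := by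
    refine ((hasDerivAt_ue (-s)).scomp s (hasDerivAt_neg s)).congr_deriv ?_
    simp
  refine ((((h1.const_mul z).const_sub 1).clog_real h).add
    (((ofRealCLM.hasDerivAt (x := s)).add_const (π : ℂ)).mul_const I)).congr_deriv ?_
  have h2 := slitPlane_ne_zero h
  have h3 : 1 - z * ue (-s) = ue (-s) * (ue s - z) := by linear_combination -ue_neg_mul s
  rw [h3] at h2 ⊢
  have h4 := right_ne_zero_of_mul h2
  have h5 := ue_neg_mul s
  have h6 := ue_ne_zero (-s)
  simp only [ofRealCLM_apply, ofReal_one]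
  field_simp
  linear_combination (0 : ℂ) * h5

lemma hasDerivAt_comp_update {f : ℝ → ℂ} {f' : ℂ} {k i : ι} (h : HasDerivAt f f' (θ i)) :
    HasDerivAt (fun s => f (update θ k s i)) (if i = k then f' else 0) (θ k) := by
  have h1 : HasDerivAt f f' (update θ k (θ k) i) := by rwa [update_eq_self]
  refine (h1.scomp (θ k) (hasDerivAt_update_apply k i (θ k))).congr_deriv ?_
  split_ifs <;> simp

lemma Sep.hasDerivAt_eLog_update {d : ℝ} (h : Sep θ d) {j : ι} {z : ℂ}
    (hz : ‖z - zpt θ j‖ < d / 2) (k : ι) :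
    HasDerivAt (fun s => eLog n α β (update θ k s) j z)
      (if k = j then 0 else α k * (I * zpt θ k / (zpt θ k - z))) (θ k) := by
  have h1 := (hasDerivAt_comp_update (k := k)
    (hasDerivAt_log_mul_ue_neg (mul_ue_mem_slitPlane (h.lt_one hz)))).const_mul (lam n α β)
  have h2 := HasDerivAt.fun_sum (u := univ.erase j) fun i hi =>
    (hasDerivAt_comp_update (k := k) (hasDerivAt_log_one_sub_mul_ue_neg
      (h.one_sub_mem (ne_of_mem_erase hi) hz))).const_mul (α i)
  refine (h1.add h2).congr_deriv ?_
  simp only [ite_self, mul_zero, zero_add, mul_ite]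
  rw [sum_ite_eq']
  simp only [mem_erase, mem_univ, and_true, zpt_eq]
  by_cases hkj : k = j <;> simp [hkj]

/-- The logarithm of `h` at `0`, without the singular term. -/
def eZero (α : ι → ℂ) (θ : ι → ℝ) (z : ℂ) : ℂ :=
  ∑ j, α j * (log (1 - z * ue (-θ j)) + (θ j + π) * I)

lemma one_sub_mem_of_norm_lt {z : ℂ} (hz : ‖z‖ < 1) (t : ℝ) : 1 - z * ue t ∈ slitPlane := by
  refine one_sub_mem_slitPlane (by rw [norm_mul, norm_ue, mul_one]; exact hz.le) fun h => ?_
  have := congrArg norm h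
  rw [norm_mul, norm_ue, mul_one, norm_one] at this
  exact hz.ne this

lemma hasDerivAt_eZero_update {z : ℂ} (hz : ‖z‖ < 1) (k : ι) :
    HasDerivAt (fun s => eZero α (update θ k s) z)
      (α k * (I * zpt θ k / (zpt θ k - z))) (θ k) := by
  have h2 := HasDerivAt.fun_sum (u := univ) fun i _ =>
    (hasDerivAt_comp_update (k := k) (hasDerivAt_log_one_sub_mul_ue_neg
      (one_sub_mem_of_norm_lt hz (-θ i)))).const_mul (α i)
  refine h2.congr_deriv ?_
  simp only [mul_ite, mul_zero]
  rw [sum_ite_eq']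
  simp [zpt_eq]

lemma hLog_eq_eZero {z : ℂ} (hz : ‖z‖ < 1) :
    hLog n α β θ z = lam n α β * logFrom (θ 0) z + eZero α θ z := by
  rw [hLog, eZero, sum_congr rfl fun i _ => by
    rw [logFrom_sub_eq (one_sub_mem_of_norm_lt hz (-θ i))]]

lemma differentiableAt_eZero {z : ℂ} (hz : ‖z‖ < 1) : DifferentiableAt ℂ (eZero α θ) z :=
  DifferentiableAt.fun_sum fun i _ => ((((differentiableAt_id.mul_const _).const_sub 1).clog
    (one_sub_mem_of_norm_lt hz (-θ i))).add_const _).const_mul _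

lemma Sep.differentiableAt_gLoc_update {d : ℝ} (h : ∀ᶠ θ' in 𝓝 θ, Sep θ' d) (hθ : IsConfiguration θ)
    (hα : Admissible α) {j : ι}
    (ha : NonResonant (α j)) (k : ι) :
    DifferentiableAt ℝ
      (fun s => gLoc n α β (update θ k s) (zpt θ j) d j (zpt θ j)) (θ k) := by
  have hs := h.self_of_nhds
  have hd := hs.1
  have hd1 := hs.2.1
  have hinj := hs.injective
  have hclose : ∀ᶠ θ' : ι → ℝ in 𝓝 θ, ‖zpt θ' j - zpt θ j‖ < d / 512 := by
    have : ContinuousAt (fun θ' : ι → ℝ => ‖zpt θ' j - zpt θ j‖) θ :=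
      ((continuous_zpt j).sub continuous_const).norm.continuousAt
    refine this.eventually (gt_mem_nhds ?_)
    simpa using hd
  have hupd : update θ k (θ k) = θ := update_eq_self k θ
  have hu : ∀ i, ContDiffAt ℝ 1 (fun s => update θ k s i) (θ k) := fun i =>
    (contDiff_update_apply k i).contDiffAt
  have hk : ∀ z, ‖z - zpt θ j‖ < d / 16 →
      DifferentiableAt ℝ (fun s => kLoc n α β (update θ k s) (zpt θ j) d j z) (θ k) :=
    fun z hz => Sep.differentiableAt_kLoc hu (by rwa [hupd]) (by rw [hupd, sub_self, norm_zero]; linarith)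
      hz (differentiableAt_resid0 hα hinj k) (differentiableAt_resid hα hinj k)
  have hE : ∀ z, ‖z - zpt θ j‖ < d / 2 →
      DifferentiableAt ℝ (fun s => eLog n α β (update θ k s) j z) (θ k) :=
    fun z hz => (hs.hasDerivAt_eLog_update hz k).differentiableAt
  have hz0 : ‖zpt θ j - zpt θ j‖ < d / 16 := by rw [sub_self, norm_zero]; linarith
  have hc : DifferentiableAt ℝ (fun s => locConst n α β (update θ k s) (zpt θ j) d j) (θ k) := by
    have hall := (tendsto_update k).eventually
      ((h.and hclose).and (eventually_isConfiguration hθ))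
    by_cases h0 : α j = 0
    · set z : ℂ := ((1 - d / 512 : ℝ) : ℂ) * zpt θ j with hz
      have hzn : ‖z‖ = 1 - d / 512 := by
        rw [hz, norm_mul, zpt_eq, norm_ue, mul_one, norm_real, norm_of_nonneg (by linarith)]
      have hzd : ‖z - zpt θ j‖ = d / 512 := by
        have : z - zpt θ j = ((-(d / 512) : ℝ) : ℂ) * zpt θ j := by rw [hz]; push_cast; ring
        rw [this, norm_mul, zpt_eq, norm_ue, mul_one, norm_real, norm_neg,
          norm_of_nonneg (by linarith)]
      have hz1 : ‖z‖ < 1 := by rw [hzn]; linarith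
      have hl : DifferentiableAt ℝ (fun s => log (1 - z * ue (-update θ k s j)) +
          (update θ k s j + π) * I) (θ k) :=
        (hasDerivAt_comp_update (k := k) (i := j)
          (hasDerivAt_log_one_sub_mul_ue_neg (one_sub_mem_of_norm_lt hz1 _))).differentiableAt
      have hmain : DifferentiableAt ℝ (fun s => cauchyT n α β (update θ k s) z *
          exp (-(2 * eLog n α β (update θ k s) j z)) -
          (dConst α β j / (2 * π * I) * (log (1 - z * ue (-update θ k s j)) +
          (update θ k s j + π) * I) + sConst α β j * exp (2 * π * I * β j)) -
          kLoc n α β (update θ k s) (zpt θ j) d j z) (θ k) :=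
        (((differentiableAt_cauchyT_update hα hinj k hz1.ne).mul
          (((hE z (by linarith)).const_mul 2).neg.cexp)).sub
          ((hl.const_mul _).add_const _)).sub (hk z (by linarith))
      refine hmain.congr_of_eventuallyEq ?_
      filter_upwards [hall] with s hs'
      obtain ⟨⟨h1, h2⟩, h3⟩ := hs'
      have h4 := h1.cauchyT_eq_gLoc (n := n) (β := β) h3 hα ha (h2.trans (by linarith))
        (z := z) (by
          rw [mem_ball_iff_norm]
          have := norm_sub_le_norm_sub_add_norm_sub z (zpt θ j) (zpt (update θ k s) j)
          rw [norm_sub_rev (zpt θ j)] at this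
          linarith) hz1.ne (by
          rintro ⟨r, hr, hr'⟩
          rw [hr', norm_mul, zpt_eq, norm_ue, mul_one, norm_real,
            norm_of_nonneg (by linarith)] at hz1
          linarith)
      rw [if_pos h0, gLoc, logFrom_sub_eq (one_sub_mem_of_norm_lt hz1 _), cConst,
        if_neg (not_not.2 h0), if_pos hz1] at h4
      rw [h4]
      have h5 : exp (2 * eLog n α β (update θ k s) j z) *
          exp (-(2 * eLog n α β (update θ k s) j z)) = 1 := by
        rw [← exp_add, add_neg_cancel, exp_zero]
      linear_combination (-(kLoc n α β (update θ k s) (zpt θ j) d j z +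
        locConst n α β (update θ k s) (zpt θ j) d j +
        (dConst α β j / (2 * π * I) * (log (1 - z * ue (-update θ k s j)) +
          (update θ k s j + π) * I) + sConst α β j * exp (2 * π * I * β j)))) * h5
    · refine (differentiableAt_const (0 : ℂ)).congr_of_eventuallyEq ?_
      filter_upwards [hall] with s hs'
      obtain ⟨⟨h1, h2⟩, h3⟩ := hs'
      exact (h1.locConst_spec (n := n) (β := β) h3 hα ha (h2.trans (by linarith))).1 h0
  exact ((hE _ (by linarith)).const_mul 2).cexp.mul ((hk _ hz0).add hc)

/-! ### The scalar factors as a matrix with explicit jumps -/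

/-- The matrix `U(G) h ^ σ₃`. -/
def psiMat (n : ℕ) (α β : ι → ℂ) (θ : ι → ℝ) (z : ℂ) : Mat :=
  upper (cauchyT n α β θ z) * expSigma3 (hLog n α β θ z)

lemma det_psiMat (z : ℂ) : (psiMat n α β θ z).det = 1 := by
  rw [psiMat, det_mul, det_upper, det_expSigma3, one_mul]

lemma continuous_upper : Continuous upper := by
  refine continuous_matrix fun i j => ?_
  fin_cases i <;> fin_cases j <;> simp [upper] <;> fun_prop

lemma continuous_expSigma3 : Continuous expSigma3 := by
  refine continuous_matrix fun i j => ?_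
  fin_cases i <;> fin_cases j <;> simp [expSigma3] <;> fun_prop

lemma hasJump_psiMat_circle (hα : Admissible α) (hθ : IsConfiguration θ)
    {j : ι} {p : ℂ} (hp : p ∈ sphere (0 : ℂ) 1 ∩ sector θ j) :
    HasJump (psiMat n α β θ) {z | ‖z‖ < 1} {z | 1 < ‖z‖} p (upper (sConst α β j)) := by
  obtain ⟨t, rfl⟩ : ∃ t, ue t = p := by
    refine ⟨arg p, ?_⟩
    have := norm_mul_exp_arg_mul_I p
    rw [mem_sphere_zero_iff_norm.1 hp.1, ofReal_one, one_mul] at this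
    exact this
  obtain ⟨s, hs, ht⟩ : ∃ s, ue s = ue t ∧ s ∈ Set.Ioo (θ j) (nextAngle θ j) := by
    have h1 := hp.2.2
    rw [argFrom_ue] at h1
    exact ⟨_, ue_toIcoMod _ _, h1⟩
  rw [← hs]
  clear hp hs
  clear t
  rename' s => t
  obtain ⟨W, c, hW, h1, h2⟩ := exists_arc_local (n := n) (β := β) hα hθ ht
  have hH := (hasDerivAt_hLog (n := n) (α := α) (β := β) (cutFree_of_mem_arc hθ ht)).continuousAt
  have key : ∀ (c : ℂ) (S : Set ℂ), (∀ᶠ z in 𝓝 (ue t), z ∈ S → cauchyT n α β θ z =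
      exp (2 * hLog n α β θ z) * (W z + c)) → Tendsto (psiMat n α β θ) (𝓝[S] (ue t))
      (𝓝 (upper (exp (2 * hLog n α β θ (ue t)) * (W (ue t) + c)) * expSigma3 (hLog n α β θ (ue t)))) := by
    intro c S hS
    have h3 : ContinuousAt (fun z => upper (exp (2 * hLog n α β θ z) * (W z + c)) *
        expSigma3 (hLog n α β θ z)) (ue t) :=
      (continuous_upper.continuousAt.comp ((continuousAt_const.mul hH).cexp.mul
        (hW.add continuousAt_const))).mul (continuous_expSigma3.continuousAt.comp hH)
    refine (h3.mono_left nhdsWithin_le_nhds).congr' ?_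
    filter_upwards [eventually_nhdsWithin_iff.2 hS] with z hz
    rw [psiMat, hz]
  refine ⟨_, _, key _ _ h1, key _ _ h2, ?_⟩
  rw [mul_assoc, expSigma3_mul_upper, ← mul_assoc, upper_mul_upper]
  congr 2
  ring

lemma hasJump_psiMat_of_hLog (hα : Admissible α) (hinj : Injective (zpt θ))
    {p : ℂ} (hp : ‖p‖ ≠ 1) {φ : ℝ} {H : ℂ → ℂ} {q : ℂ} (hH : ContinuousAt H p)
    (h1 : ∀ᶠ z in 𝓝 p, z ∈ leftOf φ → hLog n α β θ z = H z)
    (h2 : ∀ᶠ z in 𝓝 p, z ∈ rightOf φ → hLog n α β θ z = H z + q) :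
    HasJump (psiMat n α β θ) (leftOf φ) (rightOf φ) p (expSigma3 (-q)) := by
  have hG := (hasDerivAt_cauchyT (n := n) (β := β) hα hinj hp).continuousAt
  have key : ∀ (c : ℂ) (S : Set ℂ), (∀ᶠ z in 𝓝 p, z ∈ S → hLog n α β θ z = H z + c) →
      Tendsto (psiMat n α β θ) (𝓝[S] p)
        (𝓝 (upper (cauchyT n α β θ p) * expSigma3 (H p + c))) := by
    intro c S hS
    have h3 : ContinuousAt (fun z => upper (cauchyT n α β θ z) * expSigma3 (H z + c)) p :=
      (continuous_upper.continuousAt.comp hG).mul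
        (continuous_expSigma3.continuousAt.comp (hH.add continuousAt_const))
    refine (h3.mono_left nhdsWithin_le_nhds).congr' ?_
    filter_upwards [eventually_nhdsWithin_iff.2 hS] with z hz
    rw [psiMat, hz]
  refine ⟨_, _, key 0 _ (by simpa using h1), key q _ h2, ?_⟩
  rw [mul_assoc, expSigma3_mul]
  congr 2
  ring

/-- The logarithm of `z` continued across the ray of `z_0`. -/
lemma logFrom_of_left {φ : ℝ} {z : ℂ} (h : z ∈ leftOf φ) : logFrom φ z = log (z * ue (-φ)) + φ * I := by
  rw [mem_leftOf] at h
  exact logFrom_of_nonneg (fun h0 => by simp [h0] at h) h.le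

lemma logFrom_of_right {φ : ℝ} {z : ℂ} (h : z ∈ rightOf φ) :
    logFrom φ z = log (z * ue (-φ)) + φ * I + 2 * π * I := by
  rw [mem_rightOf] at h
  exact logFrom_of_neg (fun h0 => by simp [h0] at h) h

lemma ray_mul_ue (j : ι) (r : ℝ) : (r : ℂ) * zpt θ j * ue (-θ j) = r := by
  rw [mul_assoc, zpt_eq, mul_comm (ue _), ue_neg_mul, mul_one]

lemma one_sub_ray_mem (hinj : Injective (zpt θ)) {i j : ι} (hij : i ≠ j) {r : ℝ}
    (hr : 0 < r) : 1 - (r : ℂ) * zpt θ j * ue (-θ i) ∈ slitPlane := by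
  by_contra hn
  obtain ⟨s, hs, h1⟩ := eq_ofReal_of_notMem_slitPlane hn
  have h2 : (r : ℂ) * zpt θ j = ((1 - s : ℝ) : ℂ) * zpt θ i :=
    eq_mul_ue_of (by push_cast; rw [← h1]; ring)
  have h3 := congrArg norm h2
  rw [norm_mul, norm_mul, zpt_eq, zpt_eq, norm_ue, norm_ue, mul_one, mul_one, norm_real, norm_real,
    norm_of_nonneg hr.le, norm_of_nonneg (by linarith)] at h3
  rw [← h3] at h2
  exact hij (hinj (mul_left_cancel₀ (ofReal_ne_zero.2 hr.ne') h2)).symm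

lemma neg_ray_mem (hinj : Injective (zpt θ)) {j : ι} (hj : j ≠ 0) {r : ℝ}
    (hr : 0 < r) : -((r : ℂ) * zpt θ j * ue (-θ 0)) ∈ slitPlane := by
  by_contra hn
  obtain ⟨s, hs, h1⟩ := eq_ofReal_of_notMem_slitPlane hn
  have h2 : (r : ℂ) * zpt θ j = ((-s : ℝ) : ℂ) * zpt θ 0 :=
    eq_mul_ue_of (by push_cast; rw [← h1]; ring)
  have h3 := congrArg norm h2
  rw [norm_mul, norm_mul, zpt_eq, zpt_eq, norm_ue, norm_ue, mul_one, mul_one, norm_real, norm_real,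
    norm_of_nonneg hr.le, norm_of_nonneg (by linarith)] at h3
  rw [← h3] at h2
  exact hj (hinj (mul_left_cancel₀ (ofReal_ne_zero.2 hr.ne') h2))

lemma continuousAt_logFrom_sub {j : ι} {z : ℂ} (h : 1 - z * ue (-θ j) ∈ slitPlane) :
    ContinuousAt (fun z => logFrom (θ j) (z - zpt θ j)) z := (hasDerivAt_logFrom_sub h).continuousAt

lemma continuousAt_log_mul_ue (φ : ℝ) {z : ℂ} (h : z * ue (-φ) ∈ slitPlane) :
    ContinuousAt (fun z => log (z * ue (-φ)) + φ * I) z :=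
  ((hasDerivAt_log_mul_ue h).continuousAt).add continuousAt_const

lemma continuousAt_rayLog (j : ι) {r : ℝ} (hr : 1 < r) :
    ContinuousAt (rayLog θ j) ((r : ℂ) * zpt θ j) := by
  refine ContinuousAt.add (ContinuousAt.clog (by fun_prop) ?_) continuousAt_const
  have : ((r : ℂ) * zpt θ j - zpt θ j) * ue (-θ j) = ((r - 1 : ℝ) : ℂ) := by
    rw [sub_mul, ray_mul_ue, zpt_eq, mul_comm (ue _), ue_neg_mul]; push_cast; ring
  rw [this, ofReal_mem_slitPlane]
  linarith

lemma norm_ray (j : ι) {r : ℝ} (hr : 0 < r) : ‖(r : ℂ) * zpt θ j‖ = r := by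
  rw [norm_mul, zpt_eq, norm_ue, mul_one, norm_real, norm_of_nonneg hr.le]

lemma hasJump_psiMat_ray (hα : Admissible α) (hinj : Injective (zpt θ))
    {j : ι} (hj : j ≠ 0) {p : ℂ} (hp : p ∈ openRay θ j) :
    HasJump (psiMat n α β θ) (leftOf (θ j)) (rightOf (θ j)) p
      (expSigma3 (-(2 * π * I * α j))) := by
  obtain ⟨r, hr, rfl⟩ := hp
  have hr0 : 0 < r := by linarith
  refine hasJump_psiMat_of_hLog hα hinj (by rw [norm_ray j hr0]; exact hr.ne')
    (H := fun z => lam n α β * logFrom (θ 0) z + (α j * rayLog θ j z +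
      ∑ i ∈ univ.erase j, α i * logFrom (θ i) (z - zpt θ i))) ?_
    (.of_forall fun z hz => ?_) (.of_forall fun z hz => ?_)
  · refine (continuousAt_const.mul (hasDerivAt_logFrom (neg_ray_mem hinj hj hr0)).continuousAt).add
      ((continuousAt_const.mul (continuousAt_rayLog j hr)).add (tendsto_finsetSum _ fun i hi => ?_))
    exact continuousAt_const.mul (continuousAt_logFrom_sub
      (one_sub_ray_mem hinj (ne_of_mem_erase hi) hr0))
  · rw [hLog, ← add_sum_erase _ _ (mem_univ j), logFrom_sub_of_left hz]
  · rw [hLog, ← add_sum_erase _ _ (mem_univ j), logFrom_sub_of_right hz]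
    ring

lemma hasJump_psiMat_ray_zero (hα : Admissible α)
    (hinj : Injective (zpt θ)) {p : ℂ} (hp : p ∈ openRay θ 0) :
    HasJump (psiMat n α β θ) (leftOf (θ 0)) (rightOf (θ 0)) p
      (expSigma3 (-(2 * π * I * (α 0 + lam n α β)))) := by
  obtain ⟨r, hr, rfl⟩ := hp
  have hr0 : 0 < r := by linarith
  refine hasJump_psiMat_of_hLog hα hinj (by rw [norm_ray 0 hr0]; exact hr.ne')
    (H := fun z => lam n α β * (log (z * ue (-θ 0)) + θ 0 * I) + (α 0 * rayLog θ 0 z +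
      ∑ i ∈ univ.erase 0, α i * logFrom (θ i) (z - zpt θ i))) ?_
    (.of_forall fun z hz => ?_) (.of_forall fun z hz => ?_)
  · refine (continuousAt_const.mul (continuousAt_log_mul_ue _ (by
      rwa [ray_mul_ue, ofReal_mem_slitPlane]))).add
      ((continuousAt_const.mul (continuousAt_rayLog 0 hr)).add (tendsto_finsetSum _ fun i hi => ?_))
    exact continuousAt_const.mul (continuousAt_logFrom_sub
      (one_sub_ray_mem hinj (ne_of_mem_erase hi) hr0))
  · rw [hLog, ← add_sum_erase _ _ (mem_univ 0), logFrom_sub_of_left hz, logFrom_of_left hz]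
  · rw [hLog, ← add_sum_erase _ _ (mem_univ 0), logFrom_sub_of_right hz, logFrom_of_right hz]
    ring

lemma hasJump_psiMat_segment (hα : Admissible α)
    (hinj : Injective (zpt θ)) {p : ℂ} (hp : p ∈ openSegment0 θ) :
    HasJump (psiMat n α β θ) (leftOf (θ 0)) (rightOf (θ 0)) p
      (expSigma3 (-(2 * π * I * lam n α β))) := by
  obtain ⟨r, hr0, hr, rfl⟩ := hp
  have hn := norm_ray (θ := θ) 0 hr0
  refine hasJump_psiMat_of_hLog hα hinj (by rw [hn]; exact hr.ne)
    (H := fun z => lam n α β * (log (z * ue (-θ 0)) + θ 0 * I) +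
      ∑ i, α i * logFrom (θ i) (z - zpt θ i)) ?_
    (.of_forall fun z hz => ?_) (.of_forall fun z hz => ?_)
  · refine (continuousAt_const.mul (continuousAt_log_mul_ue _ (by
      rwa [ray_mul_ue, ofReal_mem_slitPlane]))).add (tendsto_finsetSum _ fun i _ => ?_)
    exact continuousAt_const.mul (continuousAt_logFrom_sub
      (one_sub_mem_of_norm_lt (by rw [hn]; exact hr) _))
  · rw [hLog, logFrom_of_left hz]
  · rw [hLog, logFrom_of_right hz]
    ring

/-! ### Behaviour at infinity -/

lemma logFrom_sub_of_one_lt {φ t : ℝ} (ht : t - φ ∈ Set.Ioo 0 (2 * π)) {r : ℝ} (hr : 1 < r) :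
    logFrom φ (r * ue t - ue φ) = Real.log r + t * I + log (1 - ue φ / (r * ue t)) := by
  have hr0 : 0 < r := by linarith
  set w : ℂ := 1 - ue φ / (r * ue t) with hw
  have hw1 : ue φ / (r * ue t) = ue (φ - t) / r := by rw [ue_sub, div_div, mul_comm]
  have hn : ‖ue (φ - t) / r‖ < 1 := by
    rw [norm_div, norm_ue, norm_real, norm_of_nonneg hr0.le, div_lt_one hr0]
    exact hr
  have hre : 0 < w.re := by
    have := (re_le_norm (ue (φ - t) / r)).trans_lt hn
    rw [hw, hw1, sub_re, one_re]
    linarith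
  have hw0 : w ≠ 0 := fun h => by simp [h] at hre
  have hη := abs_lt.1 (abs_arg_lt_pi_div_two_iff.2 (.inl hre))
  have him : ‖w‖ * Real.sin (arg w + (t - φ)) = Real.sin (t - φ) := by
    have e1 : (‖w‖ : ℂ) * ue (arg w + (t - φ)) = ue (t - φ) - ((1 / r : ℝ) : ℂ) := by
      have h2 : (‖w‖ : ℂ) * ue (arg w) = w := norm_mul_exp_arg_mul_I w
      rw [ue_add, ← mul_assoc, h2, hw, hw1, sub_mul, one_mul, div_mul_eq_mul_div, ← ue_add,
        sub_add_sub_cancel, sub_self, ue_zero]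
      push_cast
      rfl
    have e2 := congrArg im e1
    rwa [im_ofReal_mul, sub_im, ofReal_im, sub_zero, ue, exp_ofReal_mul_I_im, ue,
      exp_ofReal_mul_I_im] at e2
  have hpos : 0 < ‖w‖ := norm_pos_iff.2 hw0
  have hmem : t + arg w ∈ Set.Ico φ (φ + 2 * π) := by
    obtain ⟨h0, h2⟩ := ht
    have hsgn : Real.sin (arg w + (t - φ)) = Real.sin (t - φ) / ‖w‖ := by rw [← him]; field_simp
    rcases lt_trichotomy (t - φ) π with h | h | h
    · have h3 : 0 < Real.sin (arg w + (t - φ)) := by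
        rw [hsgn]; exact div_pos (Real.sin_pos_of_pos_of_lt_pi h0 h) hpos
      constructor
      · by_contra hc
        have := Real.sin_nonpos_of_nonpos_of_neg_pi_le (x := arg w + (t - φ)) (by linarith)
          (by linarith)
        linarith
      · linarith
    · constructor <;> linarith [hη.1, hη.2, Real.pi_pos]
    · have h3 : Real.sin (arg w + (t - φ)) < 0 := by
        rw [hsgn]
        refine div_neg_of_neg_of_pos ?_ hpos
        rw [← Real.sin_sub_two_pi]
        exact Real.sin_neg_of_neg_of_neg_pi_lt (by linarith) (by linarith)
      constructor
      · linarith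
      · by_contra hc
        have := Real.sin_nonneg_of_nonneg_of_le_pi (x := arg w + (t - φ) - 2 * π) (by linarith)
          (by linarith)
        rw [Real.sin_sub_two_pi] at this
        linarith
  have hz : (r : ℂ) * ue t - ue φ = r * w * ue t := by
    have : (r : ℂ) ≠ 0 := ofReal_ne_zero.2 hr0.ne'
    rw [hw]
    field_simp [ue_ne_zero]
  obtain ⟨k, hk⟩ := arg_mul_ue (r * w) (mul_ne_zero (ofReal_ne_zero.2 hr0.ne') hw0) t
  rw [arg_real_mul _ hr0] at hk
  rw [hz, logFrom, argFrom_eq hmem (k := k) (by rw [hk]; ring), norm_mul, norm_mul, norm_ue, mul_one,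
    norm_real, norm_of_nonneg hr0.le, Real.log_mul hr0.ne' hpos.ne', log]
  push_cast
  ring

/-- The part of `h` that tends to `1` at infinity, logarithmically. -/
def eInf (α : ι → ℂ) (θ : ι → ℝ) (z : ℂ) : ℂ := ∑ i, α i * log (1 - zpt θ i / z)

lemma eq_norm_mul_ue_argFrom (φ : ℝ) (z : ℂ) : z = ‖z‖ * ue (argFrom φ z) := by
  rw [argFrom, ue_toIcoMod]
  exact (norm_mul_exp_arg_mul_I z).symm

lemma exists_sector {z : ℂ} (hz : z ∉ contour θ) (hz1 : 1 < ‖z‖) :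
    ∃ j, z ∈ sector θ j := by
  have hz0 : z ≠ 0 := fun h => hz (.inl (.inr (.inl h)))
  obtain ⟨j, h | h⟩ := exists_arc (toIcoMod_mem_Ico two_pi_pos (θ 0) (arg z))
  · refine absurd (.inr (Set.mem_iUnion.2 ⟨j, ‖z‖, hz1, ?_⟩)) hz
    rw [zpt_eq, ← h]
    exact eq_norm_mul_ue_argFrom (θ 0) z
  · exact ⟨j, hz0, h⟩

lemma hLog_of_mem_sector (hθ : IsConfiguration θ) {j : ι} {z : ℂ} (hz : z ∈ sector θ j)
    (hz1 : 1 < ‖z‖) : hLog n α β θ z = expInfty n α β * logFrom (θ 0) z +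
      2 * π * I * ∑ k ∈ Ioi j, α k + (eInf α θ z - n * logFrom (θ 0) z) := by
  have hzt := eq_norm_mul_ue_argFrom (θ 0) z
  have key : ∀ i, logFrom (θ i) (z - zpt θ i) = logFrom (θ 0) z +
      (if i ∈ Ioi j then 2 * π * I else 0) + log (1 - zpt θ i / z) := by
    intro i
    have h1 := mem_Ioo_of_mem_arc hθ hz.2 i
    by_cases hi : i ≤ j
    · rw [if_pos hi] at h1
      have := logFrom_sub_of_one_lt (φ := θ i) (t := argFrom (θ 0) z) (by simpa using h1) hz1
      rw [← hzt] at this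
      rw [if_neg (by simpa using hi), zpt_eq, this, logFrom]
      ring
    · rw [if_neg hi] at h1
      have := logFrom_sub_of_one_lt (φ := θ i) (t := argFrom (θ 0) z + 2 * π)
        (by push_cast at h1; constructor <;> linarith [h1.1, h1.2]) hz1
      rw [ue_periodic, ← hzt] at this
      rw [if_pos (by simpa using hi), zpt_eq, this, logFrom]
      push_cast
      ring
  have hsum : ∑ i, α i * (if i ∈ Ioi j then 2 * π * I else 0) = 2 * π * I * ∑ k ∈ Ioi j, α k := by
    simp only [mul_ite, mul_zero, sum_ite_mem, univ_inter]
    rw [mul_sum]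
    exact sum_congr rfl fun i _ => by ring
  rw [hLog, eInf, ← hsum, lam, expInfty]
  simp only [key, mul_add, sum_add_distrib, ← sum_mul, ← sum_div, sum_sub_distrib]
  ring

/-! ### Asymptotics at infinity -/

lemma isBigO_mom_inv_sub (hα : Admissible α) (hinj : Injective (zpt θ))
    {u : ℝ → ℂ} (hu : PerC1 u) :
    (fun z => mom n α β θ fun t => u t * (ue t - z)⁻¹) =O[cobounded ℂ] fun z => z⁻¹ := by
  refine Asymptotics.IsBigO.of_bound (‖(2 * π : ℂ)⁻¹‖ * (2 *
    ∫ t in (0 : ℝ)..(2 * π), ‖u t * (ue t * weight n α β θ t)‖)) ?_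
  filter_upwards [eventually_ge_norm 2] with z hz
  rw [mom, norm_mul, mul_assoc]
  refine mul_le_mul_of_nonneg_left ?_ (norm_nonneg _)
  have hi := (hu.integrable_mom (n := n) (β := β) hα hinj).norm
  rw [mul_right_comm, ← integral_const_mul]
  refine norm_integral_le_of_norm_le (by positivity) (.of_forall fun t _ => ?_)
    (hi.const_mul _)
  have h1 : ‖z‖ / 2 ≤ ‖ue t - z‖ := by
    have := norm_sub_norm_le z (ue t)
    rw [norm_ue, norm_sub_rev] at this
    linarith
  have h2 : ‖(ue t - z)⁻¹‖ ≤ 2 * ‖z⁻¹‖ := by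
    rw [norm_inv, norm_inv, ← div_eq_mul_inv, inv_le_comm₀ (by linarith) (by positivity), inv_div]
    exact h1
  rw [mul_right_comm, norm_mul _ (ue t - z)⁻¹, mul_comm]
  exact mul_le_mul_of_nonneg_right h2 (norm_nonneg _)

lemma isBigO_inv_one : (fun z : ℂ => z⁻¹) =O[cobounded ℂ] fun _ => (1 : ℂ) :=
  (tendsto_inv₀_cobounded (α := ℂ)).isBigO_one ℂ

lemma isBigO_log_one_sub (c : ℂ) :
    (fun z => log (1 - c / z)) =O[cobounded ℂ] fun z : ℂ => z⁻¹ := by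
  have h1 : (fun w : ℂ => log (1 - c * w)) =O[𝓝 0] fun w => w := by
    have h : HasDerivAt (fun w : ℂ => log (1 - c * w)) (-c / (1 - c * 0)) 0 := by
      refine (((hasDerivAt_id (0 : ℂ)).const_mul c).const_sub 1).clog (by simp) |>.congr_deriv ?_
      simp
    simpa using h.isBigO_sub
  exact h1.comp_tendsto (tendsto_inv₀_cobounded (α := ℂ))

lemma isBigO_eInf : eInf α θ =O[cobounded ℂ] fun z => z⁻¹ :=
  .fun_sum fun _ _ => (isBigO_log_one_sub _).const_mul_left _

lemma tendsto_eInf : Tendsto (eInf α θ) (cobounded ℂ) (𝓝 0) :=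
  isBigO_eInf.trans_tendsto tendsto_inv₀_cobounded

lemma isBigO_exp_eInf_sub_one (c : ℂ) :
    (fun z => exp (c * eInf α θ z) - 1) =O[cobounded ℂ] fun z => z⁻¹ := by
  have h1 : (fun w : ℂ => exp (c * w) - 1) =O[𝓝 0] fun w => w := by
    have h : HasDerivAt (fun w : ℂ => exp (c * w)) (exp (c * 0) * (c * 1)) 0 :=
      ((hasDerivAt_id (0 : ℂ)).const_mul c).cexp
    simpa using h.isBigO_sub
  exact (h1.comp_tendsto tendsto_eInf).trans isBigO_eInf

lemma isBigO_eval_div_pow {p : ℂ[X]} (hp : p.degree < n) :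
    (fun z => p.eval z * (z ^ n)⁻¹) =O[cobounded ℂ] fun z => z⁻¹ := by
  have h1 : (fun z => p.eval z * (z ^ n)⁻¹) =
      fun z => ∑ i ∈ p.support, p.coeff i * (z ^ i * (z ^ n)⁻¹) := by
    ext z
    rw [eval_eq_sum, Polynomial.sum, sum_mul]
    exact sum_congr rfl fun i _ => mul_assoc _ _ _
  rw [h1]
  refine .fun_sum fun i hi => .const_mul_left ?_ _
  have hin : i < n := by exact_mod_cast (Polynomial.le_degree_of_mem_supp i hi).trans_lt hp
  obtain ⟨k, rfl⟩ := Nat.exists_eq_add_of_lt hin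
  have h2 : (fun z : ℂ => (z⁻¹) ^ k * z⁻¹) =O[cobounded ℂ] fun z => z⁻¹ := by
    have := ((isBigO_inv_one.pow k).mul (Asymptotics.isBigO_refl (fun z : ℂ => z⁻¹) _))
    simpa using this
  refine h2.congr' ?_ .rfl
  filter_upwards [eventually_ge_norm 1] with z hz
  have : z ≠ 0 := fun h => by norm_num [h] at hz
  rw [← pow_succ, inv_pow, add_assoc, pow_add z i, mul_inv, mul_inv_cancel_left₀ (pow_ne_zero _ this)]

lemma pow_mul_mom_inv_sub (hα : Admissible α) (hinj : Injective (zpt θ))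
    (p : ℂ[X]) (N : ℕ) {z : ℂ} (hz : ‖z‖ ≠ 1) :
    z ^ N * mom n α β θ (fun t => p.eval (ue t) * (ue t - z)⁻¹) =
      mom n α β θ (fun t => (p * X ^ N).eval (ue t) * (ue t - z)⁻¹) -
        ∑ k ∈ range N, ℒ (p * X ^ k) * z ^ (N - 1 - k) := by
  have h1 : ∑ k ∈ range N, ℒ (p * X ^ k) * z ^ (N - 1 - k) =
      ℒ (p * ∑ k ∈ range N, X ^ k * C z ^ (N - 1 - k)) := by
    rw [mul_sum, map_sum]
    refine sum_congr rfl fun k _ => ?_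
    rw [← C_pow, ← mul_assoc, mul_comm _ (C _), ← smul_eq_C_mul, map_smul, smul_eq_mul, mul_comm]
  rw [h1, ell_eq hα hinj, ← mom_const_mul, eq_sub_iff_add_eq, ← mom_add
    (((PerC1.const _).mul ((PerC1.polynomial p).mul (perC1_inv_sub hz))).integrable_mom hα hinj)
    ((PerC1.polynomial _).integrable_mom hα hinj)]
  refine mom_congr ∅ Set.finite_empty fun t _ => ?_
  have h2 := ue_sub_ne_zero hz t
  have h3 := congrArg (eval (ue t)) (geom_sum₂_mul (X : ℂ[X]) (C z) N)
  simp only [eval_mul, eval_sub, eval_pow, eval_X, eval_C] at h3 ⊢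
  rw [eq_sub_iff_add_eq, ← eq_sub_iff_add_eq] at h3
  field_simp
  linear_combination (eval (ue t) p) * h3

/-- The matrix `U(G) h ^ σ₃`, normalised at infinity. -/
def psiInf (n : ℕ) (α β : ι → ℂ) (θ : ι → ℝ) (z : ℂ) : Mat :=
  !![exp (eInf α θ z) * (z ^ n)⁻¹, cauchyT n α β θ z * (exp (-eInf α θ z) * z ^ n);
    0, exp (-eInf α θ z) * z ^ n]

lemma exp_logFrom {φ : ℝ} {z : ℂ} (hz : z ≠ 0) : exp (logFrom φ z) = z := by
  rw [logFrom, exp_add, ← ofReal_exp, Real.exp_log (norm_pos_iff.2 hz)]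
  exact (eq_norm_mul_ue_argFrom φ z).symm

lemma psiMat_mul_of_mem_sector (hθ : IsConfiguration θ) {j : ι} {z : ℂ}
    (hz : z ∈ sector θ j) (hz1 : 1 < ‖z‖) :
    psiMat n α β θ z * expSigma3 (-(expInfty n α β * logFrom (θ 0) z
        + 2 * π * I * ∑ k ∈ Ioi j, α k)) = psiInf n α β θ z := by
  have h1 : exp (n * logFrom (θ 0) z) = z ^ n := by rw [exp_nat_mul, exp_logFrom hz.1]
  rw [psiMat, mul_assoc, expSigma3_mul, hLog_of_mem_sector hθ hz hz1, psiInf, ← h1, ← exp_neg,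
    ← exp_add, ← exp_add, add_neg_cancel_comm, upper, expSigma3]
  ext a b
  fin_cases a <;> fin_cases b <;> simp [mul_apply, sub_eq_add_neg]
  · left; ring_nf
  · ring_nf

lemma det_psiInf {z : ℂ} (hz : z ≠ 0) : (psiInf n α β θ z).det = 1 := by
  rw [psiInf, det_fin_two_of, mul_zero, sub_zero, mul_mul_mul_comm, ← exp_add,
    add_neg_cancel, exp_zero, inv_mul_cancel₀ (pow_ne_zero _ hz), mul_one]

/-- The second column of the solution, with the leading behaviour at infinity. -/
lemma isBigO_pow_mul_mom (hα : Admissible α) (hinj : Injective (zpt θ))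
    (hn : 1 ≤ n) {p : ℂ[X]} {c : ℂ}
    (h : ∀ k < n, ell n α β θ (p * X ^ k) = if k = n - 1 then -c else 0) :
    (fun z => z ^ n * mom n α β θ (fun t => p.eval (ue t) * (ue t - z)⁻¹) - c)
      =O[cobounded ℂ] fun z => z⁻¹ := by
  refine (isBigO_mom_inv_sub (n := n) (β := β) hα hinj (PerC1.polynomial (p * X ^ n))).congr' ?_ .rfl
  filter_upwards [eventually_ge_norm 2] with z hz
  rw [pow_mul_mom_inv_sub hα hinj p n (by linarith), sum_congr rfl fun k hk => by
    rw [h k (mem_range.1 hk)]]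
  simp only [ite_mul, zero_mul, sum_ite_eq']
  rw [if_pos (mem_range.2 (by omega)), Nat.sub_self, pow_zero]
  ring

lemma IsBigO.mul_sub_of_sub {f g : ℂ → ℂ} {c : ℂ} 
    (hf : (fun z => f z - c) =O[cobounded ℂ] fun z => z⁻¹)
    (hg : (fun z => g z - 1) =O[cobounded ℂ] fun z => z⁻¹) :
    (fun z => f z * g z - c) =O[cobounded ℂ] fun z => z⁻¹ := by
  have h1 : (fun z => (f z - c) * (g z - 1)) =O[cobounded ℂ] fun z => z⁻¹ := by
    simpa using hf.mul (hg.trans isBigO_inv_one)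
  refine ((h1.add hf).add (hg.const_mul_left c)).congr_left fun z => ?_
  ring

lemma isBigO_solM_mul_psiInf (hα : Admissible α)
    (hinj : Injective (zpt θ)) (hn : 1 ≤ n) (h0 : (momMatrix n α β θ).det ≠ 0) (a b : Fin 2) :
    (fun z => (solM (ell n α β θ) n z * psiInf n α β θ z - 1) a b)
      =O[cobounded ℂ] fun z => z⁻¹ := by
  have hPQ := isOrthPair_poly (ℓ := ell n α β θ) (n := n) (by rwa [toepMatrix_ell])
  have hexp : ∀ c : ℂ, (fun z => exp (c * eInf α θ z) - 1) =O[cobounded ℂ] fun z => z⁻¹ :=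
    isBigO_exp_eInf_sub_one
  have e1 : (fun z => exp (eInf α θ z) - 1) =O[cobounded ℂ] fun z => z⁻¹ := by simpa using hexp 1
  have e2 : (fun z => exp (-eInf α θ z) - 1) =O[cobounded ℂ] fun z => z⁻¹ := by
    simpa using hexp (-1)
  have col1 : ∀ (p : ℂ[X]) (c : ℂ), (p - C c * X ^ n).degree < (n : WithBot ℕ) →
      (fun z => p.eval z * (exp (eInf α θ z) * (z ^ n)⁻¹) - c) =O[cobounded ℂ]
        fun z => z⁻¹ := by
    intro p c hp
    have h1 : (fun z => p.eval z * (z ^ n)⁻¹ - c) =O[cobounded ℂ] fun z => z⁻¹ := by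
      refine (isBigO_eval_div_pow hp).congr' ?_ .rfl
      filter_upwards [eventually_ge_norm 1] with z hz
      have : z ≠ 0 := fun h => by norm_num [h] at hz
      simp only [eval_sub, eval_mul, eval_C, eval_pow, eval_X]
      field_simp
    refine (IsBigO.mul_sub_of_sub h1 e1).congr_left fun z => ?_
    ring
  have col2 : ∀ (p : ℂ[X]) (c : ℂ),
      (∀ k < n, ell n α β θ (p * X ^ k) = if k = n - 1 then -c else 0) →
      (fun z => p.eval z * (cauchyT n α β θ z * (exp (-eInf α θ z) * z ^ n)) +
        (remPoly (ell n α β θ) p).eval z * (exp (-eInf α θ z) * z ^ n) - c)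
        =O[cobounded ℂ] fun z => z⁻¹ := by
    intro p c hp
    refine (IsBigO.mul_sub_of_sub (isBigO_pow_mul_mom hα hinj hn hp) e2).congr' ?_ .rfl
    filter_upwards [eventually_ge_norm 2] with z hz
    rw [mom_mul_inv_sub hα hinj p (by linarith), eval_remPoly]
    ring
  have hP : (polyP (ell n α β θ) n - C 1 * X ^ n).degree < (n : WithBot ℕ) := by
    rw [C_1, one_mul]
    have := degree_sub_lt_left (p := polyP (ell n α β θ) n) (q := X ^ n) ?_ hPQ.monic.ne_zero ?_
    · rwa [degree_eq_natDegree hPQ.monic.ne_zero, hPQ.natDegree] at this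
    · rw [degree_eq_natDegree hPQ.monic.ne_zero, hPQ.natDegree, degree_X_pow]
    · rw [hPQ.monic.leadingCoeff, leadingCoeff_X_pow]
  have hQ : (polyQ (ell n α β θ) n - C 0 * X ^ n).degree < (n : WithBot ℕ) := by
    rw [C_0, zero_mul, sub_zero]
    exact hPQ.degree
  have hdeg : ∀ k < n, (X ^ k : ℂ[X]).degree < (n : WithBot ℕ) := fun k hk => by
    rw [degree_X_pow]; exact_mod_cast hk
  fin_cases a <;> fin_cases b <;>
    simp only [solM, psiInf, Matrix.sub_apply, mul_apply, Fin.sum_univ_two, Fin.zero_eta,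
      Fin.mk_one, of_apply, cons_val', cons_val_zero, cons_val_one,
      cons_val_fin_one, mul_zero, add_zero, one_apply, if_true]
  · exact col1 _ _ hP
  · exact col2 _ 0 fun k hk => by rw [hPQ.orth _ (hdeg k hk)]; simp
  · exact col1 _ _ hQ
  · refine col2 _ 1 fun k hk => ?_
    rw [hPQ.coorth _ (hdeg k hk), coeff_X_pow]
    simp only [eq_comm]
    split_ifs <;> simp

/-! ### The solution built from orthogonal polynomials -/

section

variable {𝕜 : Type*} [NontriviallyNormedField 𝕜] [NormedAlgebra 𝕜 ℂ] {x : 𝕜}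

lemma differentiableAt_matrix_mul {A B : 𝕜 → Mat} (hA : ∀ a b, DifferentiableAt 𝕜 (fun y => A y a b) x)
    (hB : ∀ a b, DifferentiableAt 𝕜 (fun y => B y a b) x) (a b : Fin 2) :
    DifferentiableAt 𝕜 (fun y => (A y * B y) a b) x := by
  simp only [mul_apply, Fin.sum_univ_two]
  exact ((hA a 0).mul (hB 0 b)).add ((hA a 1).mul (hB 1 b))

lemma differentiableAt_upper {f : 𝕜 → ℂ} (hf : DifferentiableAt 𝕜 f x) (a b : Fin 2) :
    DifferentiableAt 𝕜 (fun y => upper (f y) a b) x := by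
  fin_cases a <;> fin_cases b <;> simp [upper, hf]

lemma differentiableAt_expSigma3 {f : 𝕜 → ℂ} (hf : DifferentiableAt 𝕜 f x) (a b : Fin 2) :
    DifferentiableAt 𝕜 (fun y => expSigma3 (f y) a b) x := by
  fin_cases a <;> fin_cases b <;> simp [expSigma3, hf.cexp]
  exact hf.neg.cexp

end

def phiSol (n : ℕ) (α β : ι → ℂ) (θ : ι → ℝ) (z : ℂ) : Mat :=
  solM (ell n α β θ) n z * psiMat n α β θ z

def phiF (n : ℕ) (α β : ι → ℂ) (θ : ι → ℝ) (o : ℂ) (d : ℝ)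
    (j : ι) (z : ℂ) : Mat :=
  solM (ell n α β θ) n z * (upper (gLoc n α β θ o d j z) * expSigma3 (eLog n α β θ j z))

def phiF0 (n : ℕ) (α β : ι → ℂ) (θ : ι → ℝ) (z : ℂ) : Mat :=
  solM (ell n α β θ) n z * (upper (cauchyT n α β θ z) * expSigma3 (eZero α θ z))

lemma continuous_solM : Continuous (𝓜) :=
  continuous_matrix fun a b => continuous_iff_continuousAt.2 fun z => (hasDerivAt_solM z a b).continuousAt

lemma HasJump.mul_left {Φ M : ℂ → Mat} {plus minus : Set ℂ} {p : ℂ} {J : Mat}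
    (h : HasJump Φ plus minus p J) (hM : Continuous M) :
    HasJump (fun z => M z * Φ z) plus minus p J := by
  obtain ⟨Φp, Φm, h1, h2, h3⟩ := h
  have hM' : ∀ S, Tendsto M (𝓝[S] p) (𝓝 (M p)) := fun S => hM.continuousAt.mono_left nhdsWithin_le_nhds
  exact ⟨M p * Φp, M p * Φm, (hM' _).mul h1, (hM' _).mul h2, by rw [h3, mul_assoc]⟩

lemma norm_ne_one_of_notMem_contour {z : ℂ} (hz : z ∉ contour θ) : ‖z‖ ≠ 1 :=
  fun h => hz (.inl (.inl (by simpa using h)))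

lemma notMem_openRay_of_notMem_contour {z : ℂ} (hz : z ∉ contour θ) (j : ι) :
    z ∉ openRay θ j := fun h => hz (.inr (Set.mem_iUnion.2 ⟨j, h⟩))

lemma differentiableAt_psiMat (hα : Admissible α) (hinj : Injective (zpt θ))
    {z : ℂ} (hz : z ∉ contour θ) (a b : Fin 2) :
    DifferentiableAt ℂ (fun z => psiMat n α β θ z a b) z :=
  differentiableAt_matrix_mul
    (differentiableAt_upper
      (hasDerivAt_cauchyT hα hinj (norm_ne_one_of_notMem_contour hz)).differentiableAt)
    (differentiableAt_expSigma3 (hasDerivAt_hLog (cutFree_of_notMem_contour hz)).differentiableAt) a b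

lemma isBigO_phiSol (hθ : IsConfiguration θ) (hα : Admissible α)
    (hinj : Injective (zpt θ)) (hn : 1 ≤ n) (h0 : (momMatrix n α β θ).det ≠ 0)
    (j : ι) (a b : Fin 2) :
    (fun z => (phiSol n α β θ z * expSigma3 (-(expInfty n α β * logFrom (θ 0) z
        + 2 * π * I * ∑ k ∈ Ioi j, α k)) - 1) a b)
      =O[cobounded ℂ ⊓ 𝓟 (sector θ j \ contour θ)] fun z => z⁻¹ := by
  refine ((isBigO_solM_mul_psiInf hα hinj hn h0 a b).mono inf_le_left).congr' ?_ .rfl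
  rw [EventuallyEq, eventually_inf_principal]
  filter_upwards [eventually_gt_norm 1] with z hz hzs
  rw [phiSol, mul_assoc, psiMat_mul_of_mem_sector hθ hzs.1 hz]

/-- The orthogonal polynomials and their Cauchy transforms solve the Riemann-Hilbert problem. -/
lemma isPhiSolution_phiSol {d : ℝ} (h : Sep θ d) (hθ : IsConfiguration θ)
    (hα : Admissible α) (hα' : ∀ j, NonResonant (α j))
    (hn : 1 ≤ n) (h0 : (momMatrix n α β θ).det ≠ 0) {o : ι → ℂ}
    (ho : ∀ j, ‖zpt θ j - o j‖ < d / 32) :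
    IsPhiSolution n α β θ (d / 128) (phiSol n α β θ) (fun j => phiF n α β θ (o j) d j)
      (phiF0 n α β θ) where
  analytic a b z hz := by
    have hinj : Injective (zpt θ) := zpt_injective hθ
    exact (differentiableAt_matrix_mul (fun a b => (hasDerivAt_solM z a b).differentiableAt)
      (differentiableAt_psiMat hα hinj hz) a b).differentiableWithinAt
  jump_circle j p hp := (hasJump_psiMat_circle hα hθ hp).mul_left continuous_solM
  jump_ray j hj p hp := (hasJump_psiMat_ray hα (zpt_injective hθ) hj hp).mul_left continuous_solM
  jump_ray_zero p hp := (hasJump_psiMat_ray_zero hα (zpt_injective hθ) hp).mul_left continuous_solM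
  jump_segment p hp := (hasJump_psiMat_segment hα (zpt_injective hθ) hp).mul_left continuous_solM
  infinity := isBigO_phiSol hθ hα (zpt_injective hθ) hn h0
  factor_analytic j a b z hz := by
    have hd := h.1
    rw [mem_ball_iff_norm] at hz
    refine (differentiableAt_matrix_mul (fun a b => (hasDerivAt_solM z a b).differentiableAt)
      (differentiableAt_matrix_mul (differentiableAt_upper
        (h.differentiableAt_gLoc (hα' j) (ho j) (by linarith)))
      (differentiableAt_expSigma3 (h.hasDerivAt_eLog (by linarith)).differentiableAt))
      a b).differentiableWithinAt
  factor j z hz := by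
    rw [phiSol, psiMat, h.upper_cauchyT_eq hθ hα (hα' j) (ho j) hz.1
      (norm_ne_one_of_notMem_contour hz.2) (notMem_openRay_of_notMem_contour hz.2 j), phiF]
    simp only [mul_assoc]
  factor0_analytic a b z hz := by
    have hd := h.2.1
    rw [mem_ball_zero_iff] at hz
    refine (differentiableAt_matrix_mul (fun a b => (hasDerivAt_solM z a b).differentiableAt)
      (differentiableAt_matrix_mul (differentiableAt_upper
        (hasDerivAt_cauchyT hα (zpt_injective hθ) (by linarith)).differentiableAt)
      (differentiableAt_expSigma3 (differentiableAt_eZero (by linarith))))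
      a b).differentiableWithinAt
  factor0 z hz := by
    have hd := h.2.1
    have hz1 := mem_ball_zero_iff.1 hz.1
    rw [phiSol, psiMat, hLog_eq_eZero (by linarith), phiF0, add_comm, ← expSigma3_mul]
    simp only [mul_assoc]

/-! ### Topology of the contour -/

lemma contour_compl_eq : (contour θ)ᶜ = {z | CutFree θ z} ∩ {z | ‖z‖ ≠ 1} := by
  ext z
  refine ⟨fun hz => ⟨cutFree_of_notMem_contour hz, norm_ne_one_of_notMem_contour hz⟩, ?_⟩
  rintro ⟨h1, h2⟩ ((h | h | ⟨r, h0, hr, rfl⟩) | h)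
  · exact h2 (by simpa using h)
  · exact h1.ne_zero h
  · have := h1.1
    rw [ray_mul_ue, ← ofReal_neg, ofReal_mem_slitPlane] at this
    linarith
  · obtain ⟨j, r, hr, rfl⟩ := Set.mem_iUnion.1 h
    have := h1.2 j
    rw [ray_mul_ue, ← ofReal_one, ← ofReal_sub, ofReal_mem_slitPlane] at this
    linarith

lemma isOpen_contour_compl : IsOpen (contour θ)ᶜ := by
  rw [contour_compl_eq]
  exact isOpen_cutFree.inter (isOpen_ne_fun continuous_norm continuous_const)

lemma dense_contour_compl : Dense (contour θ)ᶜ := by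
  have h1 : ∀ v : ℂ, ∀ᵐ z : ℂ, z ∉ Submodule.span ℝ {v} := fun v => by
    refine measure_eq_zero_iff_ae_notMem.1 (MeasureTheory.Measure.addHaar_submodule _ _ fun h => ?_)
    have h2 := finrank_span_le_card (R := ℝ) {v}
    rw [h, finrank_top, finrank_real_complex] at h2
    simp at h2
  have h2 : ∀ᵐ z : ℂ, z ∉ sphere (0 : ℂ) 1 :=
    measure_eq_zero_iff_ae_notMem.1 (MeasureTheory.Measure.addHaar_sphere volume 0 1)
  have h3 : ∀ᵐ z : ℂ, ∀ j, z ∉ Submodule.span ℝ {zpt θ j} := ae_all_iff.2 fun j => h1 _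
  refine MeasureTheory.Measure.dense_of_ae (μ := (volume : Measure ℂ)) ?_
  filter_upwards [h2, h3] with z hz hj
  rintro ((h | h | ⟨r, _, _, rfl⟩) | h)
  · exact hz h
  · rw [Set.mem_singleton_iff.1 h] at hj
    exact hj 0 (zero_mem _)
  · exact hj 0 (Submodule.mem_span_singleton.2 ⟨r, by simp⟩)
  · obtain ⟨j, r, _, rfl⟩ := Set.mem_iUnion.1 h
    exact hj j (Submodule.mem_span_singleton.2 ⟨r, by simp⟩)

/-! ### Comparison of two matrices with the same jumps -/

lemma HasJump.exists_tendsto_mul_adjugate {Φ Ψ : ℂ → Mat} {plus minus : Set ℂ} {p : ℂ} {J : Mat}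
    (h : HasJump Φ plus minus p J) (h' : HasJump Ψ plus minus p J) (hJ : J.det = 1) (a b : Fin 2) :
    ∃ L, Tendsto (fun z => (Φ z * (Ψ z).adjugate) a b) (𝓝[plus] p) (𝓝 L) ∧
      Tendsto (fun z => (Φ z * (Ψ z).adjugate) a b) (𝓝[minus] p) (𝓝 L) := by
  obtain ⟨Φp, Φm, h1, h2, h3⟩ := h
  obtain ⟨Ψp, Ψm, h1', h2', h3'⟩ := h'
  have hadj : Continuous fun A : Mat => A.adjugate := continuous_id.matrix_adjugate
  have hab : Continuous fun A : Mat => A a b := continuous_id.matrix_elem a b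
  have e : Φp * Ψp.adjugate = Φm * Ψm.adjugate := by
    rw [h3, h3', adjugate_mul_distrib, mul_assoc, ← mul_assoc J, mul_adjugate, hJ,
      one_smul, one_mul]
  refine ⟨(Φm * Ψm.adjugate) a b, ?_, ?_⟩
  · rw [← e]
    exact (hab.tendsto _).comp (h1.mul ((hadj.tendsto _).comp h1'))
  · exact (hab.tendsto _).comp (h2.mul ((hadj.tendsto _).comp h2'))

lemma differentiableAt_adjugate {A : ℂ → Mat} {x : ℂ} (hA : ∀ a b, DifferentiableAt ℂ (fun y => A y a b) x)
    (a b : Fin 2) : DifferentiableAt ℂ (fun y => (A y).adjugate a b) x := by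
  simp only [adjugate_fin_two]
  fin_cases a <;> fin_cases b <;> simp [hA]

section

variable {ε : ℝ} {Φ : ℂ → Mat} {F : Fin (m + 1) → ℂ → Mat} {F0 : ℂ → Mat}
  (h : IsPhiSolution n α β θ ε Φ F F0) (hα : Admissible α) (hθ : IsConfiguration θ)
include h hα hθ

lemma IsPhiSolution.differentiableAt_mul_adjugate {z : ℂ} (hz : z ∉ contour θ) (a b : Fin 2) :
    DifferentiableAt ℂ (fun z => (Φ z * (psiMat n α β θ z).adjugate) a b) z :=
  differentiableAt_matrix_mul
    (fun a b => (h.analytic a b).differentiableAt (isOpen_contour_compl.mem_nhds hz))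
    (differentiableAt_adjugate (differentiableAt_psiMat hα (zpt_injective hθ) hz)) a b

lemma IsPhiSolution.extension_circle {j : ι} {t : ℝ} (ht : t ∈ Set.Ioo (θ j) (nextAngle θ j))
    (a b : Fin 2) : ∃ r > 0, ∃ g, DifferentiableOn ℂ g (ball (ue t) r) ∧
      ∀ z ∈ ball (ue t) r, z ∉ contour θ → g z = (Φ z * (psiMat n α β θ z).adjugate) a b := by
  have hsec : ∀ x ∈ Set.Ioo (θ j) (nextAngle θ j), ue x ∈ sphere (0 : ℂ) 1 ∩ sector θ j := by
    intro x hx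
    refine ⟨by simp [norm_ue], ue_ne_zero x, ?_⟩
    have h1 := hθ.1.monotone (Fin.zero_le j)
    rwa [argFrom_ue_of_mem ⟨h1.trans hx.1.le, hx.2.trans_le (nextAngle_le hθ j)⟩]
  have hE : Continuous fun w : ℂ => ue t * exp (I * w) := by fun_prop
  have h1 : ∀ᶠ w in 𝓝 (0 : ℂ), CutFree θ (ue t * exp (I * w)) := by
    refine hE.continuousAt.eventually (isOpen_cutFree.mem_nhds ?_)
    simpa using cutFree_of_mem_arc hθ ht
  have h2 : ∀ᶠ x in 𝓝 (0 : ℝ), t + x ∈ Set.Ioo (θ j) (nextAngle θ j) := by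
    have : Continuous fun x : ℝ => t + x := by fun_prop
    exact this.continuousAt.eventually (isOpen_Ioo.mem_nhds (by simpa using ht))
  obtain ⟨r₁, hr₁, h1⟩ := eventually_nhds_iff_ball.1 h1
  obtain ⟨r₂, hr₂, h2⟩ := eventually_nhds_iff_ball.1 h2
  have hnorm : ∀ w : ℂ, ‖ue t * exp (I * w)‖ = Real.exp (-w.im) := fun w => by
    rw [norm_ue_mul_exp]; simp
  suffices hext : ∃ ρ > 0, ∃ g, DifferentiableOn ℂ g (ball (ue t) ρ) ∧
      ∀ z ∈ ball (ue t) ρ, z ∈ {z | ‖z‖ < 1} ∪ {z | 1 < ‖z‖} →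
        g z = (Φ z * (psiMat n α β θ z).adjugate) a b by
    obtain ⟨ρ, hρ, g, hg, hgf⟩ := hext
    exact ⟨ρ, hρ, g, hg, fun z hz hzc => hgf z hz (norm_ne_one_of_notMem_contour hzc).lt_or_gt⟩
  refine exists_extension_across (c := I) (ue_ne_zero t) (by simp)
    (lt_min hr₁ hr₂) (fun w hw => ?_) (fun w hw hw0 => ?_) (fun x hx => ?_)
  · have h3 := hnorm w
    constructor
    · rw [Set.mem_ofPred_eq, h3]; simp
    · rw [Set.mem_ofPred_eq, h3]; simp
  · refine h.differentiableAt_mul_adjugate hα hθ ?_ a b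
    rw [← Set.mem_compl_iff, contour_compl_eq]
    refine ⟨h1 w (ball_subset_ball (min_le_left _ _) hw), ?_⟩
    rw [Set.mem_ofPred_eq, hnorm]
    simpa using hw0
  · have hx' := hsec _ (h2 x (by simpa using hx.trans_le (min_le_right _ _)))
    have e : ue t * exp (I * x) = ue (t + x) := by rw [ue_add, ue, ue, mul_comm I]
    rw [e]
    exact (h.jump_circle j _ hx').exists_tendsto_mul_adjugate (hasJump_psiMat_circle hα hθ hx')
      (det_upper _) a b

omit h hα hθ in
lemma mul_neg_iff_pos_neg {a b : ℝ} (ha : 0 < a) : a * b < 0 ↔ b < 0 := by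
  rw [← neg_pos, ← mul_neg, mul_pos_iff_of_pos_left ha, neg_pos]

/-- Extension across a radial part of the contour. -/
lemma IsPhiSolution.extension_radial {j : ι} {r : ℝ} (hr : 0 < r)
    (hc : ∀ᶠ z in 𝓝 ((r : ℂ) * zpt θ j), z ∈ contour θ ↔ (z * ue (-θ j)).im = 0) {J : Mat}
    (hJ : J.det = 1) {s : Set ℂ} (hs : ∀ᶠ x : ℝ in 𝓝 r, (x : ℂ) * zpt θ j ∈ s)
    (hj : ∀ p ∈ s, HasJump Φ (leftOf (θ j)) (rightOf (θ j)) p J ∧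
      HasJump (psiMat n α β θ) (leftOf (θ j)) (rightOf (θ j)) p J) (a b : Fin 2) :
    ∃ ρ > 0, ∃ g, DifferentiableOn ℂ g (ball ((r : ℂ) * zpt θ j) ρ) ∧
      ∀ z ∈ ball ((r : ℂ) * zpt θ j) ρ, z ∉ contour θ →
        g z = (Φ z * (psiMat n α β θ z).adjugate) a b := by
  have hr0 : (r : ℂ) ≠ 0 := ofReal_ne_zero.2 hr.ne'
  have hE : Continuous fun w : ℂ => (r : ℂ) * zpt θ j * exp (1 * w) := by fun_prop
  have h1 : ∀ᶠ w in 𝓝 (0 : ℂ), ((r : ℂ) * zpt θ j * exp (1 * w) ∈ contour θ ↔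
      ((r : ℂ) * zpt θ j * exp (1 * w) * ue (-θ j)).im = 0) :=
    (hE.tendsto 0).eventually (by rwa [mul_zero, exp_zero, mul_one])
  have h2 : ∀ᶠ x in 𝓝 (0 : ℝ), ((r * Real.exp x : ℝ) : ℂ) * zpt θ j ∈ s := by
    have : Continuous fun x : ℝ => r * Real.exp x := by fun_prop
    exact (this.tendsto 0).eventually (by rwa [Real.exp_zero, mul_one])
  obtain ⟨r₁, hr₁, h1⟩ := eventually_nhds_iff_ball.1 h1
  obtain ⟨r₂, hr₂, h2⟩ := eventually_nhds_iff_ball.1 h2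
  obtain ⟨r₃, hr₃, h3⟩ := eventually_nhds_iff_ball.1 hc
  have him : ∀ w : ℂ, ((r : ℂ) * zpt θ j * exp (1 * w) * ue (-θ j)).im =
      r * (Real.exp w.re * Real.sin w.im) := fun w => by
    rw [mul_assoc (r : ℂ), mul_assoc (r : ℂ), im_ofReal_mul, one_mul, zpt_eq, im_ue_mul_exp]
  have hsin : ∀ w ∈ ball (0 : ℂ) 1, (0 < w.im ↔ 0 < Real.sin w.im) ∧
      (w.im < 0 ↔ Real.sin w.im < 0) := by
    intro w hw
    have h4 := abs_lt.1 ((abs_im_le_norm w).trans_lt (mem_ball_zero_iff.1 hw))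
    have h5 := Real.pi_gt_three
    rcases lt_trichotomy w.im 0 with h6 | h6 | h6
    · have := Real.sin_neg_of_neg_of_neg_pi_lt h6 (by linarith)
      constructor <;> constructor <;> intro <;> linarith
    · simp [h6]
    · have := Real.sin_pos_of_pos_of_lt_pi h6 (by linarith)
      constructor <;> constructor <;> intro <;> linarith
  have hsg : ∀ w ∈ ball (0 : ℂ) 1, (0 < w.im ↔ (r : ℂ) * zpt θ j * exp (1 * w) ∈ leftOf (θ j)) ∧
      (w.im < 0 ↔ (r : ℂ) * zpt θ j * exp (1 * w) ∈ rightOf (θ j)) := by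
    intro w hw
    rw [mem_leftOf, mem_rightOf, him, ← mul_assoc, mul_pos_iff_of_pos_left (by positivity),
      mul_neg_iff_pos_neg (by positivity)]
    exact hsin w hw
  suffices hext : ∃ ρ > 0, ∃ g, DifferentiableOn ℂ g (ball ((r : ℂ) * zpt θ j) ρ) ∧
      ∀ z ∈ ball ((r : ℂ) * zpt θ j) ρ, z ∈ leftOf (θ j) ∪ rightOf (θ j) →
        g z = (Φ z * (psiMat n α β θ z).adjugate) a b by
    obtain ⟨ρ, hρ, g, hg, hgf⟩ := hext
    refine ⟨min ρ r₃, lt_min hρ hr₃, g, hg.mono (ball_subset_ball (min_le_left _ _)),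
      fun z hz hzc => hgf z (ball_subset_ball (min_le_left _ _) hz) ?_⟩
    have h4 := (not_congr (h3 z (ball_subset_ball (min_le_right _ _) hz))).1 hzc
    rw [Set.mem_union, mem_leftOf, mem_rightOf]
    exact (Ne.lt_or_gt h4).symm
  refine exists_extension_across (c := 1) (mul_ne_zero hr0 (by rw [zpt_eq]; exact ue_ne_zero _))
    (by simp) (lt_min (lt_min hr₁ hr₂) one_pos)
    (fun w hw => hsg w (ball_subset_ball (min_le_right _ _) hw))
    (fun w hw hw0 => ?_) (fun x hx => ?_)
  · refine h.differentiableAt_mul_adjugate hα hθ (fun hmem => ?_) a b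
    have h4 := (h1 w (ball_subset_ball ((min_le_left _ _).trans (min_le_left _ _)) hw)).1 hmem
    have h5 := hsg w (ball_subset_ball (min_le_right _ _) hw)
    rw [mem_leftOf, mem_rightOf, h4] at h5
    rcases Ne.lt_or_gt hw0 with h6 | h6
    · exact lt_irrefl _ (h5.2.1 h6)
    · exact lt_irrefl _ (h5.1.1 h6)
  · have e : (r : ℂ) * zpt θ j * exp (1 * x) = ((r * Real.exp x : ℝ) : ℂ) * zpt θ j := by
      push_cast; rw [one_mul]; ring
    have h4 := hj _ (h2 x (by simpa using hx.trans_le ((min_le_left _ _).trans (min_le_right _ _))))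
    rw [e]
    exact h4.1.exists_tendsto_mul_adjugate h4.2 hJ a b

end

/-! ### The quotient of two solutions is entire -/

lemma eq_ofReal_mul_zpt {z : ℂ} {j : ι} (h : (z * ue (-θ j)).im = 0) :
    ∃ r : ℝ, z * ue (-θ j) = r ∧ z = r * zpt θ j := by
  have h1 : z * ue (-θ j) = (((z * ue (-θ j)).re : ℝ) : ℂ) := Complex.ext (by simp) (by simpa using h)
  exact ⟨_, h1, eq_mul_ue_of h1⟩

lemma eventually_mem_contour_iff_ray (hinj : Injective (zpt θ)) (j : ι) {r : ℝ}
    (hr : 1 < r) :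
    ∀ᶠ z in 𝓝 ((r : ℂ) * zpt θ j), z ∈ contour θ ↔ (z * ue (-θ j)).im = 0 := by
  have h1 : ∀ᶠ z in 𝓝 ((r : ℂ) * zpt θ j), ∀ i, i ≠ j → 1 - z * ue (-θ i) ∈ slitPlane := by
    refine eventually_all.2 fun i => ?_
    by_cases hij : i = j
    · exact .of_forall fun z h => absurd hij h
    have hc : Continuous fun z : ℂ => 1 - z * ue (-θ i) := by fun_prop
    exact (hc.continuousAt.eventually (isOpen_slitPlane.mem_nhds
      (one_sub_ray_mem hinj hij (by linarith)))).mono fun z hz _ => hz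
  have h2 : ∀ᶠ z in 𝓝 ((r : ℂ) * zpt θ j), 1 < ‖z‖ :=
    continuous_norm.continuousAt.eventually (lt_mem_nhds (hr.trans_eq (norm_ray j (by linarith)).symm))
  have h3 : ∀ᶠ z in 𝓝 ((r : ℂ) * zpt θ j), 0 < (z * ue (-θ j)).re := by
    have hc : Continuous fun z : ℂ => (z * ue (-θ j)).re := by fun_prop
    refine hc.continuousAt.eventually (lt_mem_nhds ?_)
    simp only [ray_mul_ue, ofReal_re]; linarith
  filter_upwards [h1, h2, h3] with z h1 h2 h3
  constructor
  · rintro ((h | h | ⟨x, h0, hx, rfl⟩) | h)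
    · rw [mem_sphere_zero_iff_norm] at h; linarith
    · rw [Set.mem_singleton_iff.1 h, norm_zero] at h2; linarith
    · rw [norm_ray 0 h0] at h2; linarith
    · obtain ⟨i, x, hx, rfl⟩ := Set.mem_iUnion.1 h
      by_cases hij : i = j
      · rw [hij, ray_mul_ue, ofReal_im]
      · have := h1 i hij
        rw [ray_mul_ue, ← ofReal_one, ← ofReal_sub, ofReal_mem_slitPlane] at this
        linarith
  · intro h
    obtain ⟨x, hx, rfl⟩ := eq_ofReal_mul_zpt h
    rw [hx, ofReal_re] at h3
    rw [norm_ray j h3] at h2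
    exact .inr (Set.mem_iUnion.2 ⟨j, x, h2, rfl⟩)

lemma eventually_mem_contour_iff_segment {r : ℝ} (hr0 : 0 < r) (hr : r < 1) :
    ∀ᶠ z in 𝓝 ((r : ℂ) * zpt θ 0), z ∈ contour θ ↔ (z * ue (-θ 0)).im = 0 := by
  have h2 : ∀ᶠ z in 𝓝 ((r : ℂ) * zpt θ 0), ‖z‖ < 1 :=
    continuous_norm.continuousAt.eventually (gt_mem_nhds ((norm_ray 0 hr0).trans_lt hr))
  have h3 : ∀ᶠ z in 𝓝 ((r : ℂ) * zpt θ 0), 0 < (z * ue (-θ 0)).re := by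
    have hc : Continuous fun z : ℂ => (z * ue (-θ 0)).re := by fun_prop
    refine hc.continuousAt.eventually (lt_mem_nhds ?_)
    simpa only [ray_mul_ue, ofReal_re] using hr0
  filter_upwards [h2, h3] with z h2 h3
  constructor
  · rintro ((h | h | ⟨x, h0, hx, rfl⟩) | h)
    · rw [mem_sphere_zero_iff_norm] at h; linarith
    · rw [Set.mem_singleton_iff.1 h]; simp
    · rw [ray_mul_ue, ofReal_im]
    · obtain ⟨i, x, hx, rfl⟩ := Set.mem_iUnion.1 h
      rw [norm_ray i (by linarith)] at h2
      linarith
  · intro h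
    obtain ⟨x, hx, rfl⟩ := eq_ofReal_mul_zpt h
    rw [hx, ofReal_re] at h3
    rw [norm_ray 0 h3] at h2
    exact .inl (.inr (.inr ⟨x, h3, h2, rfl⟩))

lemma det_singFactor (j : ι) (z : ℂ) : (singFactor α β θ j z).det = 1 := by
  rw [singFactor]
  split_ifs
  · exact det_expSigma3 _
  · exact det_upper _

lemma det_connection (j : ι) (z : ℂ) : (connection n α β θ j z).det = 1 := by
  rw [connection, det_mul, det_upper, one_mul]
  split_ifs
  · exact det_expSigma3 _
  · exact det_one

lemma mul_adjugate_of_factor {A B S : Mat} (hS : S.det = 1) :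
    (A * S) * (B * S).adjugate = A * B.adjugate := by
  rw [adjugate_mul_distrib, mul_assoc, ← mul_assoc S, mul_adjugate, hS, one_smul, one_mul]

lemma exists_mem_arc_or {p : ℂ} (hp : ‖p‖ = 1) :
    ∃ j, p = zpt θ j ∨ ∃ t ∈ Set.Ioo (θ j) (nextAngle θ j), p = ue t := by
  have h1 := eq_norm_mul_ue_argFrom (θ 0) p
  rw [hp, ofReal_one, one_mul] at h1
  obtain ⟨j, h | h⟩ := exists_arc (toIcoMod_mem_Ico two_pi_pos (θ 0) (arg p))
  · exact ⟨j, .inl (by rw [zpt_eq, ← h]; exact h1)⟩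
  · exact ⟨j, .inr ⟨_, h, h1⟩⟩

section

variable {ε : ℝ} {Φ : ℂ → Mat} {F : Fin (m + 1) → ℂ → Mat} {F0 : ℂ → Mat}
  (h : IsPhiSolution n α β θ ε Φ F F0) (hε : 0 < ε) (hθ : IsConfiguration θ)
  (hα : Admissible α)
  (hα' : ∀ j, NonResonant (α j))
include h hε hα hθ

lemma IsPhiSolution.extension_zpt (hα' : ∀ j, NonResonant (α j))
    (j : ι) (a b : Fin 2) : ∃ r > 0, ∃ g, DifferentiableOn ℂ g (ball (zpt θ j) r) ∧
      ∀ z ∈ ball (zpt θ j) r, z ∉ contour θ → g z = (Φ z * (psiMat n α β θ z).adjugate) a b := by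
  obtain ⟨d, hd, -⟩ := exists_eventually_sep (zpt_injective hθ)
  have hd0 := hd.1
  have ho : ‖zpt θ j - zpt θ j‖ < d / 32 := by rw [sub_self, norm_zero]; linarith
  refine ⟨min ε (d / 128), lt_min hε (by linarith), fun z => (F j z *
    (upper (gLoc n α β θ (zpt θ j) d j z) * expSigma3 (eLog n α β θ j z)).adjugate) a b,
    fun z hz => ?_, fun z hz hzc => ?_⟩
  · have hz2 := ball_subset_ball (min_le_right _ _) hz
    rw [mem_ball_iff_norm] at hz2
    exact (differentiableAt_matrix_mul (fun a b => (h.factor_analytic j a b).differentiableAt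
      (isOpen_ball.mem_nhds (ball_subset_ball (min_le_left _ _) hz)))
      (differentiableAt_adjugate (differentiableAt_matrix_mul (differentiableAt_upper
        (hd.differentiableAt_gLoc (hα' j) ho (by linarith)))
      (differentiableAt_expSigma3 (hd.hasDerivAt_eLog (by linarith)).differentiableAt)))
      a b).differentiableWithinAt
  · simp only
    rw [h.factor j z ⟨ball_subset_ball (min_le_left _ _) hz, hzc⟩, psiMat,
      hd.upper_cauchyT_eq hθ hα (hα' j) ho (ball_subset_ball (min_le_right _ _) hz)
        (norm_ne_one_of_notMem_contour hzc) (notMem_openRay_of_notMem_contour hzc j),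
      mul_adjugate_of_factor (det_connection _ _), mul_adjugate_of_factor (det_singFactor _ _)]

lemma IsPhiSolution.extension_zero (a b : Fin 2) :
    ∃ r > 0, ∃ g, DifferentiableOn ℂ g (ball (0 : ℂ) r) ∧ ∀ z ∈ ball (0 : ℂ) r, z ∉ contour θ →
        g z = (Φ z * (psiMat n α β θ z).adjugate) a b := by
  refine ⟨min ε 1, lt_min hε one_pos, fun z => (F0 z *
    (upper (𝓒 z) * expSigma3 (eZero α θ z)).adjugate) a b,
    fun z hz => ?_, fun z hz hzc => ?_⟩
  · have hz2 := ball_subset_ball (min_le_right _ _) hz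
    rw [mem_ball_zero_iff] at hz2
    exact (differentiableAt_matrix_mul (fun a b => (h.factor0_analytic a b).differentiableAt
      (isOpen_ball.mem_nhds (ball_subset_ball (min_le_left _ _) hz)))
      (differentiableAt_adjugate (differentiableAt_matrix_mul (differentiableAt_upper
        (hasDerivAt_cauchyT hα (zpt_injective hθ) hz2.ne).differentiableAt)
      (differentiableAt_expSigma3 (differentiableAt_eZero hz2))))
      a b).differentiableWithinAt
  · have hz2 := mem_ball_zero_iff.1 (ball_subset_ball (min_le_right _ _) hz)
    simp only
    rw [h.factor0 z ⟨ball_subset_ball (min_le_left _ _) hz, hzc⟩, psiMat,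
      hLog_eq_eZero hz2, add_comm (_ * logFrom _ _), ← expSigma3_mul, ← mul_assoc (upper _),
      mul_adjugate_of_factor (det_expSigma3 _)]

include hα' in
lemma IsPhiSolution.exists_extension (p : ℂ) (a b : Fin 2) :
    ∃ r > 0, ∃ g, DifferentiableOn ℂ g (ball p r) ∧
      ∀ z ∈ ball p r, z ∉ contour θ → g z = (Φ z * (psiMat n α β θ z).adjugate) a b := by
  have hinj := zpt_injective hθ
  by_cases hp : p ∈ contour θ
  · rcases hp with (hp | hp | ⟨r, hr0, hr, rfl⟩) | hp
    · obtain ⟨j, rfl | ⟨t, ht, rfl⟩⟩ := exists_mem_arc_or (θ := θ)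
        (mem_sphere_zero_iff_norm.1 hp)
      · exact h.extension_zpt hε hθ hα hα' j a b
      · exact h.extension_circle hα hθ ht a b
    · rw [Set.mem_singleton_iff.1 hp]
      exact h.extension_zero hε hθ hα a b
    · refine h.extension_radial hα hθ hr0 (eventually_mem_contour_iff_segment hr0 hr)
        (det_expSigma3 _) (s := openSegment0 θ) ?_
        (fun p hp => ⟨h.jump_segment p hp, hasJump_psiMat_segment hα hinj hp⟩) a b
      filter_upwards [isOpen_Ioo.mem_nhds (⟨hr0, hr⟩ : r ∈ Set.Ioo 0 1)] with x hx
      exact ⟨x, hx.1, hx.2, rfl⟩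
    · obtain ⟨j, r, hr, rfl⟩ := Set.mem_iUnion.1 hp
      have hs : ∀ᶠ x : ℝ in 𝓝 r, (x : ℂ) * zpt θ j ∈ openRay θ j := by
        filter_upwards [isOpen_Ioi.mem_nhds (show r ∈ Set.Ioi 1 from hr)] with x hx
        exact ⟨x, hx, rfl⟩
      by_cases hj : j = 0
      · subst hj
        exact h.extension_radial hα hθ (by linarith) (eventually_mem_contour_iff_ray hinj 0 hr)
          (det_expSigma3 _) hs
          (fun p hp => ⟨h.jump_ray_zero p hp, hasJump_psiMat_ray_zero hα hinj hp⟩) a b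
      · exact h.extension_radial hα hθ (by linarith) (eventually_mem_contour_iff_ray hinj j hr)
          (det_expSigma3 _) hs
          (fun p hp => ⟨h.jump_ray j hj p hp, hasJump_psiMat_ray hα hinj hj hp⟩) a b
  · obtain ⟨r, hr, hb⟩ := isOpen_iff.1 isOpen_contour_compl p hp
    exact ⟨r, hr, _, fun z hz =>
      (h.differentiableAt_mul_adjugate hα hθ (hb hz) a b).differentiableWithinAt, fun z _ _ => rfl⟩

include hα' in
lemma IsPhiSolution.exists_entire : ∃ M : ℂ → Mat, (∀ a b, Differentiable ℂ fun z => M z a b) ∧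
    ∀ z ∉ contour θ, Φ z = M z * psiMat n α β θ z := by
  choose M hM hM' using fun a b => exists_entire_extension dense_contour_compl
    fun p => h.exists_extension hε hθ hα hα' p a b
  refine ⟨fun z => Matrix.of fun a b => M a b z, hM, fun z hz => ?_⟩
  have e : (Matrix.of fun a b => M a b z) = Φ z * (psiMat n α β θ z).adjugate := by
    ext a b
    exact hM' a b z hz
  simp only [e]
  rw [mul_assoc, adjugate_mul, det_psiMat, one_smul, mul_one]

end

/-! ### Uniqueness -/

lemma one_sub_div_mem {z : ℂ} (hz : 1 < ‖z‖) (j : ι) : 1 - zpt θ j / z ∈ slitPlane := by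
  rw [sub_eq_add_neg]
  refine mem_slitPlane_of_norm_lt_one ?_
  rwa [norm_neg, norm_div, zpt_eq, norm_ue, div_lt_one (by linarith)]

lemma hasDerivAt_eInf {z : ℂ} (hz : 1 < ‖z‖) :
    HasDerivAt (eInf α θ) (∑ j, α j * (1 / (z - zpt θ j) - 1 / z)) z := by
  have hz0 : z ≠ 0 := fun h => by norm_num [h] at hz
  refine HasDerivAt.fun_sum fun j _ => HasDerivAt.const_mul _ ?_
  have h1 := one_sub_div_mem (θ := θ) hz j
  have h2 : z - zpt θ j ≠ 0 := fun h => by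
    rw [← sub_eq_zero.1 h, div_self hz0] at h1
    simp at h1
  refine ((((hasDerivAt_id z).inv hz0).const_mul (zpt θ j)).const_sub 1).clog
    (by simpa [div_eq_mul_inv] using h1) |>.congr_deriv ?_ |>.congr_of_eventuallyEq ?_
  · simp only [id, Pi.inv_apply]
    have h3 : 1 - zpt θ j * z⁻¹ ≠ 0 := by rw [← div_eq_mul_inv]; exact slitPlane_ne_zero h1
    have h4 : 1 - zpt θ j * z⁻¹ = (z - zpt θ j) / z := by field_simp
    rw [h4]
    field_simp
    ring
  · exact .of_forall fun w => by simp [div_eq_mul_inv]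

lemma differentiableAt_psiInf (hα : Admissible α) (hinj : Injective (zpt θ))
    {z : ℂ} (hz : 1 < ‖z‖) (a b : Fin 2) : DifferentiableAt ℂ (fun z => psiInf n α β θ z a b) z := by
  have hz0 : z ≠ 0 := fun h => by norm_num [h] at hz
  have h1 := (hasDerivAt_eInf (α := α) (θ := θ) hz).differentiableAt
  have h2 := (hasDerivAt_cauchyT (n := n) (β := β) hα hinj hz.ne').differentiableAt
  have h3 : DifferentiableAt ℂ (fun z : ℂ => z ^ n) z := differentiableAt_id.pow n
  fin_cases a <;> fin_cases b <;> simp only [psiInf, Fin.zero_eta, Fin.mk_one, of_apply,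
    cons_val', cons_val_zero, cons_val_one, cons_val_fin_one]
  · exact h1.cexp.mul (h3.inv (pow_ne_zero _ hz0))
  · exact h2.mul (h1.neg.cexp.mul h3)
  · exact differentiableAt_const _
  · exact h1.neg.cexp.mul h3

section

variable {ε : ℝ} {Φ : ℂ → Mat} {F : Fin (m + 1) → ℂ → Mat} {F0 : ℂ → Mat}
  (h : IsPhiSolution n α β θ ε Φ F F0) (hθ : IsConfiguration θ)
  (hα : Admissible α) {M : ℂ → Mat}
  (hM : ∀ a b, Differentiable ℂ fun z => M z a b)
  (hMΦ : ∀ z ∉ contour θ, Φ z = M z * psiMat n α β θ z)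
include h hα hθ hM hMΦ

lemma IsPhiSolution.isBigO_entire (a b : Fin 2) :
    (fun z => (M z * psiInf n α β θ z - 1) a b) =O[cobounded ℂ] fun z => z⁻¹ := by
  choose C hC using fun j => (h.infinity j a b).bound
  simp only [eventually_inf_principal] at hC
  obtain ⟨R, -, hR⟩ := (Filter.hasBasis_cobounded_norm (E := ℂ)).eventually_iff.1 (eventually_all.2 hC)
  have hopen : IsOpen {z : ℂ | max R 1 < ‖z‖} := isOpen_lt continuous_const continuous_norm
  have key : ∀ z ∈ {z : ℂ | max R 1 < ‖z‖} ∩ (contour θ)ᶜ,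
      ‖(M z * psiInf n α β θ z - 1) a b‖ ≤ (∑ j, |C j|) * ‖z⁻¹‖ := by
    rintro z ⟨hz, hzc⟩
    have hz1 : 1 < ‖z‖ := (le_max_right _ _).trans_lt hz
    obtain ⟨j, hj⟩ := exists_sector hzc hz1
    have h1 := hR (x := z) ((le_max_left R 1).trans (le_of_lt hz)) j ⟨hj, hzc⟩
    rw [hMΦ z hzc, mul_assoc, psiMat_mul_of_mem_sector hθ hj hz1] at h1
    refine h1.trans (mul_le_mul_of_nonneg_right ((le_abs_self _).trans ?_) (norm_nonneg _))
    exact single_le_sum (f := fun j => |C j|) (fun j _ => abs_nonneg _) (mem_univ j)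
  refine Asymptotics.IsBigO.of_bound (∑ j, |C j|) ?_
  filter_upwards [tendsto_norm_cobounded_atTop.eventually_gt_atTop (max R 1)] with z hz
  have hz1 : 1 < ‖z‖ := (le_max_right _ _).trans_lt hz
  have hz0 : z ≠ 0 := fun h => by norm_num [h] at hz1
  refine ContinuousWithinAt.closure_le (dense_contour_compl.open_subset_closure_inter hopen hz) ?_ ?_ key
  · have h1 : ContinuousAt (fun z => (M z * psiInf n α β θ z) a b) z :=
      (differentiableAt_matrix_mul (fun a b => (hM a b) z)
        (differentiableAt_psiInf hα (zpt_injective hθ) hz1) a b).continuousAt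
    exact (h1.sub continuousAt_const).norm.continuousWithinAt
  · exact (continuousAt_const.mul (continuousAt_id.inv₀ hz0).norm).continuousWithinAt

lemma IsPhiSolution.tendsto_entire (a b : Fin 2) :
    Tendsto (fun z => (M z * psiInf n α β θ z) a b) (cobounded ℂ) (𝓝 ((1 : Mat) a b)) := by
  have h1 := (h.isBigO_entire hθ hα hM hMΦ a b).trans_tendsto tendsto_inv₀_cobounded
  simpa using h1.add_const ((1 : Mat) a b)

omit h hα hθ hM hMΦ in
lemma tendsto_exp_mul_eInf (c : ℂ) :
    Tendsto (fun z => exp (c * eInf α θ z)) (cobounded ℂ) (𝓝 1) := by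
  simpa using ((tendsto_eInf (α := α) (θ := θ)).const_mul c).cexp

omit h hα hθ hM hMΦ in
lemma eventually_ne_zero_cobounded : ∀ᶠ z : ℂ in cobounded ℂ, z ≠ 0 := by
  filter_upwards [eventually_ge_norm 1] with z hz h
  norm_num [h] at hz

lemma IsPhiSolution.exists_polynomial (a : Fin 2) :
    ∃ p : ℂ[X], p.natDegree ≤ n ∧ p.coeff n = (1 : Mat) a 0 ∧ ∀ z, M z a 0 = p.eval z := by
  have h1 : Tendsto (fun z => M z a 0 * (z ^ n)⁻¹) (cobounded ℂ) (𝓝 ((1 : Mat) a 0)) := by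
    have := (h.tendsto_entire hθ hα hM hMΦ a 0).mul (tendsto_exp_mul_eInf (α := α) (θ := θ) (-1))
    rw [mul_one] at this
    refine this.congr fun z => ?_
    simp only [mul_apply, Fin.sum_univ_two, psiInf, of_apply, cons_val',
      cons_val_zero, cons_val_one, cons_val_fin_one, mul_zero, add_zero]
    have e : exp (eInf α θ z) * exp (-1 * eInf α θ z) = 1 := by rw [← exp_add]; simp
    linear_combination M z a 0 * (z ^ n)⁻¹ * e
  have h2 : (fun z => M z a 0) =O[cobounded ℂ] fun z => z ^ n := by
    have := (h1.isBigO_one ℂ).mul (Asymptotics.isBigO_refl (fun z : ℂ => z ^ n) _)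
    refine this.congr' ?_ (.of_forall fun z => one_mul _)
    filter_upwards [eventually_ne_zero_cobounded] with z hz
    rw [mul_assoc, inv_mul_cancel₀ (pow_ne_zero _ hz), mul_one]
  obtain ⟨p, hp, hpM⟩ := exists_polynomial_of_growth (hM a 0) n h2
  refine ⟨p, hp, ?_, hpM⟩
  have h3 : (p - C (p.coeff n) * X ^ n).degree < (n : WithBot ℕ) := by
    rw [degree_lt_iff_coeff_zero]
    intro k hk
    rw [coeff_sub, coeff_C_mul, coeff_X_pow]
    split_ifs with hkn
    · rw [hkn, mul_one, sub_self]
    · rw [coeff_eq_zero_of_natDegree_lt (by omega), mul_zero, sub_zero]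
  have h4 := (isBigO_eval_div_pow h3).trans_tendsto tendsto_inv₀_cobounded
  have h5 : Tendsto (fun z => M z a 0 * (z ^ n)⁻¹) (cobounded ℂ) (𝓝 (p.coeff n)) := by
    have := h4.add_const (p.coeff n)
    rw [zero_add] at this
    refine this.congr' ?_
    filter_upwards [eventually_ne_zero_cobounded] with z hz
    rw [hpM, eval_sub, eval_mul, eval_C, eval_pow, eval_X]
    field_simp
    ring
  exact tendsto_nhds_unique h5 h1

lemma IsPhiSolution.orthogonality (hn : 1 ≤ n) {a : Fin 2} {p : ℂ[X]} (hp : ∀ z, M z a 0 = p.eval z) :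
    (∀ z, M z a 1 = (remPoly (ell n α β θ) p).eval z) ∧
      ∀ q : ℂ[X], q.degree < n → ell n α β θ (p * q) = -(1 : Mat) a 1 * q.coeff (n - 1) := by
  have hinj := zpt_injective hθ
  set c := (1 : Mat) a 1
  have h1 : Tendsto (fun z => z ^ n * (p.eval z * cauchyT n α β θ z + M z a 1))
      (cobounded ℂ) (𝓝 c) := by
    have := (h.tendsto_entire hθ hα hM hMΦ a 1).mul (tendsto_exp_mul_eInf (α := α) (θ := θ) 1)
    rw [mul_one] at this
    refine this.congr fun z => ?_
    simp only [mul_apply, Fin.sum_univ_two, psiInf, of_apply, cons_val',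
      cons_val_zero, cons_val_one, cons_val_fin_one]
    have e : exp (-eInf α θ z) * exp (1 * eInf α θ z) = 1 := by rw [← exp_add]; simp
    rw [hp]
    linear_combination z ^ n * (p.eval z * cauchyT n α β θ z + M z a 1) * e
  have h2 : Tendsto (fun z : ℂ => (z ^ n)⁻¹) (cobounded ℂ) (𝓝 0) := by
    have := (tendsto_inv₀_cobounded (α := ℂ)).pow n
    simpa [zero_pow (by omega : n ≠ 0)] using this
  have hmom := isBigO_mom_inv_sub (n := n) (β := β) hα hinj (PerC1.polynomial p)
  have h3 : Tendsto (fun z => M z a 1 - (remPoly (ell n α β θ) p).eval z)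
      (cobounded ℂ) (𝓝 0) := by
    have := (h1.mul h2).sub (hmom.trans_tendsto tendsto_inv₀_cobounded)
    rw [mul_zero, sub_zero] at this
    refine this.congr' ?_
    filter_upwards [eventually_gt_norm 1] with z hz
    have hz0 : z ≠ 0 := fun h => by norm_num [h] at hz
    rw [mom_mul_inv_sub hα hinj p hz.ne', eval_remPoly]
    field_simp
    ring
  have h4 : ∀ z, M z a 1 = (remPoly (ell n α β θ) p).eval z := fun z =>
    sub_eq_zero.1 (Differentiable.apply_eq_of_tendsto_cocompact
      (f := fun z => M z a 1 - (remPoly (ell n α β θ) p).eval z)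
      ((hM a 1).sub (remPoly (ell n α β θ) p).differentiable) z
      (by rwa [← cobounded_eq_cocompact]))
  refine ⟨h4, ?_⟩
  set r : ℂ[X] := ∑ k ∈ range n, C (ell n α β θ (p * X ^ k)) * X ^ (n - 1 - k) with hr
  have h5 : Tendsto (fun z => r.eval z) (cobounded ℂ) (𝓝 (-c)) := by
    have := ((isBigO_mom_inv_sub (n := n) (β := β) hα hinj
      (PerC1.polynomial (p * X ^ n))).trans_tendsto tendsto_inv₀_cobounded).sub h1
    rw [zero_sub] at this
    refine this.congr' ?_
    filter_upwards [eventually_gt_norm 1] with z hz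
    have e1 := pow_mul_mom_inv_sub (n := n) (β := β) hα hinj p n hz.ne'
    rw [mom_mul_inv_sub hα hinj p hz.ne', ← eval_remPoly, ← h4] at e1
    rw [e1, hr, eval_finsetSum]
    simp
  have h6 : r = C (-c) := Polynomial.funext fun z => by
    rw [eval_C]
    exact Differentiable.apply_eq_of_tendsto_cocompact r.differentiable z
      (by rwa [← cobounded_eq_cocompact])
  have h7 : ∀ k < n, ell n α β θ (p * X ^ k) = if k = n - 1 then -c else 0 := by
    intro k hk
    have := congrArg (fun q => q.coeff (n - 1 - k)) h6
    simp only [hr, finsetSum_coeff, coeff_C_mul, coeff_X_pow, coeff_C] at this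
    rw [sum_eq_single k] at this
    · simpa [show n - 1 - k = 0 ↔ k = n - 1 by omega] using this
    · intro i hi hik
      rw [mem_range] at hi
      rw [if_neg (by omega), mul_zero]
    · intro hk'
      exact absurd (mem_range.2 hk) hk'
  intro q hq
  refine ext_of_orth (f := -c • lcoeff ℂ (n - 1)) (fun k hk => ?_) hq
  rw [h7 k hk, LinearMap.smul_apply, lcoeff_apply, coeff_X_pow, smul_eq_mul]
  simp only [eq_comm]
  split_ifs <;> ring

lemma IsPhiSolution.isOrthPair_of_entire (hn : 1 ≤ n) :
    ∃ P Q, IsOrthPair ℒ n P Q ∧ ∀ z, M z = !![P.eval z, (remPoly ℒ P).eval z;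
      Q.eval z, (remPoly ℒ Q).eval z] := by
  obtain ⟨P, hP, hPn, hPM⟩ := h.exists_polynomial hθ hα hM hMΦ 0
  obtain ⟨Q, hQ, hQn, hQM⟩ := h.exists_polynomial hθ hα hM hMΦ 1
  obtain ⟨h1, h2⟩ := h.orthogonality hθ hα hM hMΦ hn hPM
  obtain ⟨h3, h4⟩ := h.orthogonality hθ hα hM hMΦ hn hQM
  refine ⟨P, Q, ⟨monic_of_natDegree_le_of_coeff_eq_one n hP (by simpa using hPn), ?_, ?_,
    fun q hq => by rw [h2 q hq]; simp, fun q hq => by rw [h4 q hq]; simp⟩, fun z => ?_⟩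
  · refine natDegree_eq_of_le_of_coeff_ne_zero hP ?_
    rw [hPn]; simp
  · rw [degree_lt_iff_coeff_zero]
    intro k hk
    rcases hk.eq_or_lt with rfl | hk
    · simpa using hQn
    · exact coeff_eq_zero_of_natDegree_lt (by omega)
  · rw [← hPM, ← hQM, ← h1, ← h3]
    ext a b
    fin_cases a <;> fin_cases b <;> rfl

end

/-- The solution of the Riemann-Hilbert problem is unique, and it exists only if the determinant
does not vanish. -/
lemma IsPhiSolution.eq_phiSol {ε : ℝ} {Φ : ℂ → Mat} {F : ι → ℂ → Mat} {F0 : ℂ → Mat}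
    (h : IsPhiSolution n α β θ ε Φ F F0) (hε : 0 < ε) (hθ : IsConfiguration θ)
    (hα : Admissible α) (hα' : ∀ j, NonResonant (α j))
    (hn : 1 ≤ n) : (momMatrix n α β θ).det ≠ 0 ∧ ∀ z ∉ contour θ, Φ z = phiSol n α β θ z := by
  obtain ⟨M, hM, hMΦ⟩ := h.exists_entire hε hθ hα hα'
  obtain ⟨P, Q, hPQ, hMPQ⟩ := h.isOrthPair_of_entire hθ hα hM hMΦ hn
  have h0 : (momMatrix n α β θ).det ≠ 0 := by rw [← toepMatrix_ell]; exact hPQ.det_ne_zero hn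
  obtain ⟨rfl, rfl⟩ := hPQ.unique (isOrthPair_poly (by rwa [toepMatrix_ell])) hn
  exact ⟨h0, fun z hz => by rw [hMΦ z hz, hMPQ, phiSol, solM]⟩

lemma eqOn_ball_of_eqOn_compl {f g : ℂ → ℂ} {p : ℂ} {r : ℝ}
    (hf : ContinuousOn f (ball p r)) (hg : ContinuousOn g (ball p r))
    (h : ∀ z ∈ ball p r \ contour θ, f z = g z) : Set.EqOn f g (ball p r) :=
  Set.EqOn.of_subset_closure (s := ball p r ∩ (contour θ)ᶜ) h hf hg Set.inter_subset_left
    (dense_contour_compl.open_subset_closure_inter isOpen_ball)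

lemma eq_of_mul_eq_of_det {A B S : Mat} (hS : S.det = 1) (h : A * S = B * S) : A = B := by
  have := congrArg (· * S.adjugate) h
  simpa only [mul_assoc, mul_adjugate, hS, one_smul, mul_one] using this

section

variable {ε : ℝ} {Φ : ℂ → Mat} {F : Fin (m + 1) → ℂ → Mat} {F0 : ℂ → Mat}
  (h : IsPhiSolution n α β θ ε Φ F F0) (hε : 0 < ε) (hθ : IsConfiguration θ)
  (hα : Admissible α) (hα' : ∀ j, NonResonant (α j))
  (hn : 1 ≤ n) {d : ℝ} (hd : Sep θ d)
include h hε hθ hα hα' hn hd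

/-- The holomorphic factors are determined by the problem. -/
lemma IsPhiSolution.factor_eq {o : ι → ℂ} (ho : ∀ j, ‖zpt θ j - o j‖ < d / 32)
    (j : ι) {z : ℂ} (hz : z ∈ ball (zpt θ j) (min ε (d / 128))) :
    F j z = phiF n α β θ (o j) d j z := by
  obtain ⟨h0, hΦ⟩ := h.eq_phiSol hε hθ hα hα' hn
  have hs := isPhiSolution_phiSol hd hθ hα hα' hn h0 ho
  have s1 := ball_subset_ball (x := zpt θ j) (min_le_left ε (d / 128))
  have s2 := ball_subset_ball (x := zpt θ j) (min_le_right ε (d / 128))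
  ext a b
  refine eqOn_ball_of_eqOn_compl (θ := θ) (f := fun z => F j z a b)
    (g := fun z => phiF n α β θ (o j) d j z a b)
    ((h.factor_analytic j a b).continuousOn.mono s1)
    ((hs.factor_analytic j a b).continuousOn.mono s2) (fun z hz => ?_) hz
  have e := hΦ z hz.2
  rw [h.factor j z ⟨s1 hz.1, hz.2⟩, hs.factor j z ⟨s2 hz.1, hz.2⟩] at e
  have := eq_of_mul_eq_of_det (det_singFactor _ _) (eq_of_mul_eq_of_det (det_connection _ _) e)
  simp only [this]

lemma IsPhiSolution.factor0_eq {z : ℂ} (hz : z ∈ ball 0 (min ε (d / 128))) :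
    F0 z = phiF0 n α β θ z := by
  obtain ⟨h0, hΦ⟩ := h.eq_phiSol hε hθ hα hα' hn
  have hd0 := hd.1
  have hs := isPhiSolution_phiSol hd hθ hα hα' hn h0 (o := zpt θ)
    (fun j => by rw [sub_self, norm_zero]; linarith)
  have s1 := ball_subset_ball (x := (0 : ℂ)) (min_le_left ε (d / 128))
  have s2 := ball_subset_ball (x := (0 : ℂ)) (min_le_right ε (d / 128))
  ext a b
  refine eqOn_ball_of_eqOn_compl (θ := θ) (f := fun z => F0 z a b)
    (g := fun z => phiF0 n α β θ z a b)
    ((h.factor0_analytic a b).continuousOn.mono s1)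
    ((hs.factor0_analytic a b).continuousOn.mono s2) (fun z hz => ?_) hz
  have e := hΦ z hz.2
  rw [h.factor0 z ⟨s1 hz.1, hz.2⟩, hs.factor0 z ⟨s2 hz.1, hz.2⟩] at e
  have := eq_of_mul_eq_of_det (det_expSigma3 _) e
  simp only [this]

end

/-! ### The Fuchsian system -/

lemma hasDerivAt_matrix_mul {A B : ℂ → Mat} {A' B' : Mat} {z : ℂ}
    (hA : ∀ a b, HasDerivAt (fun z => A z a b) (A' a b) z)
    (hB : ∀ a b, HasDerivAt (fun z => B z a b) (B' a b) z) (a b : Fin 2) :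
    HasDerivAt (fun z => (A z * B z) a b) ((A' * B z + A z * B') a b) z := by
  simp only [Matrix.add_apply, mul_apply, Fin.sum_univ_two]
  refine (((hA a 0).mul (hB 0 b)).add ((hA a 1).mul (hB 1 b))).congr_deriv ?_
  ring

/-- The coefficient matrix of the system satisfied by `U(G) h ^ σ₃`. -/
def xiTot (n : ℕ) (α β : ι → ℂ) (θ : ι → ℝ) (z : ℂ) : Mat :=
  xiMat (logDerivW n α β θ z / 2) (residSum n α β θ z)

lemma hasDerivAt_triangular {E Ei G : ℂ → ℂ} {z r ρ κ : ℂ} (hE : HasDerivAt E ((r / 2 + κ) * E z) z)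
    (hEi : HasDerivAt Ei (-(r / 2 + κ) * Ei z) z) (hG : HasDerivAt G (r * G z + ρ) z) (a b : Fin 2) :
    HasDerivAt (fun z => (!![E z, G z * Ei z; 0, Ei z] : Mat) a b)
      ((xiMat (r / 2) ρ * !![E z, G z * Ei z; 0, Ei z] +
        κ • (!![E z, G z * Ei z; 0, Ei z] * sigma3)) a b) z := by
  fin_cases a <;> fin_cases b <;> simp [xiMat, sigma3]
  · exact hE.congr_deriv (by ring)
  · exact (hG.mul hEi).congr_deriv (by ring)
  · exact hasDerivAt_const _ _
  · exact hEi.congr_deriv (by ring)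

lemma psiMat_eq (z : ℂ) : psiMat n α β θ z = !![exp (hLog n α β θ z),
    𝓒 z * exp (-hLog n α β θ z); 0, exp (-hLog n α β θ z)] := by
  rw [psiMat, upper, expSigma3]
  ext a b
  fin_cases a <;> fin_cases b <;> simp [mul_apply]

section

variable (hα : Admissible α) (hinj : Injective (zpt θ))
include hα hinj

lemma hasDerivAt_psiMat {z : ℂ} (hz : z ∉ contour θ) (a b : Fin 2) :
    HasDerivAt (fun z => psiMat n α β θ z a b) ((xiTot n α β θ z * psiMat n α β θ z) a b) z := by
  have hc := cutFree_of_notMem_contour hz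
  have hL := hasDerivAt_hLog (n := n) (α := α) (β := β) hc
  have := hasDerivAt_triangular (κ := 0) (r := logDerivW n α β θ z) (z := z)
    (E := fun z => exp (hLog n α β θ z)) (Ei := fun z => exp (-hLog n α β θ z))
    (hL.cexp.congr_deriv (by ring)) (hL.neg.cexp.congr_deriv (by simp; ring))
    (hasDerivAt_cauchyT_ode (n := n) (β := β) hα hinj (norm_ne_one_of_notMem_contour hz) hc.ne_zero) a b
  simp only [psiMat_eq, xiTot]
  simpa using this

lemma hasDerivAt_psiInf {z : ℂ} (hz : 1 < ‖z‖) (a b : Fin 2) :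
    HasDerivAt (fun z => psiInf n α β θ z a b) ((xiTot n α β θ z * psiInf n α β θ z +
      (-expInfty n α β / z) • (psiInf n α β θ z * sigma3)) a b) z := by
  have hz0 : z ≠ 0 := fun h => by norm_num [h] at hz
  have hL := hasDerivAt_eInf (α := α) (θ := θ) hz

  have hP' : HasDerivAt (fun z : ℂ => z ^ n) (n / z * z ^ n) z := by
    refine (hasDerivAt_pow n z).congr_deriv ?_
    rcases n with _ | k
    · simp
    · rw [Nat.add_sub_cancel, pow_succ]; field_simp
  have e : logDerivW n α β θ z / 2 + -expInfty n α β / z =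
      (∑ j, α j * (1 / (z - zpt θ j) - 1 / z)) - n / z := by
    have e1 : ∑ j, α j * (1 / (z - zpt θ j) - 1 / z) = ∑ j, α j / (z - zpt θ j) - (∑ j, α j) / z := by
      rw [sum_div, ← sum_sub_distrib]
      exact sum_congr rfl fun j _ => by ring
    have e2 : ∑ j, 2 * α j / (z - zpt θ j) = 2 * ∑ j, α j / (z - zpt θ j) := by
      rw [mul_sum]
      exact sum_congr rfl fun j _ => by ring
    rw [logDerivW, lam, expInfty, e1, e2, ← sum_div, ← sum_div, sum_sub_distrib, sum_add_distrib]
    ring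
  have := hasDerivAt_triangular (κ := -expInfty n α β / z) (r := logDerivW n α β θ z) (z := z)
    (E := fun z => exp (eInf α θ z) * (z ^ n)⁻¹) (Ei := fun z => exp (-eInf α θ z) * z ^ n)
    ((hL.cexp.mul (hP'.inv (pow_ne_zero _ hz0))).congr_deriv (by
      have := pow_ne_zero n hz0
      rw [e]
      generalize ∑ j, α j * (1 / (z - zpt θ j) - 1 / z) = s
      simp only [Pi.inv_apply]
      field_simp
      ring))
    ((hL.neg.cexp.mul hP').congr_deriv (by rw [e]; simp; ring))
    (hasDerivAt_cauchyT_ode (n := n) (β := β) hα hinj hz.ne' hz0) a b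
  exact this

end

lemma xiTot_eq (z : ℂ) : xiTot n α β θ z = (∑ k, (z - zpt θ k)⁻¹ • xiMat (α k) (resid n α β θ k)) +
      z⁻¹ • xiMat (lam n α β) (resid0 n α β θ) := by
  have e : logDerivW n α β θ z / 2 = (∑ k, (z - zpt θ k)⁻¹ * α k) + z⁻¹ * lam n α β := by
    rw [logDerivW, add_div, sum_div, add_comm]
    congr 1
    · exact sum_congr rfl fun k _ => by ring
    · ring
  ext a b
  simp only [Matrix.add_apply, Matrix.sum_apply, Matrix.smul_apply, smul_eq_mul, xiTot, e]
  fin_cases a <;> fin_cases b <;> simp [xiMat, residSum, div_eq_mul_inv, mul_comm, add_comm]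

/-- The derivative of a function that is `O(1 / z)` at infinity tends to zero. -/
lemma tendsto_deriv_of_isBigO {f : ℂ → ℂ} (hf : ∀ z, 1 < ‖z‖ → DifferentiableAt ℂ f z)
    (hO : f =O[cobounded ℂ] fun z => z⁻¹) :
    Tendsto (deriv f) (cobounded ℂ) (𝓝 0) := by
  obtain ⟨C, hC⟩ := hO.bound
  obtain ⟨R, -, hR⟩ := (Filter.hasBasis_cobounded_norm (E := ℂ)).eventually_iff.1 hC
  have h1 : Tendsto (fun z : ℂ => |C| * (2 * ‖z⁻¹‖)) (cobounded ℂ) (𝓝 0) := by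
    simpa using ((tendsto_inv₀_cobounded (α := ℂ)).norm.const_mul 2).const_mul |C|
  refine squeeze_zero_norm' ?_ h1
  filter_upwards [tendsto_norm_cobounded_atTop.eventually_gt_atTop (max (R + 1) 3)] with z hz
  have hz1 : R + 1 < ‖z‖ := (le_max_left _ _).trans_lt hz
  have hz2 : 3 < ‖z‖ := (le_max_right _ _).trans_lt hz
  have hw : ∀ w ∈ closedBall z 1, ‖z‖ - 1 ≤ ‖w‖ := fun w hw => by
    rw [mem_closedBall_iff_norm'] at hw
    linarith [norm_sub_norm_le z w]
  have h2 : DiffContOnCl ℂ f (ball z 1) := by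
    refine DifferentiableOn.diffContOnCl fun w hwz => (hf w ?_).differentiableWithinAt
    rw [closure_ball z one_ne_zero] at hwz
    linarith [hw w hwz]
  have h3 := Complex.norm_deriv_le_of_forall_mem_sphere_norm_le one_pos h2
    (C := |C| * (2 * ‖z⁻¹‖)) fun w hws => ?_
  · rwa [div_one] at h3
  · have h4 := hw w (sphere_subset_closedBall hws)
    refine (hR (x := w) (show R ≤ ‖w‖ by linarith)).trans ?_
    refine mul_le_mul (le_abs_self C) ?_ (norm_nonneg _) (abs_nonneg _)
    rw [norm_inv, norm_inv, ← div_eq_mul_inv, inv_le_comm₀ (by linarith) (by positivity), inv_div]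
    linarith

lemma differentiable_dslope {f : ℂ → ℂ} (hf : Differentiable ℂ f) (c : ℂ) :
    Differentiable ℂ (dslope f c) :=
  differentiableOn_univ.1 ((differentiableOn_dslope Filter.univ_mem).2 hf.differentiableOn)

section

variable (hα : Admissible α) (hinj : Injective (zpt θ)) (hn : 1 ≤ n)
  (h0 : (momMatrix n α β θ).det ≠ 0)
include hα hinj hn h0

lemma tendsto_logDeriv_solM :
    Tendsto (fun z => (derivMat (solM (ell n α β θ) n) z + solM (ell n α β θ) n z * xiTot n α β θ z) *
      (solM (ell n α β θ) n z).adjugate) (cobounded ℂ) (𝓝 0) := by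
  set M := solM (ell n α β θ) n
  set W : ℂ → Mat := fun z => M z * psiInf n α β θ z with hW
  have hM : ∀ z a b, HasDerivAt (fun z => M z a b) (derivMat M z a b) z := fun z a b =>
    (hasDerivAt_solM z a b).differentiableAt.hasDerivAt
  have hO := isBigO_solM_mul_psiInf (β := β) hα hinj hn h0
  have h1 : Tendsto W (cobounded ℂ) (𝓝 1) :=
    tendsto_pi_nhds.2 fun a => tendsto_pi_nhds.2 fun b => by
      simpa using ((hO a b).trans_tendsto tendsto_inv₀_cobounded).add_const ((1 : Mat) a b)
  have hd : ∀ z, 1 < ‖z‖ → ∀ a b, HasDerivAt (fun z => (W z - 1) a b)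
      ((derivMat M z * psiInf n α β θ z + M z * (xiTot n α β θ z * psiInf n α β θ z +
        (-expInfty n α β / z) • (psiInf n α β θ z * sigma3))) a b) z := fun z hz a b =>
    (hasDerivAt_matrix_mul (hM z) (hasDerivAt_psiInf hα hinj hz) a b).sub_const _
  have h2 : Tendsto (fun z => derivMat (fun z => W z - 1) z) (cobounded ℂ) (𝓝 0) :=
    tendsto_pi_nhds.2 fun a => tendsto_pi_nhds.2 fun b =>
      tendsto_deriv_of_isBigO (fun z hz => (hd z hz a b).differentiableAt) (hO a b)
  have h3 : Tendsto (fun z : ℂ => -expInfty n α β / z) (cobounded ℂ) (𝓝 0) := by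
    simpa [div_eq_mul_inv] using (tendsto_inv₀_cobounded (α := ℂ)).const_mul (-expInfty n α β)
  have hadj : Continuous fun A : Mat => A.adjugate := continuous_id.matrix_adjugate
  have h4 := (h2.sub (h3.smul (h1.mul_const sigma3))).mul ((hadj.tendsto _).comp h1)
  simp only [zero_smul, sub_zero, zero_mul] at h4
  refine h4.congr' ?_
  filter_upwards [eventually_gt_norm 1] with z hz
  have e : derivMat (fun z => W z - 1) z = derivMat M z * psiInf n α β θ z +
      M z * (xiTot n α β θ z * psiInf n α β θ z +
        (-expInfty n α β / z) • (psiInf n α β θ z * sigma3)) := by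
    ext a b
    exact (hd z hz a b).deriv
  have hz0 : z ≠ 0 := fun h => by norm_num [h] at hz
  rw [e]
  simp only [Function.comp_apply, hW, adjugate_mul_distrib]
  rw [mul_add (M z), Matrix.mul_smul, ← mul_assoc (M z) (psiInf _ _ _ _ _) sigma3, add_sub_assoc,
    add_sub_cancel_right, ← mul_assoc (M z), ← add_mul, mul_assoc, ← mul_assoc (psiInf _ _ _ _ _),
    mul_adjugate, det_psiInf hz0, one_smul, one_mul]

/-- The logarithmic derivative of the polynomial part. -/
lemma logDeriv_solM_eq {z : ℂ} (hz0 : z ≠ 0) (hz : ∀ k, z - zpt θ k ≠ 0) :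
    (derivMat (solM (ell n α β θ) n) z + solM (ell n α β θ) n z * xiTot n α β θ z) *
      (solM (ell n α β θ) n z).adjugate =
    (∑ k, (z - zpt θ k)⁻¹ • (solM (ell n α β θ) n (zpt θ k) * xiMat (α k) (resid n α β θ k) *
      (solM (ell n α β θ) n (zpt θ k)).adjugate)) +
    z⁻¹ • (solM (ell n α β θ) n 0 * xiMat (lam n α β) (resid0 n α β θ) *
      (solM (ell n α β θ) n 0).adjugate) := by
  set M := solM (ell n α β θ) n with hMdef
  have hM : ∀ a b, Differentiable ℂ fun z => M z a b := fun a b z =>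
    (hasDerivAt_solM z a b).differentiableAt
  have hN : ∀ (X : Mat) (a b : Fin 2), Differentiable ℂ fun z => (M z * X * (M z).adjugate) a b :=
    fun X a b z => differentiableAt_matrix_mul
      (differentiableAt_matrix_mul (fun a b => hM a b z) fun a b => differentiableAt_const (X a b))
      (differentiableAt_adjugate fun a b => hM a b z) a b
  have hD : ∀ a b, Differentiable ℂ fun z => derivMat M z a b := fun a b =>
    differentiableOn_univ.1 ((hM a b).differentiableOn.deriv isOpen_univ)
  have hsl : ∀ (X : Mat) (a b : Fin 2) {c z : ℂ}, z - c ≠ 0 →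
      dslope (fun z => (M z * X * (M z).adjugate) a b) c z =
        ((z - c)⁻¹ • (M z * X * (M z).adjugate) - (z - c)⁻¹ • (M c * X * (M c).adjugate)) a b := by
    intro X a b c z hc
    rw [dslope_of_ne _ (_root_.sub_ne_zero.1 hc), slope_def_field, Matrix.sub_apply, Matrix.smul_apply,
      Matrix.smul_apply, smul_eq_mul, smul_eq_mul]
    ring
  ext a b
  set K : ℂ → ℂ := fun z => (derivMat M z * (M z).adjugate) a b +
    (∑ k, dslope (fun z => (M z * xiMat (α k) (resid n α β θ k) * (M z).adjugate) a b) (zpt θ k) z) +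
    dslope (fun z => (M z * xiMat (lam n α β) (resid0 n α β θ) * (M z).adjugate) a b) 0 z with hK
  have hKd : Differentiable ℂ K := by
    refine (Differentiable.add (fun z => ?_) (Differentiable.fun_sum fun k _ =>
      differentiable_dslope (hN _ a b) _)).add (differentiable_dslope (hN _ a b) _)
    exact differentiableAt_matrix_mul (fun a b => hD a b z)
      (differentiableAt_adjugate fun a b => hM a b z) a b
  have hKe : ∀ z : ℂ, z ≠ 0 → (∀ k, z - zpt θ k ≠ 0) →
      K z = ((derivMat M z + M z * xiTot n α β θ z) * (M z).adjugate) a b -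
        ((∑ k, (z - zpt θ k)⁻¹ • (M (zpt θ k) * xiMat (α k) (resid n α β θ k) *
        (M (zpt θ k)).adjugate)) + z⁻¹ • (M 0 * xiMat (lam n α β) (resid0 n α β θ) *
        (M 0).adjugate)) a b := by
    intro z hz0 hz
    have e1 := hsl (xiMat (lam n α β) (resid0 n α β θ)) a b (c := 0) (z := z) (by rwa [sub_zero])
    rw [sub_zero] at e1
    rw [hK]
    simp only [e1, hsl _ a b (hz _)]
    rw [xiTot_eq, add_mul, mul_add (M z), mul_sum, add_mul (∑ k, _), sum_mul]
    simp only [Matrix.mul_smul, Matrix.smul_mul, Matrix.add_apply, Matrix.sub_apply,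
      Matrix.sum_apply, sum_sub_distrib]
    ring
  have hnp : ∀ᶠ z : ℂ in cobounded ℂ, z ≠ 0 ∧ ∀ k, z - zpt θ k ≠ 0 := by
    filter_upwards [eventually_gt_norm 1] with z hz
    exact ⟨fun h => by norm_num [h] at hz, fun k => zpt_ne_of_norm hz.ne' k⟩
  have hlim : Tendsto K (cobounded ℂ) (𝓝 0) := by
    have t1 : Tendsto (fun z => ((derivMat M z + M z * xiTot n α β θ z) * (M z).adjugate) a b)
        (cobounded ℂ) (𝓝 0) :=
      ((continuous_id.matrix_elem a b).tendsto (0 : Mat)).comp (tendsto_logDeriv_solM hα hinj hn h0)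
    have hi : ∀ c : ℂ, Tendsto (fun z : ℂ => (z - c)⁻¹) (cobounded ℂ) (𝓝 0) := fun c =>
      tendsto_inv₀_cobounded.comp (tendsto_sub_const_cobounded c)
    have t2 : Tendsto (fun z => ((∑ k, (z - zpt θ k)⁻¹ • (M (zpt θ k) * xiMat (α k) (resid n α β θ k) *
        (M (zpt θ k)).adjugate)) + z⁻¹ • (M 0 * xiMat (lam n α β) (resid0 n α β θ) *
        (M 0).adjugate)) a b) (cobounded ℂ) (𝓝 0) := by
      simp only [Matrix.add_apply, Matrix.sum_apply, Matrix.smul_apply, smul_eq_mul]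
      simpa using (tendsto_finsetSum univ fun k _ => (hi (zpt θ k)).mul_const
        ((M (zpt θ k) * xiMat (α k) (resid n α β θ k) * (M (zpt θ k)).adjugate) a b)).add
        ((tendsto_inv₀_cobounded (α := ℂ)).mul_const _)
    have := t1.sub t2
    rw [sub_zero] at this
    exact this.congr' (hnp.mono fun z hz => (hKe z hz.1 hz.2).symm)
  have h1 := hKd.apply_eq_of_tendsto_cocompact z (by rwa [← cobounded_eq_cocompact])
  rw [hKe z hz0 hz, sub_eq_zero] at h1
  exact h1

lemma hasDerivAt_phiSol {z : ℂ} (hz : z ∉ contour θ) (a b : Fin 2) :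
    HasDerivAt (fun z => phiSol n α β θ z a b)
      ((((∑ k, (z - zpt θ k)⁻¹ • (solM (ell n α β θ) n (zpt θ k) * xiMat (α k) (resid n α β θ k) *
        (solM (ell n α β θ) n (zpt θ k)).adjugate)) +
        z⁻¹ • (solM (ell n α β θ) n 0 * xiMat (lam n α β) (resid0 n α β θ) *
        (solM (ell n α β θ) n 0).adjugate)) * phiSol n α β θ z) a b) z := by
  have hc := cutFree_of_notMem_contour hz
  have h1 := hasDerivAt_matrix_mul (fun a b => (hasDerivAt_solM z a b).differentiableAt.hasDerivAt)
    (hasDerivAt_psiMat (n := n) (β := β) hα hinj hz) a b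
    (A' := derivMat (solM (ell n α β θ) n) z)
  refine h1.congr_deriv ?_
  rw [← logDeriv_solM_eq hα hinj hn h0 hc.ne_zero fun k => hc.sub_ne_zero k, phiSol, ← mul_assoc,
    mul_assoc _ (adjugate _), adjugate_mul,
    det_solM (by rwa [toepMatrix_ell]) hn, one_smul, mul_one, add_mul, mul_assoc]

end

/-! ### Traces of logarithmic derivatives -/

/-- The derivative of `U(g) e ^ σ₃`. -/
def dTri (g e g' e' : ℂ) : Mat := !![e' * exp e, (g' - g * e') * exp (-e); 0, -(e' * exp (-e))]

lemma hasDerivAt_mul_tri {𝕜 : Type*} [NontriviallyNormedField 𝕜] [NormedAlgebra 𝕜 ℂ] {x : 𝕜}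
    {M : 𝕜 → Mat} {D : Mat} {g e : 𝕜 → ℂ} {g' e' : ℂ}
    (hM : ∀ a b, HasDerivAt (fun y => M y a b) (D a b) x) (hg : HasDerivAt g g' x)
    (he : HasDerivAt e e' x) (a b : Fin 2) :
    HasDerivAt (fun y => (M y * (upper (g y) * expSigma3 (e y))) a b)
      ((D * (upper (g x) * expSigma3 (e x)) + M x * dTri (g x) (e x) g' e') a b) x := by
  have h : ∀ a b, HasDerivAt (fun y => (upper (g y) * expSigma3 (e y)) a b)
      (dTri (g x) (e x) g' e' a b) x := by
    intro a b
    fin_cases a <;> fin_cases b <;> simp [upper, expSigma3, dTri]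
    · exact he.cexp.congr_deriv (mul_comm _ _)
    · exact (hg.mul he.neg.cexp).congr_deriv (by simp only [Pi.neg_apply]; ring)
    · exact hasDerivAt_const _ _
    · exact he.neg.cexp.congr_deriv (by simp only [Pi.neg_apply]; ring)
  simp only [Matrix.add_apply, mul_apply (M := D), mul_apply (M := M _), Fin.sum_univ_two]
  refine (((hM a 0).mul (h 0 b)).add ((hM a 1).mul (h 1 b))).congr_deriv ?_
  ring

lemma det_upper_mul_expSigma3 (g e : ℂ) : (upper g * expSigma3 e).det = 1 := by
  rw [det_mul, det_upper, det_expSigma3, one_mul]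

lemma dTri_mul_inv (g e g' e' : ℂ) : dTri g e g' e' * (upper g * expSigma3 e)⁻¹ =
    !![e', g' - 2 * g * e'; 0, -e'] := by
  have h : exp e * exp (-e) = 1 := by rw [← exp_add, add_neg_cancel, exp_zero]
  rw [inv_of_det_one (det_upper_mul_expSigma3 g e)]
  ext a b
  fin_cases a <;> fin_cases b <;> simp [upper, expSigma3, dTri]
  · linear_combination e' * h
  · linear_combination (g' - 2 * g * e') * h
  · linear_combination e' * h

lemma trace_conj_mul_tri {M D : Mat} (hM : M.det = 1) (g e g' e' a r : ℂ) :
    trace (M * xiMat a r * M⁻¹ * (D * (upper g * expSigma3 e) + M * dTri g e g' e') *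
      (M * (upper g * expSigma3 e))⁻¹) =
      trace (M * xiMat a r * M⁻¹ * D * M⁻¹) + 2 * a * e' := by
  have hu : IsUnit M.det := by rw [hM]; exact isUnit_one
  have hN : IsUnit (upper g * expSigma3 e).det := by rw [det_upper_mul_expSigma3]; exact isUnit_one
  have h1 := dTri_mul_inv g e g' e'
  generalize hT : dTri g e g' e' = T at *
  generalize upper g * expSigma3 e = N at *
  have h2 : M * xiMat a r * M⁻¹ * (D * N + M * T) * (M * N)⁻¹ =
      M * xiMat a r * M⁻¹ * D * M⁻¹ + M * (xiMat a r * (T * N⁻¹) * M⁻¹) := by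
    rw [Matrix.mul_inv_rev, mul_add, add_mul]
    congr 1
    · rw [← mul_assoc _ D N, mul_assoc _ N, ← mul_assoc N, mul_nonsing_inv _ hN, one_mul]
    · simp only [mul_assoc]
      rw [← mul_assoc M⁻¹ M, nonsing_inv_mul _ hu, one_mul]
  rw [h2, trace_add, trace_mul_comm M (_ * M⁻¹), mul_assoc (xiMat a r * (T * N⁻¹)) M⁻¹ M, nonsing_inv_mul _ hu,
    mul_one, h1, xiMat, mul_fin_two, trace_fin_two_of]
  ring

lemma conj_tri_sigma3 (M : Mat) (g e a : ℂ) :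
    a • (M * (upper g * expSigma3 e) * sigma3 * (M * (upper g * expSigma3 e))⁻¹) =
      M * xiMat a (-(2 * a * g)) * M⁻¹ := by
  have h : exp e * exp (-e) = 1 := by rw [← exp_add, add_neg_cancel, exp_zero]
  have h1 : a • (upper g * expSigma3 e * sigma3 * (upper g * expSigma3 e)⁻¹) =
      xiMat a (-(2 * a * g)) := by
    rw [inv_of_det_one (det_upper_mul_expSigma3 g e)]
    ext i j
    fin_cases i <;> fin_cases j <;> simp [upper, expSigma3, sigma3, xiMat]
    · linear_combination a * h
    · linear_combination (-2 * a * g) * h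
    · linear_combination a * h
  rw [← h1, Matrix.mul_inv_rev]
  simp only [mul_assoc, Matrix.mul_smul, Matrix.smul_mul]

lemma conj_tri_unit12 (M : Mat) (g e c : ℂ) :
    c • (M * (upper g * expSigma3 e) * unit12 * (M * (upper g * expSigma3 e))⁻¹) =
      M * xiMat 0 (c * exp (2 * e)) * M⁻¹ := by
  have h1 : c • (upper g * expSigma3 e * unit12 * (upper g * expSigma3 e)⁻¹) =
      xiMat 0 (c * exp (2 * e)) := by
    rw [inv_of_det_one (det_upper_mul_expSigma3 g e)]
    ext i j
    fin_cases i <;> fin_cases j <;> simp [upper, expSigma3, unit12, xiMat]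
    rw [← exp_add, two_mul]
    simp
  rw [← h1, Matrix.mul_inv_rev]
  simp only [mul_assoc, Matrix.mul_smul, Matrix.smul_mul]

/-! ### Derivatives of the determinant and of the explicit factor -/

lemma hasDerivAt_toeplitzDet (hθ : IsConfiguration θ) (hα : Admissible α) (hn : 1 ≤ n)
    (h0 : (momMatrix n α β θ).det ≠ 0) (k : ι) :
    HasDerivAt (alongAngle θ k (toeplitzDet n α β)) (toeplitzDet n α β θ *
      (dell n α β θ k (polyP (ell n α β θ) n * derivative (polyQ (ell n α β θ) n) -
        polyQ (ell n α β θ) n * derivative (polyP (ell n α β θ) n)) -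
        n * (I * (α k + β k)))) (θ k) := by
  have hP := isOrthPair_poly (ℓ := ell n α β θ) (n := n) (by rwa [toepMatrix_ell])
  have h1 := hasDerivAt_det_toepMatrix (ℓ := fun s => ell n α β (update θ k s)) (τ := θ k)
    (δ := dell n α β θ k) (hasDerivAt_ell hα (zpt_injective hθ) k)
    (P := polyP (ell n α β θ) n) (Q := polyQ (ell n α β θ) n) (by rwa [update_eq_self]) hn
  simp only [toepMatrix_ell, update_eq_self] at h1
  have h2 : HasDerivAt (fun s => exp (-(n * (I * ∑ j, ((update θ k s j : ℝ) : ℂ) *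
      (α j + β j))))) (exp (-(n * (I * ∑ j, (θ j : ℂ) * (α j + β j)))) *
      -(n * (I * (α k + β k)))) (θ k) := by
    have h3 := HasDerivAt.fun_sum (u := univ) fun j _ =>
      (hasDerivAt_comp_update (k := k) (i := j) (θ := θ)
        (f := fun x => (x : ℂ)) ofRealCLM.hasDerivAt).mul_const (α j + β j)
    refine ((h3.const_mul I).const_mul (n : ℂ)).neg.cexp.congr_deriv ?_
    simp [ite_mul]
  refine ((h2.mul h1).congr_of_eventuallyEq ?_).congr_deriv ?_
  · filter_upwards [(tendsto_update k).eventually (eventually_isConfiguration hθ)] with s hs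
    exact toeplitzDet_eq hs
  · rw [toeplitzDet_eq hθ]
    simp only [update_eq_self]
    ring

lemma one_sub_zpt_mem (hinj : Injective (zpt θ)) {i j : ι} (h : i ≠ j) :
    1 - zpt θ i * ue (-θ j) ∈ slitPlane := by
  simpa using one_sub_ray_mem hinj h.symm (r := 1) one_pos

lemma hasDerivAt_logFrom_zpt (hθ : IsConfiguration θ) (k : ι) {i j : ι}
    (hij : j < i) :
    HasDerivAt (fun s => logFrom (update θ k s j) (zpt (update θ k s) i - zpt (update θ k s) j))
      ((if i = k then I * zpt θ k / (zpt θ k - zpt θ j) else 0) +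
        (if j = k then I * zpt θ k / (zpt θ k - zpt θ i) else 0)) (θ k) := by
  have hinj := zpt_injective hθ
  have hmem := one_sub_zpt_mem hinj hij.ne'
  have e1 : ∀ θ' : ι → ℝ, zpt θ' i * ue (-θ' j) = 1 * ue (-(θ' j - θ' i)) := fun θ' => by
    rw [zpt_eq, one_mul, ← ue_add]; congr 1; ring
  have hd := (hasDerivAt_update_apply (θ := θ) k j (θ k)).sub (hasDerivAt_update_apply (θ := θ) k i (θ k))
  have h1 := hasDerivAt_log_one_sub_mul_ue_neg (z := 1) (s := update θ k (θ k) j -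
    update θ k (θ k) i) (by rw [update_eq_self, ← e1]; exact hmem)
  have h2 := (h1.scomp (θ k) hd).add (hasDerivAt_comp_update (k := k) (i := i) (θ := θ)
        (f := fun x => (x : ℂ) * I) (ofRealCLM.hasDerivAt.mul_const I))
  refine (h2.congr_of_eventuallyEq ?_).congr_deriv ?_
  · filter_upwards [(tendsto_update k).eventually (eventually_isConfiguration hθ)] with s hs
    rw [logFrom_sub_eq (one_sub_zpt_mem (zpt_injective hs) hij.ne'), e1]
    simp only [Function.comp_apply, Pi.add_apply, Pi.sub_apply]
    push_cast
    ring
  · have hne : zpt θ i ≠ zpt θ j := fun h => hij.ne' (hinj h)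
    have hne' := _root_.sub_ne_zero.2 hne
    have e2 : ue (θ j - θ i) = zpt θ j / zpt θ i := by rw [ue_sub, zpt_eq, zpt_eq]
    have hz : ∀ i, zpt θ i ≠ 0 := fun i => by rw [zpt_eq]; exact ue_ne_zero _
    have hi := hz i
    have h3 : zpt θ j / zpt θ i - 1 ≠ 0 := by
      rw [div_sub_one hi]
      exact div_ne_zero (_root_.sub_ne_zero.2 hne.symm) hi
    have h4 := _root_.sub_ne_zero.2 hne.symm
    simp only [update_eq_self, e2]
    have h5 : I * (zpt θ j / zpt θ i) / (zpt θ j / zpt θ i - 1) = I * zpt θ j / (zpt θ j - zpt θ i) := by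
      field_simp
    rw [h5]
    by_cases hik : i = k
    · subst hik
      rw [if_pos rfl, if_pos rfl, if_pos rfl, if_neg hij.ne, if_neg hij.ne]
      simp
      field_simp
      ring
    · rw [if_neg hik, if_neg hik, if_neg hik]
      by_cases hjk : j = k
      · subst hjk; simp
      · simp [hjk]

lemma hasDerivAt_tauFactor (hθ : IsConfiguration θ) (k : ι) :
    HasDerivAt (alongAngle θ k (tauFactor n α β)) (tauFactor n α β θ *
      (2 * ∑ i ∈ univ.erase k, α k * α i * (I * zpt θ k / (zpt θ k - zpt θ i)) +
        (2 * α k * lam n α β + n * (α k + β k)) * I)) (θ k) := by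
  have h1 := HasDerivAt.fun_sum (u := univ) fun i _ =>
    HasDerivAt.fun_sum (u := Iio i) fun j hj =>
      (hasDerivAt_logFrom_zpt hθ k (mem_Iio.1 hj)).const_mul (2 * α j * α i)
  have h2 := HasDerivAt.fun_sum (u := univ) fun j _ =>
    (hasDerivAt_comp_update (k := k) (i := j) (θ := θ) (f := fun x => (x : ℂ) * I)
      (ofRealCLM.hasDerivAt.mul_const I)).const_mul (2 * α j * lam n α β + n * (α j + β j))
  have e : ∀ θ' : ι → ℝ, tauFactor n α β θ' = exp ((∑ i, ∑ j ∈ Iio i,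
      2 * α j * α i * logFrom (θ' j) (zpt θ' i - zpt θ' j)) +
      ∑ j, (2 * α j * lam n α β + n * (α j + β j)) * ((θ' j : ℂ) * I)) := fun θ' => by
    rw [exp_add, exp_sum, exp_sum, tauFactor]
    simp only [exp_sum]
  have h3 := (h1.add h2).cexp
  simp only [Pi.add_apply, ← e] at h3
  refine h3.congr_deriv ?_
  rw [update_eq_self]
  congr 2
  · have e1 : ∑ i, ∑ j ∈ Iio i, 2 * α j * α i *
        (if i = k then I * zpt θ k / (zpt θ k - zpt θ j) else 0) =
        ∑ j, if j < k then 2 * (α k * α j * (I * zpt θ k / (zpt θ k - zpt θ j))) else 0 := by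
      rw [sum_eq_single k (fun i _ hi => by simp [hi]) (by simp), ← sum_filter]
      refine sum_congr (by ext; simp) fun j _ => ?_
      rw [if_pos rfl]; ring
    have e2 : ∑ i, ∑ j ∈ Iio i, 2 * α j * α i *
        (if j = k then I * zpt θ k / (zpt θ k - zpt θ i) else 0) =
        ∑ i, if k < i then 2 * (α k * α i * (I * zpt θ k / (zpt θ k - zpt θ i))) else 0 := by
      refine sum_congr rfl fun i _ => ?_
      simp only [mul_ite, mul_zero, sum_ite_eq', mem_Iio]
      split_ifs <;> ring
    simp only [mul_add, sum_add_distrib]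
    rw [e1, e2, ← sum_add_distrib, ← add_sum_erase _ _ (mem_univ k), mul_sum]
    simp only [lt_irrefl, if_false, zero_add, add_zero]
    refine sum_congr rfl fun i hi => ?_
    rcases lt_or_gt_of_ne (ne_of_mem_erase hi) with h | h
    · rw [if_pos h, if_neg h.not_gt, add_zero]
    · rw [if_pos h, if_neg h.not_gt, zero_add]
  · simp

/-! ### The coefficients of the system -/

lemma det_solM_ell (h0 : (momMatrix n α β θ).det ≠ 0) (hn : 1 ≤ n) (z : ℂ) :
    (𝓜 z).det = 1 :=
  det_solM (by rwa [toepMatrix_ell]) hn z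

lemma resid0_eq : -(2 * lam n α β * 𝓒 0) = resid0 n α β θ := by
  rw [resid0, cauchyT]
  simp

section

variable {ε : ℝ} {Φ : ℂ → Mat} {F : Fin (m + 1) → ℂ → Mat} {F0 : ℂ → Mat}
  (h : IsPhiSolution n α β θ ε Φ F F0) (hε : 0 < ε) (hθ : IsConfiguration θ)
  (hα : Admissible α) (hα' : ∀ j, NonResonant (α j))
  (hn : 1 ≤ n) {d : ℝ} (hd : Sep θ d)
include h hε hθ hα hα' hn hd

lemma IsPhiSolution.factor_zpt (j : ι) :
    F j (zpt θ j) = phiF n α β θ (zpt θ j) d j (zpt θ j) := by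
  have hd0 := hd.1
  exact h.factor_eq hε hθ hα hα' hn hd (fun j => by rw [sub_self, norm_zero]; linarith) j
    (mem_ball_self (lt_min hε (by linarith)))

lemma IsPhiSolution.factor0_zero : F0 0 = phiF0 n α β θ 0 := by
  have hd0 := hd.1
  exact h.factor0_eq hε hθ hα hα' hn hd (mem_ball_self (lt_min hε (by linarith)))

lemma IsPhiSolution.coefA_eq (j : ι) :
    coefA α β θ F j = 𝓜 (zpt θ j) * xiMat (α j) (resid n α β θ j) * (𝓜 (zpt θ j))⁻¹ := by
  have hd0 := hd.1
  have ho : ‖zpt θ j - zpt θ j‖ < d / 32 := by rw [sub_self, norm_zero]; linarith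
  rw [coefA, h.factor_zpt hε hθ hα hα' hn hd]
  split_ifs with ha
  · rw [phiF, conj_tri_sigma3, hd.gLoc_zpt hθ hα (hα' j) ho ha]
  · rw [phiF, conj_tri_unit12, hd.resid_eq_of_eq_zero hθ hα (hα' j) ho (not_not.1 ha), not_not.1 ha]

lemma IsPhiSolution.coefB_eq :
    coefB n α β F0 = 𝓜 0 * xiMat (lam n α β) (resid0 n α β θ) * (𝓜 0)⁻¹ := by
  rw [coefB, h.factor0_zero hε hθ hα hα' hn hd, phiF0, conj_tri_sigma3, resid0_eq]

/-- The Fuchsian system. -/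
lemma IsPhiSolution.hasDerivAt {z : ℂ} (hz : z ∉ contour θ) (a b : Fin 2) :
    HasDerivAt (fun w => Φ w a b) ((fuchsMatrix n α β θ F F0 z * Φ z) a b) z := by
  obtain ⟨h0, hΦ⟩ := h.eq_phiSol hε hθ hα hα' hn
  have h1 := hasDerivAt_phiSol (n := n) (β := β) hα (zpt_injective hθ) hn h0 hz a b
  have hinv : ∀ z, (solM (ell n α β θ) n z).adjugate = (solM (ell n α β θ) n z)⁻¹ := fun z => by
    rw [Matrix.inv_def, det_solM_ell h0 hn, Ring.inverse_one, one_smul]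
  simp only [hinv, ← h.coefA_eq hε hθ hα hα' hn hd, ← h.coefB_eq hε hθ hα hα' hn hd, ← hΦ z hz] at h1
  refine h1.congr_of_eventuallyEq ?_
  filter_upwards [isOpen_contour_compl.mem_nhds hz] with w hw
  rw [hΦ w hw]

/-- The trace of the logarithmic derivative of the factor at `z_k` with respect to `z`. -/
lemma IsPhiSolution.trace_deriv_factor (k : ι) :
    I * zpt θ k * trace (coefA α β θ F k * derivMat (F k) (zpt θ k) * (F k (zpt θ k))⁻¹) =
      dell n α β θ k (polyP (ell n α β θ) n * derivative (polyQ (ell n α β θ) n) -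
        polyQ (ell n α β θ) n * derivative (polyP (ell n α β θ) n)) +
      I * zpt θ k * (2 * α k * (lam n α β / zpt θ k +
        ∑ i ∈ univ.erase k, α i / (zpt θ k - zpt θ i))) := by
  obtain ⟨h0, -⟩ := h.eq_phiSol hε hθ hα hα' hn
  have hd0 := hd.1
  have ho : ∀ j, ‖zpt θ j - zpt θ j‖ < d / 32 := fun j => by rw [sub_self, norm_zero]; linarith
  obtain ⟨D, hM⟩ : ∃ D : Mat, ∀ a b, HasDerivAt (fun z => solM (ell n α β θ) n z a b) (D a b) (zpt θ k) :=
    ⟨_, hasDerivAt_solM _⟩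
  have hg := (hd.differentiableAt_gLoc (n := n) (β := β) (hα' k) (ho k) (ho k)).hasDerivAt
  have he := hd.hasDerivAt_eLog (n := n) (α := α) (β := β) (j := k) (z := zpt θ k)
    (by rw [sub_self, norm_zero]; linarith)
  have hF := hasDerivAt_mul_tri hM hg he
  have hev : ∀ᶠ z in 𝓝 (zpt θ k), F k z = phiF n α β θ (zpt θ k) d k z := by
    filter_upwards [ball_mem_nhds (zpt θ k) (lt_min hε (show 0 < d / 128 by linarith))]
      with z hz using h.factor_eq hε hθ hα hα' hn hd ho k hz
  have e := ext fun a b => ((hF a b).congr_of_eventuallyEq (f₁ := fun z => F k z a b)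
    (hev.mono fun z hz => by simp only [hz, phiF])).deriv
  change derivMat (F k) (zpt θ k) = _ at e
  rw [e, h.coefA_eq hε hθ hα hα' hn hd, hev.self_of_nhds, phiF,
    trace_conj_mul_tri (det_solM_ell h0 hn _), mul_add, trace_solM_deriv h0 hn k hM]

end

/-! ### Families of solutions -/

lemma continuousAt_det_momMatrix (hα : Admissible α)
    (hinj : Injective (zpt θ)) :
    ContinuousAt (fun θ' => (momMatrix n α β θ').det) θ := by
  simp only [det_apply]
  refine tendsto_finsetSum _ fun σ _ => Tendsto.const_smul (tendsto_finsetProd _ fun i _ => ?_) _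
  exact continuousAt_mom hα hinj ⟨perC1_ue.1.pow _, fun t => by simp only [perC1_ue.2 t]⟩

/-- The problem remains solvable for nearby points. -/
lemma eventually_isPhiSolution (hn : 1 ≤ n) (hθ : IsConfiguration θ)
    (hα : Admissible α) (hα' : ∀ j, NonResonant (α j))
    (h0 : (momMatrix n α β θ).det ≠ 0) {d : ℝ} (hd : ∀ᶠ θ' in 𝓝 θ, Sep θ' d) :
    ∀ᶠ θ' in 𝓝 θ, IsPhiSolution n α β θ' (d / 128) (phiSol n α β θ')
      (fun j => phiF n α β θ' (zpt θ j) d j) (phiF0 n α β θ') := by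
  have hd0 := hd.self_of_nhds.1
  have hclose : ∀ᶠ θ' : ι → ℝ in 𝓝 θ, ∀ j, ‖zpt θ' j - zpt θ j‖ < d / 32 :=
    eventually_all.2 fun j => by
      have : ContinuousAt (fun θ' : ι → ℝ => ‖zpt θ' j - zpt θ j‖) θ :=
        ((continuous_zpt j).sub continuous_const).norm.continuousAt
      refine this.eventually (gt_mem_nhds ?_)
      simpa using hd0
  filter_upwards [hd, hclose, eventually_isConfiguration hθ,
    (continuousAt_det_momMatrix hα (zpt_injective hθ)).eventually_ne h0] with θ' h1 h2 h3 h4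
  exact isPhiSolution_phiSol h1 h3 hα hα' hn h4 h2

lemma partialZMat_eq {k : ι} {G : (ι → ℝ) → Mat} {D : Mat}
    (h : ∀ a b, HasDerivAt (alongAngle θ k fun θ' => G θ' a b) (D a b) (θ k)) :
    partialZMat θ k G = (I * zpt θ k)⁻¹ • D := by
  ext a b
  rw [partialZMat, of_apply, partialZ, (h a b).deriv, Matrix.smul_apply, smul_eq_mul]

section

variable {ε : ℝ} {Φ : (Fin (m + 1) → ℝ) → ℂ → Mat} {F : (Fin (m + 1) → ℝ) → Fin (m + 1) → ℂ → Mat}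
  {F0 : (Fin (m + 1) → ℝ) → ℂ → Mat}
  (h : ∀ᶠ θ' in 𝓝 θ, IsPhiSolution n α β θ' ε (Φ θ') (F θ') (F0 θ')) (hε : 0 < ε)
  (hθ : IsConfiguration θ)
  (hα : Admissible α) (hα' : ∀ j, NonResonant (α j))
  (hn : 1 ≤ n) {d : ℝ} (hd : ∀ᶠ θ' in 𝓝 θ, Sep θ' d) (k : Fin (m + 1)) {D : ℂ → Mat}
  (hD : ∀ z a b, HasDerivAt (fun s => solM (ell n α β (update θ k s)) n z a b) (D z a b) (θ k))
include h hε hθ hα hα' hn hd hD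

lemma exists_hasDerivAt_factor (j : ι) : ∃ D' : Mat,
    (∀ a b, HasDerivAt (alongAngle θ k fun θ' => F θ' j (zpt θ j) a b) (D' a b) (θ k)) ∧
    trace (coefA α β θ (F θ) j * D' * (F θ j (zpt θ j))⁻¹) =
      trace (solM (ell n α β θ) n (zpt θ j) * xiMat (α j) (resid n α β θ j) *
        (solM (ell n α β θ) n (zpt θ j))⁻¹ * D (zpt θ j) * (solM (ell n α β θ) n (zpt θ j))⁻¹) +
      2 * α j * (if k = j then 0 else α k * (I * zpt θ k / (zpt θ k - zpt θ j))) := by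
  have hs := hd.self_of_nhds
  have hd0 := hs.1
  have hh := h.self_of_nhds
  obtain ⟨h0, -⟩ := hh.eq_phiSol hε hθ hα hα' hn
  have hclose : ∀ᶠ θ' : ι → ℝ in 𝓝 θ, ∀ i, ‖zpt θ' i - zpt θ i‖ < min ε (d / 128) :=
    eventually_all.2 fun i => by
      have : ContinuousAt (fun θ' : ι → ℝ => ‖zpt θ' i - zpt θ i‖) θ :=
        ((continuous_zpt i).sub continuous_const).norm.continuousAt
      refine this.eventually (gt_mem_nhds ?_)
      simpa using ⟨hε, hd0⟩
  have hev : ∀ᶠ θ' in 𝓝 θ, F θ' j (zpt θ j) = phiF n α β θ' (zpt θ j) d j (zpt θ j) := by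
    filter_upwards [h, hd, hclose, eventually_isConfiguration hθ] with θ' h1 h2 h3 h4
    refine h1.factor_eq hε h4 hα hα' hn h2 (o := zpt θ)
      (fun i => (h3 i).trans_le ((min_le_right _ _).trans (by linarith))) j ?_
    rw [mem_ball, dist_comm, dist_eq_norm]
    exact h3 j
  have hg := (Sep.differentiableAt_gLoc_update (n := n) (β := β) hd hθ hα (hα' j) k).hasDerivAt
  have he := hs.hasDerivAt_eLog_update (n := n) (α := α) (β := β) (j := j) (z := zpt θ j)
    (by rw [sub_self, norm_zero]; linarith) k
  have hF := hasDerivAt_mul_tri (hD (zpt θ j)) hg he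
  simp only [update_eq_self] at hF
  refine ⟨_, fun a b => (hF a b).congr_of_eventuallyEq
    (((tendsto_update k).eventually hev).mono fun s hs => by simp only [alongAngle, hs, phiF]), ?_⟩
  rw [hh.coefA_eq hε hθ hα hα' hn hs, hev.self_of_nhds, phiF, trace_conj_mul_tri (det_solM_ell h0 hn _)]

lemma exists_hasDerivAt_factor0 : ∃ D' : Mat,
    (∀ a b, HasDerivAt (alongAngle θ k fun θ' => F0 θ' 0 a b) (D' a b) (θ k)) ∧
    trace (coefB n α β (F0 θ) * D' * (F0 θ 0)⁻¹) =
      trace (solM (ell n α β θ) n 0 * xiMat (lam n α β) (resid0 n α β θ) *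
        (solM (ell n α β θ) n 0)⁻¹ * D 0 * (solM (ell n α β θ) n 0)⁻¹) +
      2 * lam n α β * (α k * (I * zpt θ k / (zpt θ k - 0))) := by
  have hs := hd.self_of_nhds
  have hh := h.self_of_nhds
  obtain ⟨h0, -⟩ := hh.eq_phiSol hε hθ hα hα' hn
  have hev : ∀ᶠ θ' in 𝓝 θ, F0 θ' 0 = phiF0 n α β θ' 0 := by
    filter_upwards [h, hd, eventually_isConfiguration hθ] with θ' h1 h2 h3
    exact h1.factor0_zero hε h3 hα hα' hn h2
  have hg := (differentiableAt_cauchyT_update (n := n) (β := β) hα (zpt_injective hθ) k (z := 0)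
    (by simp)).hasDerivAt
  have he := hasDerivAt_eZero_update (α := α) (θ := θ) (z := 0) (by simp) k
  have hF := hasDerivAt_mul_tri (hD 0) hg he
  simp only [update_eq_self] at hF
  refine ⟨_, fun a b => (hF a b).congr_of_eventuallyEq
    (((tendsto_update k).eventually hev).mono fun s hs => by simp only [alongAngle, hs, phiF0]), ?_⟩
  rw [hh.coefB_eq hε hθ hα hα' hn hs, hev.self_of_nhds, phiF0, trace_conj_mul_tri (det_solM_ell h0 hn _)]

end

lemma tauFactor_ne_zero : tauFactor n α β θ ≠ 0 :=
  mul_ne_zero (prod_ne_zero_iff.2 fun _ _ => prod_ne_zero_iff.2 fun _ _ => exp_ne_zero _)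
    (prod_ne_zero_iff.2 fun _ _ => exp_ne_zero _)

end FisherHartwig

end

theorem mainTheorem5 (m n : ℕ) (hn : 1 ≤ n) (α β : Fin (m + 1) → ℂ) (θ : Fin (m + 1) → ℝ)
    (hθ : IsConfiguration θ)
    (hα : ∀ j, -(1 / 2 : ℝ) < (α j).re)
    (hα' : ∀ j, α j = 0 ∨ Complex.exp (4 * Real.pi * Complex.I * α j) ≠ 1)
    (hsolv : PhiSolvable n α β θ) :
    -- the determinant does not vanish, and the problem stays solvable for nearby points
    toeplitzDet n α β θ ≠ 0 ∧
    (∃ ε > 0, ∃ (Φ : (Fin (m + 1) → ℝ) → ℂ → Mat)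
        (F : (Fin (m + 1) → ℝ) → Fin (m + 1) → ℂ → Mat) (F0 : (Fin (m + 1) → ℝ) → ℂ → Mat),
      ∀ᶠ θ' in 𝓝 θ, IsPhiSolution n α β θ' ε (Φ θ') (F θ') (F0 θ')) ∧
    -- for every family of solutions at the nearby points:
    ∀ ε > 0, ∀ (Φ : (Fin (m + 1) → ℝ) → ℂ → Mat)
        (F : (Fin (m + 1) → ℝ) → Fin (m + 1) → ℂ → Mat) (F0 : (Fin (m + 1) → ℝ) → ℂ → Mat),
      (∀ᶠ θ' in 𝓝 θ, IsPhiSolution n α β θ' ε (Φ θ') (F θ') (F0 θ')) →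
      -- the Fuchsian system
      (∀ z ∉ contour θ, ∀ a b, HasDerivAt (fun w => Φ θ w a b)
        ((fuchsMatrix n α β θ (F θ) (F0 θ) z * Φ θ z) a b) z) ∧
      ∀ k,
        -- existence of all the derivatives with respect to the point with index k
        DifferentiableAt ℝ (alongAngle θ k (toeplitzDet n α β)) (θ k) ∧
        (∀ j a b, DifferentiableAt ℝ (alongAngle θ k fun θ' => F θ' j (zpt θ j) a b) (θ k)) ∧
        (∀ a b, DifferentiableAt ℝ (alongAngle θ k fun θ' => F0 θ' 0 a b) (θ k)) ∧
        DifferentiableAt ℝ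
          (alongAngle θ k fun θ' => toeplitzDet n α β θ' * tauFactor n α β θ') (θ k) ∧
        -- the differential identity
        partialZ θ k (toeplitzDet n α β) / toeplitzDet n α β θ =
          (∑ j, Matrix.trace (coefA α β θ (F θ) j *
              partialZMat θ k (fun θ' => F θ' j (zpt θ j)) * (F θ j (zpt θ j))⁻¹))
          + Matrix.trace (coefB n α β (F0 θ) *
              partialZMat θ k (fun θ' => F0 θ' 0) * (F0 θ 0)⁻¹)
          + 2 * ∑ j ∈ Finset.univ.erase k, α k * α j / (zpt θ j - zpt θ k)
          - 2 * lam n α β * α k / zpt θ k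
          - n * (α k + β k) / zpt θ k ∧
        -- up to the explicit factor, the determinant is the Jimbo-Miwa-Ueno tau-function
        partialZ θ k (fun θ' => toeplitzDet n α β θ' * tauFactor n α β θ') /
            (toeplitzDet n α β θ * tauFactor n α β θ) =
          Matrix.trace (coefA α β θ (F θ) k *
            derivMat (F θ k) (zpt θ k) * (F θ k (zpt θ k))⁻¹) := by
  obtain ⟨ε₀, hε₀, Φ₀, F₀, F00, hs₀⟩ := hsolv
  obtain ⟨h0, -⟩ := hs₀.eq_phiSol hε₀ hθ hα hα' hn
  have hinj := zpt_injective hθ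
  have hD : toeplitzDet n α β θ ≠ 0 := by
    rw [toeplitzDet_eq hθ]
    exact mul_ne_zero (exp_ne_zero _) h0
  obtain ⟨d, hd, hd'⟩ := exists_eventually_sep hinj
  refine ⟨hD, ⟨d / 128, by have := hd.1; positivity, _, fun θ' j => phiF n α β θ' (zpt θ j) d j, _,
    eventually_isPhiSolution hn hθ hα hα' h0 hd'⟩, ?_⟩
  intro ε hε Φ F F0 h
  have hh := h.self_of_nhds
  refine ⟨fun z hz a b => hh.hasDerivAt hε hθ hα hα' hn hd hz a b, fun k => ?_⟩
  have hz : ∀ j, zpt θ j ≠ 0 := fun j => exp_ne_zero _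
  have hell := hasDerivAt_ell (n := n) (β := β) hα hinj k
  have h0' : (toepMatrix (ell n α β (Function.update θ k (θ k))) n).det ≠ 0 := by
    rwa [Function.update_eq_self, toepMatrix_ell]
  choose D hM _ using exists_hasDerivAt_solM_param (ℓ := fun s => ell n α β (Function.update θ k s))
    (δ := dell n α β θ k) hell h0'
  choose D1 hF htr using exists_hasDerivAt_factor h hε hθ hα hα' hn hd' k hM
  obtain ⟨D0, hF0, htr0⟩ := exists_hasDerivAt_factor0 h hε hθ hα hα' hn hd' k hM
  have hsum := sum_trace_solM_param (β := β) (ℓ := fun s => ell n α β (Function.update θ k s))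
    (δ := dell n α β θ k) hα hinj hn (by simp only [Function.update_eq_self]) hell h0' hM
  have hdet := hasDerivAt_toeplitzDet (β := β) hθ hα hn h0 k
  have htau := hasDerivAt_tauFactor (n := n) (α := α) (β := β) hθ k
  have hdt := hdet.mul htau
  have hz' := hh.trace_deriv_factor hε hθ hα hα' hn hd k
  simp only [Function.update_eq_self] at hsum
  refine ⟨hdet.differentiableAt, fun j a b => (hF j a b).differentiableAt,
    fun a b => (hF0 a b).differentiableAt, hdt.differentiableAt, ?_, ?_⟩
  · rw [partialZ, hdet.deriv, partialZMat_eq hF0]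
    simp only [fun j => partialZMat_eq (hF j), Matrix.mul_smul, Matrix.smul_mul, Matrix.trace_smul,
      htr, htr0, smul_eq_mul, ← Finset.mul_sum, Finset.sum_add_distrib]
    have e1 : ∑ j, 2 * α j * (if k = j then 0 else α k * (I * zpt θ k / (zpt θ k - zpt θ j))) =
        -(I * zpt θ k * (2 * ∑ j ∈ Finset.univ.erase k, α k * α j / (zpt θ j - zpt θ k))) := by
      rw [← Finset.add_sum_erase _ _ (Finset.mem_univ k), if_pos rfl, mul_zero, zero_add]
      simp only [Finset.mul_sum, ← Finset.sum_neg_distrib]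
      refine Finset.sum_congr rfl fun j hj => ?_
      rw [if_neg (Finset.ne_of_mem_erase hj).symm, ← neg_sub (zpt θ j), div_neg]
      ring
    rw [← hsum, e1]
    generalize ∑ j ∈ Finset.univ.erase k, α k * α j / (zpt θ j - zpt θ k) = S
    generalize (∑ j : Fin (m + 1), Matrix.trace (n := Fin 2) (_ : Mat) : ℂ) = S1
    generalize Matrix.trace (n := Fin 2) (_ : Mat) = S2
    have := hz k
    have := I_ne_zero
    field_simp
    ring
  · have hT := tauFactor_ne_zero (n := n) (α := α) (β := β) (θ := θ)
    have hk := hz k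
    have hI := mul_ne_zero I_ne_zero hk
    refine mul_left_cancel₀ hI ?_
    change I * zpt θ k * ((I * zpt θ k)⁻¹ * deriv (alongAngle θ k (toeplitzDet n α β) *
      alongAngle θ k (tauFactor n α β)) (θ k) / _) = _
    rw [hz', hdt.deriv, ← mul_div_assoc, mul_inv_cancel_left₀ hI]
    simp only [alongAngle, Function.update_eq_self]
    have e1 : ∑ i ∈ Finset.univ.erase k, α k * α i * (I * zpt θ k / (zpt θ k - zpt θ i)) =
        I * zpt θ k * (α k * ∑ i ∈ Finset.univ.erase k, α i / (zpt θ k - zpt θ i)) := by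
      simp only [Finset.mul_sum]
      exact Finset.sum_congr rfl fun i _ => by ring
    rw [e1]
    generalize ∑ i ∈ Finset.univ.erase k, α i / (zpt θ k - zpt θ i) = S
    generalize dell n α β θ k _ = T
    field_simp
    ring
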